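/- Conventions. Manifolds are smooth, finite-dimensional, Hausdorff and second countable, without boundary. Let $G,K$ be Lie groups with Lie algebras $\mathfrak g,\mathfrak k$, and let $M$ be a manifold with a smooth left $G$-action. Structure groups of principal bundles act on the right. For a $G$-action on $Q$ and $A\in\mathfrak g$ let $\rho(A)$ be the vector field $\frac{d}{dt}\big|_{0}e^{-tA}q$. $\theta$ is the Maurer–Cartan form of $G$, and for $\alpha\in\Omega^1(X;\mathfrak g)$ and $g\in C^\infty(X,G)$ put $\alpha\cdot g=\mathrm{Ad}_{g^{-1}}\alpha+g^*\theta$. Prestacks (presheaves of groupoids on the category of manifolds) are described by their total categories over the category of manifolds: objects over $X$, and morphisms $a\to b$ over each smooth map $u:X\to Y$, which correspond to the morphisms $a\to u^*b$ over $X$. Morphisms and $2$-morphisms of prestacks are functors and natural transformations over the category of manifolds. The prestacks used are: * $\mathcal B K$ (resp. $\mathcal B_\nabla K$): over $X$, principal $K$-bundles on $X$ (resp. with connection); morphisms over $u$ are smooth $K$-equivariant maps of total spaces covering $u$ (resp. which preserve the connections). * $EG\times_GM$: over $X$, principal $G$-bundles $P\to X$ with a smooth map $F:P\to M$ such that $F(pg)=g^{-1}F(p)$;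 $E_\nabla G\times_GM$: the same with a connection $\Theta_P$ on $P$. Morphisms are $G$-bundle maps compatible with $F$ (and preserving the connections). * $M/\!/G$: over $X$, smooth maps $f:X\to M$; a morphism $f\to f'$ over $u:X\to Y$ is a $g\in C^\infty(X,G)$ with $gf=f'\circ u$. * $M/\!/_\nabla G$: over $X$, pairs $(\alpha,f)\in\Omega^1(X;\mathfrak g)\times C^\infty(X,M)$; a morphism $(\alpha,f)\to(\alpha',f')$ over $u$ is a $g\in C^\infty(X,G)$ with $(\alpha\cdot g^{-1},gf)=(u^*\alpha',f'\circ u)$. For a prestack $\mathcal M$ let $\mathrm{Bun}_K(\mathcal M)$ and $\mathrm{Bun}^\nabla_K(\mathcal M)$ be the categories of morphisms $\mathcal M\to\mathcal BK$ and $\mathcal M\to\mathcal B_\nabla K$. Let $G\text{-}\mathrm{Bun}_K(M)$ be the category of $G$-equivariant principal $K$-bundles $Q$ on $M$, let $G\text{-}\mathrm{Bun}^\nabla_K(M)$ be the category of those with a $G$-invariant connection $\Theta_Q$ (morphisms: $G$-equivariant bundle maps over $\mathrm{id}_M$, preserving the connections in the second case), and let $G_{\mathrm{bas}}\text{-}\mathrm{Bun}^\nabla_K(M)$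 be the full subcategory of $G$-basic connections, i.e. those which also satisfy $\iota_{\rho(A)}\Theta_Q=0$ for all $A\in\mathfrak g$. Theorem. Consider the following functors. * $T_1^\nabla:G\text{-}\mathrm{Bun}^\nabla_K(M)\to\mathrm{Bun}^\nabla_K(E_\nabla G\times_GM)$, $\ (Q,\Theta_Q)\mapsto\big[(P,\Theta_P,F)\mapsto\big((F^*Q)/G,\,(1-\iota_{\rho(\Theta_P)})F^*\Theta_Q\big)\big]$. (It is determined up to natural isomorphism by this description.) * $T_2^\nabla:\mathrm{Bun}^\nabla_K(E_\nabla G\times_GM)\to\mathrm{Bun}^\nabla_K(M/\!/_\nabla G)$, precomposition with the morphism $M/\!/_\nabla G\to E_\nabla G\times_GM$ sending $(\alpha,f)$ to the trivial bundle $X\times G$ with the connection $\mathrm{Ad}_{h^{-1}}\alpha+h^*\theta$ and the map $F_f(x,h)=h^{-1}f(x)$, and a morphism $g$ over $u$ to $(x,h)\mapsto(u(x),g(x)h)$. * $T_3^\nabla:\mathrm{Bun}^\nabla_K(M/\!/_\nabla G)\to G\text{-}\mathrm{Bun}^\nabla_K(M)$, $\ \mathcal Q\mapsto\mathcal Q(0,\mathrm{id}_M)$,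 where $g\in G$ acts by applying $\mathcal Q$ to the constant map $g$, viewed as a morphism $(0,\mathrm{id}_M)\to(0,\mathrm{id}_M)$ over the translation $m\mapsto gm$. Then: 1. These functors are well defined (in particular the $G$-action on $\mathcal Q(0,\mathrm{id}_M)$ is smooth), and each of $T_1^\nabla,T_2^\nabla,T_3^\nabla$ is an equivalence of categories. 2. The same holds for the analogous functors $T_1,T_2,T_3$ without connections (with $T_3(\mathcal Q)=\mathcal Q(\mathrm{id}_M)$), giving $G\text{-}\mathrm{Bun}_K(M)\simeq\mathrm{Bun}_K(EG\times_GM)\simeq\mathrm{Bun}_K(M/\!/G)$. 3. An object $\mathcal Q$ of $\mathrm{Bun}^\nabla_K(M/\!/_\nabla G)$ descends to $M/\!/G$, i.e. is isomorphic to the composite of the forgetful morphism $M/\!/_\nabla G\to M/\!/G$, $(\alpha,f)\mapsto f$, with an object of $\mathrm{Bun}^\nabla_K(M/\!/G)$, if and only if the connection of $T_3^\nabla(\mathcal Q)$ is $G$-basic. 4. The functor $G_{\mathrm{bas}}\text{-}\mathrm{Bun}^\nabla_K(M)\to\mathrm{Bun}^\nabla_K(EG\times_GM)$, $(Q,\Theta_Q)\mapsto[(P,F)\mapsto((F^*Q)/G,F^*\Theta_Q)]$,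 the functor $\mathrm{Bun}^\nabla_K(EG\times_GM)\to\mathrm{Bun}^\nabla_K(M/\!/G)$ given by restriction to trivial bundles, and the functor $\mathrm{Bun}^\nabla_K(M/\!/G)\to G_{\mathrm{bas}}\text{-}\mathrm{Bun}^\nabla_K(M)$ given by precomposition with $M/\!/_\nabla G\to M/\!/G$ followed by $T_3^\nabla$ are (well defined and) equivalences of categories. -/

import Mathlib

open scoped Manifold ContDiff Topology
open CategoryTheory

universe u v v' v''

noncomputable section

namespace EquivBun

/-! ### Manifolds, derivatives, Lie groups, one-forms -/

/-- A smooth finite-dimensional manifold: Hausdorff, second countable, without boundary, modelled on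
the finite-dimensional real vector space `E` (through the model space `H`). -/
structure Mfd : Type (u + 1) where
  carrier : Type u
  E : Type u
  H : Type u
  [normedAddCommGroup : NormedAddCommGroup E]
  [normedSpace : NormedSpace ℝ E]
  [finiteDimensional : FiniteDimensional ℝ E]
  [topModel : TopologicalSpace H]
  I : ModelWithCorners ℝ E H
  [boundaryless : I.Boundaryless]
  [top : TopologicalSpace carrier]
  [charted : ChartedSpace H carrier]
  [isManifold : IsManifold I ∞ carrier]
  [t2 : T2Space carrier]
  [secondCountable : SecondCountableTopology carrier]

instance : CoeSort Mfd.{u} (Type u) := ⟨Mfd.carrier⟩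

attribute [instance] Mfd.normedAddCommGroup Mfd.normedSpace Mfd.finiteDimensional Mfd.topModel
  Mfd.boundaryless Mfd.top Mfd.charted Mfd.isManifold Mfd.t2 Mfd.secondCountable

/-- Smooth maps between manifolds. -/
abbrev Map (X Y : Mfd.{u}) : Type u := C^∞⟮X.I, X; Y.I, Y⟯

/-- The identity map. -/
abbrev Map.id (X : Mfd.{u}) : Map X X := ContMDiffMap.id

/-- The product manifold. -/
abbrev Mfd.prod (X Y : Mfd.{u}) : Mfd.{u} where
  carrier := X × Y
  E := X.E × Y.E
  H := ModelProd X.H Y.H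
  I := X.I.prod Y.I

/-- The tangent space `T_x X`. -/
abbrev Mfd.T (X : Mfd.{u}) (x : X) : Type u := TangentSpace X.I x

/-- The derivative `T_x X → T_{f x} Y` of a map `f : X → Y` at `x`. -/
abbrev der {X Y : Mfd.{u}} (f : X → Y) (x : X) : X.T x →L[ℝ] Y.T (f x) := mfderiv X.I Y.I f x

/-- A finite-dimensional Lie group. -/
structure LieGrp : Type (u + 1) extends Mfd.{u} where
  [group : Group carrier]
  [lieGroup : LieGroup I ∞ carrier]

instance : CoeSort LieGrp.{u} (Type u) := ⟨fun G => G.carrier⟩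

attribute [instance] LieGrp.group LieGrp.lieGroup

/-- The vector space underlying the Lie algebra `T_1 G`. (Every tangent space is, by definition, a
copy of the model vector space; the normed structure of the latter is used to speak of smooth
functions with values in the Lie algebra.) -/
abbrev LieGrp.Lie (G : LieGrp.{u}) : Type u := G.E

/-- The adjoint action `Ad g`: the derivative at `1` of `h ↦ g h g⁻¹` (which maps `1` to `1`). -/
def LieGrp.Ad (G : LieGrp.{u}) (g : G) : G.Lie →L[ℝ] G.Lie :=
  der (X := G.toMfd) (Y := G.toMfd) (fun h : G => g * h * g⁻¹) 1

/-- The (left) Maurer-Cartan form at `g`: the derivative at `g` of `h ↦ g⁻¹ h` (which maps `g`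
to `1`). -/
def LieGrp.mc (G : LieGrp.{u}) (g : G) : G.T g →L[ℝ] G.Lie :=
  der (X := G.toMfd) (Y := G.toMfd) (fun h : G => g⁻¹ * h) g

/-- Smooth one-forms on `X` with values in the vector space `V`: families of linear forms on the
tangent spaces which are smooth as a function on the tangent bundle. -/
@[ext]
structure OneForm (X : Mfd.{u}) (V : Type u) [NormedAddCommGroup V] [NormedSpace ℝ V] where
  val : ∀ x : X, X.T x →L[ℝ] V
  smooth : ContMDiff X.I.tangent 𝓘(ℝ, V) ∞ (fun w : TangentBundle X.I X => val w.proj w.snd)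

/-- The zero form. -/
def OneForm.zero (X : Mfd.{u}) (V : Type u) [NormedAddCommGroup V] [NormedSpace ℝ V] :
    OneForm X V where
  val := fun _ => 0
  smooth := contMDiff_const

/-- The pullback of a (pointwise) one-form. -/
def pull {X Y : Mfd.{u}} {V : Type u} [NormedAddCommGroup V] [NormedSpace ℝ V] (f : Map X Y)
    (α : ∀ y : Y, Y.T y →L[ℝ] V) (x : X) : X.T x →L[ℝ] V :=
  (α (f x)).comp (der f x)

/-- The right action `α · g = Ad_{g⁻¹} α + g^* θ` of a map `g : X → G` on a Lie algebra valued
one-form, with `θ` the Maurer-Cartan form. -/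
def gauge {X : Mfd.{u}} {G : LieGrp.{u}} (α : ∀ x : X, X.T x →L[ℝ] G.Lie) (g : Map X G.toMfd)
    (x : X) : X.T x →L[ℝ] G.Lie :=
  (G.Ad (g x)⁻¹).comp (α x) + (G.mc (g x)).comp (der g x)

section Calculus

theorem Map.mdiff {X Y : Mfd.{u}} (f : Map X Y) (x : X) : MDifferentiableAt X.I Y.I f x :=
  f.contMDiff.mdifferentiable (by simp) x

theorem der_comp {X Y Z : Mfd.{u}} (g : Map Y Z) (f : Map X Y) (x : X) (w : X.T x) :
    der (fun x => g (f x)) x w = der g (f x) (der f x w) :=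
  mfderiv_comp_apply x (g.mdiff (f x)) (f.mdiff x) w

theorem pull_apply {X Y : Mfd.{u}} {V : Type u} [NormedAddCommGroup V] [NormedSpace ℝ V]
    (f : Map X Y) (α : ∀ y : Y, Y.T y →L[ℝ] V) (x : X) (w : X.T x) :
    pull f α x w = α (f x) (der f x w) := rfl

theorem pull_pull {X Y Z : Mfd.{u}} {V : Type u} [NormedAddCommGroup V] [NormedSpace ℝ V]
    (f : Map X Y) (g : Map Y Z) (α : ∀ y : Z, Z.T y →L[ℝ] V) :
    pull f (pull g α) = pull (g.comp f) α := by
  funext x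
  ext w
  exact congrArg (α (g (f x))) (der_comp g f x w).symm

theorem pull_id {X : Mfd.{u}} {V : Type u} [NormedAddCommGroup V] [NormedSpace ℝ V]
    (α : ∀ y : X, X.T y →L[ℝ] V) : pull (Map.id X) α = α := by
  funext x
  ext w
  have h : der (Map.id X) x w = w := by
    change mfderiv X.I X.I id x w = w
    rw [mfderiv_id]; rfl
  exact congrArg (α x) h

variable {G : LieGrp.{u}}

theorem mul_smooth : ContMDiff (G.I.prod G.I) G.I ∞ (fun z : G × G => z.1 * z.2) :=
  contMDiff_mul G.I ∞

/-- Left translation. -/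
def lmul (g : G) : Map G.toMfd G.toMfd := ⟨fun h => g * h, contMDiff_mul_left⟩

/-- Right translation. -/
def rmul (g : G) : Map G.toMfd G.toMfd := ⟨fun h => h * g, contMDiff_mul_right⟩

/-- Conjugation. -/
def cnj (g : G) : Map G.toMfd G.toMfd :=
  ⟨fun h => g * h * g⁻¹, contMDiff_mul_right.comp contMDiff_mul_left⟩

theorem Ad_apply (g : G) (A : G.Lie) : G.Ad g A = der (cnj g) 1 A := rfl

theorem mc_apply (g : G) (w : G.T g) : G.mc g w = der (lmul g⁻¹) g w := rfl

theorem der_congr_pt {X Y : Mfd.{u}} (f : X → Y) {x y : X} (h : x = y) (w : X.E) :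
    (der f x (w : X.T x) : Y.E) = der f y (w : X.T y) := by subst h; rfl

theorem Ad_mul (g h : G) (A : G.Lie) : G.Ad (g * h) A = G.Ad g (G.Ad h A) := by
  have h1 := der_comp (cnj g) (cnj h) (1 : G) A
  have h2 : (fun x => (cnj g) ((cnj h) x)) = (cnj (g * h) : G → G) := by
    funext x; simp [cnj, mul_assoc]
  rw [h2] at h1
  refine h1.trans ?_
  exact der_congr_pt (cnj g) (by simp [cnj]) _

theorem Ad_one (A : G.Lie) : G.Ad 1 A = A := by
  have h : (cnj (1 : G) : G → G) = id := by funext x; simp [cnj]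
  rw [Ad_apply, h]
  change mfderiv G.I G.I id 1 A = A
  rw [mfderiv_id]; rfl

theorem mc_mul {X : Mfd.{u}} (a b : Map X G.toMfd) (x : X) (w : X.T x) :
    G.mc ((a * b) x) (der (a * b : Map X G.toMfd) x w)
      = G.Ad (b x)⁻¹ (G.mc (a x) (der a x w)) + G.mc (b x) (der b x w) := by
  have h0 := mfderiv_prodMk (a.mdiff x) (b.mdiff x)
  let m : Map (G.toMfd.prod G.toMfd) G.toMfd := ⟨fun z => z.1 * z.2, mul_smooth⟩
  let c : Map X (G.toMfd.prod G.toMfd) := ⟨fun x => (a x, b x), a.contMDiff.prodMk b.contMDiff⟩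
  have h1 : der (a * b : Map X G.toMfd) x w = der m (c x) (der c x w) := der_comp m c x w
  have h2 : der c x w = (der a x w, der b x w) := by
    change mfderiv X.I (G.I.prod G.I) (fun x => (a x, b x)) x w = _
    rw [h0]; rfl
  have h3 : der m (c x) ((der a x w, der b x w) : G.E × G.E)
      = @HAdd.hAdd G.E G.E G.E _ (der (rmul (b x)) (a x) (der a x w))
        (der (lmul (a x)) (b x) (der b x w)) :=
    mfderiv_prod_eq_add_apply (m.mdiff (c x))
  rw [h1, h2]
  refine (congrArg (G.mc ((a * b) x)) h3).trans ?_
  refine ((G.mc ((a * b) x)).map_add _ _).trans ?_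
  congr 1
  · have e1 := der_comp (lmul ((a * b) x)⁻¹) (rmul (b x)) (a x) (der a x w)
    refine e1.symm.trans ?_
    have e2 := der_comp (cnj (b x)⁻¹) (lmul (a x)⁻¹) (a x) (der a x w)
    have e3 : (fun y => (lmul ((a * b) x)⁻¹) ((rmul (b x)) y))
        = fun y => (cnj (b x)⁻¹) ((lmul (a x)⁻¹) y) := by
      funext y; simp [lmul, rmul, cnj, mul_assoc]
    rw [e3]
    refine e2.trans ?_
    exact der_congr_pt (cnj (b x)⁻¹) (by simp [lmul]) _
  · have e1 := der_comp (lmul ((a * b) x)⁻¹) (lmul (a x)) (b x) (der b x w)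
    refine e1.symm.trans ?_
    have e3 : (fun y => (lmul ((a * b) x)⁻¹) ((lmul (a x)) y)) = lmul (b x)⁻¹ := by
      funext y; simp [lmul, mul_assoc]
    rw [e3]; rfl

theorem mc_const {X : Mfd.{u}} (g : G) (x : X) (w : X.T x) :
    G.mc g (der (fun _ : X => g) x w) = 0 := by
  have h : der (X := X) (Y := G.toMfd) (fun _ : X => g) x w = 0 := by
    change mfderiv X.I G.I (fun _ : X => g) x w = 0
    rw [mfderiv_const]; rfl
  rw [h, map_zero]

theorem gauge_apply {X : Mfd.{u}} (α : ∀ x : X, X.T x →L[ℝ] G.Lie) (g : Map X G.toMfd) (x : X)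
    (w : X.T x) : gauge α g x w = G.Ad (g x)⁻¹ (α x w) + G.mc (g x) (der g x w) := rfl

theorem gauge_one {X : Mfd.{u}} (α : ∀ x : X, X.T x →L[ℝ] G.Lie) :
    gauge α (1 : Map X G.toMfd) = α := by
  funext x
  ext w
  rw [gauge_apply]
  have h : G.mc ((1 : Map X G.toMfd) x) (der (1 : Map X G.toMfd) x w) = 0 := mc_const 1 x w
  have h' : G.Ad ((1 : Map X G.toMfd) x)⁻¹ (α x w) = α x w := by
    change G.Ad (1 : G)⁻¹ (α x w) = _
    rw [inv_one, Ad_one]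
  rw [h, h', add_zero]

theorem gauge_gauge {X : Mfd.{u}} (α : ∀ x : X, X.T x →L[ℝ] G.Lie) (g h : Map X G.toMfd) :
    gauge (gauge α g) h = gauge α (g * h) := by
  funext x
  ext w
  have e : G.Ad ((g * h) x)⁻¹ (α x w) = G.Ad (h x)⁻¹ (G.Ad (g x)⁻¹ (α x w)) := by
    rw [← Ad_mul]
    change G.Ad (g x * h x)⁻¹ _ = _
    rw [mul_inv_rev]
  rw [gauge_apply, gauge_apply, gauge_apply, mc_mul, map_add, e, add_assoc]

theorem pull_gauge {X Y : Mfd.{u}} (u : Map X Y) (α : ∀ y : Y, Y.T y →L[ℝ] G.Lie)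
    (g : Map Y G.toMfd) : pull u (gauge α g) = gauge (pull u α) (g.comp u) := by
  funext x
  ext w
  rw [pull_apply, gauge_apply, gauge_apply]
  exact congrArg (fun z => _ + G.mc (g (u x)) z) (der_comp g u x w).symm

theorem smooth_snd {EN HN N : Type u} [NormedAddCommGroup EN] [NormedSpace ℝ EN]
    [TopologicalSpace HN] {J : ModelWithCorners ℝ EN HN} [TopologicalSpace N] [ChartedSpace HN N]
    {Y : Mfd.{u}} {y : Y} (f : N → TangentBundle Y.I Y)
    (hf : ContMDiff J Y.I.tangent ∞ f) (hy : ∀ t, (f t).proj = y) :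
    ContMDiff J 𝓘(ℝ, Y.E) ∞ (fun t => ((f t).snd : Y.E)) := by
  intro t
  have h := (Bundle.contMDiffAt_totalSpace.1 (hf t)).2
  refine h.congr_of_eventuallyEq (Filter.Eventually.of_forall fun s => ?_)
  have key : ∀ (p q : TangentBundle Y.I Y), p.proj = q.proj →
      (p.snd : Y.E) = (trivializationAt Y.E (TangentSpace Y.I) q.proj p).2 := by
    rintro ⟨p, v⟩ ⟨q, w⟩ (rfl : p = q)
    exact (tangentCoordChange_self (I := Y.I) (x := p) (z := p) (v := v)
      (mem_extChartAt_source p)).symm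
  exact key (f s) (f t) ((hy s).trans (hy t).symm)

theorem tangent_prod_der {X Y Z : Mfd.{u}} (f : Map (X.prod Y) Z) (x : X) (y : Y) (w : Y.T y) :
    der f (x, y) ((0, w) : X.E × Y.E) = der (fun z => f (x, z)) y w := by
  have h := mfderiv_prod_eq_add_apply (v := ((0, w) : X.E × Y.E)) (f.mdiff (x, y))
  refine h.trans ?_
  have h0 : der (fun z => f (z, y)) x (0 : X.T x) = 0 := map_zero _
  exact (congrArg (fun s : Z.E => @HAdd.hAdd Z.E Z.E Z.E _ s (der (fun z => f (x, z)) y w)) h0).trans (zero_add _)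

theorem mc_smooth :
    ContMDiff G.I.tangent 𝓘(ℝ, G.E) ∞ (fun w : TangentBundle G.I G => G.mc w.proj w.snd) := by
  let m : Map (G.toMfd.prod G.toMfd) G.toMfd := ⟨fun z => z.1 * z.2, mul_smooth⟩
  have hT : ContMDiff (G.I.prod G.I).tangent G.I.tangent ∞ (tangentMap (G.I.prod G.I) G.I m) :=
    m.contMDiff.contMDiff_tangentMap (by simp)
  have hp : ContMDiff G.I.tangent G.I ∞ (fun w : TangentBundle G.I G => w.proj) :=
    Bundle.contMDiff_proj _
  have hz : ContMDiff G.I.tangent G.I.tangent ∞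
      (fun w : TangentBundle G.I G => (⟨(w.proj)⁻¹, 0⟩ : TangentBundle G.I G)) :=
    (Bundle.contMDiff_zeroSection ℝ (TangentSpace G.I : G → Type _)).comp hp.inv
  have hc := hT.comp ((contMDiff_equivTangentBundleProd_symm (I := G.I) (M := G) (I' := G.I)
    (M' := G)).comp (hz.prodMk contMDiff_id))
  refine (smooth_snd (Y := G.toMfd) (y := (1 : G)) _ hc fun w => ?_).congr fun w => ?_
  · exact inv_mul_cancel w.proj
  · exact (tangent_prod_der m (w.proj)⁻¹ w.proj w.snd).symm

theorem Ad_smooth :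
    ContMDiff (G.I.prod 𝓘(ℝ, G.E)) 𝓘(ℝ, G.E) ∞ (fun z : G × G.E => G.Ad z.1 z.2) := by
  let m : Map (G.toMfd.prod G.toMfd) G.toMfd := ⟨fun z => z.1 * z.2 * z.1⁻¹,
    mul_smooth.mul contMDiff_fst.inv⟩
  have hT : ContMDiff (G.I.prod G.I).tangent G.I.tangent ∞ (tangentMap (G.I.prod G.I) G.I m) :=
    m.contMDiff.contMDiff_tangentMap (by simp)
  have hz : ContMDiff (G.I.prod 𝓘(ℝ, G.E)) G.I.tangent ∞
      (fun z : G × G.E => (⟨z.1, 0⟩ : TangentBundle G.I G)) :=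
    (Bundle.contMDiff_zeroSection ℝ (TangentSpace G.I : G → Type _)).comp contMDiff_fst
  have hA : ContMDiff (G.I.prod 𝓘(ℝ, G.E)) G.I.tangent ∞
      (fun z : G × G.E => (⟨(1 : G), z.2⟩ : TangentBundle G.I G)) := by
    intro z
    refine Bundle.contMDiffAt_totalSpace.2 ⟨contMDiffAt_const, ?_⟩
    refine contMDiffAt_snd.congr_of_eventuallyEq (Filter.Eventually.of_forall fun s => ?_)
    exact tangentCoordChange_self (I := G.I) (x := (1 : G)) (z := (1 : G)) (v := s.2)
      (mem_extChartAt_source (1 : G))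
  have hc := hT.comp ((contMDiff_equivTangentBundleProd_symm (I := G.I) (M := G) (I' := G.I)
    (M' := G)).comp (hz.prodMk hA))
  refine (smooth_snd (Y := G.toMfd) (y := (1 : G)) _ hc fun z => ?_).congr fun z => ?_
  · change z.1 * 1 * z.1⁻¹ = 1
    simp
  · exact (tangent_prod_der m z.1 (1 : G) z.2).symm

end Calculus

/-! ### Group actions and principal bundles -/

/-- A smooth left action of the Lie group `G` on the manifold `M`. -/
structure LeftAction (G : LieGrp.{u}) (M : Mfd.{u}) where
  act : G → M → M
  one_act : ∀ m, act 1 m = m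
  mul_act : ∀ g h m, act (g * h) m = act g (act h m)
  smooth : ContMDiff (G.I.prod M.I) M.I ∞ (fun z : G × M => act z.1 z.2)

namespace LeftAction

variable {G : LieGrp.{u}} {M : Mfd.{u}} (a : LeftAction G M)

/-- The action of a fixed element. -/
def transl (g : G) : Map M M :=
  ⟨a.act g, a.smooth.comp (contMDiff_const.prodMk contMDiff_id)⟩

/-- The vector field `ρ(A)` at `m`, that is `d/dt` of `exp (-t A) · m` at `t = 0`, or in other words
the derivative of the orbit map `g ↦ g · m` at `1`, applied to `-A`. -/
def fund (A : G.Lie) (m : M) : M.T m :=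
  der (X := G.toMfd) (fun g => a.act g m) 1 (-A)

end LeftAction

/-- A principal `K`-bundle over `X`: a smooth right action of `K` on the total space together with
a smooth invariant projection to `X` which is locally, over `X`, equivariantly diffeomorphic to the
product with `K`. -/
structure PrinBundle (K : LieGrp.{u}) (X : Mfd.{u}) where
  tot : Mfd.{u}
  proj : Map tot X
  act : tot → K → tot
  act_one : ∀ p, act p 1 = p
  act_mul : ∀ p k l, act p (k * l) = act (act p k) l
  smooth_act : ContMDiff (tot.I.prod K.I) tot.I ∞ (fun z : tot × K => act z.1 z.2)
  proj_act : ∀ p k, proj (act p k) = proj p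
  locTriv : ∀ x : X, ∃ (U : Set X) (e : OpenPartialHomeomorph tot (X × K)),
    x ∈ U ∧ IsOpen U ∧ e.source = proj ⁻¹' U ∧ e.target = U ×ˢ Set.univ ∧
    ContMDiffOn tot.I (X.I.prod K.I) ∞ e e.source ∧
    ContMDiffOn (X.I.prod K.I) tot.I ∞ e.symm e.target ∧
    (∀ p ∈ e.source, (e p).1 = proj p) ∧
    ∀ p ∈ e.source, ∀ k, e (act p k) = ((e p).1, (e p).2 * k)

/-- A morphism of principal `K`-bundles covering `f : X → Y`: a smooth `K`-equivariant map of total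
spaces over `f`. (It identifies the source with the pullback of the target along `f`; over the
identity it is an isomorphism.) -/
@[ext]
structure BunHom {K : LieGrp.{u}} {X Y : Mfd.{u}} (f : Map X Y) (P : PrinBundle K X)
    (Q : PrinBundle K Y) where
  map : Map P.tot Q.tot
  map_act : ∀ p k, map (P.act p k) = Q.act (map p) k
  proj_map : ∀ p, Q.proj (map p) = f (P.proj p)

/-- The identity. -/
def BunHom.id {K : LieGrp.{u}} {X : Mfd.{u}} (P : PrinBundle K X) : BunHom (Map.id X) P P where
  map := Map.id P.tot
  map_act := fun _ _ => rfl
  proj_map := fun _ => rfl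

/-- Composition, in diagrammatic order. -/
def BunHom.comp {K : LieGrp.{u}} {X Y Z : Mfd.{u}} {f : Map X Y} {g : Map Y Z} {P : PrinBundle K X}
    {Q : PrinBundle K Y} {R : PrinBundle K Z} (φ : BunHom f P Q) (ψ : BunHom g Q R) :
    BunHom (g.comp f) P R where
  map := ψ.map.comp φ.map
  map_act := fun p k => by
    change ψ.map (φ.map _) = R.act (ψ.map (φ.map p)) k
    rw [φ.map_act, ψ.map_act]
  proj_map := fun p => by
    change R.proj (ψ.map (φ.map p)) = g (f _)
    rw [ψ.proj_map, φ.proj_map]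

/-- A principal connection on `P`, as a Lie algebra valued one-form on the total space with
`R_k^* Θ = Ad_{k⁻¹} Θ` and `Θ(ρ(A)) = A` for the vector fields `ρ(A)` generated by the right
action. -/
structure Connection {K : LieGrp.{u}} {X : Mfd.{u}} (P : PrinBundle K X) extends
    OneForm P.tot K.Lie where
  equivariant : ∀ (p : P.tot) (k : K) (w : P.tot.T p),
    val (P.act p k) (der (fun q => P.act q k) p w) = K.Ad k⁻¹ (val p w)
  vertical : ∀ (p : P.tot) (A : K.Lie),
    val (P.act p 1) (der (X := K.toMfd) (fun k => P.act p k) 1 A) = A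

/-- The map `φ` of total spaces preserves connections: `φ^* Θ' = Θ`. -/
def Connection.Pres {K : LieGrp.{u}} {X Y : Mfd.{u}} {P : PrinBundle K X} {Q : PrinBundle K Y}
    (Θ : Connection P) (Θ' : Connection Q) (φ : Map P.tot Q.tot) : Prop :=
  pull φ Θ'.val = Θ.val

theorem Connection.pres_id {K : LieGrp.{u}} {X : Mfd.{u}} {P : PrinBundle K X}
    (Θ : Connection P) : Θ.Pres Θ (Map.id P.tot) := pull_id _

theorem Connection.Pres.comp {K : LieGrp.{u}} {X Y Z : Mfd.{u}} {P : PrinBundle K X}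
    {Q : PrinBundle K Y} {R : PrinBundle K Z} {Θ : Connection P} {Θ' : Connection Q}
    {Θ'' : Connection R} {φ : Map P.tot Q.tot} {ψ : Map Q.tot R.tot} (h : Θ.Pres Θ' φ)
    (h' : Θ'.Pres Θ'' ψ) : Θ.Pres Θ'' (ψ.comp φ) := by
  unfold Connection.Pres at *
  rw [← pull_pull, h', h]

/-- A principal bundle with connection. -/
structure BunConn (K : LieGrp.{u}) (X : Mfd.{u}) extends PrinBundle K X where
  conn : Connection toPrinBundle

/-- A connection-preserving morphism of principal bundles covering `f`. -/
@[ext]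
structure ConnHom {K : LieGrp.{u}} {X Y : Mfd.{u}} (f : Map X Y) (P : BunConn K X)
    (Q : BunConn K Y) extends BunHom f P.toPrinBundle Q.toPrinBundle where
  pres : P.conn.Pres Q.conn map

/-! ### Prestacks as categories over the category of manifolds

A presheaf of groupoids on manifolds is described by its total category over the category of
manifolds: its objects over `X` are the objects of the groupoid of `X`, and its morphisms over a
smooth map `f : X → Y`, from `a` (over `X`) to `b` (over `Y`), are the morphisms from `a` to the
pullback `f^* b` in the groupoid of `X`. In all the examples below pullbacks exist and every
morphism has the universal property of a pullback, so that a morphism of presheaves of groupoids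
(functors commuting with pullbacks up to coherent isomorphism) is the same as a functor between
the total categories over the category of manifolds, and a 2-morphism is the same as a natural
transformation over the category of manifolds. -/

set_option linter.checkUnivs false in
/-- A category over the category of manifolds. -/
structure OverMan where
  Obj : Mfd.{u} → Type v
  Hom : ∀ {X Y : Mfd.{u}}, Map X Y → Obj X → Obj Y → Type u
  id : ∀ {X : Mfd.{u}} (a : Obj X), Hom (Map.id X) a a
  comp : ∀ {X Y Z : Mfd.{u}} {f : Map X Y} {g : Map Y Z} {a : Obj X} {b : Obj Y} {c : Obj Z},
    Hom f a b → Hom g b c → Hom (g.comp f) a c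
  id_comp : ∀ {X Y : Mfd.{u}} {f : Map X Y} {a : Obj X} {b : Obj Y} (φ : Hom f a b),
    (comp (id a) φ : Hom f a b) = φ
  comp_id : ∀ {X Y : Mfd.{u}} {f : Map X Y} {a : Obj X} {b : Obj Y} (φ : Hom f a b),
    (comp φ (id b) : Hom f a b) = φ
  assoc : ∀ {X Y Z W : Mfd.{u}} {f : Map X Y} {g : Map Y Z} {h : Map Z W} {a : Obj X} {b : Obj Y}
    {c : Obj Z} {d : Obj W} (φ : Hom f a b) (ψ : Hom g b c) (χ : Hom h c d),
    comp (comp φ ψ) χ = comp φ (comp ψ χ)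

/-- A morphism of prestacks: a functor over the category of manifolds. -/
structure Mor (A : OverMan.{u, v}) (B : OverMan.{u, v'}) where
  obj : ∀ {X : Mfd.{u}}, A.Obj X → B.Obj X
  map : ∀ {X Y : Mfd.{u}} {f : Map X Y} {a : A.Obj X} {b : A.Obj Y},
    A.Hom f a b → B.Hom f (obj a) (obj b)
  map_id : ∀ {X : Mfd.{u}} (a : A.Obj X), map (A.id a) = B.id (obj a)
  map_comp : ∀ {X Y Z : Mfd.{u}} {f : Map X Y} {g : Map Y Z} {a : A.Obj X} {b : A.Obj Y}
    {c : A.Obj Z} (φ : A.Hom f a b) (ψ : A.Hom g b c),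
    map (A.comp φ ψ) = B.comp (map φ) (map ψ)

/-- A 2-morphism: a natural transformation over the category of manifolds. -/
@[ext]
structure Trans {A : OverMan.{u, v}} {B : OverMan.{u, v'}} (S T : Mor A B) where
  app : ∀ {X : Mfd.{u}} (a : A.Obj X), B.Hom (Map.id X) (S.obj a) (T.obj a)
  naturality : ∀ {X Y : Mfd.{u}} {f : Map X Y} {a : A.Obj X} {b : A.Obj Y} (φ : A.Hom f a b),
    (B.comp (S.map φ) (app b) : B.Hom f (S.obj a) (T.obj b)) = B.comp (app a) (T.map φ)

/-- The category of morphisms between two prestacks. -/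
instance (A : OverMan.{u, v}) (B : OverMan.{u, v'}) : Category (Mor A B) where
  Hom := Trans
  id S :=
    { app := fun a => B.id (S.obj a)
      naturality := fun φ => (B.comp_id _).trans (B.id_comp _).symm }
  comp {S T U} σ τ :=
    { app := fun a => B.comp (σ.app a) (τ.app a)
      naturality := fun {X Y f a b} φ => by
        have e1 := B.assoc (S.map φ) (σ.app b) (τ.app b)
        have e2 := B.assoc (σ.app a) (T.map φ) (τ.app b)
        have e3 := B.assoc (σ.app a) (τ.app a) (U.map φ)
        have n1 := σ.naturality φ
        have n2 := τ.naturality φ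
        refine e1.symm.trans (Eq.trans ?_ e3.symm)
        refine Eq.trans (congrArg (fun z => B.comp (f := f) (g := Map.id Y) z (τ.app b)) n1) ?_
        refine e2.trans ?_
        exact congrArg (fun z => B.comp (f := Map.id X) (g := f) (σ.app a) z) n2 }
  id_comp σ := Trans.ext (by funext X a; exact B.id_comp _)
  comp_id σ := Trans.ext (by funext X a; exact B.comp_id _)
  assoc σ τ υ := Trans.ext (by funext X a; exact B.assoc _ _ _)

/-- Composition of morphisms of prestacks. -/
def Mor.comp {A : OverMan.{u, v}} {B : OverMan.{u, v'}} {C : OverMan.{u, v''}} (J : Mor A B)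
    (S : Mor B C) : Mor A C where
  obj a := S.obj (J.obj a)
  map φ := S.map (J.map φ)
  map_id a := by rw [J.map_id, S.map_id]
  map_comp φ ψ := by rw [J.map_comp, S.map_comp]

/-- The functor given by precomposition with `J`. -/
def Mor.precomp {A : OverMan.{u, v}} {B : OverMan.{u, v'}} (J : Mor A B) (C : OverMan.{u, v''}) :
    Mor B C ⥤ Mor A C where
  obj S := J.comp S
  map σ :=
    { app := fun a => σ.app (J.obj a)
      naturality := fun φ => σ.naturality (J.map φ) }
  map_id _ := rfl
  map_comp _ _ := rfl

/-! ### The prestacks -/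

/-- The stack of principal `K`-bundles. -/
def B (K : LieGrp.{u}) : OverMan.{u, u + 1} where
  Obj X := PrinBundle K X
  Hom f P Q := BunHom f P Q
  id P := BunHom.id P
  comp φ ψ := φ.comp ψ
  id_comp _ := rfl
  comp_id _ := rfl
  assoc _ _ _ := rfl

/-- The stack of principal `K`-bundles with connection. -/
def BConn (K : LieGrp.{u}) : OverMan.{u, u + 1} where
  Obj X := BunConn K X
  Hom f P Q := ConnHom f P Q
  id P := { BunHom.id P.toPrinBundle with pres := P.conn.pres_id }
  comp φ ψ := { φ.toBunHom.comp ψ.toBunHom with pres := φ.pres.comp ψ.pres }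
  id_comp _ := rfl
  comp_id _ := rfl
  assoc _ _ _ := rfl

section Quotients

variable {G : LieGrp.{u}} {M : Mfd.{u}} (a : LeftAction G M)

/-- An object of the Borel quotient stack over `X`: a principal `G`-bundle over `X` with an
equivariant map `F` from its total space to `M`, that is `F(p g) = g⁻¹ F(p)`. -/
structure BorelObj (X : Mfd.{u}) extends PrinBundle G X where
  F : Map tot M
  F_act : ∀ p g, F (act p g) = a.act g⁻¹ (F p)

/-- An object of the differential Borel quotient stack: in addition a connection. -/
structure BorelConnObj (X : Mfd.{u}) extends BorelObj a X where
  conn : Connection toPrinBundle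

variable {a}

/-- A bundle morphism compatible with the maps to `M`. -/
@[ext]
structure BorelHom {X Y : Mfd.{u}} (f : Map X Y) (P : BorelObj a X) (Q : BorelObj a Y) extends
    BunHom f P.toPrinBundle Q.toPrinBundle where
  F_map : ∀ p, Q.F (map p) = P.F p

/-- A bundle morphism compatible with the connections and with the maps to `M`. -/
@[ext]
structure BorelConnHom {X Y : Mfd.{u}} (f : Map X Y) (P : BorelConnObj a X)
    (Q : BorelConnObj a Y) extends BorelHom f P.toBorelObj Q.toBorelObj where
  pres : P.conn.Pres Q.conn map

/-- The identity. -/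
def BorelHom.id {X : Mfd.{u}} (P : BorelObj a X) : BorelHom (Map.id X) P P :=
  { BunHom.id P.toPrinBundle with F_map := fun _ => rfl }

/-- Composition. -/
def BorelHom.comp {X Y Z : Mfd.{u}} {f : Map X Y} {g : Map Y Z} {P : BorelObj a X}
    {Q : BorelObj a Y} {R : BorelObj a Z} (φ : BorelHom f P Q) (ψ : BorelHom g Q R) :
    BorelHom (g.comp f) P R :=
  { φ.toBunHom.comp ψ.toBunHom with
    F_map := fun p => (ψ.F_map (φ.map p)).trans (φ.F_map p) }

variable (a)

/-- The Borel quotient stack `EG ×_G M`. -/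
def Borel : OverMan.{u, u + 1} where
  Obj X := BorelObj a X
  Hom f P Q := BorelHom f P Q
  id P := BorelHom.id P
  comp φ ψ := φ.comp ψ
  id_comp _ := rfl
  comp_id _ := rfl
  assoc _ _ _ := rfl

/-- The differential Borel quotient stack `E_∇G ×_G M`. -/
def BorelConn : OverMan.{u, u + 1} where
  Obj X := BorelConnObj a X
  Hom f P Q := BorelConnHom f P Q
  id P := { BorelHom.id P.toBorelObj with pres := P.conn.pres_id }
  comp φ ψ := { φ.toBorelHom.comp ψ.toBorelHom with pres := φ.pres.comp ψ.pres }
  id_comp _ := rfl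
  comp_id _ := rfl
  assoc _ _ _ := rfl

/-- The action groupoid `M // G`: objects over `X` are the smooth maps `X → M`, and a morphism over
`u : X → Y` from `f : X → M` to `f' : Y → M` is a smooth map `g : X → G` with `g f = f' ∘ u`. -/
def ActGpd : OverMan.{u, u} where
  Obj X := Map X M
  Hom {X _} u f f' := { g : Map X G.toMfd // ∀ x, a.act (g x) (f x) = f' (u x) }
  id f := ⟨1, fun x => a.one_act (f x)⟩
  comp {X Y Z u v f f' f''} g h := ⟨h.1.comp u * g.1, fun x => by
    change a.act (h.1 (u x) * g.1 x) (f x) = f'' (v (u x))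
    rw [a.mul_act, g.2, h.2]⟩
  id_comp {X Y f a b} g := Subtype.ext (mul_one g.1)
  comp_id g := Subtype.ext (one_mul g.1)
  assoc {X Y Z W u v w f f' f'' f'''} g h k := Subtype.ext
    (mul_assoc (k.1.comp (v.comp u)) (h.1.comp u) g.1).symm

/-- The differential action groupoid `M //_∇ G`: objects over `X` are pairs `(α, f)` of a Lie algebra
valued one-form on `X` and a smooth map `X → M`. A morphism over `u : X → Y` from `(α, f)` to
`(α', f')` is a smooth map `g : X → G` with `(α · g⁻¹, g f) = (u^* α', f' ∘ u)`. -/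
def DiffActGpd : OverMan.{u, u} where
  Obj X := OneForm X G.Lie × Map X M
  Hom {X _} u p q := { g : Map X G.toMfd //
    gauge p.1.val g⁻¹ = pull u q.1.val ∧ ∀ x, a.act (g x) (p.2 x) = q.2 (u x) }
  id p := ⟨1, by rw [inv_one, gauge_one, pull_id], fun x => a.one_act (p.2 x)⟩
  comp {X Y Z u v p q r} g h := ⟨h.1.comp u * g.1, by
      rw [mul_inv_rev, ← gauge_gauge, g.2.1, ← pull_pull]
      exact (pull_gauge u q.1.val h.1⁻¹).symm.trans (congrArg (pull u) h.2.1),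
    fun x => by
      change a.act (h.1 (u x) * g.1 x) (p.2 x) = r.2 (v (u x))
      rw [a.mul_act, g.2.2, h.2.2]⟩
  id_comp g := Subtype.ext (mul_one g.1)
  comp_id g := Subtype.ext (one_mul g.1)
  assoc {X Y Z W u v w f f' f'' f'''} g h k := Subtype.ext
    (mul_assoc (k.1.comp (v.comp u)) (h.1.comp u) g.1).symm

/-- The morphism `M //_∇ G → M // G` which forgets the one-form. -/
def forgetForm : Mor (DiffActGpd a) (ActGpd a) where
  obj p := p.2
  map g := ⟨g.1, g.2.2⟩
  map_id _ := rfl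
  map_comp _ _ := rfl

end Quotients

/-! ### The trivial bundle, and the morphisms from the action groupoids to the quotient stacks -/

/-- The pullback of a form. -/
def OneForm.pull {X Y : Mfd.{u}} {V : Type u} [NormedAddCommGroup V] [NormedSpace ℝ V]
    (α : OneForm Y V) (f : Map X Y) : OneForm X V where
  val := EquivBun.pull f α.val
  smooth := α.smooth.comp (f.contMDiff.contMDiff_tangentMap (by simp))

/-- The form `α · g`. -/
def OneForm.gauge {X : Mfd.{u}} {G : LieGrp.{u}} (α : OneForm X G.Lie) (g : Map X G.toMfd) :
    OneForm X G.Lie where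
  val := EquivBun.gauge α.val g
  smooth := by
    have hT : ContMDiff X.I.tangent G.I.tangent ∞ (tangentMap X.I G.I g) :=
      g.contMDiff.contMDiff_tangentMap (by simp)
    have hp : ContMDiff X.I.tangent X.I ∞ (fun w : TangentBundle X.I X => w.proj) :=
      Bundle.contMDiff_proj _
    exact (Ad_smooth.comp ((g.contMDiff.comp hp).inv.prodMk α.smooth)).add (mc_smooth.comp hT)

section Trivial

variable {G : LieGrp.{u}}

/-- The projection `X × G → X`. -/
def prFst (X : Mfd.{u}) (G : LieGrp.{u}) : Map (X.prod G.toMfd) X := ContMDiffMap.fst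

/-- The projection `X × G → G`. -/
def prSnd (X : Mfd.{u}) (G : LieGrp.{u}) : Map (X.prod G.toMfd) G.toMfd := ContMDiffMap.snd

/-- The trivial bundle `X × G → X`, with `(x, h) k = (x, h k)`. -/
def trivBundle (G : LieGrp.{u}) (X : Mfd.{u}) : PrinBundle G X where
  tot := X.prod G.toMfd
  proj := prFst X G
  act p k := (p.1, p.2 * k)
  act_one p := by rw [mul_one]
  act_mul p k l := by rw [mul_assoc]
  smooth_act := (contMDiff_fst.comp contMDiff_fst).prodMk
    ((contMDiff_snd.comp contMDiff_fst).mul contMDiff_snd)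
  proj_act _ _ := rfl
  locTriv x := ⟨Set.univ, OpenPartialHomeomorph.refl (X × G), trivial, isOpen_univ, rfl,
    by simp, contMDiffOn_id, contMDiffOn_id, fun _ _ => rfl, fun _ _ _ => rfl⟩

/-- The connection form `Θ_α` on the trivial bundle `X × G` determined by the form `α` on `X`; in a
formula, `Θ_α` is `Ad_{h⁻¹} α + h^* θ` at `(x, h)`. -/
def trivForm {X : Mfd.{u}} (α : OneForm X G.Lie) : OneForm (X.prod G.toMfd) G.Lie :=
  (α.pull (prFst X G)).gauge (prSnd X G)

theorem trivForm_equivariant {X : Mfd.{u}} (α : OneForm X G.Lie) (p : X.prod G.toMfd) (k : G)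
    (w : (X.prod G.toMfd).T p) :
    (trivForm α).val (p.1, p.2 * k)
      (der (X := X.prod G.toMfd) (Y := X.prod G.toMfd) (fun q => (q.1, q.2 * k)) p w)
      = G.Ad k⁻¹ ((trivForm α).val p w) := by
  let R : Map (X.prod G.toMfd) (X.prod G.toMfd) := ⟨fun p => (p.1, p.2 * k),
    contMDiff_fst.prodMk (contMDiff_snd.mul contMDiff_const)⟩
  let c : Map (X.prod G.toMfd) G.toMfd := ⟨fun _ => k, contMDiff_const⟩
  let β := pull (prFst X G) α.val
  have e1 : pull R (gauge β (prSnd X G)) = gauge (gauge β (prSnd X G)) c := by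
    rw [pull_gauge, pull_pull, gauge_gauge]
    rfl
  have e2 := congrArg (fun γ : ∀ x, (X.prod G.toMfd).T x →L[ℝ] G.Lie => γ p w) e1
  refine e2.trans ((gauge_apply (gauge β (prSnd X G)) c p w).trans ?_)
  have e3 : G.mc (c p) (der c p w) = 0 := mc_const k p w
  rw [e3, add_zero]
  rfl

theorem trivForm_vertical {X : Mfd.{u}} (α : OneForm X G.Lie) (p : X.prod G.toMfd) (A : G.Lie) :
    (trivForm α).val (p.1, p.2 * 1)
      (der (X := G.toMfd) (Y := X.prod G.toMfd) (fun k => (p.1, p.2 * k)) 1 A) = A := by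
  let J : Map G.toMfd (X.prod G.toMfd) := ⟨fun k => (p.1, p.2 * k),
    contMDiff_const.prodMk contMDiff_mul_left⟩
  have e1 : pull J (gauge (pull (prFst X G) α.val) (prSnd X G))
      = gauge (pull ((prFst X G).comp J) α.val) (lmul p.2) := by
    rw [pull_gauge, pull_pull]
    rfl
  have e2 := congrArg (fun γ : ∀ x, G.T x →L[ℝ] G.Lie => γ 1 A) e1
  refine e2.trans ((gauge_apply _ _ (1 : G) A).trans ?_)
  have e3 : der ((prFst X G).comp J) (1 : G) A = 0 := by
    change mfderiv G.I X.I (fun _ : G => p.1) 1 A = 0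
    rw [mfderiv_const]; rfl
  have e6 : pull ((prFst X G).comp J) α.val (1 : G) A = 0 :=
    (congrArg (α.val p.1) e3).trans (map_zero _)
  rw [e6, map_zero, zero_add]
  have e4 := der_comp (lmul (lmul p.2 1)⁻¹) (lmul p.2) (1 : G) A
  refine e4.symm.trans ?_
  have e5 : (fun x => (lmul (lmul p.2 1)⁻¹) ((lmul p.2) x)) = (id : G → G) := by
    funext y; simp [lmul]
  rw [e5]
  change mfderiv G.I G.I id 1 A = A
  rw [mfderiv_id]; rfl

/-- The connection `Θ_α`. -/
def trivConn {X : Mfd.{u}} (α : OneForm X G.Lie) : Connection (trivBundle G X) where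
  toOneForm := trivForm α
  equivariant := trivForm_equivariant α
  vertical := trivForm_vertical α

variable {M : Mfd.{u}} (a : LeftAction G M)

/-- The trivial bundle with the equivariant map `F_f(x, h) = h⁻¹ f(x)`. -/
def trivObj {X : Mfd.{u}} (f : Map X M) : BorelObj a X :=
  { trivBundle G X with
    F := ⟨fun p => a.act p.2⁻¹ (f p.1),
      a.smooth.comp (contMDiff_snd.inv.prodMk (f.contMDiff.comp contMDiff_fst))⟩
    F_act := fun p k => by
      change a.act (p.2 * k)⁻¹ (f p.1) = a.act k⁻¹ (a.act p.2⁻¹ (f p.1))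
      rw [mul_inv_rev, a.mul_act] }

/-- The morphism `φ_g(x, h) = (u(x), g(x) h)` of trivial bundles. -/
def trivMap {X Y : Mfd.{u}} (u : Map X Y) (g : Map X G.toMfd) :
    Map (X.prod G.toMfd) (Y.prod G.toMfd) :=
  ⟨fun p => (u p.1, g p.1 * p.2), (u.contMDiff.comp contMDiff_fst).prodMk
    ((g.contMDiff.comp contMDiff_fst).mul contMDiff_snd)⟩

/-- The same, as a morphism of the Borel quotient stack. -/
def trivHom {X Y : Mfd.{u}} {u : Map X Y} {f : Map X M} {f' : Map Y M} (g : Map X G.toMfd)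
    (h : ∀ x, a.act (g x) (f x) = f' (u x)) : BorelHom u (trivObj a f) (trivObj a f') where
  map := trivMap u g
  map_act p k := by
    change (u p.1, g p.1 * (p.2 * k)) = (u p.1, g p.1 * p.2 * k)
    rw [mul_assoc]
  proj_map _ := rfl
  F_map p := by
    change a.act (g p.1 * p.2)⁻¹ (f' (u p.1)) = a.act p.2⁻¹ (f p.1)
    rw [← h, ← a.mul_act]
    congr 1
    group

theorem trivHom_pres {X Y : Mfd.{u}} {u : Map X Y} {α : OneForm X G.Lie} {β : OneForm Y G.Lie}
    {g : Map X G.toMfd} (h : gauge α.val g⁻¹ = pull u β.val) :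
    (trivConn α).Pres (trivConn β) (trivMap u g) := by
  change pull (trivMap u g) (gauge (pull (prFst Y G) β.val) (prSnd Y G))
    = gauge (pull (prFst X G) α.val) (prSnd X G)
  have e1 : (prSnd Y G).comp (trivMap u g) = g.comp (prFst X G) * prSnd X G := rfl
  have e2 : pull ((prFst Y G).comp (trivMap u g)) β.val = pull (prFst X G) (pull u β.val) :=
    (pull_pull (prFst X G) u β.val).symm
  rw [pull_gauge, pull_pull, e1, e2, ← gauge_gauge, ← pull_gauge, ← h, gauge_gauge,
    inv_mul_cancel, gauge_one]

theorem trivMap_one {X : Mfd.{u}} :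
    trivMap (G := G) (Map.id X) 1 = Map.id (X.prod G.toMfd) := by
  ext p
  exacts [rfl, one_mul p.2]

theorem trivMap_comp {X Y Z : Mfd.{u}} (u : Map X Y) (v : Map Y Z) (g : Map X G.toMfd)
    (h : Map Y G.toMfd) :
    trivMap (v.comp u) (h.comp u * g) = (trivMap v h).comp (trivMap u g) := by
  ext p
  exacts [rfl, mul_assoc (h (u p.1)) (g p.1) p.2]

/-- The morphism `M // G → EG ×_G M` given by trivial bundles. -/
def triv : Mor (ActGpd a) (Borel a) where
  obj f := trivObj a f
  map g := trivHom a g.1 g.2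
  map_id _ := BorelHom.ext trivMap_one
  map_comp g h := BorelHom.ext (trivMap_comp _ _ g.1 h.1)

/-- The morphism `M //_∇ G → E_∇G ×_G M` given by trivial bundles. -/
def trivWithConn : Mor (DiffActGpd a) (BorelConn a) where
  obj p := { trivObj a p.2 with conn := trivConn p.1 }
  map g := { trivHom a g.1 g.2.2 with pres := trivHom_pres g.2.1 }
  map_id _ := BorelConnHom.ext trivMap_one
  map_comp g h := BorelConnHom.ext (trivMap_comp _ _ g.1 h.1)

end Trivial

/-! ### Equivariant bundles on `M` -/

section Equivariant

variable {G : LieGrp.{u}} {M : Mfd.{u}} (a : LeftAction G M) (K : LieGrp.{u})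

/-- A `G`-equivariant principal `K`-bundle on `M`. -/
structure EqBun extends PrinBundle K M where
  gact : LeftAction G tot
  gact_act : ∀ g q k, gact.act g (act q k) = act (gact.act g q) k
  proj_gact : ∀ g q, proj (gact.act g q) = a.act g (proj q)

/-- A `G`-equivariant principal `K`-bundle on `M` with `G`-invariant connection. -/
structure EqBunConn extends EqBun a K where
  conn : Connection toPrinBundle
  invariant : ∀ g, conn.Pres conn (gact.transl g)

/-- The bundle with connection underlying an equivariant bundle with connection. -/
def EqBunConn.toBunConn {a : LeftAction G M} {K : LieGrp.{u}} (Q : EqBunConn a K) : BunConn K M :=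
  { Q.toPrinBundle with conn := Q.conn }

variable {a K}

/-- Morphisms: `G`-equivariant bundle morphisms covering the identity of `M`. -/
@[ext]
structure EqHom (Q R : EqBun a K) extends BunHom (Map.id M) Q.toPrinBundle R.toPrinBundle where
  map_gact : ∀ g q, map (Q.gact.act g q) = R.gact.act g (map q)

/-- Morphisms which in addition preserve the connection. -/
@[ext]
structure EqConnHom (Q R : EqBunConn a K) extends EqHom Q.toEqBun R.toEqBun where
  pres : Q.conn.Pres R.conn map

/-- The identity. -/
def EqHom.id (Q : EqBun a K) : EqHom Q Q :=
  { BunHom.id Q.toPrinBundle with map_gact := fun _ _ => rfl }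

/-- Composition. -/
def EqHom.comp {Q R S : EqBun a K} (φ : EqHom Q R) (ψ : EqHom R S) : EqHom Q S :=
  { φ.toBunHom.comp ψ.toBunHom with
    map_gact := fun g q =>
      (congrArg ψ.map (φ.map_gact g q)).trans (ψ.map_gact g (φ.map q)) }

instance : Category (EqBun a K) where
  Hom := EqHom
  id := EqHom.id
  comp := EqHom.comp

instance : Category (EqBunConn a K) where
  Hom := EqConnHom
  id Q := { EqHom.id Q.toEqBun with pres := Q.conn.pres_id }
  comp φ ψ := { φ.toEqHom.comp ψ.toEqHom with pres := φ.pres.comp ψ.pres }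

variable (a K) in
/-- The connection is `G`-basic: it is `G`-invariant and vanishes on the vector fields `ρ(A)`. -/
def IsBasic : ObjectProperty (EqBunConn a K) := fun Q =>
  ∀ (A : G.Lie) (q : Q.tot), Q.conn.val q (Q.gact.fund A q) = 0

end Equivariant

/-! ### Evaluation at `id_M` and at `(0, id_M)` -/

section Evaluation

variable {G : LieGrp.{u}} {M : Mfd.{u}} (a : LeftAction G M) {K : LieGrp.{u}}

/-- The object `id_M` of `M // G` over `M`. -/
def idPt : (ActGpd a).Obj M := Map.id M

/-- The object `(0, id_M)` of `M //_∇ G` over `M`. -/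
def idPtConn : (DiffActGpd a).Obj M := (OneForm.zero M G.Lie, Map.id M)

/-- An element `g` of `G` is a morphism from `id_M` to `id_M` over the translation by `g`. -/
def shift (g : G) : (ActGpd a).Hom (a.transl g) (idPt a) (idPt a) :=
  ⟨ContMDiffMap.const g, fun _ => rfl⟩

/-- An element `g` of `G` is a morphism from `(0, id_M)` to `(0, id_M)` over the translation
by `g`. -/
def shiftConn (g : G) : (DiffActGpd a).Hom (a.transl g) (idPtConn a) (idPtConn a) :=
  ⟨ContMDiffMap.const g, by
    have h : ∀ x (w : M.T x), gauge (G := G) (OneForm.zero M G.Lie).val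
        (ContMDiffMap.const g : Map M G.toMfd)⁻¹ x w = 0 := by
      intro x w
      rw [gauge_apply]
      have e1 : G.mc ((ContMDiffMap.const g : Map M G.toMfd)⁻¹ x)
        (der ((ContMDiffMap.const g : Map M G.toMfd)⁻¹ : Map M G.toMfd) x w) = 0 := mc_const g⁻¹ x w
      rw [e1, add_zero]
      exact map_zero _
    funext x
    ext w
    exact h x w, fun _ => rfl⟩

variable {a}

/-- For a morphism `S : M // G → BK`, the map by which `g` acts on the total space of `S(id_M)`. -/
def evalMap (S : Mor (ActGpd a) (B K)) (g : G) :
    Map (PrinBundle.tot (S.obj (idPt a))) (PrinBundle.tot (S.obj (idPt a))) :=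
  BunHom.map (S.map (shift a g))

/-- For a morphism `S : M //_∇ G → B_∇ K`, the map by which `g` acts on the total space of
`S(0, id_M)`. -/
def evalMapConn (S : Mor (DiffActGpd a) (BConn K)) (g : G) :
    Map (BunConn.toPrinBundle (S.obj (idPtConn a))).tot
      (BunConn.toPrinBundle (S.obj (idPtConn a))).tot :=
  (ConnHom.toBunHom (S.map (shiftConn a g))).map

theorem map_eq (S : Mor (ActGpd a) (B K)) {X Y : Mfd.{u}} {u u' : Map X Y}
    {p : (ActGpd a).Obj X} {q : (ActGpd a).Obj Y} (φ : (ActGpd a).Hom u p q)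
    (φ' : (ActGpd a).Hom u' p q) (hu : u = u') (h : φ.1 = φ'.1) :
    BunHom.map (S.map φ) = BunHom.map (S.map φ') := by
  subst hu
  rw [Subtype.ext h]

theorem mapConn_eq (S : Mor (DiffActGpd a) (BConn K)) {X Y : Mfd.{u}} {u u' : Map X Y}
    {p : (DiffActGpd a).Obj X} {q : (DiffActGpd a).Obj Y} (φ : (DiffActGpd a).Hom u p q)
    (φ' : (DiffActGpd a).Hom u' p q) (hu : u = u') (h : φ.1 = φ'.1) :
    (ConnHom.toBunHom (S.map φ)).map = (ConnHom.toBunHom (S.map φ')).map := by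
  subst hu
  rw [Subtype.ext h]

theorem evalMap_one (S : Mor (ActGpd a) (B K)) : evalMap S 1 = Map.id _ := by
  refine (map_eq S (shift a 1) ((ActGpd a).id (idPt a)) ?_ rfl).trans ?_
  · ext m; exact a.one_act m
  · rw [S.map_id]; rfl

theorem evalMap_mul (S : Mor (ActGpd a) (B K)) (g h : G) :
    evalMap S (g * h) = (evalMap S g).comp (evalMap S h) := by
  refine (map_eq S (shift a (g * h)) ((ActGpd a).comp (shift a h) (shift a g)) ?_ rfl).trans ?_
  · ext m; exact a.mul_act g h m
  · rw [S.map_comp]; rfl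

theorem evalMapConn_one (S : Mor (DiffActGpd a) (BConn K)) : evalMapConn S 1 = Map.id _ := by
  refine (mapConn_eq S (shiftConn a 1) ((DiffActGpd a).id (idPtConn a)) ?_ rfl).trans ?_
  · ext m; exact a.one_act m
  · rw [S.map_id]; rfl

theorem evalMapConn_mul (S : Mor (DiffActGpd a) (BConn K)) (g h : G) :
    evalMapConn S (g * h) = (evalMapConn S g).comp (evalMapConn S h) := by
  refine (mapConn_eq S (shiftConn a (g * h))
    ((DiffActGpd a).comp (shiftConn a h) (shiftConn a g)) ?_ rfl).trans ?_
  · ext m; exact a.mul_act g h m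
  · rw [S.map_comp]; rfl

variable (a K)

/-- For every `S : M // G → BK` the action of `G` on the total space of `S(id_M)` is smooth. -/
def EvalSmooth : Prop := ∀ S : Mor (ActGpd a) (B K),
  ContMDiff (G.I.prod (PrinBundle.tot (S.obj (idPt a))).I) (PrinBundle.tot (S.obj (idPt a))).I ∞
    (fun z : G × PrinBundle.tot (S.obj (idPt a)) => evalMap S z.1 z.2)

/-- For every `S : M //_∇ G → B_∇ K` the action of `G` on the total space of `S(0, id_M)` is
smooth. -/
def EvalConnSmooth : Prop := ∀ S : Mor (DiffActGpd a) (BConn K),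
  ContMDiff (G.I.prod (BunConn.toPrinBundle (S.obj (idPtConn a))).tot.I)
    (BunConn.toPrinBundle (S.obj (idPtConn a))).tot.I ∞
    (fun z : G × (BunConn.toPrinBundle (S.obj (idPtConn a))).tot => evalMapConn S z.1 z.2)

variable {a K}

/-- The functor `S ↦ S(id_M)`, from bundles on `M // G` to equivariant bundles on `M`. -/
def evalFunctor (hs : EvalSmooth a K) : Mor (ActGpd a) (B K) ⥤ EqBun a K where
  obj S :=
    { (S.obj (idPt a) : PrinBundle K M) with
      gact :=
        { act := fun g q => evalMap S g q
          one_act := fun q => by rw [evalMap_one]; rfl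
          mul_act := fun g h q => by rw [evalMap_mul]; rfl
          smooth := hs S }
      gact_act := fun g q k => (S.map (shift a g) : BunHom _ _ _).map_act q k
      proj_gact := fun g q => (S.map (shift a g) : BunHom _ _ _).proj_map q }
  map {S T} σ :=
    { (σ.app (idPt a) : BunHom _ _ _) with
      map_gact := fun g q => congrArg (fun φ : BunHom _ _ _ => φ.map q)
        (σ.naturality (shift a g)) }

/-- The functor `S ↦ S(0, id_M)`, from bundles with connection on `M //_∇ G` to equivariant bundles
with invariant connection on `M`. -/
def evalConnFunctor (hs : EvalConnSmooth a K) : Mor (DiffActGpd a) (BConn K) ⥤ EqBunConn a K where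
  obj S :=
    { (S.obj (idPtConn a) : BunConn K M) with
      gact :=
        { act := fun g q => evalMapConn S g q
          one_act := fun q => by rw [evalMapConn_one]; rfl
          mul_act := fun g h q => by rw [evalMapConn_mul]; rfl
          smooth := hs S }
      gact_act := fun g q k => (S.map (shiftConn a g) : ConnHom _ _ _).map_act q k
      proj_gact := fun g q => (S.map (shiftConn a g) : ConnHom _ _ _).proj_map q
      invariant := fun g => (S.map (shiftConn a g) : ConnHom _ _ _).pres }
  map {S T} σ :=
    { (σ.app (idPtConn a) : ConnHom _ _ _) with
      map_gact := fun g q => congrArg (fun φ : ConnHom _ _ _ => φ.map q)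
        (σ.naturality (shiftConn a g)) }

end Evaluation

/-! ### The associated bundles `(F^* Q) / G` -/

section Associated

variable {G : LieGrp.{u}} {M : Mfd.{u}} {a : LeftAction G M} {K : LieGrp.{u}}

/-- The set underlying the bundle `F^* Q` over `P`: pairs `(p, q)` with `F(p) = π(q)`. -/
def FibProd (Q : EqBun a K) {X : Mfd.{u}} (P : BorelObj a X) : Type u :=
  { z : P.tot × Q.tot // P.F z.1 = Q.proj z.2 }

/-- The pair `(p, q)`. -/
abbrev FibProd.mk {Q : EqBun a K} {X : Mfd.{u}} {P : BorelObj a X} (p : P.tot) (q : Q.tot)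
    (h : P.F p = Q.proj q) : FibProd Q P := ⟨(p, q), h⟩

/-- The map of the pullbacks induced by a morphism in the Borel quotient stack. -/
def FibProd.mapLeft (Q : EqBun a K) {X Y : Mfd.{u}} {f : Map X Y} {P : BorelObj a X}
    {P' : BorelObj a Y} (φ : BorelHom f P P') (z : FibProd Q P) : FibProd Q P' :=
  FibProd.mk (φ.map z.1.1) z.1.2 ((φ.F_map z.1.1).trans z.2)

/-- The map of the pullbacks induced by a morphism of equivariant bundles. -/
def FibProd.mapRight {Q Q' : EqBun a K} (ψ : EqHom Q Q') {X : Mfd.{u}} {P : BorelObj a X}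
    (z : FibProd Q P) : FibProd Q' P :=
  FibProd.mk z.1.1 (ψ.map z.1.2) (z.2.trans (ψ.proj_map z.1.2).symm)

/-- A principal `K`-bundle `R` over `X` is the quotient `(F^* Q) / G`: a surjective map `quo` from
`F^* Q` to the total space of `R`, whose fibres are the orbits of the action
`g (p, q) = (p g⁻¹, g q)` of `G`, which is `K`-equivariant, covers `P → X`, and is smooth (that is,
takes smooth families of points of `F^* Q ⊆ P × Q` to smooth families). The bundle `R` with the map
`quo` is unique up to unique isomorphism. -/
structure Quotient (Q : EqBun a K) {X : Mfd.{u}} (P : BorelObj a X) (R : PrinBundle K X) where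
  quo : FibProd Q P → R.tot
  surj : Function.Surjective quo
  fibre : ∀ z z' : FibProd Q P, quo z = quo z' ↔
    ∃ g : G, z'.1.1 = P.act z.1.1 g⁻¹ ∧ z'.1.2 = Q.gact.act g z.1.2
  quo_act : ∀ (p : P.tot) (q : Q.tot) (h : P.F p = Q.proj q) (k : K),
    quo (FibProd.mk p (Q.act q k) (h.trans (Q.proj_act q k).symm))
      = R.act (quo (FibProd.mk p q h)) k
  proj_quo : ∀ z : FibProd Q P, R.proj (quo z) = P.proj z.1.1
  smooth : ∀ (Y : Mfd.{u}) (b : Map Y P.tot) (c : Map Y Q.tot)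
    (h : ∀ y, P.F (b y) = Q.proj (c y)),
    ContMDiff Y.I R.tot.I ∞ (fun y => quo (FibProd.mk (b y) (c y) (h y)))

/-- The connection `Θ_R` on the quotient is the one induced by `(1 - ι_{ρ(Θ_P)}) F^* Θ_Q`: the
pullbacks of both to any family of points `(b, c) : Y → F^* Q` agree. -/
def IsInducedConn {Q : EqBunConn a K} {X : Mfd.{u}} {P : BorelConnObj a X} {R : BunConn K X}
    (τ : Quotient Q.toEqBun P.toBorelObj R.toPrinBundle) : Prop :=
  ∀ (Y : Mfd.{u}) (b : Map Y P.tot) (c : Map Y Q.tot) (h : ∀ y, P.F (b y) = Q.proj (c y))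
    (y : Y) (w : Y.T y),
    R.conn.val (τ.quo (FibProd.mk (b y) (c y) (h y)))
        (der (fun y => τ.quo (FibProd.mk (b y) (c y) (h y))) y w)
      = Q.conn.val (c y) (der c y w)
        - Q.conn.val (c y) (Q.gact.fund (P.conn.val (b y) (der b y w)) (c y))

/-- The connection `Θ_R` on the quotient is the one induced by `F^* Θ_Q`. -/
def IsDescendedConn {Q : EqBunConn a K} {X : Mfd.{u}} {P : BorelObj a X} {R : BunConn K X}
    (τ : Quotient Q.toEqBun P R.toPrinBundle) : Prop :=
  ∀ (Y : Mfd.{u}) (b : Map Y P.tot) (c : Map Y Q.tot) (h : ∀ y, P.F (b y) = Q.proj (c y))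
    (y : Y) (w : Y.T y),
    R.conn.val (τ.quo (FibProd.mk (b y) (c y) (h y)))
        (der (fun y => τ.quo (FibProd.mk (b y) (c y) (h y))) y w)
      = Q.conn.val (c y) (der c y w)

variable (a K)

/-- The functor `Q ↦ ((P, F) ↦ (F^* Q) / G)`, from equivariant bundles on `M` to bundles on
`EG ×_G M`: the value at `(P, F)` is a quotient of `F^* Q`, and the functoriality in `P` and `Q` is
the one of the quotients. -/
structure AssocFunctor where
  functor : EqBun a K ⥤ Mor (Borel a) (B K)
  quotient : ∀ (Q : EqBun a K) {X : Mfd.{u}} (P : BorelObj a X),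
    Quotient Q P ((functor.obj Q).obj P : PrinBundle K X)
  map_quo : ∀ (Q : EqBun a K) {X Y : Mfd.{u}} {f : Map X Y} {P : BorelObj a X} {P' : BorelObj a Y}
    (φ : BorelHom f P P') (z : FibProd Q P),
    BunHom.map ((functor.obj Q).map φ) ((quotient Q P).quo z)
      = (quotient Q P').quo (FibProd.mapLeft Q φ z)
  app_quo : ∀ {Q Q' : EqBun a K} (ψ : Q ⟶ Q') {X : Mfd.{u}} (P : BorelObj a X) (z : FibProd Q P),
    BunHom.map ((functor.map ψ).app P) ((quotient Q P).quo z)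
      = (quotient Q' P).quo (FibProd.mapRight ψ z)

/-- The functor `(Q, Θ_Q) ↦ ((P, Θ_P, F) ↦ ((F^* Q) / G, (1 - ι_{ρ(Θ_P)}) F^* Θ_Q))`, from
equivariant bundles with invariant connection on `M` to bundles with connection on `E_∇G ×_G M`. -/
structure AssocConnFunctor where
  functor : EqBunConn a K ⥤ Mor (BorelConn a) (BConn K)
  quotient : ∀ (Q : EqBunConn a K) {X : Mfd.{u}} (P : BorelConnObj a X),
    Quotient Q.toEqBun P.toBorelObj (BunConn.toPrinBundle ((functor.obj Q).obj P))
  conn : ∀ (Q : EqBunConn a K) {X : Mfd.{u}} (P : BorelConnObj a X), IsInducedConn (quotient Q P)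
  map_quo : ∀ (Q : EqBunConn a K) {X Y : Mfd.{u}} {f : Map X Y} {P : BorelConnObj a X}
    {P' : BorelConnObj a Y} (φ : BorelConnHom f P P') (z : FibProd Q.toEqBun P.toBorelObj),
    (ConnHom.toBunHom ((functor.obj Q).map φ)).map ((quotient Q P).quo z)
      = (quotient Q P').quo (FibProd.mapLeft Q.toEqBun φ.toBorelHom z)
  app_quo : ∀ {Q Q' : EqBunConn a K} (ψ : Q ⟶ Q') {X : Mfd.{u}} (P : BorelConnObj a X)
    (z : FibProd Q.toEqBun P.toBorelObj),
    (ConnHom.toBunHom ((functor.map ψ).app P)).map ((quotient Q P).quo z)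
      = (quotient Q' P).quo (FibProd.mapRight (EqConnHom.toEqHom ψ) z)

/-- The functor `(Q, Θ_Q) ↦ ((P, F) ↦ ((F^* Q) / G, F^* Θ_Q))`, from equivariant bundles with basic
connection on `M` to bundles with connection on `EG ×_G M`. -/
structure AssocBasicFunctor where
  functor : (IsBasic a K).FullSubcategory ⥤ Mor (Borel a) (BConn K)
  quotient : ∀ (Q : (IsBasic a K).FullSubcategory) {X : Mfd.{u}} (P : BorelObj a X),
    Quotient Q.obj.toEqBun P (BunConn.toPrinBundle ((functor.obj Q).obj P))
  conn : ∀ (Q : (IsBasic a K).FullSubcategory) {X : Mfd.{u}} (P : BorelObj a X),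
    IsDescendedConn (quotient Q P)
  map_quo : ∀ (Q : (IsBasic a K).FullSubcategory) {X Y : Mfd.{u}} {f : Map X Y}
    {P : BorelObj a X} {P' : BorelObj a Y} (φ : BorelHom f P P') (z : FibProd Q.obj.toEqBun P),
    (ConnHom.toBunHom ((functor.obj Q).map φ)).map ((quotient Q P).quo z)
      = (quotient Q P').quo (FibProd.mapLeft Q.obj.toEqBun φ z)
  app_quo : ∀ {Q Q' : (IsBasic a K).FullSubcategory} (ψ : Q ⟶ Q') {X : Mfd.{u}}
    (P : BorelObj a X) (z : FibProd Q.obj.toEqBun P),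
    (ConnHom.toBunHom ((functor.map ψ).app P)).map ((quotient Q P).quo z)
      = (quotient Q' P).quo (FibProd.mapRight (EqConnHom.toEqHom ψ.hom) z)

end Associated

end EquivBun

end

open scoped Manifold ContDiff Topology
open CategoryTheory

noncomputable section

namespace EquivBun

/-! ### Further manifolds, and derivatives of maps which are smooth at a point -/

/-! In each of the three versions the functors form a cyclic triangle: equivariant bundles on `M`,
bundles on the Borel quotient, bundles on the action groupoid, and back. By
`isEquivalence_of_triangle` it is enough that restriction to trivial bundles and evaluation at the
universal object are fully faithful, and that going once around from an equivariant bundle `Q` gives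
`Q` back. For the last point, `q ↦ [((π(q), 1), q)]` is a natural isomorphism from `Q` to the
quotient `(F^* Q)/G` for the trivial bundle over `M` (`Quotient.unitHom`). Inverses of the second
and third functor never have to be constructed.

A transformation between bundle-valued morphisms is controlled by its values over points (`PtObjs`,
`ptMap`): every point of every value is reached from an object over the one-point manifold, and two
arrows reaching it differ by a morphism over the point. Uniqueness and the existence of a natural
equivariant map of sets are then formal; smoothness and compatibility with connections remain. For
trivial bundles both are local, and every object of the Borel quotient is locally isomorphic to a
trivial one (`LocEquiv`). For `M // G` every `f` has a morphism to `id_M`, which makes smoothness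
immediate.

The hard case is `M //_∇ G`, where `(α, f)` need not have a morphism to `(0, id_M)`. Over points
every form vanishes, which still gives a fibrewise map `κ` from the value at `(α, f)` to the value
at `(0, id_M)` (`comparison`). Two facts about `κ` carry the proof.

First, `κ` is smooth (`smooth_comparison`). The object `(s α, f)` over `X × ℝ` restricts to every
line `{x} × ℝ` with zero form, so `κ` is constant along curves which are horizontal in the direction
of `ℝ` (`comparison_eq_of_horizontal`). At `s = 0` it is smooth because there is a genuine morphism,
and local horizontal sections propagate smoothness to `s = 1` by a clopen argument. These sections
come from solving `l⁻¹ dl/ds = b` in `K` with smooth dependence on parameters, which is derived from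
the implicit function theorem in the space of continuous curves.

Second, the connection at `(α, f)` is `κ^* Θ` minus the value of `Θ` on `ρ(α)` (`val_comparison`).
It suffices to test this on curves, and over a line a form can be gauged away. Hence an isomorphism
class is determined by the equivariant bundle with its invariant connection, and morphisms extend.

For basic connections, a morphism out of `M // G` preserves connections also along the action map `G
× M → M`, which forces the connection to vanish on orbits. Precomposition with the morphism
forgetting the form is fully faithful, so the same triangle argument applies, and the descent
criterion follows because full faithfulness reflects isomorphisms.

The quotient bundle is glued from local sections. The form `(1 - ι_{ρ(Θ_P)}) F^* Θ_Q` descends to it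
because moving a family of points of `F^* Q` by a family `g` in `G` changes both terms by the same
multiple of the Maurer-Cartan form of `g`. -/

/-- The one-point manifold. -/
abbrev Mfd.pt : Mfd.{u} where
  carrier := PUnit
  E := PUnit
  H := PUnit
  I := 𝓘(ℝ, PUnit)

/-- A finite-dimensional vector space as a manifold. -/
abbrev Mfd.vec (V : Type u) [NormedAddCommGroup V] [NormedSpace ℝ V] [FiniteDimensional ℝ V] :
    Mfd.{u} where
  carrier := V
  E := V
  H := V
  I := 𝓘(ℝ, V)
  secondCountable := by infer_instance

/-- The real line. -/
abbrev Mfd.line : Mfd.{u} := Mfd.vec (ULift.{u} ℝ)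

/-- An open submanifold. -/
abbrev Mfd.opn (X : Mfd.{u}) (U : TopologicalSpace.Opens X) : Mfd.{u} where
  carrier := U
  E := X.E
  H := X.H
  I := X.I

/-- The inclusion of an open submanifold. -/
def Mfd.incl (X : Mfd.{u}) (U : TopologicalSpace.Opens X) : Map (X.opn U) X :=
  ⟨Subtype.val, contMDiff_subtype_val (I := X.I) (M := X) (U := U)⟩

/-- The inclusion of a point. -/
def Mfd.point {X : Mfd.{u}} (x : X) : Map Mfd.pt.{u} X := ContMDiffMap.const x

/-- The composite of smooth maps. -/
abbrev Map.cmp {X Y Z : Mfd.{u}} (g : Map Y Z) (f : Map X Y) : Map X Z := ContMDiffMap.comp g f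

/-- Smoothness of a map of manifolds. -/
abbrev Sm (X Y : Mfd.{u}) (f : X → Y) : Prop := ContMDiff X.I Y.I ∞ f

/-- Smoothness of a map of manifolds at a point. -/
abbrev SmAt (X Y : Mfd.{u}) (f : X → Y) (x : X) : Prop := ContMDiffAt X.I Y.I ∞ f x

/-- Differentiability of a map of manifolds at a point. -/
abbrev DiffAt (X Y : Mfd.{u}) (f : X → Y) (x : X) : Prop := MDifferentiableAt X.I Y.I f x

section Germs

variable {X Y Z W : Mfd.{u}}

theorem SmAt.diff {f : X → Y} {x : X} (h : SmAt X Y f x) : DiffAt X Y f x :=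
  h.mdifferentiableAt (by simp)

theorem SmAt.comp {g : Y → Z} {f : X → Y} (x : X) (hg : SmAt Y Z g (f x)) (hf : SmAt X Y f x) :
    SmAt X Z (fun x => g (f x)) x :=
  ContMDiffAt.comp x hg hf

theorem SmAt.congr {f g : X → Y} {x : X} (hf : SmAt X Y f x) (h : g =ᶠ[𝓝 x] f) : SmAt X Y g x :=
  ContMDiffAt.congr_of_eventuallyEq hf h

theorem SmAt.prodMk {f : X → Y} {g : X → Z} {x : X} (hf : SmAt X Y f x) (hg : SmAt X Z g x) :
    SmAt X (Y.prod Z) (fun x => (f x, g x)) x :=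
  ContMDiffAt.prodMk hf hg

theorem smAt_id (x : X) : SmAt X X (fun x => x) x := contMDiffAt_id

theorem smAt_const (y : Y) (x : X) : SmAt X Y (fun _ => y) x := contMDiffAt_const

theorem SmAt.eventually {f : X → Y} {x : X} (hf : SmAt X Y f x) {p : Y → Prop}
    (h : ∀ᶠ y in 𝓝 (f x), p y) : ∀ᶠ z in 𝓝 x, p (f z) :=
  hf.continuousAt.eventually h

theorem Map.smAt (f : Map X Y) (x : X) : SmAt X Y f x := f.contMDiff x

theorem der_comp_at {g : Y → Z} {f : X → Y} (x : X) (hg : DiffAt Y Z g (f x))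
    (hf : DiffAt X Y f x) (w : X.T x) :
    (der (X := X) (Y := Z) (fun x => g (f x)) x w : Z.E)
      = der (X := Y) (Y := Z) g (f x) (der (X := X) (Y := Y) f x w) :=
  mfderiv_comp_apply x hg hf w

theorem der_prodMk {f : X → Y} {g : X → Z} {x : X} (hf : DiffAt X Y f x) (hg : DiffAt X Z g x)
    (w : X.T x) :
    (der (X := X) (Y := Y.prod Z) (fun x => (f x, g x)) x w : Y.E × Z.E)
      = (der (X := X) (Y := Y) f x w, der (X := X) (Y := Z) g x w) := by
  have h := mfderiv_prodMk hf hg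
  change mfderiv X.I (Y.I.prod Z.I) (fun x => (f x, g x)) x w = _
  rw [h]; rfl

theorem diffAt_prodMk {f : X → Y} {g : X → Z} {x : X} (hf : DiffAt X Y f x)
    (hg : DiffAt X Z g x) : DiffAt X (Y.prod Z) (fun x => (f x, g x)) x :=
  hf.prodMk hg

/-- The derivative of a map of two variables along a pair of families. -/
theorem der_pair {m : X × Y → Z} {f : W → X} {g : W → Y} {w : W}
    (hm : DiffAt (X.prod Y) Z m (f w, g w)) (hf : DiffAt W X f w) (hg : DiffAt W Y g w)
    (v : W.T w) :
    (der (X := W) (Y := Z) (fun z => m (f z, g z)) w v : Z.E)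
      = @HAdd.hAdd Z.E Z.E Z.E _
        (der (X := X) (Y := Z) (fun x => m (x, g w)) (f w) (der (X := W) (Y := X) f w v))
        (der (X := Y) (Y := Z) (fun y => m (f w, y)) (g w) (der (X := W) (Y := Y) g w v)) := by
  have h1 := der_comp_at (X := W) (Y := X.prod Y) (Z := Z) (g := m) (f := fun z => (f z, g z)) w hm
    (diffAt_prodMk hf hg) v
  refine h1.trans ?_
  rw [show (der (X := W) (Y := X.prod Y) (fun z => (f z, g z)) w v : X.E × Y.E) = _ from
    der_prodMk hf hg v]
  exact mfderiv_prod_eq_add_apply hm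

theorem der_congr {f g : X → Y} {x : X} (h : f =ᶠ[𝓝 x] g) (w : X.T x) :
    (der (X := X) (Y := Y) f x w : Y.E) = der (X := X) (Y := Y) g x w := by
  have := h.mfderiv_eq (I := X.I) (I' := Y.I)
  exact congrArg (fun (L : X.E →L[ℝ] Y.E) => L w) this

theorem der_id (x : X) (w : X.T x) : (der (X := X) (Y := X) (fun x => x) x w : X.E) = w := by
  change mfderiv X.I X.I id x w = w
  rw [mfderiv_id]; rfl

theorem der_const (y : Y) (x : X) (w : X.T x) :
    (der (X := X) (Y := Y) (fun _ => y) x w : Y.E) = 0 := by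
  change mfderiv X.I Y.I (fun _ : X => y) x w = 0
  rw [mfderiv_const]; rfl

/-- The smoothness, at the points over an open set, of the pullback of a smooth form by a map which
is smooth on this set. -/
theorem contMDiffOn_pull {V : Type u} [NormedAddCommGroup V] [NormedSpace ℝ V] (α : OneForm Y V)
    {f : X → Y} {U : Set X} (hU : IsOpen U) (hf : ContMDiffOn X.I Y.I ∞ f U) :
    ContMDiffOn X.I.tangent 𝓘(ℝ, V) ∞
      (fun w : TangentBundle X.I X => α.val (f w.proj) (der (X := X) (Y := Y) f w.proj w.snd))
      (Bundle.TotalSpace.proj ⁻¹' U) := by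
  have h := α.smooth.comp_contMDiffOn
    (hf.contMDiffOn_tangentMapWithin (m := ∞) (by simp) hU.uniqueMDiffOn)
  refine h.congr fun w hw => ?_
  have : mfderivWithin X.I Y.I f U w.proj = mfderiv X.I Y.I f w.proj :=
    mfderivWithin_of_mem_nhds (hU.mem_nhds hw)
  change _ = α.val (f w.proj) (mfderivWithin X.I Y.I f U w.proj w.snd)
  rw [this]

/-- The unit vector of the line. -/
abbrev oneL : Mfd.line.{u} := ⟨1⟩

/-- The map `t ↦ s + ε sin t`. -/
def sinMap (s ε : ℝ) : Map Mfd.line.{u} Mfd.line.{u} :=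
  ⟨fun t => ⟨s + ε * Real.sin t.down⟩, by
    have h : ContDiff ℝ ∞ (fun t : ULift.{u} ℝ => (⟨s + ε * Real.sin t.down⟩ : ULift.{u} ℝ)) := by
      have h1 : ContDiff ℝ ∞ (fun t : ULift.{u} ℝ => t.down) :=
        (ContinuousLinearEquiv.ulift (R₁ := ℝ) (M₁ := ℝ)).contDiff
      have h2 : ContDiff ℝ ∞ (fun t : ℝ => (⟨t⟩ : ULift.{u} ℝ)) :=
        (ContinuousLinearEquiv.ulift (R₁ := ℝ) (M₁ := ℝ)).symm.contDiff
      exact h2.comp (contDiff_const.add (contDiff_const.mul (Real.contDiff_sin.comp h1)))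
    exact h.contMDiff⟩

/-- The sine replaces the identity so that a curve known only on a short interval can be
reparametrized to the whole line while keeping a nonzero velocity at `0`. -/
theorem der_sinMap (s ε : ℝ) : der (sinMap.{u} s ε) (⟨0⟩ : Mfd.line.{u}) oneL = (⟨ε⟩ : ULift.{u} ℝ) := by
  change mfderiv _ _ _ _ _ = _
  rw [mfderiv_eq_fderiv]
  let e : ULift.{u} ℝ ≃L[ℝ] ℝ := ContinuousLinearEquiv.ulift
  have h1 : HasDerivAt (fun t : ℝ => s + ε * Real.sin t) ε 0 := by
    simpa using ((Real.hasDerivAt_sin 0).const_mul ε).const_add s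
  have h2 : HasFDerivAt (fun t : ULift.{u} ℝ => s + ε * Real.sin (e t))
     ((ContinuousLinearMap.toSpanSingleton ℝ ε).comp (e : ULift.{u} ℝ →L[ℝ] ℝ)) ⟨0⟩ :=
    HasFDerivAt.comp (⟨0⟩ : ULift.{u} ℝ) (g := fun t : ℝ => s + ε * Real.sin t) h1.hasFDerivAt e.hasFDerivAt
  have h3 : HasFDerivAt (sinMap.{u} s ε) _ (⟨0⟩ : ULift.{u} ℝ) :=
    (e.symm : ℝ →L[ℝ] ULift.{u} ℝ).hasFDerivAt.comp (⟨0⟩ : ULift.{u} ℝ) h2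
  rw [h3.fderiv]
  change (⟨(1 : ℝ) • ε⟩ : ULift.{u} ℝ) = ⟨ε⟩
  rw [one_smul]

/-- The line `x + t v` in a chart, reparametrized so that it is defined on the whole line. -/
theorem exists_curve (x : X) (w : X.T x) : ∃ (c : Map Mfd.line.{u} X) (ε : ℝ), ε ≠ 0 ∧ ∃ h : c ⟨0⟩ = x,
    (der c ⟨0⟩ oneL : X.E) = ε • (w : X.E) := by
  let φ := extChartAt X.I x
  have hsm : ContMDiffOn 𝓘(ℝ, X.E) X.I ∞ φ.symm φ.target := contMDiffOn_extChartAt_symm x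
  have hφ : ContMDiffAt X.I 𝓘(ℝ, X.E) ∞ φ x := contMDiffAt_extChartAt
  have ht : φ.target ∈ 𝓝 (φ x) := extChartAt_target_mem_nhds x
  let v : X.E := mfderiv X.I 𝓘(ℝ, X.E) φ x w
  obtain ⟨δ, hδ, hball⟩ := Metric.mem_nhds_iff.1 ht
  -- Small enough that the segment of length `ε ‖v‖` stays in the ball of radius `δ`; the `+ 1`
  -- covers `v = 0`.
  let ε : ℝ := δ / (2 * (‖v‖ + 1))
  have hε : 0 < ε := by positivity
  let e : ULift.{u} ℝ ≃L[ℝ] ℝ := ContinuousLinearEquiv.ulift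
  let ℓ : ULift.{u} ℝ → X.E := fun t => φ x + e t • v
  have hℓ : ContDiff ℝ ∞ ℓ := contDiff_const.add (e.contDiff.smul contDiff_const)
  have hmem : ∀ t : ULift.{u} ℝ, ℓ (sinMap 0 ε t) ∈ φ.target := by
    intro t
    apply hball
    have h1 : |ε * Real.sin t.down| ≤ ε := by
      rw [abs_mul, abs_of_pos hε]
      exact mul_le_of_le_one_right hε.le (Real.abs_sin_le_one _)
    have h2 : ε * ‖v‖ < δ := by
      have : ε * (2 * (‖v‖ + 1)) = δ := by
        simp only [ε]; field_simp
      nlinarith [norm_nonneg v]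
    have h3 : e (sinMap 0 ε t) = ε * Real.sin t.down := zero_add _
    simp only [ℓ, h3, Metric.mem_ball, dist_self_add_left, norm_smul, Real.norm_eq_abs]
    exact lt_of_le_of_lt (mul_le_mul_of_nonneg_right h1 (norm_nonneg v)) h2
  have hℓ' : Sm Mfd.line.{u} (Mfd.vec X.E) (fun t => ℓ (sinMap 0 ε t)) :=
    hℓ.contMDiff.comp (sinMap 0 ε).contMDiff
  have hc : Sm Mfd.line.{u} X (fun t => φ.symm (ℓ (sinMap 0 ε t))) :=
    hsm.comp_contMDiff hℓ' hmem
  have hs0 : sinMap.{u} 0 ε ⟨0⟩ = (⟨0⟩ : ULift.{u} ℝ) := by simp [sinMap]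
  have hℓ0 : ℓ ⟨0⟩ = φ x := by
    change φ x + (0 : ℝ) • v = _
    rw [zero_smul, add_zero]
  refine ⟨⟨_, hc⟩, ε, hε.ne', ?_, ?_⟩
  · change φ.symm (ℓ (sinMap 0 ε ⟨0⟩)) = x
    rw [hs0, hℓ0]
    exact extChartAt_to_inv x
  · have hd : SmAt (Mfd.vec X.E) X φ.symm (φ x) := (hsm _ (mem_of_mem_nhds ht)).contMDiffAt ht
    have hd' : DiffAt (Mfd.vec X.E) X φ.symm (ℓ (sinMap 0 ε ⟨0⟩)) := by rw [hs0, hℓ0]; exact hd.diff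
    have e1 := der_comp_at (X := Mfd.line.{u}) (Y := Mfd.vec X.E) (Z := X) (g := φ.symm)
      (f := fun t => ℓ (sinMap 0 ε t)) ⟨0⟩ hd' (SmAt.diff (hℓ' _)) oneL
    refine e1.trans ?_
    have e2 := der_comp_at (X := Mfd.line.{u}) (Y := Mfd.line.{u}) (Z := Mfd.vec X.E) (g := ℓ)
      (f := sinMap 0 ε) ⟨0⟩ (SmAt.diff (hℓ.contMDiff _)) ((sinMap 0 ε).mdiff _) oneL
    have e3 : (der (X := Mfd.line.{u}) (Y := Mfd.vec X.E) ℓ (sinMap 0 ε ⟨0⟩)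
        (der (sinMap 0 ε) (⟨0⟩ : Mfd.line.{u}) oneL) : X.E) = ε • v := by
      rw [der_sinMap]
      have : HasFDerivAt ℓ ((ContinuousLinearMap.toSpanSingleton ℝ v).comp (e : ULift.{u} ℝ →L[ℝ] ℝ))
          (sinMap 0 ε ⟨0⟩ : ULift.{u} ℝ) := by
        refine HasFDerivAt.const_add _ ?_
        exact (ContinuousLinearMap.toSpanSingleton ℝ v).hasFDerivAt.comp (sinMap 0 ε ⟨0⟩ : ULift.{u} ℝ) e.hasFDerivAt
      change mfderiv _ _ _ _ _ = _
      rw [mfderiv_eq_fderiv, this.fderiv]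
      rfl
    rw [show (der (X := Mfd.line.{u}) (Y := Mfd.vec X.E) (fun t => ℓ (sinMap 0 ε t)) ⟨0⟩ oneL : X.E)
      = ε • v from e2.trans e3]
    refine ((der (X := Mfd.vec X.E) (Y := X) φ.symm (ℓ (sinMap 0 ε ⟨0⟩))).map_smul ε v).trans ?_
    congr 1
    have e4 : (der (X := Mfd.vec X.E) (Y := X) φ.symm (ℓ (sinMap 0 ε ⟨0⟩)) v : X.E)
        = der (X := Mfd.vec X.E) (Y := X) φ.symm (φ x) v :=
      der_congr_pt (X := Mfd.vec X.E) φ.symm (by rw [hs0, hℓ0]) v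
    refine e4.trans ?_
    have e5 := der_comp_at (X := X) (Y := Mfd.vec X.E) (Z := X) (g := φ.symm) (f := φ) x hd.diff
      (SmAt.diff (X := X) (Y := Mfd.vec X.E) hφ) w
    refine e5.symm.trans ?_
    have e6 : (fun y => φ.symm (φ y)) =ᶠ[𝓝 x] fun y => y := by
      filter_upwards [extChartAt_source_mem_nhds (I := X.I) x] with y hy
      exact φ.left_inv hy
    exact (der_congr e6 w).trans (der_id x w)

end Germs

/-! ### Local sections, division and lifts in principal bundles -/

theorem OneForm.val_congr {X : Mfd.{u}} {V : Type u} [NormedAddCommGroup V] [NormedSpace ℝ V]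
    (α : OneForm X V) {x y : X} (h : x = y) (w : X.E) :
    α.val x (w : X.T x) = α.val y (w : X.T y) := by subst h; rfl

namespace PrinBundle

variable {K : LieGrp.{u}} {X Y : Mfd.{u}} (P : PrinBundle K X)

/-- A local section `s` of a principal bundle, and the resulting fibre coordinate `k`. -/
structure LocSec where
  U : TopologicalSpace.Opens X
  s : X → P.tot
  k : P.tot → K
  smooth_s : ∀ x ∈ U, SmAt X P.tot s x
  smooth_k : ∀ p, P.proj p ∈ U → SmAt P.tot K.toMfd k p
  proj_s : ∀ x ∈ U, P.proj (s x) = x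
  act_k : ∀ p, P.proj p ∈ U → P.act (s (P.proj p)) (k p) = p
  k_act : ∀ p, P.proj p ∈ U → ∀ l, k (P.act p l) = k p * l

theorem exists_locSec (x : X) : ∃ σ : LocSec P, x ∈ σ.U := by
  obtain ⟨U, e, hx, hU, hs, ht, he, he', hproj, hact⟩ := P.locTriv x
  have hsrc : ∀ p, P.proj p ∈ U → p ∈ e.source := fun p hp => by rw [hs]; exact hp
  have htgt : ∀ y ∈ U, ((y, 1) : X × K) ∈ e.target := fun y hy => by rw [ht]; exact ⟨hy, trivial⟩
  have hps : ∀ y ∈ U, P.proj (e.symm (y, 1)) = y := fun y hy => by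
    rw [← hproj _ (e.map_target (htgt y hy)), e.right_inv (htgt y hy)]
  refine ⟨⟨⟨U, hU⟩, fun y => e.symm (y, 1), fun p => (e p).2, ?_, ?_, hps, ?_, ?_⟩, hx⟩
  · intro y hy
    have h1 : ContMDiffAt (X.I.prod K.I) P.tot.I ∞ e.symm (y, 1) :=
      (he' _ (htgt y hy)).contMDiffAt (e.open_target.mem_nhds (htgt y hy))
    have h2 : ContMDiffAt X.I (X.I.prod K.I) ∞ (fun y : X => (y, (1 : K))) y :=
      contMDiffAt_id.prodMk contMDiffAt_const
    exact ContMDiffAt.comp y h1 h2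
  · intro p hp
    have h1 : ContMDiffAt P.tot.I (X.I.prod K.I) ∞ e p :=
      (he _ (hsrc p hp)).contMDiffAt (e.open_source.mem_nhds (hsrc p hp))
    exact contMDiffAt_snd.comp p h1
  · intro p hp
    have hsp := e.map_target (htgt _ hp)
    refine e.injOn (hsrc _ ?_) (hsrc p hp) ?_
    · rw [P.proj_act, hps _ hp]; exact hp
    · rw [hact _ hsp, e.right_inv (htgt _ hp), one_mul, ← hproj p (hsrc p hp)]
  · intro p hp l
    simp only [hact p (hsrc p hp)]

theorem proj_surj (x : X) : ∃ p, P.proj p = x := by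
  obtain ⟨σ, h⟩ := P.exists_locSec x
  exact ⟨σ.s x, σ.proj_s x h⟩

theorem act_free {p : P.tot} {k l : K} (h : P.act p k = P.act p l) : k = l := by
  obtain ⟨σ, hσ⟩ := P.exists_locSec (P.proj p)
  have := congrArg σ.k h
  rw [σ.k_act p hσ, σ.k_act p hσ] at this
  exact mul_left_cancel this

theorem exists_act {p q : P.tot} (h : P.proj p = P.proj q) : ∃ k, P.act p k = q := by
  obtain ⟨σ, hσ⟩ := P.exists_locSec (P.proj p)
  refine ⟨(σ.k p)⁻¹ * σ.k q, ?_⟩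
  have h1 := σ.act_k p hσ
  have h2 := σ.act_k q (h ▸ hσ)
  nth_rewrite 1 [← h1]
  rw [← P.act_mul, mul_inv_cancel_left, h, h2]

open Classical in
/-- The element `k` with `p k = q`. -/
def div (p q : P.tot) : K := if h : P.proj p = P.proj q then (P.exists_act h).choose else 1

theorem act_div {p q : P.tot} (h : P.proj p = P.proj q) : P.act p (P.div p q) = q := by
  rw [div, dif_pos h]
  exact (P.exists_act h).choose_spec

theorem div_eq {p q : P.tot} {k : K} (h : P.act p k = q) : P.div p q = k :=
  P.act_free ((P.act_div (by rw [← h, P.proj_act])).trans h.symm)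

/-- Over the domain of a local section with fibre coordinate `k`, division is `k(p)⁻¹ k(q)`; the
arbitrary choice in `div` is harmless because the action is free. -/
theorem smAt_div {b c : Y → P.tot} {y : Y} (hb : SmAt Y P.tot b y) (hc : SmAt Y P.tot c y)
    (h : ∀ᶠ z in 𝓝 y, P.proj (b z) = P.proj (c z)) :
    SmAt Y K.toMfd (fun z => P.div (b z) (c z)) y := by
  obtain ⟨σ, hσ⟩ := P.exists_locSec (P.proj (b y))
  have h0 := h.self_of_nhds
  have h1 : SmAt Y K.toMfd (fun z => (σ.k (b z))⁻¹ * σ.k (c z)) y :=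
    ((σ.smooth_k _ hσ).comp y hb).inv.mul ((σ.smooth_k _ (h0 ▸ hσ)).comp y hc)
  refine h1.congr_of_eventuallyEq ?_
  have h2 : ∀ᶠ z in 𝓝 y, P.proj (b z) ∈ σ.U :=
    (P.proj.contMDiff.continuous.continuousAt.comp hb.continuousAt).eventually
      (σ.U.isOpen.mem_nhds hσ)
  filter_upwards [h, h2] with z hz hz2
  refine P.div_eq ?_
  nth_rewrite 1 [← σ.act_k (b z) hz2]
  rw [← P.act_mul, mul_inv_cancel_left, hz, σ.act_k _ (hz ▸ hz2)]

theorem smAt_act {b : Y → P.tot} {k : Y → K} {y : Y} (hb : SmAt Y P.tot b y)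
    (hk : SmAt Y K.toMfd k y) : SmAt Y P.tot (fun z => P.act (b z) (k z)) y :=
  ContMDiffAt.comp y (P.smooth_act (b y, k y)) (hb.prodMk hk)

/-- Right translation. -/
def ract (k : K) : Map P.tot P.tot :=
  ⟨fun p => P.act p k, P.smooth_act.comp (contMDiff_id.prodMk contMDiff_const)⟩

/-- The orbit map. -/
def orb (p : P.tot) : Map K.toMfd P.tot :=
  ⟨fun k => P.act p k, P.smooth_act.comp (contMDiff_const.prodMk contMDiff_id)⟩

/-- An equivariant map is recovered from its values on a local section `s` as `f(s(π(z))) k(z)`, so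
smoothness along the section suffices. -/
theorem smAt_of_equivariant {f : P.tot → Y} {p : P.tot} (actY : Y → K → Y)
    (hact : ContMDiff (Y.I.prod K.I) Y.I ∞ (fun z : Y × K => actY z.1 z.2))
    (hf : ∀ p k, f (P.act p k) = actY (f p) k) (σ : LocSec P) (hσ : P.proj p ∈ σ.U)
    (hs : SmAt X Y (fun x => f (σ.s x)) (P.proj p)) : SmAt P.tot Y f p := by
  have h1 : SmAt P.tot Y (fun p => actY (f (σ.s (P.proj p))) (σ.k p)) p :=
    ContMDiffAt.comp p (hact (f (σ.s (P.proj p)), σ.k p))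
      (((ContMDiffAt.comp p hs (P.proj.smAt p))).prodMk (σ.smooth_k p hσ))
  refine h1.congr_of_eventuallyEq ?_
  have h2 : ∀ᶠ z in 𝓝 p, P.proj z ∈ σ.U :=
    P.proj.contMDiff.continuous.continuousAt.eventually (σ.U.isOpen.mem_nhds hσ)
  filter_upwards [h2] with z hz
  rw [← hf, σ.act_k z hz]

end PrinBundle

namespace BunHom

variable {K : LieGrp.{u}} {X Y Z : Mfd.{u}} {f : Map X Y} {R : PrinBundle K X} {Q : PrinBundle K Y}

theorem lift_unique (φ : BunHom f R Q) {r r' : R.tot} (h : R.proj r = R.proj r')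
    (h' : φ.map r = φ.map r') : r = r' := by
  obtain ⟨k, rfl⟩ := R.exists_act h
  rw [φ.map_act] at h'
  have : (1 : K) = k := Q.act_free ((Q.act_one _).trans h')
  rw [← this, R.act_one]

/-- The point over `x` which is mapped to `q`. -/
def lift (φ : BunHom f R Q) (x : X) (q : Q.tot) : R.tot :=
  R.act (R.proj_surj x).choose (Q.div (φ.map (R.proj_surj x).choose) q)

theorem proj_lift (φ : BunHom f R Q) (x : X) (q : Q.tot) : R.proj (φ.lift x q) = x := by
  rw [lift, R.proj_act, (R.proj_surj x).choose_spec]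

theorem map_lift (φ : BunHom f R Q) {x : X} {q : Q.tot} (h : Q.proj q = f x) :
    φ.map (φ.lift x q) = q := by
  rw [lift, φ.map_act, Q.act_div]
  rw [φ.proj_map, (R.proj_surj x).choose_spec, h]

theorem lift_eq (φ : BunHom f R Q) {x : X} {q : Q.tot} {r : R.tot} (h : R.proj r = x)
    (h' : φ.map r = q) : φ.lift x q = r :=
  φ.lift_unique ((φ.proj_lift x q).trans h.symm)
    ((φ.map_lift (by rw [← h', φ.proj_map, h])).trans h'.symm)

/-- The definition of `lift` starts from an arbitrary point over `x`. By uniqueness this point may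
be replaced by `s(x)` for a local section `s`, and then only division and the action enter. -/
theorem smAt_lift (φ : BunHom f R Q) {b : Z → X} {c : Z → Q.tot} {z : Z} (hb : SmAt Z X b z)
    (hc : SmAt Z Q.tot c z) (h : ∀ᶠ z in 𝓝 z, Q.proj (c z) = f (b z)) :
    SmAt Z R.tot (fun z => φ.lift (b z) (c z)) z := by
  obtain ⟨σ, hσ⟩ := R.exists_locSec (b z)
  have hs : SmAt Z R.tot (fun z => σ.s (b z)) z := (σ.smooth_s _ hσ).comp z hb
  have hs' : SmAt Z Q.tot (fun z => φ.map (σ.s (b z))) z := (φ.map.smAt _).comp z hs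
  have h2 : ∀ᶠ z in 𝓝 z, b z ∈ σ.U := hb.continuousAt.eventually (σ.U.isOpen.mem_nhds hσ)
  have h3 : ∀ᶠ z in 𝓝 z, Q.proj (φ.map (σ.s (b z))) = Q.proj (c z) := by
    filter_upwards [h, h2] with z hz hz2
    rw [φ.proj_map, σ.proj_s _ hz2, hz]
  refine (R.smAt_act hs (Q.smAt_div hs' hc h3)).congr_of_eventuallyEq ?_
  filter_upwards [h2, h3] with z hz2 hz3
  refine φ.lift_eq ?_ ?_
  · rw [R.proj_act, σ.proj_s _ hz2]
  · rw [φ.map_act, Q.act_div hz3]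

theorem lift_act (φ : BunHom f R Q) {x : X} {q : Q.tot} (h : Q.proj q = f x) (k : K) :
    φ.lift x (Q.act q k) = R.act (φ.lift x q) k :=
  φ.lift_eq (by rw [R.proj_act, φ.proj_lift]) (by rw [φ.map_act, φ.map_lift h])

/-- The factorization of a bundle morphism over `f ∘ g` through a bundle morphism over `f`. -/
def factor {g : Map Z X} {R' : PrinBundle K Z} (φ : BunHom f R Q) (χ : BunHom (f.comp g) R' Q) :
    BunHom g R' R where
  map := ⟨fun r => φ.lift (g (R'.proj r)) (χ.map r), fun r =>
    φ.smAt_lift (Z := R'.tot) (Map.smAt (g.comp R'.proj) r) (χ.map.smAt r)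
      (Filter.Eventually.of_forall fun r => χ.proj_map r)⟩
  map_act r k := by
    change φ.lift (g (R'.proj (R'.act r k))) (χ.map (R'.act r k)) = _
    rw [R'.proj_act, χ.map_act]
    exact φ.lift_act (χ.proj_map r) k
  proj_map r := φ.proj_lift _ _

theorem map_factor {g : Map Z X} {R' : PrinBundle K Z} (φ : BunHom f R Q)
    (χ : BunHom (f.comp g) R' Q) (r : R'.tot) : φ.map ((φ.factor χ).map r) = χ.map r :=
  φ.map_lift (χ.proj_map r)

/-- The inverse of a bundle morphism over the identity. -/
def inv {R R' : PrinBundle K X} (φ : BunHom (Map.id X) R R') : BunHom (Map.id X) R' R :=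
  factor (f := Map.id X) (g := Map.id X) φ (BunHom.id R')

theorem map_inv {R R' : PrinBundle K X} (φ : BunHom (Map.id X) R R') (r : R'.tot) :
    φ.map (φ.inv.map r) = r :=
  map_factor (f := Map.id X) (g := Map.id X) φ (BunHom.id R') r

theorem inv_map {R R' : PrinBundle K X} (φ : BunHom (Map.id X) R R') (r : R.tot) :
    φ.inv.map (φ.map r) = r :=
  φ.lift_eq (x := R'.proj (φ.map r)) (by rw [φ.proj_map]; rfl) rfl

theorem pres_inv {R R' : PrinBundle K X} {Θ : Connection R} {Θ' : Connection R'}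
    (φ : BunHom (Map.id X) R R') (h : Θ.Pres Θ' φ.map) : Θ'.Pres Θ φ.inv.map := by
  have e : φ.map.comp φ.inv.map = Map.id R'.tot := by ext r; exact φ.map_inv r
  unfold Connection.Pres at *
  rw [← h, pull_pull, e, pull_id]

end BunHom

/-! ### The derivatives of group actions -/

section Derivatives

variable {K : LieGrp.{u}} {X Y : Mfd.{u}}

theorem der_mc (g : K) (w : K.E) :
    (der (lmul g) (1 : K) (K.mc g (w : K.T g)) : K.E) = w := by
  have h1 := der_comp (lmul g) (lmul g⁻¹) g w
  have h2 : (fun x => (lmul g) ((lmul g⁻¹) x)) = fun x : K => x := by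
    funext x; simp [lmul]
  rw [h2] at h1
  refine (Eq.trans ?_ h1.symm).trans (der_id (X := K.toMfd) g w)
  exact der_congr_pt (lmul g) (by simp [lmul]) _

theorem mc_injective (g : K) {w : K.E} (h : (K.mc g (w : K.T g) : K.E) = 0) : w = 0 := by
  have h1 := der_mc g w
  rw [h] at h1
  rw [← h1]
  exact map_zero _

/-- The Leibniz rule, with the group variable rewritten through `p l = (p k)(k⁻¹ l)`. This turns the
derivative of the second factor into the fundamental vector at `p k` of its Maurer-Cartan form. -/
theorem PrinBundle.der_act (P : PrinBundle K X) {p : Y → P.tot} {k : Y → K} {y : Y}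
    (hp : DiffAt Y P.tot p y) (hk : DiffAt Y K.toMfd k y) (w : Y.T y) :
    (der (X := Y) (Y := P.tot) (fun y => P.act (p y) (k y)) y w : P.tot.E)
      = @HAdd.hAdd P.tot.E P.tot.E P.tot.E _
        (der (P.ract (k y)) (p y) (der (X := Y) (Y := P.tot) p y w))
        (der (P.orb (P.act (p y) (k y))) (1 : K)
          (K.mc (k y) (der (X := Y) (Y := K.toMfd) k y w))) := by
  have h1 := der_pair (X := P.tot) (Y := K.toMfd) (Z := P.tot) (W := Y)
    (m := fun z => P.act z.1 z.2) (f := p) (g := k) (w := y)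
    (SmAt.diff (X := P.tot.prod K.toMfd) (P.smooth_act _)) hp hk w
  refine h1.trans ?_
  congr 1
  have h2 : (fun l => P.act (p y) l)
      = fun l => P.orb (P.act (p y) (k y)) (lmul (k y)⁻¹ l) := by
    funext l
    change _ = P.act (P.act (p y) (k y)) ((k y)⁻¹ * l)
    rw [← P.act_mul, mul_inv_cancel_left]
  rw [h2]
  refine (der_comp (P.orb (P.act (p y) (k y))) (lmul (k y)⁻¹) (k y) _).trans ?_
  exact der_congr_pt (P.orb (P.act (p y) (k y))) (by simp [lmul]) _

theorem Connection.val_orb {P : PrinBundle K X} (Θ : Connection P) (p : P.tot) (A : K.Lie) :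
    Θ.val p (der (P.orb p) (1 : K) A : P.tot.E) = A :=
  (Θ.toOneForm.val_congr (P.act_one p).symm _).trans (Θ.vertical p A)

/-- The connection form on the derivative of a product. -/
theorem Connection.val_der_act {P : PrinBundle K X} (Θ : Connection P) {p : Y → P.tot}
    {k : Y → K} {y : Y} (hp : DiffAt Y P.tot p y) (hk : DiffAt Y K.toMfd k y) (w : Y.T y) :
    Θ.val (P.act (p y) (k y)) (der (X := Y) (Y := P.tot) (fun y => P.act (p y) (k y)) y w)
      = K.Ad (k y)⁻¹ (Θ.val (p y) (der (X := Y) (Y := P.tot) p y w))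
        + K.mc (k y) (der (X := Y) (Y := K.toMfd) k y w) := by
  refine (congrArg (Θ.val (P.act (p y) (k y))) (P.der_act hp hk w)).trans ?_
  refine ((Θ.val (P.act (p y) (k y))).map_add _ _).trans ?_
  congr 1
  · exact Θ.equivariant _ _ _
  · exact Θ.val_orb _ _

namespace LeftAction

variable {G : LieGrp.{u}} {M N : Mfd.{u}} (a : LeftAction G M)

/-- The orbit map. -/
def orb (m : M) : Map G.toMfd M :=
  ⟨fun g => a.act g m, a.smooth.comp (contMDiff_id.prodMk contMDiff_const)⟩

theorem fund_eq (A : G.Lie) (m : M) : (a.fund A m : M.E) = - der (a.orb m) (1 : G) A :=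
  (der (a.orb m) (1 : G)).map_neg A

theorem fund_zero (m : M) : (a.fund 0 m : M.E) = 0 := by
  rw [fund_eq]
  exact neg_eq_zero.2 (map_zero _)

theorem smAt_act {g : Y → G} {m : Y → M} {y : Y} (hg : SmAt Y G.toMfd g y)
    (hm : SmAt Y M m y) : SmAt Y M (fun y => a.act (g y) (m y)) y :=
  ContMDiffAt.comp y (a.smooth (g y, m y)) (hg.prodMk hm)

/-- The derivative of a family of translates. -/
theorem der_act {g : Y → G} {m : Y → M} {y : Y} (hg : DiffAt Y G.toMfd g y) (hm : DiffAt Y M m y)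
    (w : Y.T y) :
    (der (X := Y) (Y := M) (fun y => a.act (g y) (m y)) y w : M.E)
      = der (a.transl (g y)) (m y) (@HSub.hSub M.E M.E M.E _ (der (X := Y) (Y := M) m y w)
        (a.fund (G.mc (g y) (der (X := Y) (Y := G.toMfd) g y w)) (m y))) := by
  have h1 := der_pair (X := G.toMfd) (Y := M) (Z := M) (W := Y)
    (m := fun z => a.act z.1 z.2) (f := g) (g := m) (w := y)
    (SmAt.diff (X := G.toMfd.prod M) (a.smooth _)) hg hm w
  refine h1.trans ?_
  rw [fund_eq]
  refine (add_comm (G := M.E) _ _).trans (Eq.trans ?_ (congrArg (der (a.transl (g y)) (m y))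
    (sub_neg_eq_add (α := M.E) _ _)).symm)
  refine Eq.trans ?_ (map_add (der (a.transl (g y)) (m y)) _ _).symm
  congr 1
  -- Writing `l m = g (g⁻¹ l m)` produces the Maurer-Cartan form of `g`, followed by the orbit map
  -- at `1`. The minus sign in the formula is the one in the definition of `fund`.
  have h2 : (fun l => a.act l (m y)) = fun l => a.transl (g y) (a.orb (m y) (lmul (g y)⁻¹ l)) := by
    funext l
    change _ = a.act (g y) (a.act ((g y)⁻¹ * l) (m y))
    rw [← a.mul_act, mul_inv_cancel_left]
  rw [h2]
  refine (der_comp ((a.transl (g y)).comp (a.orb (m y))) (lmul (g y)⁻¹) (g y) _).trans ?_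
  refine (der_congr_pt ((a.transl (g y)).comp (a.orb (m y)))
    (show lmul (g y)⁻¹ (g y) = (1 : G) from inv_mul_cancel _) _).trans ?_
  refine (der_comp (a.transl (g y)) (a.orb (m y)) (1 : G) _).trans ?_
  exact der_congr_pt (a.transl (g y)) (a.one_act (m y)) _

theorem fund_map {b : LeftAction G N} (f : Map M N) (hf : ∀ g m, f (a.act g m) = b.act g (f m))
    (A : G.Lie) (m : M) : (b.fund A (f m) : N.E) = der f m (a.fund A m) := by
  have h1 := der_comp f (a.orb m) (1 : G) (-A)
  have h2 : (fun g => f (a.orb m g)) = b.orb (f m) := by funext g; exact hf g m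
  rw [h2] at h1
  exact h1.trans (der_congr_pt f (a.one_act m) _)

/-- Differentiate `(g h g⁻¹)(g m) = g (h m)` with respect to `h` at `1`. -/
theorem fund_Ad (g : G) (A : G.Lie) (m : M) :
    (a.fund (G.Ad g A) (a.act g m) : M.E) = der (a.transl g) m (a.fund A m) := by
  have h1 := der_comp (a.orb (a.act g m)) (cnj g) (1 : G) (-A)
  have h2 := der_comp (a.transl g) (a.orb m) (1 : G) (-A)
  have h3 : (fun h => a.orb (a.act g m) (cnj g h)) = fun h => a.transl g (a.orb m h) := by
    funext h
    change a.act (g * h * g⁻¹) (a.act g m) = a.act g (a.act h m)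
    rw [← a.mul_act, ← a.mul_act, inv_mul_cancel_right]
  rw [h3] at h1
  have h4 : (a.fund (G.Ad g A) (a.act g m) : M.E)
      = der (a.orb (a.act g m)) (cnj g 1) (der (cnj g) (1 : G) (-A)) := by
    rw [show (der (cnj g) (1 : G) (-A) : G.E) = -G.Ad g A from map_neg (G.Ad g) A]
    exact der_congr_pt (a.orb (a.act g m)) (by simp [cnj]) _
  rw [h4]
  refine h1.symm.trans (h2.trans ?_)
  exact der_congr_pt (a.transl g) (a.one_act m) _

end LeftAction

/-- The value of an invariant connection on the derivative of a family of translates. -/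
theorem Connection.val_der_gact {G : LieGrp.{u}} {M : Mfd.{u}} {Q : PrinBundle K M}
    (Θ : Connection Q) (b : LeftAction G Q.tot) (hΘ : ∀ g, Θ.Pres Θ (b.transl g)) {g : Y → G}
    {q : Y → Q.tot} {y : Y} (hg : DiffAt Y G.toMfd g y) (hq : DiffAt Y Q.tot q y) (w : Y.T y) :
    Θ.val (b.act (g y) (q y)) (der (X := Y) (Y := Q.tot) (fun y => b.act (g y) (q y)) y w)
      = Θ.val (q y) (der (X := Y) (Y := Q.tot) q y w)
        - Θ.val (q y) (b.fund (G.mc (g y) (der (X := Y) (Y := G.toMfd) g y w)) (q y)) := by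
  refine (congrArg (Θ.val (b.act (g y) (q y))) (b.der_act hg hq w)).trans ?_
  refine (congrArg (fun (β : ∀ q : Q.tot, Q.tot.T q →L[ℝ] K.Lie) => β (q y) _) (hΘ (g y))).trans ?_
  exact map_sub (Θ.val (q y)) _ _

theorem trivConn_val_der (α : OneForm X K.Lie) {p : Y → X × K} {y : Y}
    (hp : DiffAt Y (X.prod K.toMfd) p y) (w : Y.T y) :
    ((trivConn α).val (p y) (der (X := Y) (Y := X.prod K.toMfd) p y w) : K.E)
      = @HAdd.hAdd K.E K.E K.E _
        (K.Ad (p y).2⁻¹ (α.val (p y).1 (der (X := Y) (Y := X) (fun y => (p y).1) y w)))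
        (K.mc (p y).2 (der (X := Y) (Y := K.toMfd) (fun y => (p y).2) y w)) := by
  have h1 := der_comp_at (X := Y) (Y := X.prod K.toMfd) (Z := X) (g := prFst X K) (f := p) y
    ((prFst X K).mdiff _) hp w
  have h2 := der_comp_at (X := Y) (Y := X.prod K.toMfd) (Z := K.toMfd) (g := prSnd X K) (f := p) y
    ((prSnd X K).mdiff _) hp w
  rw [show (der (X := Y) (Y := X) (fun y => (p y).1) y w : X.E) = _ from h1,
    show (der (X := Y) (Y := K.toMfd) (fun y => (p y).2) y w : K.E) = _ from h2]
  rfl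

/-- The Maurer-Cartan form of `g` is the value of the zero-form connection of the trivial bundle on
the derivative of `(y, g(y))`. The product rule is therefore a case of `Connection.val_der_act`, and
needs smoothness only at one point. -/
theorem mc_mul_at {g h : Y → K} {y : Y} (hg : SmAt Y K.toMfd g y) (hh : SmAt Y K.toMfd h y)
    (w : Y.T y) :
    (K.mc (g y * h y) (der (X := Y) (Y := K.toMfd) (fun y => g y * h y) y w) : K.E)
      = @HAdd.hAdd K.E K.E K.E _
        (K.Ad (h y)⁻¹ (K.mc (g y) (der (X := Y) (Y := K.toMfd) g y w)))
        (K.mc (h y) (der (X := Y) (Y := K.toMfd) h y w)) := by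
  let T := trivConn (G := K) (OneForm.zero Y K.Lie)
  have h1 := T.val_der_act (Y := Y) (p := fun y => (y, g y)) (k := h) (y := y)
    (SmAt.diff (X := Y) (Y := Y.prod K.toMfd) (contMDiffAt_id.prodMk hg)) hh.diff w
  have h2 := trivConn_val_der (OneForm.zero Y K.Lie) (p := fun y => (y, g y * h y)) (y := y)
    (SmAt.diff (X := Y) (Y := Y.prod K.toMfd) (contMDiffAt_id.prodMk (hg.mul hh))) w
  have h3 := trivConn_val_der (OneForm.zero Y K.Lie) (p := fun y => (y, g y)) (y := y)
    (SmAt.diff (X := Y) (Y := Y.prod K.toMfd) (contMDiffAt_id.prodMk hg)) w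
  have e2 := h2.trans (add_eq_right.2 (map_zero (K.Ad (g y * h y)⁻¹)))
  have e3 := h3.trans (add_eq_right.2 (map_zero (K.Ad (g y)⁻¹)))
  exact e2.symm.trans (h1.trans (congrArg (fun z : K.E => @HAdd.hAdd K.E K.E K.E _
    (K.Ad (h y)⁻¹ z) (K.mc (h y) (der (X := Y) (Y := K.toMfd) h y w))) e3))

/-- Apply the product rule to the constant `g g⁻¹ = 1`. -/
theorem mc_inv {g : Y → K} {y : Y} (hg : SmAt Y K.toMfd g y) (w : Y.T y) :
    (K.mc (g y)⁻¹ (der (X := Y) (Y := K.toMfd) (fun y => (g y)⁻¹) y w) : K.E)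
      = -K.Ad (g y) (K.mc (g y) (der (X := Y) (Y := K.toMfd) g y w)) := by
  have h1 := mc_mul_at hg (h := fun y => (g y)⁻¹) hg.inv w
  have h2 : (fun y => g y * (g y)⁻¹) = fun _ => (1 : K) := by funext y; exact mul_inv_cancel _
  have h3 : (K.mc (g y * (g y)⁻¹) (der (X := Y) (Y := K.toMfd) (fun y => g y * (g y)⁻¹) y w) : K.E)
      = 0 := by
    rw [h2]
    exact (congrArg (K.mc (g y * (g y)⁻¹)) (der_const (Y := K.toMfd) (1 : K) y w)).trans
      (map_zero _)
  rw [h3, inv_inv] at h1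
  exact eq_neg_of_add_eq_zero_right h1.symm

end Derivatives

/-! ### Transformations which are given over points -/

section Retraction

variable {X : Mfd.{u}} (U : TopologicalSpace.Opens X)

open Classical in
/-- A retraction onto an open submanifold, which is smooth on it. -/
def Mfd.retr (x : U) (y : X) : X.opn U := if h : y ∈ U then ⟨y, h⟩ else x

theorem Mfd.retr_of_mem (x : U) {y : X} (h : y ∈ U) : X.retr U x y = ⟨y, h⟩ := dif_pos h

theorem Mfd.smAt_retr (x : U) {y : X} (h : y ∈ U) : SmAt X (X.opn U) (X.retr U x) y := by
  refine (contMDiffAt_subtype_iff (I := X.I) (I' := X.I) (M := X) (M' := U) (U := U)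
    (f := X.retr U x) (x := ⟨y, h⟩)).1 ?_
  refine (contMDiff_id (I := X.I) (M := U) (⟨y, h⟩ : U)).congr_of_eventuallyEq ?_
  exact Filter.Eventually.of_forall fun z => X.retr_of_mem U x z.2

end Retraction

variable {K : LieGrp.{u}}

theorem pull_eq_of_comp {X Y Y' Z : Mfd.{u}} {V : Type u} [NormedAddCommGroup V]
    [NormedSpace ℝ V] {f : Map X Y} {g : Map Y Z} {f' : Map X Y'} {g' : Map Y' Z}
    (e : g.comp f = g'.comp f') (α : ∀ z : Z, Z.T z →L[ℝ] V) :
    pull f (pull g α) = pull f' (pull g' α) := by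
  rw [pull_pull, pull_pull, e]

/-- The bundle morphism over an open inclusion is a submersion. -/
theorem BunHom.der_surj {X : Mfd.{u}} {U : TopologicalSpace.Opens X} {R : PrinBundle K (X.opn U)}
    {Q : PrinBundle K X} (φ : BunHom (X.incl U) R Q) (r : R.tot) (w : Q.tot.E) :
    ∃ w' : R.tot.E, (der φ.map r (w' : R.tot.T r) : Q.tot.E) = w := by
  let q := φ.map r
  have hq : Q.proj q = X.incl U (R.proj r) := φ.proj_map r
  have hqU : Q.proj q ∈ U := by rw [hq]; exact (R.proj r).2
  let b : Q.tot → X.opn U := fun q => X.retr U (R.proj r) (Q.proj q)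
  have hb : SmAt Q.tot (X.opn U) b q := SmAt.comp q (X.smAt_retr U (R.proj r) hqU)
    (Q.proj.smAt q)
  have hev : ∀ᶠ q' in 𝓝 q, Q.proj q' = X.incl U (b q') := by
    have : ∀ᶠ q' in 𝓝 q, Q.proj q' ∈ U :=
      Q.proj.contMDiff.continuous.continuousAt.eventually (U.isOpen.mem_nhds hqU)
    filter_upwards [this] with q' h
    exact (congrArg (X.incl U) (X.retr_of_mem U (R.proj r) h)).symm
  have hl : SmAt Q.tot R.tot (fun q => φ.lift (b q) q) q :=
    φ.smAt_lift (Z := Q.tot) hb (Map.smAt (Map.id Q.tot) q) hev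
  have hlq : φ.lift (b q) q = r := φ.lift_eq (by
    refine Eq.trans ?_ (X.retr_of_mem U (R.proj r) hqU).symm
    exact Subtype.ext hq.symm) rfl
  -- Lifting along the local retraction of the base inverts `φ` near `φ(r)`; the derivative of this
  -- local inverse supplies the preimage.
  refine ⟨der (X := Q.tot) (Y := R.tot) (fun q => φ.lift (b q) q) q (w : Q.tot.T q), ?_⟩
  have h1 := der_comp_at (X := Q.tot) (Y := R.tot) (Z := Q.tot) (g := φ.map)
    (f := fun q => φ.lift (b q) q) q (φ.map.mdiff _) hl.diff w
  have h2 : (fun q => φ.map (φ.lift (b q) q)) =ᶠ[𝓝 q] fun q => q := by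
    filter_upwards [hev] with q' h
    exact φ.map_lift h
  exact (der_congr_pt φ.map hlq.symm _).trans (h1.symm.trans ((der_congr h2 w).trans (der_id q w)))

/-! ### Bundle-valued morphisms of prestacks and their transformations over points -/

section Underlying

variable {A : OverMan.{u, v}} (S : Mor A (B K))

/-- The bundle assigned to an object. -/
abbrev Mor.bun {X : Mfd.{u}} (P : A.Obj X) : PrinBundle K X := S.obj P

/-- The bundle morphism assigned to a morphism. -/
abbrev Mor.hom {X Y : Mfd.{u}} {f : Map X Y} {P : A.Obj X} {P' : A.Obj Y} (φ : A.Hom f P P') :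
    BunHom f (S.bun P) (S.bun P') := S.map φ

theorem Mor.hom_comp {X Y Z : Mfd.{u}} {f : Map X Y} {g : Map Y Z} {P : A.Obj X} {P' : A.Obj Y}
    {P'' : A.Obj Z} (φ : A.Hom f P P') (ψ : A.Hom g P' P'') (z : (S.bun P).tot) :
    (S.hom (A.comp φ ψ)).map z = (S.hom ψ).map ((S.hom φ).map z) := by
  rw [Mor.hom, S.map_comp]; rfl

theorem Mor.hom_id {X : Mfd.{u}} (P : A.Obj X) (z : (S.bun P).tot) :
    (S.hom (A.id P)).map z = z := by
  rw [Mor.hom, S.map_id]; rfl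

variable {S} {S' : Mor A (B K)}

/-- The bundle morphism assigned to an object by a transformation. -/
abbrev Trans.hom (σ : Trans S S') {X : Mfd.{u}} (P : A.Obj X) :
    BunHom (Map.id X) (S.bun P) (S'.bun P) := σ.app P

theorem Trans.hom_map (σ : Trans S S') {X Y : Mfd.{u}} {f : Map X Y} {P : A.Obj X} {P' : A.Obj Y}
    (φ : A.Hom f P P') (z : (S.bun P).tot) :
    (σ.hom P').map ((S.hom φ).map z) = (S'.hom φ).map ((σ.hom P).map z) :=
  congrArg (fun ψ : BunHom f (S.bun P) (S'.bun P') => ψ.map z) (σ.naturality φ)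

end Underlying

/-- A family of objects over the point from which all points of all objects can be reached, uniquely
up to morphisms in the family. -/
structure PtObjs (A : OverMan.{u, v}) {ι : Type v'} (J : ι → A.Obj Mfd.pt) : Prop where
  reach : ∀ {X : Mfd.{u}} (P : A.Obj X) (x : X), ∃ i, Nonempty (A.Hom (Mfd.point x) (J i) P)
  connect : ∀ {X : Mfd.{u}} (P : A.Obj X) (x : X) {i i' : ι} (φ : A.Hom (Mfd.point x) (J i) P)
    (φ' : A.Hom (Mfd.point x) (J i') P),
    ∃ γ : A.Hom (Map.id Mfd.pt) (J i) (J i'), (A.comp γ φ' : A.Hom (Mfd.point x) (J i) P) = φ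

section Pointwise

variable {A : OverMan.{u, v}} {ι : Type v'} {J : ι → A.Obj Mfd.pt} (hJ : PtObjs A J)
  (S S' : Mor A (B K)) (τ : ∀ i, BunHom (Map.id Mfd.pt) (S.bun (J i)) (S'.bun (J i)))

/-- The naturality of a family of bundle morphisms over the point. -/
def PtNatural : Prop :=
  ∀ {i i' : ι} (γ : A.Hom (Map.id Mfd.pt) (J i) (J i')) (z : (S.bun (J i)).tot),
    (τ i').map ((S.hom γ).map z) = (S'.hom γ).map ((τ i).map z)

/-- The map of total spaces given, over every point, by the maps `τ`. -/
def ptMap {X : Mfd.{u}} (P : A.Obj X) (q : (S.bun P).tot) : (S'.bun P).tot :=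
  (S'.hom (hJ.reach P ((S.bun P).proj q)).choose_spec.some).map
    ((τ (hJ.reach P ((S.bun P).proj q)).choose).map
      ((S.hom (hJ.reach P ((S.bun P).proj q)).choose_spec.some).lift PUnit.unit q))

variable {S S' τ}

/-- Independence of the chosen arrow: another arrow from a point differs from the chosen one by some
`γ` over the point, and the family `τ` commutes with `γ`. -/
theorem ptMap_map (hτ : PtNatural S S' τ) {X : Mfd.{u}} (P : A.Obj X) (x : X) {i : ι} (φ : A.Hom (Mfd.point x) (J i) P)
    (z : (S.bun (J i)).tot) :
    ptMap hJ S S' τ P ((S.hom φ).map z) = (S'.hom φ).map ((τ i).map z) := by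
  obtain ⟨q, hq⟩ : ∃ q, q = (S.hom φ).map z := ⟨_, rfl⟩
  have hx : x = (S.bun P).proj q := by rw [hq, (S.hom φ).proj_map]; rfl
  rw [← hq]
  subst hx
  unfold ptMap
  generalize (hJ.reach P ((S.bun P).proj q)).choose_spec.some = φ₀
  obtain ⟨γ, hγ⟩ := hJ.connect P ((S.bun P).proj q) φ φ₀
  have h1 : ∀ z, (S.hom φ).map z = (S.hom φ₀).map ((S.hom γ).map z) := fun z => by
    rw [← hγ]; exact S.hom_comp γ φ₀ z
  have h2 : ∀ z, (S'.hom φ).map z = (S'.hom φ₀).map ((S'.hom γ).map z) := fun z => by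
    rw [← hγ]; exact S'.hom_comp γ φ₀ z
  have h3 : (S.hom φ₀).lift PUnit.unit q = (S.hom γ).map z :=
    (S.hom φ₀).lift_eq rfl ((h1 z).symm.trans hq.symm)
  rw [h3, hτ, h2]

theorem exists_ptLift (hJ : PtObjs A J) (S : Mor A (B K)) {X : Mfd.{u}} (P : A.Obj X)
    (q : (S.bun P).tot) :
    ∃ (i : ι) (φ : A.Hom (Mfd.point ((S.bun P).proj q)) (J i) P) (z : (S.bun (J i)).tot),
      (S.hom φ).map z = q := by
  obtain ⟨i, ⟨φ⟩⟩ := hJ.reach P ((S.bun P).proj q)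
  exact ⟨i, φ, (S.hom φ).lift PUnit.unit q, (S.hom φ).map_lift rfl⟩

theorem ptMap_act (hτ : PtNatural S S' τ) {X : Mfd.{u}} (P : A.Obj X) (q : (S.bun P).tot) (k : K) :
    ptMap hJ S S' τ P ((S.bun P).act q k) = (S'.bun P).act (ptMap hJ S S' τ P q) k := by
  obtain ⟨i, φ, z, hz⟩ := exists_ptLift hJ _ P q
  rw [← hz, ← (S.hom φ).map_act, ptMap_map hJ hτ, ptMap_map hJ hτ, (τ i).map_act,
    (S'.hom φ).map_act]

theorem proj_ptMap (hτ : PtNatural S S' τ) {X : Mfd.{u}} (P : A.Obj X) (q : (S.bun P).tot) :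
    (S'.bun P).proj (ptMap hJ S S' τ P q) = (S.bun P).proj q := by
  obtain ⟨i, φ, z, hz⟩ := exists_ptLift hJ _ P q
  have h := ptMap_map hJ hτ P _ φ z
  rw [hz] at h
  rw [h, (S'.hom φ).proj_map]
  rfl

theorem ptMap_natural (hτ : PtNatural S S' τ) {X Y : Mfd.{u}} {f : Map X Y} {P : A.Obj X} {P' : A.Obj Y}
    (χ : A.Hom f P P') (q : (S.bun P).tot) :
    ptMap hJ S S' τ P' ((S.hom χ).map q) = (S'.hom χ).map (ptMap hJ S S' τ P q) := by
  obtain ⟨i, φ, z, hz⟩ := exists_ptLift hJ _ P q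
  rw [← hz, ptMap_map hJ hτ, ← S.hom_comp φ χ, ← S'.hom_comp φ χ]
  exact ptMap_map hJ hτ P' (f ((S.bun P).proj q)) (A.comp φ χ) z

/-- The transformation given over points by `τ`. -/
def ptTrans (hτ : PtNatural S S' τ) (hs : ∀ {X : Mfd.{u}} (P : A.Obj X),
    Sm (S.bun P).tot (S'.bun P).tot (ptMap hJ S S' τ P)) : Trans S S' where
  app P := show BunHom _ (S.bun P) (S'.bun P) from
    { map := ⟨ptMap hJ S S' τ P, hs P⟩
      map_act := ptMap_act hJ hτ P
      proj_map := proj_ptMap hJ hτ P }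
  naturality φ := BunHom.ext (ContMDiffMap.ext fun q => ptMap_natural hJ hτ φ q)

/-- Two transformations are equal if they agree over points. -/
theorem trans_ext (hJ : PtObjs A J) {σ σ' : Trans S S'} (h : ∀ i (z : (S.bun (J i)).tot),
    (σ.hom (J i)).map z = (σ'.hom (J i)).map z) : σ = σ' := by
  refine Trans.ext ?_
  funext X P
  refine BunHom.ext (ContMDiffMap.ext fun q => ?_)
  obtain ⟨i, φ, z, hz⟩ := exists_ptLift hJ _ P q
  change (σ.hom P).map q = (σ'.hom P).map q
  rw [← hz, σ.hom_map, σ'.hom_map, h]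

end Pointwise

/-! ### Morphisms of prestacks which become equivalences after stackification -/

/-- The morphism `J` is fully faithful over points and locally surjective. -/
structure LocEquiv {A : OverMan.{u, v}} {A' : OverMan.{u, v'}} (J : Mor A A') : Prop where
  full : ∀ {t t' : A.Obj Mfd.pt} (γ : A'.Hom (Map.id Mfd.pt) (J.obj t) (J.obj t')),
    ∃ γ', J.map γ' = γ
  restrict : ∀ {X : Mfd.{u}} (t : A.Obj X) (x : X), ∃ t', Nonempty (A.Hom (Mfd.point x) t' t)
  local_surj : ∀ {X : Mfd.{u}} (P : A'.Obj X) (x : X), ∃ (U : TopologicalSpace.Opens X)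
    (_ : x ∈ U) (t : A.Obj (X.opn U)), Nonempty (A'.Hom (X.incl U) (J.obj t) P)
  connect : ∀ {X : Mfd.{u}} (P : A'.Obj X) (x : X) {t t' : A.Obj Mfd.pt}
    (φ : A'.Hom (Mfd.point x) (J.obj t) P) (φ' : A'.Hom (Mfd.point x) (J.obj t') P),
    ∃ γ : A'.Hom (Map.id Mfd.pt) (J.obj t) (J.obj t'),
      (A'.comp γ φ' : A'.Hom (Mfd.point x) (J.obj t) P) = φ

/-- The morphism which forgets the connections. -/
def forgetConn (K : LieGrp.{u}) : Mor (BConn K) (B K) where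
  obj P := P.toPrinBundle
  map φ := φ.toBunHom
  map_id _ := rfl
  map_comp _ _ := rfl

/-- The transformation which forgets the connections. -/
def Trans.forget {A : OverMan.{u, v}} {S S' : Mor A (BConn K)} (σ : Trans S S') :
    Trans (S.comp (forgetConn K)) (S'.comp (forgetConn K)) where
  app P := ConnHom.toBunHom (σ.app P)
  naturality φ := congrArg (fun ψ : ConnHom _ _ _ => ψ.toBunHom) (σ.naturality φ)

theorem Trans.forget_injective {A : OverMan.{u, v}} {S S' : Mor A (BConn K)} {σ σ' : Trans S S'}
    (h : σ.forget = σ'.forget) : σ = σ' := by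
  refine Trans.ext ?_
  funext X P
  exact ConnHom.ext (congrArg (fun τ : Trans (S.comp (forgetConn K)) (S'.comp (forgetConn K)) =>
    BunHom.map (τ.app P)) h)

/-- A transformation of underlying bundles which preserves the connections. -/
def Trans.withConn {A : OverMan.{u, v}} {S S' : Mor A (BConn K)}
    (σ : Trans (S.comp (forgetConn K)) (S'.comp (forgetConn K)))
    (h : ∀ {X : Mfd.{u}} (P : A.Obj X), (BunConn.conn (S.obj P)).Pres (BunConn.conn (S'.obj P))
      (σ.hom P).map) : Trans S S' where
  app P := show ConnHom _ _ _ from { σ.hom P with pres := h P }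
  naturality φ := ConnHom.ext (congrArg BunHom.map (σ.naturality φ))

namespace LocEquiv

variable {A : OverMan.{u, v}} {A' : OverMan.{u, v'}} {J : Mor A A'}

theorem ptObjs (hJ : LocEquiv J) : PtObjs A' (fun t : A.Obj Mfd.pt => J.obj t) where
  reach {X} P x := by
    obtain ⟨U, hx, t, ⟨φ⟩⟩ := hJ.local_surj P x
    obtain ⟨t', ⟨ψ⟩⟩ := hJ.restrict t ⟨x, hx⟩
    exact ⟨t', ⟨A'.comp (J.map ψ) φ⟩⟩
  connect P x _ _ φ φ' := hJ.connect P x φ φ'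

/-- Fullness over points makes the restriction of `σ` to points natural in all of `A'`, which gives
a map of sets on every value. Smoothness can be checked locally, where every object comes from `A`
and the map is a conjugate of `σ`. -/
theorem exists_trans (hJ : LocEquiv J) (S S' : Mor A' (B K)) (σ : Trans (J.comp S) (J.comp S')) :
    ∃ τ : Trans S S', ∀ {X : Mfd.{u}} (t : A.Obj X) (z : (S.bun (J.obj t)).tot),
      (τ.hom (J.obj t)).map z = (σ.hom t).map z := by
  have hτ : PtNatural (J := fun t : A.Obj Mfd.pt => J.obj t) S S' (fun t => σ.hom t) := by
    intro t t' γ z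
    obtain ⟨γ', rfl⟩ := hJ.full γ
    exact σ.hom_map γ' z
  -- The pointwise map agrees with `σ` on everything reached from an object of `A`, not only from
  -- objects over points: restrict `t` to the point below `z`.
  have key : ∀ {X Y : Mfd.{u}} {f : Map X Y} (t : A.Obj X) (P : A'.Obj Y)
      (φ : A'.Hom f (J.obj t) P) (z : (S.bun (J.obj t)).tot),
      ptMap hJ.ptObjs S S' (fun t => σ.hom t) P ((S.hom φ).map z)
        = (S'.hom φ).map ((σ.hom t).map z) := by
    intro X Y f t P φ z
    obtain ⟨t₀, ⟨ψ⟩⟩ := hJ.restrict t ((S.bun (J.obj t)).proj z)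
    obtain ⟨z₀, hz₀⟩ : ∃ z₀, ((J.comp S).hom ψ).map z₀ = z :=
      ⟨((J.comp S).hom ψ).lift PUnit.unit z, ((J.comp S).hom ψ).map_lift rfl⟩
    have h1 := ptMap_map hJ.ptObjs hτ P (f _) (A'.comp (J.map ψ) φ) z₀
    have h2 := σ.hom_map ψ z₀
    rw [hz₀] at h2
    refine (congrArg (fun y => ptMap hJ.ptObjs S S' (fun t => σ.hom t) P ((S.hom φ).map y))
      hz₀.symm).trans (Eq.trans ?_ (congrArg (S'.hom φ).map h2.symm))
    exact (congrArg (ptMap hJ.ptObjs S S' (fun t => σ.hom t) P)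
      (S.hom_comp (J.map ψ) φ z₀).symm).trans (h1.trans (S'.hom_comp (J.map ψ) φ _))
  refine ⟨ptTrans hJ.ptObjs hτ fun {X} P q => ?_, fun t z => ?_⟩
  -- Near `q` the map is `S'(φ) ∘ σ_t ∘ S(φ)⁻¹`, where the inverse is the smooth lift along the
  -- retraction to `U`.
  · obtain ⟨U, hx, t, ⟨φ⟩⟩ := hJ.local_surj P ((S.bun P).proj q)
    let b : (S.bun P).tot → X.opn U := fun q' => X.retr U ⟨_, hx⟩ ((S.bun P).proj q')
    have hb : SmAt (S.bun P).tot (X.opn U) b q :=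
      SmAt.comp q (X.smAt_retr U ⟨_, hx⟩ hx) ((S.bun P).proj.smAt q)
    have hev : ∀ᶠ q' in 𝓝 q, (S.bun P).proj q' = X.incl U (b q') := by
      have : ∀ᶠ q' in 𝓝 q, (S.bun P).proj q' ∈ U :=
        (S.bun P).proj.contMDiff.continuous.continuousAt.eventually (U.isOpen.mem_nhds hx)
      filter_upwards [this] with q' h
      exact (congrArg (X.incl U) (X.retr_of_mem U ⟨_, hx⟩ h)).symm
    have hl : SmAt (S.bun P).tot (S.bun (J.obj t)).tot (fun q' => (S.hom φ).lift (b q') q') q :=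
      (S.hom φ).smAt_lift (Z := (S.bun P).tot) hb (Map.smAt (Map.id (S.bun P).tot) q) hev
    have h1 : SmAt (S.bun P).tot (S'.bun P).tot
        (fun q' => (S'.hom φ).map ((σ.hom t).map ((S.hom φ).lift (b q') q'))) q :=
      SmAt.comp q (Map.smAt (S'.hom φ).map _) (SmAt.comp q (Map.smAt (σ.hom t).map _) hl)
    refine h1.congr ?_
    filter_upwards [hev] with q' hq'
    rw [← key, (S.hom φ).map_lift hq']
  · have h := key t (J.obj t) (A'.id (J.obj t)) z
    rw [S.hom_id] at h
    exact h.trans (S'.hom_id _ _)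

theorem trans_ext' (hJ : LocEquiv J) {S S' : Mor A' (B K)} {τ τ' : Trans S S'}
    (h : ∀ {X : Mfd.{u}} (t : A.Obj X) (z : (S.bun (J.obj t)).tot),
      (τ.hom (J.obj t)).map z = (τ'.hom (J.obj t)).map z) : τ = τ' :=
  trans_ext hJ.ptObjs fun t z => h t z

theorem full_B (hJ : LocEquiv J) : (J.precomp (B K)).Full where
  map_surjective {S S'} σ := by
    obtain ⟨τ, hτ⟩ := hJ.exists_trans S S' σ
    refine ⟨τ, Trans.ext ?_⟩
    funext X t
    exact BunHom.ext (ContMDiffMap.ext fun z => hτ t z)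

theorem faithful_B (hJ : LocEquiv J) : (J.precomp (B K)).Faithful where
  map_injective {S S'} _ _ h := hJ.trans_ext' fun t z =>
    congrArg (fun σ : Trans (J.comp S) (J.comp S') => (σ.hom t).map z) h

theorem faithful_BConn (hJ : LocEquiv J) : (J.precomp (BConn K)).Faithful where
  map_injective {S S'} _ _ h := Trans.forget_injective (hJ.trans_ext' fun t z =>
    congrArg (fun σ : Trans (J.comp S) (J.comp S') => (σ.forget.hom t).map z) h)

/-- Preservation of connections is local. It holds after pullback to an object of the form `J t`,
and the bundle morphism over the open inclusion has surjective derivatives, so nothing is lost by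
this pullback. -/
theorem full_BConn (hJ : LocEquiv J) : (J.precomp (BConn K)).Full where
  map_surjective {S S'} σ := by
    obtain ⟨τ, hτ⟩ := hJ.exists_trans (S.comp (forgetConn K)) (S'.comp (forgetConn K))
      (Trans.forget (A := A) (S := J.comp S) (S' := J.comp S') σ)
    have hp : ∀ {X : Mfd.{u}} (P : A'.Obj X), (BunConn.conn (S.obj P)).Pres
        (BunConn.conn (S'.obj P)) (τ.hom P).map := by
      intro X P
      funext q
      ext w
      obtain ⟨U, hx, t, ⟨φ⟩⟩ := hJ.local_surj P ((BunConn.toPrinBundle (S.obj P)).proj q)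
      let Φ : ConnHom _ (S.obj (J.obj t)) (S.obj P) := S.map φ
      let Φ' : ConnHom _ (S'.obj (J.obj t)) (S'.obj P) := S'.map φ
      let Ψ : ConnHom _ (S.obj (J.obj t)) (S'.obj (J.obj t)) := σ.app t
      obtain ⟨r, hr⟩ : ∃ r, Φ.map r = q := ⟨Φ.lift ⟨_, hx⟩ q, Φ.map_lift rfl⟩
      subst hr
      obtain ⟨w', rfl⟩ := Φ.der_surj r w
      have e : (τ.hom P).map.comp Φ.map = Φ'.map.comp Ψ.map := by
        ext z
        exact (τ.hom_map φ z).trans (congrArg Φ'.map (hτ t z))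
      have e1 : pull Φ.map (pull (τ.hom P).map (BunConn.conn (S'.obj P)).val)
          = pull Φ.map (BunConn.conn (S.obj P)).val := by
        refine (pull_eq_of_comp e _).trans ?_
        refine (congrArg (pull Ψ.map) Φ'.pres).trans ?_
        exact Ψ.pres.trans Φ.pres.symm
      exact congrArg (fun β : ∀ z, (BunConn.toPrinBundle (S.obj (J.obj t))).tot.T z →L[ℝ] K.Lie =>
        β r w') e1
    refine ⟨Trans.withConn τ hp, Trans.ext ?_⟩
    funext X t
    exact ConnHom.ext (ContMDiffMap.ext fun z => hτ t z)

end LocEquiv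

/-! ### Restriction to trivial bundles -/

variable {G K : LieGrp.{u}} {M : Mfd.{u}} (a : LeftAction G M)

theorem Connection.pres_of_comp {X Y Z : Mfd.{u}} {P : PrinBundle K X} {Q : PrinBundle K Y}
    {R : PrinBundle K Z} {Θ : Connection P} {Θ' : Connection Q} {Θ'' : Connection R}
    {φ : Map P.tot Q.tot} {ψ : Map Q.tot R.tot} {χ : Map P.tot R.tot} (h : Θ'.Pres Θ'' ψ)
    (h' : Θ.Pres Θ'' χ) (e : ψ.comp φ = χ) : Θ.Pres Θ' φ := by
  unfold Connection.Pres at *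
  rw [← h, pull_pull, e, h']

/-- The total space of the trivial bundle over the domain of a local section, as an object over the
bundle. -/
def PrinBundle.LocSec.secMap {X : Mfd.{u}} {P : PrinBundle K X} (σ : P.LocSec) :
    Map (X.opn σ.U) P.tot :=
  ⟨fun x => σ.s x, fun x =>
    SmAt.comp (X := X.opn σ.U) (f := X.incl σ.U) x (σ.smooth_s _ x.2) ((X.incl σ.U).smAt x)⟩

/-- The trivialization defined by a local section. -/
def PrinBundle.LocSec.trivialization {X : Mfd.{u}} {P : PrinBundle K X} (σ : P.LocSec) :
    BunHom (X.incl σ.U) (trivBundle K (X.opn σ.U)) P where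
  map := ⟨fun z => P.act (σ.secMap z.1) z.2, fun z =>
    P.smAt_act (Y := (X.opn σ.U).prod K.toMfd) (SmAt.comp z (σ.secMap.smAt _)
      ((prFst (X.opn σ.U) K).smAt z)) ((prSnd (X.opn σ.U) K).smAt z)⟩
  map_act _ _ := P.act_mul _ _ _
  proj_map z := (P.proj_act _ _).trans (σ.proj_s _ z.1.2)

theorem PrinBundle.LocSec.trivialization_pres {X : Mfd.{u}} {P : PrinBundle K X} (σ : P.LocSec)
    (Θ : Connection P) :
    (trivConn (Θ.toOneForm.pull σ.secMap)).Pres Θ σ.trivialization.map := by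
  funext z
  ext w
  have h1 := Θ.val_der_act (Y := (X.opn σ.U).prod K.toMfd) (p := fun z => σ.secMap z.1)
    (k := fun z => z.2) (y := z)
    (SmAt.diff (SmAt.comp z (σ.secMap.smAt _) ((prFst (X.opn σ.U) K).smAt z)))
    (SmAt.diff ((prSnd (X.opn σ.U) K).smAt z)) w
  refine h1.trans ?_
  have h2 := der_comp σ.secMap (prFst (X.opn σ.U) K) z w
  exact congrArg (fun v : P.tot.E => @HAdd.hAdd K.E K.E K.E _ (K.Ad z.2⁻¹ (Θ.val (σ.secMap z.1) v))
    (K.mc z.2 (der (prSnd (X.opn σ.U) K) z w))) h2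

/-- The group-valued function is the second component of the image of `(x, 1)`; equivariance
determines the morphism from it. -/
theorem trivHom_surjective {X Y : Mfd.{u}} {u : Map X Y} {f : Map X M} {f' : Map Y M}
    (φ : BorelHom u (trivObj a f) (trivObj a f')) :
    ∃ (g : Map X G.toMfd) (h : ∀ x, a.act (g x) (f x) = f' (u x)), trivHom a g h = φ := by
  have h1 : ∀ x, (φ.map (x, 1)).1 = u x := fun x => φ.proj_map (x, 1)
  let g : Map X G.toMfd := ⟨fun x => (φ.map (x, 1)).2, fun x =>
    SmAt.comp x ((prSnd Y G).smAt _) (SmAt.comp x (φ.map.smAt (x, 1))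
      (SmAt.prodMk (smAt_id x) (smAt_const _ x)))⟩
  have h2 : ∀ x, a.act (g x) (f x) = f' (u x) := by
    intro x
    have h3 : a.act (φ.map (x, 1)).2⁻¹ (f' (φ.map (x, 1)).1) = a.act (1 : G)⁻¹ (f x) :=
      φ.F_map (x, 1)
    rw [inv_one, a.one_act, h1] at h3
    refine (congrArg (a.act (g x)) h3.symm).trans ?_
    rw [← a.mul_act, show g x * (φ.map (x, 1)).2⁻¹ = 1 from mul_inv_cancel _, a.one_act]
  refine ⟨g, h2, BorelHom.ext (ContMDiffMap.ext fun z => ?_)⟩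
  have h3 : φ.map (z.1, 1 * z.2) = ((φ.map (z.1, 1)).1, (φ.map (z.1, 1)).2 * z.2) :=
    φ.map_act (z.1, 1) z.2
  rw [one_mul, h1] at h3
  exact h3.symm

/-- The restriction of an object of the action groupoid to a point. -/
theorem actGpd_restrict {X : Mfd.{u}} (f : (ActGpd a).Obj X) (x : X) :
    ∃ t', Nonempty ((ActGpd a).Hom (Mfd.point x) t' f) :=
  ⟨ContMDiffMap.comp f (Mfd.point x), ⟨⟨1, fun _ => a.one_act _⟩⟩⟩

/-- A morphism of `M //_∇ G` with trivial group component. -/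
def diffActHom {X Y : Mfd.{u}} {u : Map X Y} {p : (DiffActGpd a).Obj X} {q : (DiffActGpd a).Obj Y}
    (h : p.1.val = pull u q.1.val) (h' : ∀ x, p.2 x = q.2 (u x)) : (DiffActGpd a).Hom u p q :=
  ⟨1, by rw [inv_one, gauge_one, h], fun x => (a.one_act _).trans (h' x)⟩

/-- All morphisms are cartesian: a bundle morphism over `f ∘ g` factors through one over `f`, and
compatibility with the maps to `M` is inherited. -/
theorem borel_factor {X Y Z : Mfd.{u}} {f : Map X Y} {g : Map Z X} {R : BorelObj a X}
    {Q : BorelObj a Y} {R' : BorelObj a Z} (φ : BorelHom f R Q) (χ : BorelHom (f.comp g) R' Q) :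
    ∃ γ : BorelHom g R' R, γ.comp φ = χ :=
  ⟨{ φ.toBunHom.factor χ.toBunHom with
      F_map := fun p => by
        rw [← φ.F_map, ← χ.F_map]
        exact congrArg Q.F (φ.toBunHom.map_factor χ.toBunHom p) },
    BorelHom.ext (ContMDiffMap.ext fun p => φ.toBunHom.map_factor χ.toBunHom p)⟩

theorem borelConn_factor {X Y Z : Mfd.{u}} {f : Map X Y} {g : Map Z X} {R : BorelConnObj a X}
    {Q : BorelConnObj a Y} {R' : BorelConnObj a Z} (φ : BorelConnHom f R Q)
    (χ : BorelConnHom (f.comp g) R' Q) :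
    ∃ γ : BorelConnHom g R' R, γ.toBorelHom.comp φ.toBorelHom = χ.toBorelHom := by
  obtain ⟨γ, hγ⟩ := borel_factor a φ.toBorelHom χ.toBorelHom
  have h := Connection.pres_of_comp φ.pres χ.pres
    (congrArg (fun ψ : BorelHom _ _ _ => ψ.map) hγ)
  exact ⟨{ γ with pres := h }, hγ⟩

/-- The trivialization of an object of the Borel quotient stack. -/
def BorelObj.trivialization {X : Mfd.{u}} (P : BorelObj a X) (σ : P.LocSec) :
    BorelHom (X.incl σ.U) (trivObj a (P.F.cmp σ.secMap)) P :=
  { σ.trivialization with F_map := fun z => P.F_act (σ.secMap z.1) z.2 }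

theorem locEquiv_triv : LocEquiv (triv a) where
  full γ := by
    obtain ⟨g, h, e⟩ := trivHom_surjective a γ
    exact ⟨⟨g, h⟩, e⟩
  restrict t x := actGpd_restrict a t x
  local_surj {X} P x := by
    obtain ⟨σ, hσ⟩ := PrinBundle.exists_locSec (BorelObj.toPrinBundle P) x
    exact ⟨σ.U, hσ, _, ⟨BorelObj.trivialization a P σ⟩⟩
  connect {X} P x t t' φ φ' := borel_factor a (g := Map.id Mfd.pt) φ' φ

/-- The tangent space of the point is zero. This is why forms and connections disappear over points,
and why every object of `M //_∇ G` restricts there to one with zero form. -/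
theorem form_pt_ext {V : Type u} [NormedAddCommGroup V] [NormedSpace ℝ V]
    (α β : ∀ x : Mfd.pt.{u}, Mfd.pt.T x →L[ℝ] V) : α = β := by
  funext x
  ext w
  have : w = 0 := Subsingleton.elim (α := PUnit) _ _
  rw [this, map_zero, map_zero]

theorem locEquiv_trivWithConn : LocEquiv (trivWithConn a) where
  full γ := by
    obtain ⟨g, h, e⟩ := trivHom_surjective a γ.toBorelHom
    exact ⟨⟨g, form_pt_ext _ _, h⟩, BorelConnHom.ext
      (congrArg (fun ψ : BorelHom _ _ _ => ψ.map) e)⟩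
  restrict t x := ⟨(t.1.pull (Mfd.point x), t.2.comp (Mfd.point x)),
    ⟨diffActHom a rfl fun _ => rfl⟩⟩
  local_surj {X} P x := by
    obtain ⟨σ, hσ⟩ := PrinBundle.exists_locSec (BorelConnObj.toBorelObj P).toPrinBundle x
    exact ⟨σ.U, hσ, ((BorelConnObj.conn P).toOneForm.pull σ.secMap,
      (BorelConnObj.toBorelObj P).F.cmp σ.secMap),
      ⟨{ BorelObj.trivialization a (BorelConnObj.toBorelObj P) σ with
          pres := σ.trivialization_pres (BorelConnObj.conn P) }⟩⟩
  connect {X} P x t t' φ φ' := by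
    obtain ⟨γ, hγ⟩ := borelConn_factor a (g := Map.id Mfd.pt) φ' φ
    exact ⟨γ, BorelConnHom.ext (congrArg (fun ψ : BorelHom _ _ _ => ψ.map) hγ)⟩

/-! ### Evaluation at the universal object -/

section EvalData

variable {A : OverMan.{u, v}} {a}

/-- A family of morphisms from objects over the point to an object `o` over `M`, such that `G` acts
on `o` and the morphisms between the objects over the point come from this action. -/
structure EvalData (a : LeftAction G M) (o : A.Obj M) (J : M → A.Obj Mfd.pt) where
  ptObjs : PtObjs A J
  arr : ∀ m, A.Hom (Mfd.point m) (J m) o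
  sh : ∀ g, A.Hom (a.transl g) o o
  comm : ∀ {m m' : M} (γ : A.Hom (Map.id Mfd.pt) (J m) (J m')), ∃ g, ∀ (K : LieGrp.{u})
    (S : Mor A (B K)) (z : (S.bun (J m)).tot),
    (S.hom (arr m')).map ((S.hom γ).map z) = (S.hom (sh g)).map ((S.hom (arr m)).map z)

namespace EvalData

variable {o : A.Obj M} {J : M → A.Obj Mfd.pt} (D : EvalData a o J) {S S' : Mor A (B K)}
  (ψ : BunHom (Map.id M) (S.bun o) (S'.bun o))

/-- The family over points induced by a morphism of the values at `o`. -/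
def fam (m : M) : BunHom (Map.id Mfd.pt) (S.bun (J m)) (S'.bun (J m)) :=
  (S'.hom (D.arr m)).factor (g := Map.id Mfd.pt) ((S.hom (D.arr m)).comp ψ)

theorem map_fam (m : M) (z : (S.bun (J m)).tot) :
    (S'.hom (D.arr m)).map ((D.fam ψ m).map z) = ψ.map ((S.hom (D.arr m)).map z) :=
  (S'.hom (D.arr m)).map_factor (g := Map.id Mfd.pt) ((S.hom (D.arr m)).comp ψ) z

variable {ψ}

/-- A morphism between objects over the point becomes, inside the value at `o`, the action of an
element of `G`, and `ψ` is equivariant. Comparing in the value at `o` is enough because a bundle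
morphism is injective on fibres. -/
theorem natural_fam (hψ : ∀ g z, ψ.map ((S.hom (D.sh g)).map z) = (S'.hom (D.sh g)).map (ψ.map z)) :
    PtNatural S S' (D.fam ψ) := by
  intro m m' γ z
  obtain ⟨g, hg⟩ := D.comm γ
  refine (S'.hom (D.arr m')).lift_unique (Subsingleton.elim (α := PUnit) _ _) ?_
  rw [map_fam, hg, hg, map_fam, hψ]

theorem ptMap_o (hψ : ∀ g z, ψ.map ((S.hom (D.sh g)).map z) = (S'.hom (D.sh g)).map (ψ.map z))
    (q : (S.bun o).tot) : ptMap D.ptObjs S S' (D.fam ψ) o q = ψ.map q := by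
  obtain ⟨z, hz⟩ : ∃ z, (S.hom (D.arr ((S.bun o).proj q))).map z = q :=
    ⟨_, (S.hom (D.arr ((S.bun o).proj q))).map_lift (x := PUnit.unit) rfl⟩
  have h := ptMap_map D.ptObjs (D.natural_fam hψ) o _ (D.arr ((S.bun o).proj q)) z
  rw [map_fam, hz] at h
  exact h

theorem ext (D : EvalData a o J) {σ σ' : Trans S S'} (h : ∀ z, (σ.hom o).map z = (σ'.hom o).map z) : σ = σ' := by
  refine trans_ext D.ptObjs fun m z => ?_
  refine (S'.hom (D.arr m)).lift_unique (Subsingleton.elim (α := PUnit) _ _) ?_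
  rw [← σ.hom_map, ← σ'.hom_map, h]

/-- The transformation induced by a morphism of the values at `o` is smooth on the objects with a
morphism to `o`. -/
theorem smooth_of_hom
    (hψ : ∀ g z, ψ.map ((S.hom (D.sh g)).map z) = (S'.hom (D.sh g)).map (ψ.map z))
    {X : Mfd.{u}} {P : A.Obj X} {f : Map X M} (φ : A.Hom f P o) :
    Sm (S.bun P).tot (S'.bun P).tot (ptMap D.ptObjs S S' (D.fam ψ) P) := by
  intro q
  have h1 : SmAt (S.bun P).tot (S'.bun P).tot
      (fun q => (S'.hom φ).lift ((S.bun P).proj q) (ψ.map ((S.hom φ).map q))) q :=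
    (S'.hom φ).smAt_lift (Z := (S.bun P).tot) ((S.bun P).proj.smAt q)
      (SmAt.comp q (ψ.map.smAt _) ((S.hom φ).map.smAt q)) (Filter.Eventually.of_forall fun q => by
        rw [ψ.proj_map, (S.hom φ).proj_map]; rfl)
  refine h1.congr (Filter.Eventually.of_forall fun q => ?_)
  refine ((S'.hom φ).lift_eq (proj_ptMap D.ptObjs (D.natural_fam hψ) P q) ?_).symm
  rw [← ptMap_natural D.ptObjs (D.natural_fam hψ) φ q, D.ptMap_o hψ]

end EvalData
end EvalData

/-! ### Evaluation without connections -/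

/-- The evaluation of bundles on `M // G` at the universal object. -/
def evalData : EvalData a (idPt a) (fun m => (Mfd.point m : Map Mfd.pt M)) where
  ptObjs :=
    { reach := fun {X} f x => ⟨(show Map X M from f) x, ⟨⟨1, fun _ => a.one_act _⟩⟩⟩
      connect := fun {X} f x m m' φ φ' => ⟨⟨φ'.1⁻¹ * φ.1, fun y => by
        have h1 := φ.2 y
        have h2 := φ'.2 y
        change a.act ((φ'.1 y)⁻¹ * φ.1 y) _ = _
        rw [a.mul_act, h1]
        refine (congrArg (a.act (φ'.1 y)⁻¹) h2.symm).trans ?_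
        rw [← a.mul_act, inv_mul_cancel, a.one_act]⟩, Subtype.ext (mul_inv_cancel_left φ'.1 φ.1)⟩ }
  arr m := ⟨1, fun _ => a.one_act _⟩
  sh g := shift a g
  comm {m m'} γ := by
    refine ⟨γ.1 PUnit.unit, fun K S z => ?_⟩
    refine (S.hom_comp γ _ z).symm.trans (Eq.trans ?_ (S.hom_comp _ (shift a _) z))
    refine congrArg (fun f : Map _ _ => f z) (map_eq S _ _ ?_ ?_)
    · ext y
      exact (γ.2 y).symm
    · ext y
      exact (one_mul _).trans (mul_one _).symm

/-- All elements of `G` act at once. Over `G × M` the object given by the second projection has two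
morphisms to `id_M`: one over the projection with component `1`, one over the action map with
component `g`. The action is the second after the inverse of the first, both smooth. -/
theorem evalSmooth : EvalSmooth a K := by
  intro S
  let o : (ActGpd a).Obj (G.toMfd.prod M) := (ContMDiffMap.snd : Map (G.toMfd.prod M) M)
  let act : Map (G.toMfd.prod M) M := ⟨fun z => a.act z.1 z.2, a.smooth⟩
  let e : (ActGpd a).Hom (ContMDiffMap.snd : Map (G.toMfd.prod M) M) o (idPt a) :=
    ⟨1, fun _ => a.one_act _⟩
  let d : (ActGpd a).Hom act o (idPt a) := ⟨ContMDiffMap.fst, fun _ => rfl⟩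
  have key : ∀ (g : G) (q : (S.bun (idPt a)).tot), evalMap S g q
      = (S.hom d).map ((S.hom e).lift (g, (S.bun (idPt a)).proj q) q) := by
    intro g q
    -- Restriction to the slice `{g} × M`: there `j` followed by `e` is the identity and `j`
    -- followed by `d` is the shift by `g`.
    let i : Map M (G.toMfd.prod M) := ⟨fun m => (g, m), contMDiff_const.prodMk contMDiff_id⟩
    let j : (ActGpd a).Hom i (idPt a) o := ⟨1, fun _ => a.one_act _⟩
    have h1 : (S.hom e).lift (g, (S.bun (idPt a)).proj q) q = (S.hom j).map q := by
      refine (S.hom e).lift_eq ((S.hom j).proj_map q) ?_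
      rw [← S.hom_comp]
      refine (congrArg (fun f : Map _ _ => f q) (map_eq S _ ((ActGpd a).id _) rfl ?_)).trans
        (S.hom_id _ q)
      exact mul_one (1 : Map M G.toMfd)
    rw [h1, ← S.hom_comp]
    refine congrArg (fun f : Map _ _ => f q) (map_eq S _ _ rfl ?_)
    ext m
    exact (mul_one g).symm
  intro z
  have h1 : SmAt (G.toMfd.prod (S.bun (idPt a)).tot) (S.bun o).tot
      (fun z => (S.hom e).lift (z.1, (S.bun (idPt a)).proj z.2) z.2) z :=
    (S.hom e).smAt_lift (Z := G.toMfd.prod (S.bun (idPt a)).tot)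
      (SmAt.prodMk contMDiffAt_fst (SmAt.comp (X := G.toMfd.prod (S.bun (idPt a)).tot) (f := fun z => z.2) z
        ((S.bun (idPt a)).proj.smAt _) contMDiffAt_snd))
      contMDiffAt_snd (Filter.Eventually.of_forall fun z => rfl)
  have h2 := SmAt.comp (X := G.toMfd.prod (S.bun (idPt a)).tot) z ((S.hom d).map.smAt _) h1
  have h3 : (fun z : G × (S.bun (idPt a)).tot => evalMap S z.1 z.2)
      = fun z => (S.hom d).map ((S.hom e).lift (z.1, (S.bun (idPt a)).proj z.2) z.2) :=
    funext fun z => key z.1 z.2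
  rw [← h3] at h2
  exact h2

/-- Every `f : X → M` is itself the base map of a morphism `f → id_M` with component `1`, so
`smooth_of_hom` applies to all objects. -/
theorem full_evalFunctor (hs : EvalSmooth a K) : (evalFunctor hs).Full where
  map_surjective {S S'} ψ := by
    have hψ : ∀ g z, ψ.map ((S.hom ((evalData a).sh g)).map z)
        = (S'.hom ((evalData a).sh g)).map (ψ.map z) := fun g z => ψ.map_gact g z
    refine ⟨ptTrans (evalData a).ptObjs ((evalData a).natural_fam hψ) fun {X} f =>
      (evalData a).smooth_of_hom hψ (P := f) (f := f) ⟨1, fun _ => a.one_act _⟩, ?_⟩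
    exact EqHom.ext (ContMDiffMap.ext fun q => (evalData a).ptMap_o hψ q)

theorem faithful_evalFunctor (hs : EvalSmooth a K) : (evalFunctor hs).Faithful where
  map_injective h := (evalData a).ext fun z =>
    congrArg (fun ψ : EqHom _ _ => ψ.map z) h

/-! ### Smooth dependence of solutions of differential equations on parameters -/

section Flow

variable {E F : Type u} [NormedAddCommGroup E] [NormedSpace ℝ E] [NormedAddCommGroup F]
  [NormedSpace ℝ F]

/-- The parameter interval of the curves used to construct flows. -/
abbrev Ivl : Type := Set.Icc (-1 : ℝ) 1

theorem neg_one_le_one_real : (-1 : ℝ) ≤ 1 := by norm_num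

/-- Pointwise application of a bilinear map to two curves. -/
def curveBilin {A : Type u} [NormedAddCommGroup A] [NormedSpace ℝ A] (L : A →L[ℝ] E →L[ℝ] F) :
    C(Ivl, A) →L[ℝ] C(Ivl, E) →L[ℝ] C(Ivl, F) :=
  LinearMap.mkContinuous₂
    (LinearMap.mk₂ ℝ (fun (A : C(Ivl, A)) (h : C(Ivl, E)) =>
      (⟨fun t => L (A t) (h t), (L.continuous.comp A.continuous).clm_apply h.continuous⟩ :
        C(Ivl, F)))
      (fun _ _ _ => by ext; simp) (fun _ _ _ => by ext; simp) (fun _ _ _ => by ext; simp)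
      (fun _ _ _ => by ext; simp)) ‖L‖ (fun A h => by
    refine (ContinuousMap.norm_le _ (by positivity)).2 fun t => ?_
    refine (L.le_opNorm₂ _ _).trans ?_
    have h1 := A.norm_coe_le_norm t
    have h2 := h.norm_coe_le_norm t
    gcongr)

theorem contDiff_curveBilin {A : Type u} [NormedAddCommGroup A] [NormedSpace ℝ A]
    (L : A →L[ℝ] E →L[ℝ] F) {n : WithTop ℕ∞} : ContDiff ℝ n fun A => curveBilin L A := by
  have h : IsBoundedLinearMap ℝ fun A => curveBilin L A :=
    ⟨⟨map_add _, map_smul _⟩, ‖L‖ + 1, by positivity, fun A =>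
      ContinuousLinearMap.opNorm_le_bound _ (by positivity) fun h => by
        refine (ContinuousMap.norm_le _ (by positivity)).2 fun t => ?_
        refine (L.le_opNorm₂ _ _).trans ?_
        have h1 := A.norm_coe_le_norm t
        have h2 := h.norm_coe_le_norm t
        gcongr
        linarith⟩
  exact h.contDiff

/-- Composition of curves with a function. -/
def curveComp (f : E → F) (hf : Continuous f) (u : C(Ivl, E)) : C(Ivl, F) :=
  ⟨fun t => f (u t), hf.comp u.continuous⟩

/-- Compact support makes the derivative of `f` globally Lipschitz, so the first order remainder at
every time is at most `C ‖h‖²`, uniformly in time. -/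
theorem hasFDerivAt_curveComp {f : E → F} (hf : ContDiff ℝ ∞ f) (hs : HasCompactSupport f)
    (u : C(Ivl, E)) :
    HasFDerivAt (curveComp f hf.continuous)
      (curveBilin (ContinuousLinearMap.id ℝ (E →L[ℝ] F)) (curveComp (fderiv ℝ f) (hf.continuous_fderiv (by simp)) u)) u := by
  obtain ⟨C, hC⟩ := (hf.fderiv_right (m := 1) (by norm_cast)).lipschitzWith_of_hasCompactSupport
    (hs.fderiv (𝕜 := ℝ)) one_ne_zero
  rw [hasFDerivAt_iff_isLittleO_nhds_zero]
  refine Asymptotics.IsBigO.trans_isLittleO (g := fun h : C(Ivl, E) => ‖h‖ ^ 2) ?_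
    (Asymptotics.isLittleO_norm_pow_id one_lt_two)
  refine Asymptotics.IsBigO.of_bound C (Filter.Eventually.of_forall fun h => ?_)
  rw [Real.norm_of_nonneg (by positivity)]
  refine (ContinuousMap.norm_le _ (by positivity)).2 fun t => ?_
  have h1 := (convex_segment (u t) (u t + h t)).norm_image_sub_le_of_norm_hasFDerivWithin_le'
    (f := f) (f' := fderiv ℝ f) (φ := fderiv ℝ f (u t)) (C := C * ‖h t‖) (x := u t)
    (y := u t + h t) (fun z _ => ((hf.differentiable (by simp)) z).hasFDerivAt.hasFDerivWithinAt)
    (fun z hz => by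
      refine (hC.norm_sub_le z (u t)).trans ?_
      gcongr
      have := norm_sub_le_of_mem_segment hz
      simpa using this)
    (left_mem_segment ℝ _ _) (right_mem_segment ℝ _ _)
  rw [add_sub_cancel_left] at h1
  change ‖f (u t + h t) - f (u t) - (fderiv ℝ f (u t)) (h t)‖ ≤ _
  refine h1.trans ?_
  have h2 := h.norm_coe_le_norm t
  rw [mul_assoc, sq]
  gcongr

/-- Induction on the order: the derivative of composition with `f` is composition with `fderiv ℝ f`,
followed by a bounded linear map. The target space is quantified inside the induction because
`fderiv` has values in a different one. -/
theorem contDiff_curveComp_nat [FiniteDimensional ℝ E] (n : ℕ) : ∀ {F : Type u} [NormedAddCommGroup F] [NormedSpace ℝ F] {f : E → F}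
    (hf : ContDiff ℝ ∞ f) (_ : HasCompactSupport f),
    ContDiff ℝ n (curveComp f hf.continuous) := by
  induction n with
  | zero =>
    intro F _ _ f hf hs
    exact contDiff_zero.2 (ContinuousMap.continuous_postcomp ⟨f, hf.continuous⟩)
  | succ n ih =>
    intro F _ _ f hf hs
    refine (contDiff_succ_iff_hasFDerivAt (n := n)).2 ⟨_, ?_, hasFDerivAt_curveComp hf hs⟩
    have h1 := ih (hf.fderiv_right (m := ∞) (by simp)) (hs.fderiv (𝕜 := ℝ))
    have h2 := contDiff_curveBilin (ContinuousLinearMap.id ℝ (E →L[ℝ] F)) (n := n)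
    exact h2.comp h1

theorem contDiff_curveComp [FiniteDimensional ℝ E] {f : E → F} (hf : ContDiff ℝ ∞ f) (hs : HasCompactSupport f) :
    ContDiff ℝ ∞ (curveComp f hf.continuous) :=
  contDiff_infty.2 fun n => contDiff_curveComp_nat n hf hs

/-- The extension of a curve to the real line. -/
def curveExt (u : C(Ivl, E)) (s : ℝ) : E := u (Set.projIcc (-1) 1 neg_one_le_one_real s)

set_option linter.unusedSectionVars false in
theorem continuous_curveExt (u : C(Ivl, E)) : Continuous (curveExt u) :=
  u.continuous.comp continuous_projIcc

set_option linter.unusedSectionVars false in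
theorem norm_curveExt_le (u : C(Ivl, E)) (s : ℝ) : ‖curveExt u s‖ ≤ ‖u‖ := u.norm_coe_le_norm _

set_option linter.unusedSectionVars false in
theorem curveExt_of_mem (u : C(Ivl, E)) (t : Ivl) : curveExt u t = u t := by
  rw [curveExt, Set.projIcc_val]

/-- The primitive of a curve. -/
def curvePrim : C(Ivl, E) →L[ℝ] C(Ivl, E) :=
  LinearMap.mkContinuous
    { toFun := fun u => ⟨fun t => ∫ s in (0 : ℝ)..t, curveExt u s,
        (intervalIntegral.continuous_primitive (fun _ _ =>
          (continuous_curveExt u).intervalIntegrable _ _) 0).comp continuous_subtype_val⟩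
      map_add' := fun u v => by
        ext t
        exact intervalIntegral.integral_add ((continuous_curveExt u).intervalIntegrable _ _)
          ((continuous_curveExt v).intervalIntegrable _ _)
      map_smul' := fun c u => by
        ext t
        exact intervalIntegral.integral_smul c _ } 1 (fun u => by
    refine (ContinuousMap.norm_le _ (by positivity)).2 fun t => ?_
    refine (intervalIntegral.norm_integral_le_of_norm_le_const
      (fun s _ => norm_curveExt_le u s)).trans ?_
    rw [one_mul, sub_zero]
    exact mul_le_of_le_one_right (norm_nonneg _) (abs_le.2 ⟨t.2.1, t.2.2⟩))

/-- The constant curve. -/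
def curveConst : E →L[ℝ] C(Ivl, E) :=
  LinearMap.mkContinuous
    { toFun := fun y => ContinuousMap.const _ y
      map_add' := fun _ _ => rfl
      map_smul' := fun _ _ => rfl } 1 (fun y => by
    rw [one_mul]
    exact (ContinuousMap.norm_le _ (norm_nonneg _)).2 fun t => le_rfl)

variable {E₁ E₂ : Type*} [NormedAddCommGroup E₁] [NormedSpace ℝ E₁] [CompleteSpace E₁]
  [NormedAddCommGroup E₂] [NormedSpace ℝ E₂] [CompleteSpace E₂]

/-- The implicit function theorem, with smoothness in a neighbourhood. -/
theorem exists_smooth_implicit {f : E₁ × E₂ → E₂} (hf : ContDiff ℝ ∞ f) (v₀ : E₁ × E₂)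
    (hinv : (fderiv ℝ f v₀ ∘L .inr ℝ E₁ E₂).IsInvertible) :
    ∃ ψ : E₁ → E₂, ψ v₀.1 = v₀.2 ∧ (∀ᶠ x in 𝓝 v₀.1, ContDiffAt ℝ ∞ ψ x ∧ f (x, ψ x) = f v₀) ∧
      ∀ᶠ v in 𝓝 v₀, f v = f v₀ → ψ v.1 = v.2 := by
  have hn : (∞ : WithTop ℕ∞) ≠ 0 := by simp
  let ψ := (hf.contDiffAt (x := v₀)).implicitFunction hn hinv
  have hψ : ContDiffAt ℝ ∞ ψ v₀.1 := (hf.contDiffAt (x := v₀)).contDiffAt_implicitFunction hn hinv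
  have hψ₀ : ψ v₀.1 = v₀.2 := (hf.contDiffAt (x := v₀)).implicitFunction_apply_self hn hinv
  have h1 := (hf.contDiffAt (x := v₀)).eventually_apply_implicitFunction hn hinv
  have h2 := (hf.contDiffAt (x := v₀)).eventually_apply_eq_iff_implicitFunction hn hinv
  refine ⟨ψ, hψ₀, ?_, h2.mono fun v hv => hv.1⟩
  -- Smoothness at the base point alone gives a neighbourhood for each finite order, which may
  -- shrink with the order. To get a single neighbourhood, the theorem is applied again at `(x, ψ
  -- x)`, where the partial derivative is still invertible. The new implicit function agrees with
  -- `ψ` near `x` by uniqueness; order one is used only for the continuity of `ψ` at `x`.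
  have h3 : ∀ᶠ x in 𝓝 v₀.1, ContDiffAt ℝ 1 ψ x := (hψ.of_le (by norm_cast)).eventually (by simp)
  have h4 : Filter.Tendsto (fun x => (x, ψ x)) (𝓝 v₀.1) (𝓝 v₀) := by
    have := continuousAt_id.prodMk hψ.continuousAt
    rw [ContinuousAt] at this
    simpa [hψ₀] using this
  have h5 : ∀ᶠ v in 𝓝 v₀, (fderiv ℝ f v ∘L .inr ℝ E₁ E₂).IsInvertible := by
    obtain ⟨e, he⟩ := hinv
    have hc : Continuous fun v => fderiv ℝ f v ∘L .inr ℝ E₁ E₂ :=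
      (hf.continuous_fderiv hn).clm_comp continuous_const
    have := e.nhds
    rw [he] at this
    filter_upwards [hc.continuousAt.eventually this] with v hv
    exact hv
  filter_upwards [h3, h4.eventually h5, h1.eventually_nhds] with x hx3 hx5 hx1
  refine ⟨?_, hx1.self_of_nhds⟩
  have h6 := (hf.contDiffAt (x := (x, ψ x))).contDiffAt_implicitFunction hn hx5
  have h7 := (hf.contDiffAt (x := (x, ψ x))).eventually_apply_eq_iff_implicitFunction hn hx5
  refine h6.congr_of_eventuallyEq ?_
  have h8 : Filter.Tendsto (fun x => (x, ψ x)) (𝓝 x) (𝓝 (x, ψ x)) :=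
    (continuousAt_id.prodMk hx3.continuousAt)
  filter_upwards [h8.eventually h7, hx1] with x' hx7 hx'
  exact (hx7.1 (hx'.trans hx1.self_of_nhds.symm)).symm

/-- The integral equation whose solutions are the integral curves. -/
theorem exists_flow_of_compact [FiniteDimensional ℝ E] {f : E → E} (hf : ContDiff ℝ ∞ f)
    (hs : HasCompactSupport f) (y₀ : E) {ρ : ℝ} (hρ : 0 < ρ) :
    ∃ r > 0, ∃ Φ : ℝ × E → E, (∀ z ∈ Set.Ioo (-r) r ×ˢ Metric.ball y₀ r, ContDiffAt ℝ ∞ Φ z) ∧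
      ∀ y ∈ Metric.ball y₀ r, Φ (0, y) = y ∧ ∀ t ∈ Set.Ioo (-r) r, Φ (t, y) ∈ Metric.ball y₀ ρ ∧
        HasDerivAt (fun t => Φ (t, y)) (f (Φ (t, y))) t := by
  let N : C(Ivl, E) → C(Ivl, E) := curveComp f hf.continuous
  -- The zeros are the curves with `u(t) = y + ε ∫₀ᵗ f(u)`, that is the integral curves from `y` run
  -- at speed `ε`. Time becomes a parameter and the curves live on a fixed interval.
  let Fn : (ℝ × E) × C(Ivl, E) → C(Ivl, E) := fun v =>
    v.2 - curveConst v.1.2 - v.1.1 • curvePrim (N v.2)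
  have hN : ContDiff ℝ ∞ N := contDiff_curveComp hf hs
  have hFn : ContDiff ℝ ∞ Fn :=
    (contDiff_snd.sub (curveConst.contDiff.comp (contDiff_snd.comp contDiff_fst))).sub
      ((contDiff_fst.comp contDiff_fst).smul (curvePrim.contDiff.comp (hN.comp contDiff_snd)))
  let v₀ : (ℝ × E) × C(Ivl, E) := ((0, y₀), curveConst y₀)
  have hFv₀ : Fn v₀ = 0 := by simp [Fn, v₀]
  -- At `ε = 0` the integral drops out and the equation is `u - y`, whose derivative in `u` is the
  -- identity.
  have hinv : (fderiv ℝ Fn v₀ ∘L .inr ℝ (ℝ × E) C(Ivl, E)).IsInvertible := by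
    have h1 : HasFDerivAt (fun u => Fn ((0, y₀), u)) (fderiv ℝ Fn v₀ ∘L .inr ℝ (ℝ × E) C(Ivl, E))
        (curveConst y₀) :=
      HasFDerivAt.comp (curveConst y₀) (g := Fn) (f := fun u => ((0, y₀), u))
        (hFn.differentiable (by simp) v₀).hasFDerivAt (hasFDerivAt_prodMk_right _ _)
    have h2 : HasFDerivAt (fun u => Fn ((0, y₀), u)) (ContinuousLinearMap.id ℝ C(Ivl, E))
        (curveConst y₀) := by
      have : (fun u => Fn ((0, y₀), u)) = fun u => u - curveConst y₀ := by
        funext u; simp [Fn]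
      rw [this]
      exact (hasFDerivAt_id _).sub_const _
    rw [h1.unique h2]
    exact ⟨ContinuousLinearEquiv.refl ℝ _, rfl⟩
  obtain ⟨ψ, hψ₀, hψ, huniq⟩ := exists_smooth_implicit hFn v₀ hinv
  rw [hFv₀] at hψ huniq
  have hcont : ContinuousAt ψ v₀.1 := hψ.self_of_nhds.1.continuousAt
  obtain ⟨δ, hδ, hδu⟩ := Metric.eventually_nhds_iff_ball.1 huniq
  have hnear : ∀ᶠ x in 𝓝 v₀.1, ‖ψ x - curveConst y₀‖ < min δ ρ := by
    have h1 : Filter.Tendsto ψ (𝓝 v₀.1) (𝓝 (curveConst y₀)) := by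
      have := hcont.tendsto; rwa [hψ₀] at this
    have h2 := h1.eventually (Metric.ball_mem_nhds (curveConst y₀) (lt_min hδ hρ))
    filter_upwards [h2] with x hx
    rwa [dist_eq_norm] at hx
  obtain ⟨r₁, hr₁, hall⟩ := Metric.eventually_nhds_iff_ball.1 (hψ.and hnear)
  let r := min r₁ δ
  have hr : 0 < r := lt_min hr₁ hδ
  have hball : ∀ {ε : ℝ} {y : E}, ε ∈ Set.Ioo (-r) r → y ∈ Metric.ball y₀ r →
      ((ε, y) : ℝ × E) ∈ Metric.ball v₀.1 r := by
    intro ε y hε hy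
    rw [Metric.mem_ball, Prod.dist_eq]
    refine max_lt ?_ hy
    change dist ε 0 < r
    rw [Real.dist_eq, sub_zero]; exact abs_lt.2 hε
  have hgood : ∀ {ε : ℝ} {y : E}, ε ∈ Set.Ioo (-r) r → y ∈ Metric.ball y₀ r →
      (ContDiffAt ℝ ∞ ψ (ε, y) ∧ Fn ((ε, y), ψ (ε, y)) = 0) ∧
        ‖ψ (ε, y) - curveConst y₀‖ < min δ ρ := fun hε hy =>
    hall _ (Metric.ball_subset_ball (min_le_left _ _) (hball hε hy))
  have hint : ∀ {ε : ℝ} {y : E}, ε ∈ Set.Ioo (-r) r → y ∈ Metric.ball y₀ r → ∀ t : Ivl,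
      ψ (ε, y) t = y + ε • ∫ s in (0 : ℝ)..t, f (curveExt (ψ (ε, y)) s) := by
    intro ε y hε hy t
    have h1 := congrArg (fun u : C(Ivl, E) => u t) (hgood hε hy).1.2
    have h2 : ψ (ε, y) t - y - ε • ∫ s in (0 : ℝ)..t, f (curveExt (ψ (ε, y)) s) = 0 := h1
    rw [sub_sub, sub_eq_zero] at h2
    exact h2
  -- The curve `t ↦ ψ(ε, y)(s t)` solves the equation with speed `s ε` and is as close to `y₀` as
  -- before. Local uniqueness identifies it with `ψ(s ε, y)`, and evaluation at `t = 1` gives the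
  -- claim.
  have hscale : ∀ {ε : ℝ} {y : E}, ε ∈ Set.Ioo (-r) r → y ∈ Metric.ball y₀ r → ∀ s : Ivl,
      ψ (s * ε, y) ⟨1, by norm_num, le_rfl⟩ = ψ (ε, y) s := by
    intro ε y hε hy s
    have hmul : ∀ t : Ivl, (s : ℝ) * t ∈ Set.Icc (-1 : ℝ) 1 := fun t => by
      have h1 : |(s : ℝ) * t| ≤ 1 := by
        rw [abs_mul]
        exact mul_le_one₀ (abs_le.2 s.2) (abs_nonneg _) (abs_le.2 t.2)
      exact abs_le.1 h1
    let w : C(Ivl, E) := ⟨fun t => ψ (ε, y) ⟨s * t, hmul t⟩, (ψ (ε, y)).continuous.comp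
      (Continuous.subtype_mk (continuous_const.mul continuous_subtype_val) _)⟩
    have hsε : (s : ℝ) * ε ∈ Set.Ioo (-r) r := by
      have h1 : |(s : ℝ) * ε| < r := by
        rw [abs_mul]
        exact lt_of_le_of_lt (mul_le_of_le_one_left (abs_nonneg _) (abs_le.2 s.2)) (abs_lt.2 hε)
      exact abs_lt.1 h1
    have hw : ‖w - curveConst y₀‖ < δ := by
      refine lt_of_le_of_lt ?_ (lt_of_lt_of_le (hgood hε hy).2 (min_le_left _ _))
      refine (ContinuousMap.norm_le _ (norm_nonneg _)).2 fun t => ?_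
      exact (ψ (ε, y) - curveConst y₀).norm_coe_le_norm ⟨s * t, hmul t⟩
    have hFw : Fn (((s : ℝ) * ε, y), w) = 0 := by
      ext t
      change w t - y - ((s : ℝ) * ε) • ∫ τ in (0 : ℝ)..t, f (curveExt w τ) = 0
      rw [sub_sub, sub_eq_zero]
      change ψ (ε, y) ⟨s * t, hmul t⟩ = _
      rw [hint hε hy]
      congr 1
      rw [mul_comm (s : ℝ) ε, mul_smul]
      congr 1
      have h1 := intervalIntegral.smul_integral_comp_mul_left (a := (0 : ℝ)) (b := t)
        (fun τ => f (curveExt (ψ (ε, y)) τ)) (s : ℝ)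
      rw [mul_zero] at h1
      change ∫ τ in (0 : ℝ)..(s * t), f (curveExt (ψ (ε, y)) τ) = _
      rw [← h1]
      congr 1
      refine intervalIntegral.integral_congr fun τ hτ => ?_
      have hτ' : τ ∈ Set.Icc (-1 : ℝ) 1 := by
        have h0 : (0 : ℝ) ∈ Set.Icc (-1 : ℝ) 1 := by constructor <;> norm_num
        exact Set.uIcc_subset_Icc h0 t.2 hτ
      change f (curveExt (ψ (ε, y)) (s * τ)) = f (curveExt w τ)
      have e1 : curveExt w τ = w ⟨τ, hτ'⟩ := curveExt_of_mem w ⟨τ, hτ'⟩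
      have e2 : curveExt (ψ (ε, y)) (s * τ) = ψ (ε, y) ⟨s * τ, hmul ⟨τ, hτ'⟩⟩ :=
        curveExt_of_mem _ ⟨s * τ, hmul ⟨τ, hτ'⟩⟩
      rw [e1, e2]; rfl
    have h3 := hδu (((s : ℝ) * ε, y), w) (by
      rw [Metric.mem_ball, Prod.dist_eq]
      refine max_lt (lt_of_lt_of_le (hball hsε hy) (min_le_right _ _)) ?_
      rw [dist_eq_norm]; exact hw) hFw
    rw [h3]
    change ψ (ε, y) _ = _
    congr 1
    exact Subtype.ext (mul_one _)
  refine ⟨r, hr, fun z => ψ z ⟨1, by norm_num, le_rfl⟩, ?_, ?_⟩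
  · rintro ⟨ε, y⟩ ⟨hε, hy⟩
    exact (ContinuousMap.evalCLM ℝ (⟨1, by norm_num, le_rfl⟩ : Ivl)).contDiff.contDiffAt.comp (ε, y)
      (hgood hε hy).1.1
  · intro y hy
    refine ⟨?_, fun t ht => ⟨?_, ?_⟩⟩
    · have h0 : (0 : ℝ) ∈ Set.Ioo (-r) r := ⟨by linarith, hr⟩
      simpa using hint h0 hy ⟨1, by norm_num, le_rfl⟩
    · rw [Metric.mem_ball, dist_eq_norm]
      refine lt_of_le_of_lt ?_ (lt_of_lt_of_le (hgood ht hy).2 (min_le_right _ _))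
      exact (ψ (t, y) - curveConst y₀).norm_coe_le_norm _
    -- A number strictly between `|t|` and `r`, hence positive also for `t = 0`. With it fixed, the
    -- flow near `t` is the single curve `τ ↦ ψ(ε, y)(τ / ε)`, to which the fundamental theorem of
    -- calculus applies.
    · let ε := (|t| + r) / 2
      have htr : |t| < r := abs_lt.2 ht
      have hε0 : 0 < ε := by have := abs_nonneg t; simp only [ε]; linarith
      have htε : |t| < ε := by simp only [ε]; linarith
      have hε : ε ∈ Set.Ioo (-r) r := ⟨by linarith, by simp only [ε]; linarith⟩
      have hdiv : ∀ {τ : ℝ}, |τ| < ε → τ / ε ∈ Set.Icc (-1 : ℝ) 1 := fun {τ} hτ => by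
        have : |τ / ε| ≤ 1 := by
          rw [abs_div, abs_of_pos hε0]; exact (div_le_one hε0).2 hτ.le
        exact abs_le.1 this
      have hval : ∀ {τ : ℝ} (hτ : |τ| < ε), ψ (τ, y) ⟨1, by norm_num, le_rfl⟩
          = ψ (ε, y) ⟨τ / ε, hdiv hτ⟩ := fun {τ} hτ => by
        have := hscale hε hy ⟨τ / ε, hdiv hτ⟩
        rwa [div_mul_cancel₀ _ hε0.ne'] at this
      have hc : Continuous fun s => f (curveExt (ψ (ε, y)) s) :=
        hf.continuous.comp (continuous_curveExt _)
      have h1 : HasDerivAt (fun b => ∫ s in (0 : ℝ)..b, f (curveExt (ψ (ε, y)) s))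
          (f (curveExt (ψ (ε, y)) (t / ε))) (t / ε) :=
        intervalIntegral.integral_hasDerivAt_right (hc.intervalIntegrable _ _)
          hc.aestronglyMeasurable.stronglyMeasurableAtFilter hc.continuousAt
      have h2 : HasDerivAt (fun τ : ℝ => τ / ε) (1 / ε) t := (hasDerivAt_id t).div_const ε
      have h3 := ((h1.scomp t h2).const_smul ε).const_add y
      have h4 : ε • ((1 / ε) • f (curveExt (ψ (ε, y)) (t / ε)))
          = f (ψ (t, y) ⟨1, by norm_num, le_rfl⟩) := by
        rw [smul_smul, mul_one_div_cancel hε0.ne', one_smul, hval htε]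
        exact congrArg f (curveExt_of_mem _ ⟨t / ε, hdiv htε⟩)
      rw [h4] at h3
      refine h3.congr_of_eventuallyEq ?_
      filter_upwards [(isOpen_lt continuous_abs continuous_const).mem_nhds htε] with τ hτ
      rw [hval hτ, hint hε hy]
      rfl

/-- The local flow of a smooth vector field. -/
theorem exists_flow [FiniteDimensional ℝ E] {V : E → E} {U : Set E} (hU : IsOpen U)
    (hV : ContDiffOn ℝ ∞ V U) {y₀ : E} (hy₀ : y₀ ∈ U) :
    ∃ r > 0, ∃ Φ : ℝ × E → E, (∀ z ∈ Set.Ioo (-r) r ×ˢ Metric.ball y₀ r, ContDiffAt ℝ ∞ Φ z) ∧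
      ∀ y ∈ Metric.ball y₀ r, Φ (0, y) = y ∧ ∀ t ∈ Set.Ioo (-r) r, Φ (t, y) ∈ U ∧
        HasDerivAt (fun t => Φ (t, y)) (V (Φ (t, y))) t := by
  obtain ⟨R, hR, hRU⟩ := Metric.isOpen_iff.1 hU y₀ hy₀
  -- The cutoff is `1` on the ball of radius `R / 4`, and the flow is confined to this ball, so
  -- along it the cut off field equals `V`.
  let χ : ContDiffBump y₀ := ⟨R / 4, R / 2, by positivity, by linarith⟩
  let f : E → E := fun y => χ y • V y
  have hts : tsupport χ ⊆ U := by
    rw [χ.tsupport_eq]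
    exact (Metric.closedBall_subset_ball (by simp only [χ]; linarith)).trans hRU
  have hf : ContDiff ℝ ∞ f := by
    refine contDiff_iff_contDiffAt.2 fun y => ?_
    by_cases hy : y ∈ tsupport χ
    · exact χ.contDiff.contDiffAt.smul ((hV y (hts hy)).contDiffAt (hU.mem_nhds (hts hy)))
    · refine contDiffAt_const (c := (0 : E)).congr_of_eventuallyEq ?_
      filter_upwards [(isClosed_tsupport χ).isOpen_compl.mem_nhds hy] with z hz
      simp [f, image_eq_zero_of_notMem_tsupport hz]
  have hs : HasCompactSupport f := χ.hasCompactSupport.smul_right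
  obtain ⟨r, hr, Φ, hΦ, hΦ'⟩ := exists_flow_of_compact hf hs y₀ (ρ := R / 4) (by positivity)
  refine ⟨r, hr, Φ, hΦ, fun y hy => ⟨(hΦ' y hy).1, fun t ht => ?_⟩⟩
  obtain ⟨h1, h2⟩ := (hΦ' y hy).2 t ht
  have h3 : f (Φ (t, y)) = V (Φ (t, y)) := by
    have : χ (Φ (t, y)) = 1 := χ.one_of_mem_closedBall (Metric.ball_subset_closedBall h1)
    simp [f, this]
  rw [h3] at h2
  exact ⟨hRU (Metric.ball_subset_ball (by linarith) h1), h2⟩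

end Flow

/-! ### The equation `l⁻¹ dl/ds = b` in a Lie group -/

section LieFlow

theorem der_line_of_hasDerivAt {V : Type u} [NormedAddCommGroup V] [NormedSpace ℝ V]
    [FiniteDimensional ℝ V] {c : ℝ → V} {c' : V} {s : Mfd.line.{u}}
    (h : HasDerivAt c c' s.down) :
    DiffAt Mfd.line.{u} (Mfd.vec V) (fun t => c t.down) s ∧
      (der (X := Mfd.line.{u}) (Y := Mfd.vec V) (fun t => c t.down) s oneL : V) = c' := by
  let e : ULift.{u} ℝ ≃L[ℝ] ℝ := ContinuousLinearEquiv.ulift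
  have h1 : HasFDerivAt (fun t : ULift.{u} ℝ => c t.down)
      ((ContinuousLinearMap.toSpanSingleton ℝ c').comp (e : ULift.{u} ℝ →L[ℝ] ℝ)) s :=
    HasFDerivAt.comp (s : ULift.{u} ℝ) (g := c) h.hasFDerivAt e.hasFDerivAt
  refine ⟨h1.differentiableAt.mdifferentiableAt, ?_⟩
  change mfderiv _ _ _ _ _ = _
  rw [mfderiv_eq_fderiv, h1.fderiv]
  exact one_smul ℝ c'

theorem smAt_vec {V W : Type u} [NormedAddCommGroup V] [NormedSpace ℝ V] [FiniteDimensional ℝ V]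
    [NormedAddCommGroup W] [NormedSpace ℝ W] [FiniteDimensional ℝ W] {f : V → W} {x : V} :
    SmAt (Mfd.vec V) (Mfd.vec W) f x ↔ ContDiffAt ℝ ∞ f x := contMDiffAt_iff_contDiffAt

theorem smAt_chart {X : Mfd.{u}} (x₀ : X) {x : X} (hx : x ∈ (extChartAt X.I x₀).source) :
    SmAt X (Mfd.vec X.E) (extChartAt X.I x₀) x :=
  contMDiffAt_extChartAt' (by rwa [extChartAt_source] at hx)

theorem smAt_chart_symm {X : Mfd.{u}} (x₀ : X) {y : X.E} (hy : y ∈ (extChartAt X.I x₀).target) :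
    SmAt (Mfd.vec X.E) X (extChartAt X.I x₀).symm y :=
  (contMDiffOn_extChartAt_symm x₀ y hy).contMDiffAt (extChartAt_target_mem_nhds' hy)

theorem isOpen_chart_target {X : Mfd.{u}} (x₀ : X) : IsOpen (extChartAt X.I x₀).target :=
  isOpen_extChartAt_target x₀

variable {K : LieGrp.{u}}

/-- The multiplication of `K` in the chart at `1`. -/
def chartMul (K : LieGrp.{u}) (κ l : K.E) : K.E :=
  extChartAt K.I (1 : K) ((extChartAt K.I (1 : K)).symm κ * (extChartAt K.I (1 : K)).symm l)

theorem contDiffAt_chartMul {κ l : K.E} (hκ : κ ∈ (extChartAt K.I (1 : K)).target)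
    (hl : l ∈ (extChartAt K.I (1 : K)).target)
    (h : (extChartAt K.I (1 : K)).symm κ * (extChartAt K.I (1 : K)).symm l
      ∈ (extChartAt K.I (1 : K)).source) :
    ContDiffAt ℝ ∞ (Function.uncurry (chartMul K)) (κ, l) := by
  refine smAt_vec.1 ?_
  have h1 : SmAt (Mfd.vec (K.E × K.E)) K.toMfd (fun z => (extChartAt K.I (1 : K)).symm z.1) (κ, l) :=
    SmAt.comp (Y := Mfd.vec K.E) (g := (extChartAt K.I (1 : K)).symm) (f := Prod.fst) (κ, l)
      (smAt_chart_symm (X := K.toMfd) (1 : K) hκ) (smAt_vec.2 contDiffAt_fst)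
  have h2 : SmAt (Mfd.vec (K.E × K.E)) K.toMfd (fun z => (extChartAt K.I (1 : K)).symm z.2) (κ, l) :=
    SmAt.comp (Y := Mfd.vec K.E) (g := (extChartAt K.I (1 : K)).symm) (f := Prod.snd) (κ, l)
      (smAt_chart_symm (X := K.toMfd) (1 : K) hl) (smAt_vec.2 contDiffAt_snd)
  exact SmAt.comp (X := Mfd.vec (K.E × K.E)) (Y := K.toMfd) (Z := Mfd.vec K.E)
    (g := extChartAt K.I (1 : K)) (κ, l)
    (smAt_chart (X := K.toMfd) (1 : K) h) (ContMDiffAt.mul h1 h2)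

/-- The vector field in the chart at `1` given by left translation. -/
def chartLeft (K : LieGrp.{u}) (κ : K.E) (A : K.Lie) : K.E :=
  fderiv ℝ (chartMul K κ) (extChartAt K.I (1 : K) 1)
    (der (X := K.toMfd) (Y := Mfd.vec K.E) (extChartAt K.I (1 : K)) 1 A)

/-- `chartLeft` is the left-invariant field of `A` read in the chart: the derivative of `l ↦ κ l` at
`1`. Translating back by `κ⁻¹` cancels the multiplication, and the chart composed with its inverse
leaves `A`. -/
theorem mc_chartLeft {κ : K.E} (hκ : κ ∈ (extChartAt K.I (1 : K)).target) (A : K.Lie) :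
    K.mc ((extChartAt K.I (1 : K)).symm κ) (der (X := Mfd.vec K.E) (Y := K.toMfd)
      (extChartAt K.I (1 : K)).symm κ (chartLeft K κ A)) = A := by
  let φ := extChartAt K.I (1 : K)
  have h1s : (1 : K) ∈ φ.source := mem_extChartAt_source (1 : K)
  have h1t : φ 1 ∈ φ.target := φ.map_source h1s
  have hm : φ.symm κ * φ.symm (φ 1) = φ.symm κ := by rw [φ.left_inv h1s, mul_one]
  have hms : φ.symm κ * φ.symm (φ 1) ∈ φ.source := by rw [hm]; exact φ.map_target hκ
  have hψ0 : chartMul K κ (φ 1) = κ := by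
    change φ (φ.symm κ * φ.symm (φ 1)) = κ
    rw [hm, φ.right_inv hκ]
  have hs : SmAt (Mfd.vec K.E) K.toMfd φ.symm κ := smAt_chart_symm (X := K.toMfd) (1 : K) hκ
  have hs1 : SmAt (Mfd.vec K.E) K.toMfd φ.symm (φ 1) := smAt_chart_symm (X := K.toMfd) (1 : K) h1t
  have hφ1 : SmAt K.toMfd (Mfd.vec K.E) φ 1 := smAt_chart (X := K.toMfd) (1 : K) h1s
  have hψ : SmAt (Mfd.vec K.E) (Mfd.vec K.E) (chartMul K κ) (φ 1) :=
    smAt_vec.2 ((contDiffAt_chartMul hκ h1t hms).comp (φ 1)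
      (contDiffAt_const.prodMk contDiffAt_id))
  let B : K.E := der (X := K.toMfd) (Y := Mfd.vec K.E) φ 1 A
  have e1 : (chartLeft K κ A : K.E)
      = der (X := Mfd.vec K.E) (Y := Mfd.vec K.E) (chartMul K κ) (φ 1) B := by
    change _ = mfderiv _ _ _ _ _
    rw [mfderiv_eq_fderiv]; rfl
  have hs' : SmAt (Mfd.vec K.E) K.toMfd φ.symm (chartMul K κ (φ 1)) := by rw [hψ0]; exact hs
  have e2 := der_comp_at (X := Mfd.vec K.E) (Y := Mfd.vec K.E) (Z := K.toMfd) (g := φ.symm)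
    (f := chartMul K κ) (φ 1) hs'.diff hψ.diff B
  have hs'' : SmAt (Mfd.vec K.E) K.toMfd (fun l => φ.symm (chartMul K κ l)) (φ 1) :=
    SmAt.comp (X := Mfd.vec K.E) (Y := Mfd.vec K.E) (Z := K.toMfd) (φ 1) hs' hψ
  have e3 := der_comp_at (X := Mfd.vec K.E) (Y := K.toMfd) (Z := K.toMfd)
    (g := lmul (φ.symm κ)⁻¹) (f := fun l => φ.symm (chartMul K κ l)) (φ 1)
    ((lmul (φ.symm κ)⁻¹).mdiff _) hs''.diff B
  have e4 : (fun l => lmul (φ.symm κ)⁻¹ (φ.symm (chartMul K κ l))) =ᶠ[𝓝 (φ 1)] φ.symm := by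
    have hc : ContinuousAt (fun l => φ.symm κ * φ.symm l) (φ 1) :=
      ((lmul (φ.symm κ)).contMDiff.continuous.continuousAt (x := φ.symm (φ 1))).comp
        hs1.continuousAt
    filter_upwards [hc.eventually ((isOpen_extChartAt_source (1 : K)).mem_nhds hms)] with l hl
    change (φ.symm κ)⁻¹ * φ.symm (φ (φ.symm κ * φ.symm l)) = φ.symm l
    rw [φ.left_inv hl, inv_mul_cancel_left]
  have e5 := der_comp_at (X := K.toMfd) (Y := Mfd.vec K.E) (Z := K.toMfd) (g := φ.symm)
    (f := φ) 1 hs1.diff hφ1.diff A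
  have e6 : (fun y => φ.symm (φ y)) =ᶠ[𝓝 (1 : K)] fun y => y := by
    filter_upwards [extChartAt_source_mem_nhds (I := K.I) (1 : K)] with y hy
    exact φ.left_inv hy
  have e7 : (der (X := Mfd.vec K.E) (Y := K.toMfd) φ.symm κ (chartLeft K κ A) : K.E)
      = der (X := Mfd.vec K.E) (Y := K.toMfd) (fun l => φ.symm (chartMul K κ l)) (φ 1) B := by
    rw [e1]
    exact (der_congr_pt (X := Mfd.vec K.E) (Y := K.toMfd) φ.symm hψ0.symm _).trans e2.symm
  change der (lmul (φ.symm κ)⁻¹) (φ.symm κ) _ = A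
  have e8 := congrArg (fun w : K.E => (der (lmul (φ.symm κ)⁻¹) (φ.symm κ) (w : K.T (φ.symm κ)) : K.E)) e7
  refine e8.trans ?_
  refine (der_congr_pt (lmul (φ.symm κ)⁻¹) (congrArg φ.symm hψ0.symm) _).trans ?_
  refine e3.symm.trans ((der_congr (X := Mfd.vec K.E) (Y := K.toMfd) e4 B).trans ?_)
  exact e5.symm.trans ((der_congr (X := K.toMfd) (Y := K.toMfd) e6 A).trans (der_id (X := K.toMfd) (1 : K) A))

/-- Local solutions of `l⁻¹ dl/ds = b`, depending smoothly on parameters. -/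
theorem exists_lie_flow {X : Mfd.{u}} {b : X × Mfd.line.{u} → K.E} {x₀ : X} {s₀ : ℝ}
    (hb : ∀ᶠ z in 𝓝 ((x₀, ⟨s₀⟩) : X × Mfd.line.{u}), SmAt (X.prod Mfd.line) (Mfd.vec K.E) b z) :
    ∃ (N : Set X) (ε : ℝ) (l : X × Mfd.line.{u} → K), IsOpen N ∧ x₀ ∈ N ∧ 0 < ε ∧
      ∀ x ∈ N, ∀ s : Mfd.line.{u}, |s.down - s₀| < ε →
        SmAt (X.prod Mfd.line) K.toMfd l (x, s) ∧
        K.mc (l (x, s)) (der (X := Mfd.line) (Y := K.toMfd) (fun t => l (x, t)) s oneL)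
          = b (x, s) := by
  let φ := extChartAt K.I (1 : K)
  let χ := extChartAt X.I x₀
  have h1s : (1 : K) ∈ φ.source := mem_extChartAt_source (1 : K)
  have h1t : φ 1 ∈ φ.target := φ.map_source h1s
  have hx₀s : x₀ ∈ χ.source := mem_extChartAt_source x₀
  obtain ⟨W, hWs, hWo, hW₀⟩ := eventually_nhds_iff.1 hb
  -- The equation is made autonomous: the parameter is carried along with velocity `0`, the time
  -- with velocity `1`, and only the last component is the equation in `K`, read in the chart at
  -- `1`.
  let T : Type u := (X.E × ULift.{u} ℝ) × K.E
  let y₀ : T := ((χ x₀, ⟨s₀⟩), φ 1)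
  let v : X.E × ULift.{u} ℝ := (0, oneL)
  let V : T → T := fun z => (v, chartLeft K z.2 (b (χ.symm z.1.1, z.1.2)))
  let W' : Set (X.E × ULift.{u} ℝ) :=
    {p | p ∈ χ.target ×ˢ Set.univ ∧ (χ.symm p.1, p.2) ∈ W}
  have hW' : IsOpen W' := by
    have hc : ContinuousOn (fun p : X.E × ULift.{u} ℝ => ((χ.symm p.1, p.2) : X × ULift.{u} ℝ))
        (χ.target ×ˢ Set.univ) :=
      ((continuousOn_extChartAt_symm x₀).comp continuousOn_fst fun p hp => hp.1).prodMk
        continuousOn_snd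
    exact hc.isOpen_inter_preimage ((isOpen_chart_target x₀).prod isOpen_univ) hWo
  let U : Set T := W' ×ˢ φ.target
  have hU : IsOpen U := hW'.prod (isOpen_chart_target (X := K.toMfd) (1 : K))
  have hy₀ : y₀ ∈ U := ⟨⟨⟨χ.map_source hx₀s, trivial⟩, by
    change (χ.symm (χ x₀), _) ∈ W
    rw [χ.left_inv hx₀s]; exact hW₀⟩, h1t⟩
  have hV : ContDiffOn ℝ ∞ V U := by
    rintro z ⟨⟨⟨hz1, -⟩, hz2⟩, hz3⟩
    refine ContDiffAt.contDiffWithinAt (contDiffAt_const.prodMk ?_)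
    have hms : φ.symm z.2 * φ.symm (φ 1) ∈ φ.source := by
      rw [φ.left_inv h1s, mul_one]; exact φ.map_target hz3
    have hD : ContDiffAt ℝ ∞ (fun z : T => fderiv ℝ (chartMul K z.2) (φ 1)) z :=
      ContDiffAt.fderiv (n := ∞) (f := fun z : T => chartMul K z.2) (g := fun _ => φ 1)
        (ContDiffAt.comp (z, φ 1) (g := Function.uncurry (chartMul K))
          (f := fun p : T × K.E => (p.1.2, p.2)) (contDiffAt_chartMul hz3 h1t hms)
          ((contDiffAt_snd.comp (z, φ 1) contDiffAt_fst).prodMk contDiffAt_snd))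
        contDiffAt_const (by simp)
    have h1 : SmAt (Mfd.vec T) X (fun z => χ.symm z.1.1) z :=
      SmAt.comp (Y := Mfd.vec X.E) (g := χ.symm) (f := fun z : T => z.1.1) z
        (smAt_chart_symm x₀ hz1) (smAt_vec.2 (contDiffAt_fst.comp z contDiffAt_fst))
    have h2 : SmAt (Mfd.vec T) Mfd.line (fun z => z.1.2) z :=
      smAt_vec.2 (contDiffAt_snd.comp z contDiffAt_fst)
    have h3 : SmAt (Mfd.vec T) (Mfd.vec K.E) (fun z => b (χ.symm z.1.1, z.1.2)) z :=
      SmAt.comp (X := Mfd.vec T) (Y := X.prod Mfd.line) (Z := Mfd.vec K.E) (g := b)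
        (f := fun z => (χ.symm z.1.1, z.1.2)) z (hWs _ hz2) (h1.prodMk h2)
    let L : K.E →L[ℝ] K.E := der (X := K.toMfd) (Y := Mfd.vec K.E) φ 1
    have hlin : ContDiff ℝ ∞ L := ContinuousLinearMap.contDiff L
    exact hD.clm_apply (hlin.contDiffAt.comp z (smAt_vec.1 h3))
  obtain ⟨r, hr, Φ, hΦ, hΦ'⟩ := exists_flow hU hV hy₀
  let ι : X → T := fun x => ((χ x, ⟨s₀⟩), φ 1)
  let N : Set X := χ.source ∩ χ ⁻¹' (Metric.ball (χ x₀) r)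
  have hN : IsOpen N := (continuousOn_extChartAt x₀).isOpen_inter_preimage
    (isOpen_extChartAt_source x₀) Metric.isOpen_ball
  have hι : ∀ x ∈ N, ι x ∈ Metric.ball y₀ r := fun x hx => by
    have h := hx.2
    rw [Set.mem_preimage, Metric.mem_ball] at h
    rw [Metric.mem_ball, Prod.dist_eq, Prod.dist_eq]
    refine max_lt (max_lt h ?_) ?_
    · rw [dist_self]; exact hr
    · rw [dist_self]; exact hr
  -- The adjoined components have the constant velocity `v` and are therefore explicit, so that `b`
  -- is evaluated at the intended point `(x, s)`.
  have hfst : ∀ y ∈ Metric.ball y₀ r, ∀ t ∈ Set.Ioo (-r) r, (Φ (t, y)).1 = y.1 + t • v := by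
    intro y hy t ht
    have hd : ∀ τ ∈ Set.Ioo (-r) r, HasDerivAt (fun τ => (Φ (τ, y)).1 - τ • v) 0 τ := by
      intro τ hτ
      have h1 : HasDerivAt (fun τ => (Φ (τ, y)).1 - τ • v) ((V (Φ (τ, y))).1 - (1 : ℝ) • v) τ :=
        ((ContinuousLinearMap.fst ℝ (X.E × ULift.{u} ℝ) K.E).hasFDerivAt.comp_hasDerivAt τ
          ((hΦ' y hy).2 τ hτ).2).sub ((hasDerivAt_id τ).smul_const v)
      have h2 : ((V (Φ (τ, y))).1 : X.E × ULift.{u} ℝ) - (1 : ℝ) • v = 0 := by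
        rw [one_smul]; exact sub_self v
      exact h2 ▸ h1
    have h0 : (0 : ℝ) ∈ Set.Ioo (-r) r := ⟨by linarith, hr⟩
    have h2 := isOpen_Ioo.is_const_of_deriv_eq_zero isPreconnected_Ioo
      (fun τ hτ => (hd τ hτ).differentiableAt.differentiableWithinAt)
      (fun τ hτ => (hd τ hτ).deriv) ht h0
    simp only [zero_smul, sub_zero, (hΦ' y hy).1] at h2
    rw [← h2]; abel
  refine ⟨N, r, fun z => φ.symm (Φ (z.2.down - s₀, ι z.1)).2, hN,
    ⟨hx₀s, Metric.mem_ball_self hr⟩, hr, fun x hx s hs => ?_⟩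
  have hst : s.down - s₀ ∈ Set.Ioo (-r) r := abs_lt.1 hs
  obtain ⟨hmem, hder⟩ := (hΦ' _ (hι x hx)).2 _ hst
  have hκ : (Φ (s.down - s₀, ι x)).2 ∈ φ.target := hmem.2
  have hfirst := hfst _ (hι x hx) _ hst
  constructor
  · have h1 : SmAt (X.prod Mfd.line) (Mfd.vec X.E) (fun z => χ z.1) (x, s) :=
      SmAt.comp (X := X.prod Mfd.line) (Y := X) (Z := Mfd.vec X.E) (g := χ) (f := Prod.fst) (x, s)
        (smAt_chart x₀ hx.1) contMDiffAt_fst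
    have hdown : ContDiff ℝ ∞ (fun t : ULift.{u} ℝ => t.down) :=
      (ContinuousLinearEquiv.ulift (R₁ := ℝ) (M₁ := ℝ)).contDiff
    have h2 : ContMDiffAt (X.I.prod 𝓘(ℝ, ULift.{u} ℝ)) 𝓘(ℝ, ℝ) ∞
        (fun z : X × Mfd.line.{u} => z.2.down - s₀) (x, s) :=
      ContMDiffAt.comp (x, s) (g := fun t : ULift.{u} ℝ => t.down - s₀)
        (hdown.sub contDiff_const).contMDiff.contMDiffAt contMDiffAt_snd
    have h3 : ContMDiffAt (X.I.prod 𝓘(ℝ, ULift.{u} ℝ)) 𝓘(ℝ, T) ∞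
        (fun z : X × Mfd.line.{u} => ι z.1) (x, s) :=
      (h1.prodMk_space contMDiffAt_const).prodMk_space contMDiffAt_const
    have h4 : ContMDiffAt (X.I.prod 𝓘(ℝ, ULift.{u} ℝ)) 𝓘(ℝ, K.E) ∞
        (fun z : X × Mfd.line.{u} => (Φ (z.2.down - s₀, ι z.1)).2) (x, s) :=
      ContMDiffAt.comp (x, s) (g := fun z => (Φ z).2)
        (hΦ _ ⟨hst, hι x hx⟩).snd.contMDiffAt (h2.prodMk_space h3)
    exact SmAt.comp (X := X.prod Mfd.line) (Y := Mfd.vec K.E) (Z := K.toMfd) (g := φ.symm) (x, s)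
      (smAt_chart_symm (X := K.toMfd) (1 : K) hκ) h4
  · have hb1 : (χ.symm (Φ (s.down - s₀, ι x)).1.1, (Φ (s.down - s₀, ι x)).1.2) = (x, s) := by
      rw [hfirst]
      refine Prod.ext ?_ ?_
      · change χ.symm (χ x + (s.down - s₀) • (0 : X.E)) = x
        rw [smul_zero, add_zero, χ.left_inv hx.1]
      · refine ULift.ext _ _ ?_
        change s₀ + (s.down - s₀) * 1 = s.down
        ring
    have h1 : HasDerivAt (fun t => (Φ (t - s₀, ι x)).2)
        (chartLeft K (Φ (s.down - s₀, ι x)).2 (b (x, s))) s.down := by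
      have h2 := (ContinuousLinearMap.snd ℝ (X.E × ULift.{u} ℝ) K.E).hasFDerivAt.comp_hasDerivAt _
        hder
      have h3 := h2.scomp s.down ((hasDerivAt_id s.down).sub_const s₀)
      rw [one_smul] at h3
      rw [← hb1]
      exact h3
    obtain ⟨h2, h3⟩ := der_line_of_hasDerivAt h1
    have h4 := der_comp_at (X := Mfd.line) (Y := Mfd.vec K.E) (Z := K.toMfd) (g := φ.symm)
      (f := fun t => (Φ (t.down - s₀, ι x)).2) s
      (smAt_chart_symm (X := K.toMfd) (1 : K) hκ).diff h2 oneL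
    rw [h3] at h4
    exact (congrArg (K.mc _) h4).trans (mc_chartLeft hκ _)

end LieFlow

/-! ### The comparison of the values of a morphism with its value at `(0, id_M)` -/

section Comparison

variable {G : LieGrp.{u}} {M : Mfd.{u}} {a : LeftAction G M} {K : LieGrp.{u}}

theorem Mor.hom_congr (T : Mor (DiffActGpd a) (B K)) {X Y : Mfd.{u}} {f f' : Map X Y}
    {p : (DiffActGpd a).Obj X} {q : (DiffActGpd a).Obj Y} (φ : (DiffActGpd a).Hom f p q)
    (φ' : (DiffActGpd a).Hom f' p q) (hf : f = f') (h : φ.1 = φ'.1) (z : (T.bun p).tot) :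
    (T.hom φ).map z = (T.hom φ').map z := by
  subst hf
  rw [Subtype.ext h]

variable (a) in
/-- The object `(0, m)` over the point. -/
def ptConn (m : M) : (DiffActGpd a).Obj Mfd.pt := (OneForm.zero Mfd.pt G.Lie, Mfd.point m)

/-- The restriction of an object to a point. -/
def ptArr {X : Mfd.{u}} (p : (DiffActGpd a).Obj X) (x : X) :
    (DiffActGpd a).Hom (Mfd.point x) (ptConn a (p.2 x)) p :=
  diffActHom a (form_pt_ext _ _) fun _ => rfl

variable (a) in
/-- The inclusion of a point of `M`. -/
def idArr (m : M) : (DiffActGpd a).Hom (Mfd.point m) (ptConn a m) (idPtConn a) :=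
  diffActHom a (form_pt_ext _ _) fun _ => rfl

theorem idArr_comm (T : Mor (DiffActGpd a) (B K)) {m m' : M}
    (γ : (DiffActGpd a).Hom (Map.id Mfd.pt) (ptConn a m) (ptConn a m'))
    (z : (T.bun (ptConn a m)).tot) :
    (T.hom (idArr a m')).map ((T.hom γ).map z)
      = (T.hom (shiftConn a (γ.1 PUnit.unit))).map ((T.hom (idArr a m)).map z) := by
  refine (T.hom_comp γ _ z).symm.trans (Eq.trans ?_ (T.hom_comp _ (shiftConn a _) z))
  refine T.hom_congr _ _ ?_ ?_ z
  · ext y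
    exact (γ.2.2 y).symm
  · ext y
    exact (one_mul _).trans (mul_one _).symm

/-- The evaluation of bundles on `M //_∇ G` at the universal object. -/
def diffData : EvalData a (idPtConn a) (ptConn a) where
  ptObjs :=
    { reach := fun {X} p x => ⟨p.2 x, ⟨ptArr p x⟩⟩
      connect := fun {X} p x m m' φ φ' => ⟨⟨φ'.1⁻¹ * φ.1, form_pt_ext _ _, fun y => by
        have h1 := φ.2.2 y
        have h2 := φ'.2.2 y
        change a.act ((φ'.1 y)⁻¹ * φ.1 y) _ = _
        rw [a.mul_act, h1]
        refine (congrArg (a.act (φ'.1 y)⁻¹) h2.symm).trans ?_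
        rw [← a.mul_act, inv_mul_cancel, a.one_act]⟩, Subtype.ext (mul_inv_cancel_left φ'.1 φ.1)⟩ }
  arr m := idArr a m
  sh g := shiftConn a g
  comm γ := ⟨γ.1 PUnit.unit, fun _ T z => idArr_comm T γ z⟩

/-- The map of the total spaces from the value of `T` at `(α, f)` to its value at `(0, id_M)`. -/
def comparison (T : Mor (DiffActGpd a) (B K)) {X : Mfd.{u}} (p : (DiffActGpd a).Obj X)
    (z : (T.bun p).tot) : (T.bun (idPtConn a)).tot :=
  (T.hom (idArr a (p.2 ((T.bun p).proj z)))).map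
    ((T.hom (ptArr p ((T.bun p).proj z))).lift PUnit.unit z)

variable (T : Mor (DiffActGpd a) (B K)) {X Y : Mfd.{u}}

theorem comparison_ptArr (p : (DiffActGpd a).Obj X) (x : X) (w : (T.bun (ptConn a (p.2 x))).tot) :
    comparison T p ((T.hom (ptArr p x)).map w) = (T.hom (idArr a (p.2 x))).map w := by
  obtain ⟨q, hq⟩ : ∃ q, q = (T.hom (ptArr p x)).map w := ⟨_, rfl⟩
  have hx : x = (T.bun p).proj q := by rw [hq, (T.hom (ptArr p x)).proj_map]; rfl
  rw [← hq]
  subst hx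
  unfold comparison
  congr 1
  exact (T.hom (ptArr p _)).lift_eq rfl hq.symm

/-- It is enough to look over a point `x`. There `φ` is the constant `φ(x)`, a morphism between
objects with zero form, and `idArr_comm` turns it into the action on the value at `(0, id_M)`. -/
theorem comparison_map {f : Map X Y} {p : (DiffActGpd a).Obj X} {q : (DiffActGpd a).Obj Y}
    (φ : (DiffActGpd a).Hom f p q) (z : (T.bun p).tot) :
    comparison T q ((T.hom φ).map z)
      = (T.hom (shiftConn a (φ.1 ((T.bun p).proj z)))).map (comparison T p z) := by
  obtain ⟨x, hx⟩ : ∃ x, x = (T.bun p).proj z := ⟨_, rfl⟩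
  obtain ⟨w, rfl⟩ : ∃ w, (T.hom (ptArr p x)).map w = z :=
    ⟨_, (T.hom (ptArr p x)).map_lift (x := PUnit.unit) hx.symm⟩
  rw [← hx, comparison_ptArr]
  let γ : (DiffActGpd a).Hom (Map.id Mfd.pt) (ptConn a (p.2 x)) (ptConn a (q.2 (f x))) :=
    ⟨ContMDiffMap.const (φ.1 x), form_pt_ext _ _, fun _ => φ.2.2 x⟩
  have h1 : (T.hom φ).map ((T.hom (ptArr p x)).map w)
      = (T.hom (ptArr q (f x))).map ((T.hom γ).map w) := by
    refine (T.hom_comp (ptArr p x) φ w).symm.trans (Eq.trans ?_ (T.hom_comp γ (ptArr q (f x)) w))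
    refine T.hom_congr _ _ ?_ ?_ w
    · ext y; rfl
    · ext y
      exact (mul_one _).trans (one_mul _).symm
  rw [h1, comparison_ptArr]
  exact idArr_comm T γ w

theorem comparison_id (z : (T.bun (idPtConn a)).tot) : comparison T (idPtConn a) z = z := by
  obtain ⟨w, hw⟩ : ∃ w, (T.hom (ptArr (idPtConn a) ((T.bun (idPtConn a)).proj z))).map w = z :=
    ⟨_, (T.hom (ptArr (idPtConn a) _)).map_lift (x := PUnit.unit) rfl⟩
  conv_lhs => rw [← hw]
  rw [comparison_ptArr]
  exact hw

theorem hom_shiftConn_one (z : (T.bun (idPtConn a)).tot) :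
    (T.hom (shiftConn a 1)).map z = z := by
  refine Eq.trans ?_ (T.hom_id (idPtConn a) z)
  refine T.hom_congr (shiftConn a 1) ((DiffActGpd a).id (idPtConn a)) ?_ rfl z
  ext m
  exact a.one_act m

theorem comparison_map_one {f : Map X Y} {p : (DiffActGpd a).Obj X} {q : (DiffActGpd a).Obj Y}
    (φ : (DiffActGpd a).Hom f p q) (hφ : φ.1 = 1) (z : (T.bun p).tot) :
    comparison T q ((T.hom φ).map z) = comparison T p z := by
  rw [comparison_map, hφ]
  exact hom_shiftConn_one T _

theorem proj_comparison (p : (DiffActGpd a).Obj X) (z : (T.bun p).tot) :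
    (T.bun (idPtConn a)).proj (comparison T p z) = p.2 ((T.bun p).proj z) :=
  (T.hom (idArr a _)).proj_map _

theorem comparison_act (p : (DiffActGpd a).Obj X) (z : (T.bun p).tot) (k : K) :
    comparison T p ((T.bun p).act z k) = (T.bun (idPtConn a)).act (comparison T p z) k := by
  obtain ⟨w, hw⟩ : ∃ w, (T.hom (ptArr p ((T.bun p).proj z))).map w = z :=
    ⟨_, (T.hom (ptArr p _)).map_lift (x := PUnit.unit) rfl⟩
  rw [← hw, ← (T.hom (ptArr p _)).map_act, comparison_ptArr, comparison_ptArr,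
    (T.hom (idArr a _)).map_act]

/-- The morphism to the universal object from an object with vanishing form. -/
def zeroHom (f : Map X M) :
    (DiffActGpd a).Hom f ((OneForm.zero X G.Lie, f) : (DiffActGpd a).Obj X) (idPtConn a) :=
  diffActHom a (by funext x; ext w; rfl) fun _ => rfl

/-- For a vanishing form there is a genuine morphism to the universal object. The comparison is then
smooth and compatible with connections; this is the starting point from which both are obtained in
general. -/
theorem comparison_zero (f : Map X M)
    (z : (T.bun ((OneForm.zero X G.Lie, f) : (DiffActGpd a).Obj X)).tot) :
    comparison T _ z = (T.hom (zeroHom f)).map z := by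
  rw [← comparison_map_one T (zeroHom f) rfl z, comparison_id]

end Comparison

/-! ### Curves in the fibres of a bundle with connection -/

section Curves

variable {K : LieGrp.{u}}

theorem eventually_eq_of_der_eq_zero {Y : Mfd.{u}} {c : Mfd.line.{u} → Y} {s : Mfd.line.{u}}
    (hc : ∀ᶠ t in 𝓝 s, SmAt Mfd.line Y c t ∧ (der (X := Mfd.line) (Y := Y) c t oneL : Y.E) = 0) :
    ∀ᶠ t in 𝓝 s, c t = c s := by
  let φ := extChartAt Y.I (c s)
  have hcs : ContinuousAt c s := hc.self_of_nhds.1.continuousAt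
  have h1 : ∀ᶠ t in 𝓝 s, c t ∈ φ.source :=
    hcs.eventually (extChartAt_source_mem_nhds (I := Y.I) (c s))
  obtain ⟨r, hr, hball⟩ := Metric.eventually_nhds_iff_ball.1 (hc.and h1)
  have h2 : ∀ t ∈ Metric.ball s r, HasFDerivAt (fun t : ULift.{u} ℝ => φ (c t))
      (0 : ULift.{u} ℝ →L[ℝ] Y.E) t := by
    intro t ht
    obtain ⟨⟨h3, h4⟩, h5⟩ := hball t ht
    have h6 := smAt_chart (X := Y) (c s) h5
    have h7 := smAt_vec.1 (SmAt.comp (X := Mfd.line) (Z := Mfd.vec Y.E) (g := φ) t h6 h3)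
    have h8 := (h7.differentiableAt (by simp)).hasFDerivAt
    have h9 := der_comp_at (X := Mfd.line) (Y := Y) (Z := Mfd.vec Y.E) (g := φ) (f := c) t
      h6.diff h3.diff oneL
    rw [h4] at h9
    have h10 : (der (X := Mfd.line) (Y := Mfd.vec Y.E) (fun t => φ (c t)) t oneL : Y.E)
      = fderiv ℝ (fun t : ULift.{u} ℝ => φ (c t)) t oneL := by
      change mfderiv _ _ _ _ _ = _
      rw [mfderiv_eq_fderiv]; rfl
    have h11 : fderiv ℝ (fun t : ULift.{u} ℝ => φ (c t)) t oneL = 0 :=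
      h10.symm.trans (h9.trans (map_zero (der (X := Y) (Y := Mfd.vec Y.E) φ (c t))))
    have h12 : fderiv ℝ (fun t : ULift.{u} ℝ => φ (c t)) t = 0 := by
      refine ContinuousLinearMap.ext fun x : ULift.{u} ℝ => ?_
      have h13 : x = x.down • (oneL : ULift.{u} ℝ) := by
        refine ULift.ext _ _ ?_
        change x.down = x.down * 1
        rw [mul_one]
      rw [h13, map_smul, h11, smul_zero, _root_.zero_apply]
    rwa [h12] at h8
  filter_upwards [Metric.ball_mem_nhds s hr] with t ht
  have h3 := (convex_ball s r).norm_image_sub_le_of_norm_hasFDerivWithin_le (C := 0)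
    (fun t ht => (h2 t ht).hasFDerivWithinAt) (fun _ _ => by simp) (Metric.mem_ball_self hr) ht
  rw [zero_mul, norm_le_zero_iff, sub_eq_zero] at h3
  exact φ.injOn (hball t ht).2 (hball s (Metric.mem_ball_self hr)).2 h3

theorem eq_of_locally_eq {Y : Type*} {c : Mfd.line.{u} → Y} {s₀ ε : ℝ}
    (h : ∀ s : Mfd.line.{u}, |s.down - s₀| < ε → ∀ᶠ t in 𝓝 s, c t = c s) {s t : Mfd.line.{u}}
    (hs : |s.down - s₀| < ε) (ht : |t.down - s₀| < ε) : c s = c t := by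
  let I : Set ℝ := Metric.ball s₀ ε
  have hI : _root_.IsPreconnected I := (convex_ball s₀ ε).isPreconnected
  have : PreconnectedSpace I := Subtype.preconnectedSpace hI
  let c' : I → Y := fun t => c ⟨t⟩
  have hc : IsLocallyConstant c' := by
    refine (IsLocallyConstant.iff_eventually_eq c').2 fun t => ?_
    have h1 : Continuous fun t : I => (⟨t⟩ : Mfd.line.{u}) :=
      continuous_uliftUp.comp continuous_subtype_val
    have h2 : |(⟨t⟩ : Mfd.line.{u}).down - s₀| < ε := t.2
    exact h1.continuousAt.eventually (h ⟨t⟩ h2)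
  exact hc.apply_eq_of_preconnectedSpace ⟨s.down, hs⟩ ⟨t.down, ht⟩

/-- A horizontal curve in a fibre is constant. -/
theorem Connection.eventually_eq_of_horizontal {X : Mfd.{u}} {P : PrinBundle K X}
    (Θ : Connection P) {c : Mfd.line.{u} → P.tot} {s : Mfd.line.{u}}
    (hc : ∀ᶠ t in 𝓝 s, SmAt Mfd.line P.tot c t ∧
      Θ.val (c t) (der (X := Mfd.line) (Y := P.tot) c t oneL) = 0 ∧
      P.proj (c t) = P.proj (c s)) :
    ∀ᶠ t in 𝓝 s, c t = c s := by
  -- Inside the fibre `c(t) = c(s) k(t)`, so the connection form on the velocity is the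
  -- Maurer-Cartan form of `k`. Horizontality makes the derivative of `k` vanish.
  let k : Mfd.line.{u} → K := fun t => P.div (c s) (c t)
  have hk : ∀ᶠ t in 𝓝 s, SmAt Mfd.line K.toMfd k t ∧
      (der (X := Mfd.line) (Y := K.toMfd) k t oneL : K.E) = 0 := by
    filter_upwards [hc.eventually_nhds] with t ht
    have h1 : SmAt Mfd.line K.toMfd k t :=
      P.smAt_div (Y := Mfd.line.{u}) (b := fun _ => c s)
        (smAt_const (X := Mfd.line.{u}) (c s) t) ht.self_of_nhds.1 (ht.mono fun _ h => h.2.2.symm)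
    refine ⟨h1, mc_injective (k t) ?_⟩
    have h2 := Θ.val_der_act (p := fun _ : Mfd.line.{u} => c s) (smAt_const _ t).diff h1.diff oneL
    have h3 : (fun t => P.act (c s) (k t)) =ᶠ[𝓝 t] c :=
      ht.mono fun t' h => P.act_div h.2.2.symm
    have h4 : P.act (c s) (k t) = c t := h3.self_of_nhds
    have h5 : (der (X := Mfd.line) (Y := P.tot) (fun t => P.act (c s) (k t)) t oneL : P.tot.E)
        = der (X := Mfd.line) (Y := P.tot) c t oneL := der_congr (X := Mfd.line) (Y := P.tot) h3 oneL
    have h6 : Θ.val (P.act (c s) (k t))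
        (der (X := Mfd.line) (Y := P.tot) (fun t => P.act (c s) (k t)) t oneL) = 0 := by
      refine (congrArg (Θ.val (P.act (c s) (k t))) h5).trans ?_
      exact (Θ.toOneForm.val_congr h4 _).trans ht.self_of_nhds.2.1
    rw [h6] at h2
    have h7 : (der (X := Mfd.line) (Y := P.tot) (fun _ => c s) t oneL : P.tot.E) = 0 :=
      der_const (X := Mfd.line.{u}) (c s) t oneL
    have h8 : Θ.val (c s) (der (X := Mfd.line) (Y := P.tot) (fun _ => c s) t oneL) = 0 :=
      (congrArg (Θ.val (c s)) h7).trans (map_zero _)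
    rw [h8, map_zero, zero_add] at h2
    exact h2.symm
  filter_upwards [eventually_eq_of_der_eq_zero hk, hc] with t h1 h2
  have h3 : k s = 1 := P.div_eq (P.act_one _)
  have h4 := P.act_div h2.2.2.symm
  change P.act (c s) (k t) = c t at h4
  rw [← h4, h1, h3, P.act_one]

/-- The function is the pullback of `Θ` by `σ` evaluated on the smooth section `(0, ∂_t)` of the
tangent bundle of `X × ℝ`. -/
theorem smAt_val_der_snd {X : Mfd.{u}} {P : PrinBundle K (X.prod Mfd.line)} (Θ : Connection P)
    {σ : X × Mfd.line.{u} → P.tot} {z : X × Mfd.line.{u}}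
    (hσ : ∀ᶠ z' in 𝓝 z, SmAt (X.prod Mfd.line) P.tot σ z') :
    SmAt (X.prod Mfd.line) (Mfd.vec K.E) (fun z => Θ.val (σ z)
      (der (X := Mfd.line) (Y := P.tot) (fun t => σ (z.1, t)) z.2 oneL)) z := by
  obtain ⟨U, hU, hUo, hz⟩ := eventually_nhds_iff.1 hσ
  have h1 := contMDiffOn_pull (X := X.prod Mfd.line) Θ.toOneForm hUo
    (f := σ) fun z hz => (hU z hz).contMDiffWithinAt
  have h0 : ContMDiff (X.I.prod 𝓘(ℝ, ULift.{u} ℝ)) X.I.tangent ∞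
      (fun z : X × Mfd.line.{u} => (⟨z.1, 0⟩ : TangentBundle X.I X)) :=
    (Bundle.contMDiff_zeroSection ℝ (TangentSpace X.I : X → Type _)).comp contMDiff_fst
  have h2 : ContMDiff (X.I.prod 𝓘(ℝ, ULift.{u} ℝ)) 𝓘(ℝ, ULift.{u} ℝ).tangent ∞
      (fun z : X × Mfd.line.{u} =>
        (⟨z.2, oneL⟩ : TangentBundle 𝓘(ℝ, ULift.{u} ℝ) (ULift.{u} ℝ))) := by
    intro z
    refine Bundle.contMDiffAt_totalSpace.2 ⟨contMDiffAt_snd, ?_⟩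
    refine (contMDiffAt_const (c := (oneL : ULift.{u} ℝ))).congr_of_eventuallyEq
      (Filter.Eventually.of_forall fun s => ?_)
    simp
  have h3 := (contMDiff_equivTangentBundleProd_symm (I := X.I) (M := X)
    (I' := 𝓘(ℝ, ULift.{u} ℝ)) (M' := ULift.{u} ℝ)).comp (h0.prodMk h2)
  have hp : Continuous (fun w : TangentBundle (X.prod Mfd.line).I (X.prod Mfd.line) => w.proj) :=
    (Bundle.contMDiff_proj (n := ∞) (IB := (X.prod Mfd.line).I)
      (TangentSpace (X.prod Mfd.line).I : X.prod Mfd.line → Type _)).continuous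
  have h4 := ContMDiffAt.comp z (h1.contMDiffAt ((hUo.preimage hp).mem_nhds hz)) (h3 z)
  refine h4.congr_of_eventuallyEq ?_
  filter_upwards [hUo.mem_nhds hz] with z' hz'
  have h5 := der_comp_at (X := Mfd.line) (Y := X.prod Mfd.line) (Z := P.tot) (g := σ)
    (f := fun t => (z'.1, t)) z'.2 (hU z' hz').diff
    (diffAt_prodMk (smAt_const _ _).diff (smAt_id _).diff) oneL
  have h6 := der_prodMk (X := Mfd.line) (Y := X) (Z := Mfd.line) (f := fun _ => z'.1)
    (g := fun t => t) (x := z'.2) (smAt_const _ _).diff (smAt_id _).diff oneL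
  have h7 := h6.trans (congrArg₂ Prod.mk (der_const (X := Mfd.line) z'.1 z'.2 oneL)
    (der_id (X := Mfd.line) z'.2 oneL))
  rw [h7] at h5
  exact congrArg (Θ.val (σ z')) h5

end Curves

/-! ### Smoothness of the comparison -/

section SmoothComparison

variable {G : LieGrp.{u}} {M : Mfd.{u}} {a : LeftAction G M} {K : LieGrp.{u}}

theorem Connection.Pres.val_der {X X' Y : Mfd.{u}} {P : PrinBundle K X} {P' : PrinBundle K X'}
    {Θ : Connection P} {Θ' : Connection P'} {φ : Map P.tot P'.tot} (h : Θ.Pres Θ' φ)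
    {b : Y → P.tot} {y : Y} (hb : DiffAt Y P.tot b y) (w : Y.T y) :
    Θ'.val (φ (b y)) (der (X := Y) (Y := P'.tot) (fun y => φ (b y)) y w)
      = Θ.val (b y) (der (X := Y) (Y := P.tot) b y w) := by
  have h1 := der_comp_at (X := Y) (Y := P.tot) (Z := P'.tot) (g := φ) (f := b) y (φ.mdiff _) hb w
  refine (congrArg (Θ'.val (φ (b y))) h1).trans ?_
  exact congrArg (fun β : ∀ p, P.tot.T p →L[ℝ] K.Lie =>
    β (b y) (der (X := Y) (Y := P.tot) b y w)) h

/-- The bundles underlying bundles with connection. -/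
abbrev Mor.und {A : OverMan.{u, v}} (S : Mor A (BConn K)) : Mor A (B K) := S.comp (forgetConn K)

/-- The connection on the value at an object. -/
def Mor.connOf {A : OverMan.{u, v}} (S : Mor A (BConn K)) {X : Mfd.{u}} (P : A.Obj X) :
    Connection (S.und.bun P) := BunConn.conn (S.obj P)

theorem Mor.pres {A : OverMan.{u, v}} (S : Mor A (BConn K)) {X Y : Mfd.{u}} {f : Map X Y}
    {P : A.Obj X} {P' : A.Obj Y} (φ : A.Hom f P P') :
    (S.connOf P).Pres (S.connOf P') (S.und.hom φ).map :=
  ConnHom.pres (S.map φ)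

/-- The projection `X × ℝ → X`. -/
def lineFst (X : Mfd.{u}) : Map (X.prod Mfd.line) X := ContMDiffMap.fst

/-- The form `s α` on `X × ℝ`. -/
def OneForm.scaled {X : Mfd.{u}} {V : Type u} [NormedAddCommGroup V] [NormedSpace ℝ V]
    (α : OneForm X V) : OneForm (X.prod Mfd.line) V where
  val z := z.2.down • EquivBun.pull (lineFst X) α.val z
  smooth := by
    have h1 : ContDiff ℝ ∞ (fun t : ULift.{u} ℝ => t.down) :=
      (ContinuousLinearEquiv.ulift (R₁ := ℝ) (M₁ := ℝ)).contDiff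
    have h2 : ContMDiff (X.prod Mfd.line.{u}).I.tangent (X.prod Mfd.line.{u}).I ∞
        (fun w : TangentBundle (X.prod Mfd.line.{u}).I (X.prod Mfd.line.{u}) => w.proj) :=
      Bundle.contMDiff_proj _
    exact ContMDiff.smul (f := fun w : TangentBundle (X.prod Mfd.line.{u}).I _ => w.proj.2.down)
      (h1.contMDiff.comp (contMDiff_snd.comp h2)) (α.pull (lineFst X)).smooth

variable {X : Mfd.{u}}

/-- The object `(s α, f)` over `X × ℝ`. -/
def cylinder (p : (DiffActGpd a).Obj X) : (DiffActGpd a).Obj (X.prod Mfd.line) :=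
  (p.1.scaled, p.2.comp (lineFst X))

/-- The inclusion of a slice. -/
def slice (X : Mfd.{u}) (s : ℝ) : Map X (X.prod Mfd.line) :=
  ⟨fun x => (x, ⟨s⟩), contMDiff_id.prodMk contMDiff_const⟩

/-- The inclusion of a line. -/
def fibreLine (x : X) : Map Mfd.line (X.prod Mfd.line) :=
  ⟨fun s => (x, s), contMDiff_const.prodMk contMDiff_id⟩

theorem scaled_slice {V : Type u} [NormedAddCommGroup V] [NormedSpace ℝ V] (α : OneForm X V)
    (s : ℝ) : pull (slice X s) α.scaled.val = fun x => s • α.val x := by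
  have h : pull (slice X s) (pull (lineFst X) α.val) = α.val := by
    rw [pull_pull]
    exact pull_id α.val
  funext x
  ext w
  have h2 := congrArg (fun β : ∀ x, X.T x →L[ℝ] V => s • β x w) h
  exact h2

/-- The inclusion of the slice at `1`. -/
def sliceOne (p : (DiffActGpd a).Obj X) : (DiffActGpd a).Hom (slice X 1) p (cylinder p) :=
  diffActHom a (by
    refine Eq.trans ?_ (scaled_slice p.1 1).symm
    funext x
    exact (one_smul ℝ (p.1.val x)).symm) fun _ => rfl

/-- The inclusion of the slice at `0`. -/
def sliceZero (p : (DiffActGpd a).Obj X) :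
    (DiffActGpd a).Hom (slice X 0) ((OneForm.zero X G.Lie, p.2) : (DiffActGpd a).Obj X)
      (cylinder p) :=
  diffActHom a (by
    refine Eq.trans ?_ (scaled_slice p.1 0).symm
    funext x
    exact (zero_smul ℝ (p.1.val x)).symm) fun _ => rfl

/-- The inclusion of the line over a point. -/
def fibreHom (p : (DiffActGpd a).Obj X) (x : X) :
    (DiffActGpd a).Hom (fibreLine x)
      ((OneForm.zero Mfd.line G.Lie, ContMDiffMap.const (p.2 x)) : (DiffActGpd a).Obj Mfd.line)
      (cylinder p) :=
  diffActHom a (by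
    have h : pull (fibreLine x) (pull (lineFst X) p.1.val)
        = fun _ => 0 := by
      rw [pull_pull]
      funext t
      ext w
      have h0 : der (X := Mfd.line) (Y := X) (fun _ => x) t w = 0 := der_const x t w
      exact (congrArg (p.1.val x) h0).trans (map_zero _)
    funext t
    ext w
    have h2 := congrArg (fun β : ∀ x, Mfd.line.{u}.T x →L[ℝ] G.Lie => t.down • β t w) h
    refine Eq.trans ?_ h2.symm
    exact (smul_zero t.down).symm) fun _ => rfl

variable (S : Mor (DiffActGpd a) (BConn K))

/-- On the line over `x` the form `s α` pulls back to zero, since the projection to `X` is constant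
there. The comparison is therefore induced by morphisms of bundles with connection, and takes a
horizontal lift of the line to a horizontal curve in the single fibre over `f(x)`. Such a curve is
constant. -/
theorem comparison_eq_of_horizontal (p : (DiffActGpd a).Obj X) (x : X)
    {h : Mfd.line.{u} → (S.und.bun (cylinder p)).tot} {s₀ ε : ℝ}
    (hh : ∀ s : Mfd.line.{u}, |s.down - s₀| < ε →
      SmAt Mfd.line (S.und.bun (cylinder p)).tot h s ∧
      (S.connOf (cylinder p)).val (h s)
        (der (X := Mfd.line) (Y := (S.und.bun (cylinder p)).tot) h s oneL) = 0 ∧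
      (S.und.bun (cylinder p)).proj (h s) = (x, s)) {s t : Mfd.line.{u}}
    (hs : |s.down - s₀| < ε) (ht : |t.down - s₀| < ε) :
    comparison S.und (cylinder p) (h s) = comparison S.und (cylinder p) (h t) := by
  refine eq_of_locally_eq (c := fun s => comparison S.und (cylinder p) (h s)) (fun s hs => ?_) hs ht
  let φ := S.und.hom (fibreHom p x)
  let χ := S.und.hom (zeroHom (a := a) (ContMDiffMap.const (p.2 x) : Map Mfd.line M))
  have hev : ∀ {s : Mfd.line.{u}}, |s.down - s₀| < ε →
      ∀ᶠ t in 𝓝 s, |t.down - s₀| < ε := fun {s} hs =>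
    (isOpen_lt ((continuous_uliftDown.sub continuous_const).abs) continuous_const).mem_nhds hs
  let y : Mfd.line.{u} → (S.und.bun _).tot := fun t => φ.lift t (h t)
  have hφy : ∀ t : Mfd.line.{u}, |t.down - s₀| < ε → φ.map (y t) = h t := fun t ht =>
    φ.map_lift (hh t ht).2.2
  have hy : ∀ t : Mfd.line.{u}, |t.down - s₀| < ε → SmAt Mfd.line (S.und.bun _).tot y t :=
    fun t ht => φ.smAt_lift (Z := Mfd.line.{u}) (smAt_id t) (hh t ht).1
      ((hev ht).mono fun t ht => (hh t ht).2.2)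
  have hc : ∀ t : Mfd.line.{u}, |t.down - s₀| < ε →
      comparison S.und (cylinder p) (h t) = χ.map (y t) := fun t ht => by
    rw [← hφy t ht]
    exact (comparison_map_one S.und (fibreHom p x) rfl (y t)).trans (comparison_zero S.und _ _)
  have key : ∀ᶠ t in 𝓝 s, χ.map (y t) = χ.map (y s) := by
    refine (S.connOf (idPtConn a)).eventually_eq_of_horizontal ?_
    filter_upwards [(hev hs).eventually_nhds] with t ht
    have ht' := ht.self_of_nhds
    refine ⟨SmAt.comp (X := Mfd.line) t (χ.map.smAt _) (hy t ht'), ?_, ?_⟩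
    · refine ((S.pres (zeroHom _)).val_der (hy t ht').diff oneL).trans ?_
      refine ((S.pres (fibreHom p x)).val_der (hy t ht').diff oneL).symm.trans ?_
      have h1 : (der (X := Mfd.line) (Y := (S.und.bun (cylinder p)).tot)
          (fun t => φ.map (y t)) t oneL : (S.und.bun (cylinder p)).tot.E)
          = der (X := Mfd.line) (Y := (S.und.bun (cylinder p)).tot) h t oneL :=
        der_congr (X := Mfd.line) (Y := (S.und.bun (cylinder p)).tot)
          (ht.mono fun t ht => hφy t ht) oneL
      refine (congrArg ((S.connOf (cylinder p)).val (φ.map (y t))) h1).trans ?_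
      exact ((S.connOf (cylinder p)).toOneForm.val_congr (hφy t ht') _).trans (hh t ht').2.1
    · rw [χ.proj_map, χ.proj_map]; rfl
  filter_upwards [key, hev hs] with t h1 h2
  rw [hc t h2, hc s hs, h1]

/-- Near every point of `X × ℝ` there are sections which are horizontal in the direction of `ℝ`. -/
theorem exists_horizontal {X : Mfd.{u}} {P : PrinBundle K (X.prod Mfd.line)} (Θ : Connection P)
    (x₀ : X) (s₀ : ℝ) :
    ∃ (N : Set X) (ε : ℝ) (h : X × Mfd.line.{u} → P.tot), IsOpen N ∧ x₀ ∈ N ∧ 0 < ε ∧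
      ∀ x ∈ N, ∀ s : Mfd.line.{u}, |s.down - s₀| < ε →
        SmAt (X.prod Mfd.line) P.tot h (x, s) ∧
        Θ.val (h (x, s)) (der (X := Mfd.line) (Y := P.tot) (fun t => h (x, t)) s oneL) = 0 ∧
        P.proj (h (x, s)) = (x, s) := by
  obtain ⟨σ, hσ⟩ := P.exists_locSec (x₀, ⟨s₀⟩)
  have hev : ∀ᶠ z in 𝓝 ((x₀, ⟨s₀⟩) : X × Mfd.line.{u}), z ∈ σ.U := σ.U.isOpen.mem_nhds hσ
  obtain ⟨N, ε, l, hN, hx₀, hε, hl⟩ := exists_lie_flow (K := K) (X := X) (x₀ := x₀) (s₀ := s₀)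
    (b := fun z => Θ.val (σ.s z) (der (X := Mfd.line) (Y := P.tot) (fun t => σ.s (z.1, t)) z.2 oneL))
    (hev.eventually_nhds.mono fun z hz => smAt_val_der_snd Θ (hz.mono fun z hz => σ.smooth_s z hz))
  obtain ⟨N₁, hN₁, N₂, hN₂, hsub⟩ := mem_nhds_prod_iff.1 hev
  obtain ⟨N₁', hN₁', hN₁o, hx₁⟩ := mem_nhds_iff.1 hN₁
  obtain ⟨r, hr, hball⟩ := Metric.mem_nhds_iff.1 hN₂
  -- Since `l⁻¹ ∂_s l = b = Θ(∂_s σ)`, the connection form on the derivative of `σ l⁻¹` is `Ad_l b -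
  -- Ad_l b = 0`.
  refine ⟨N ∩ N₁', min ε r, fun z => P.act (σ.s z) (l z)⁻¹, hN.inter hN₁o, ⟨hx₀, hx₁⟩,
    lt_min hε hr, fun x hx s hs => ?_⟩
  have hU : (x, s) ∈ σ.U := hsub ⟨hN₁' hx.2, hball (show dist s.down s₀ < r from
    lt_of_lt_of_le hs (min_le_right _ _))⟩
  obtain ⟨h1, h2⟩ := hl x hx.1 s (lt_of_lt_of_le hs (min_le_left _ _))
  have hσs := σ.smooth_s _ hU
  have hline : SmAt Mfd.line (X.prod Mfd.line) (fun t => (x, t)) s :=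
    SmAt.prodMk (smAt_const x s) (smAt_id s)
  have hσ' : SmAt Mfd.line P.tot (fun t => σ.s (x, t)) s := SmAt.comp (Y := X.prod Mfd.line) s hσs hline
  have hl' : SmAt Mfd.line K.toMfd (fun t => l (x, t)) s := SmAt.comp (Y := X.prod Mfd.line) s h1 hline
  have hli : SmAt Mfd.line K.toMfd (fun t => (l (x, t))⁻¹) s := ContMDiffAt.inv hl'
  refine ⟨P.smAt_act (Y := X.prod Mfd.line) hσs (ContMDiffAt.inv h1), ?_, ?_⟩
  · refine (Θ.val_der_act hσ'.diff hli.diff oneL).trans ?_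
    rw [mc_inv hl' oneL, h2, inv_inv]
    exact add_neg_cancel _
  · rw [P.proj_act, σ.proj_s _ hU]

/-- For fixed `x₀`, the set of parameters `s` at which the comparison is smooth along all local
sections of the slice is open and closed in `ℝ` and contains `0`. Transport along horizontal
sections relates nearby parameters in both directions. -/
theorem smAt_comparison_cylinder (p : (DiffActGpd a).Obj X) (x₀ : X) (s : ℝ) :
    ∀ h : X → (S.und.bun (cylinder p)).tot, SmAt X (S.und.bun (cylinder p)).tot h x₀ →
      (∀ᶠ x in 𝓝 x₀, (S.und.bun (cylinder p)).proj (h x) = (x, ⟨s⟩)) →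
      SmAt X (S.und.bun (idPtConn a)).tot (fun x => comparison S.und (cylinder p) (h x)) x₀ := by
  let E := S.und.bun (cylinder p)
  let Q := S.und.bun (idPtConn a)
  let A : Set ℝ := {s | ∀ h : X → E.tot, SmAt X E.tot h x₀ →
    (∀ᶠ x in 𝓝 x₀, E.proj (h x) = (x, ⟨s⟩)) →
    SmAt X Q.tot (fun x => comparison S.und (cylinder p) (h x)) x₀}
  -- The comparison of `η(x, s)` does not depend on `s` near `s₀`. A local section over the slice at
  -- `s₂` is `η(·, s₂)` times a smooth function to `K`, so its comparison is the one of `η(·, s₁)`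
  -- times the same function.
  have key : ∀ s₀ : ℝ, ∃ ε > 0, ∀ s₁ ∈ Metric.ball s₀ ε, ∀ s₂ ∈ Metric.ball s₀ ε,
      s₁ ∈ A → s₂ ∈ A := by
    intro s₀
    obtain ⟨N, ε, η, hN, hx₀, hε, hη⟩ := exists_horizontal (S.connOf (cylinder p)) x₀ s₀
    refine ⟨ε, hε, fun s₁ hs₁ s₂ hs₂ h₁ h hh hp => ?_⟩
    have hη' : ∀ s ∈ Metric.ball s₀ ε, SmAt X E.tot (fun x => η (x, ⟨s⟩)) x₀ := fun s hs =>
      SmAt.comp (Y := X.prod Mfd.line) (f := slice X s) x₀ (hη x₀ hx₀ ⟨s⟩ hs).1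
        ((slice X s).smAt x₀)
    have hNx : ∀ᶠ x in 𝓝 x₀, x ∈ N := hN.mem_nhds hx₀
    have h2 : SmAt X Q.tot (fun x => comparison S.und (cylinder p) (η (x, ⟨s₁⟩))) x₀ :=
      h₁ _ (hη' s₁ hs₁) (hNx.mono fun x hx => (hη x hx ⟨s₁⟩ hs₁).2.2)
    have hpp : ∀ᶠ x in 𝓝 x₀, E.proj (η (x, ⟨s₂⟩)) = E.proj (h x) := by
      filter_upwards [hNx, hp] with x hx hp
      exact (hη x hx ⟨s₂⟩ hs₂).2.2.trans hp.symm
    have h3 : SmAt X K.toMfd (fun x => E.div (η (x, ⟨s₂⟩)) (h x)) x₀ :=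
      E.smAt_div (hη' s₂ hs₂) hh hpp
    refine (Q.smAt_act h2 h3).congr ?_
    filter_upwards [hNx, hpp] with x hx hpx
    have hd : ∀ s : Mfd.line.{u}, |s.down - s₀| < ε →
        SmAt Mfd.line E.tot (fun t => η (x, t)) s ∧
        (S.connOf (cylinder p)).val (η (x, s))
          (der (X := Mfd.line) (Y := E.tot) (fun t => η (x, t)) s oneL) = 0 ∧
        E.proj (η (x, s)) = (x, s) := fun s hs =>
      ⟨SmAt.comp (Y := X.prod Mfd.line) (f := fibreLine x) s (hη x hx s hs).1
        ((fibreLine x).smAt s), (hη x hx s hs).2⟩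
    have h4 := comparison_eq_of_horizontal S p x hd (s := ⟨s₁⟩) (t := ⟨s₂⟩) hs₁ hs₂
    change _ = Q.act (comparison S.und (cylinder p) (η (x, ⟨s₁⟩))) _
    rw [h4]
    refine Eq.trans ?_ (comparison_act S.und (cylinder p) _ _)
    rw [E.act_div hpx]
  -- The slice at `0` carries the zero form, where the comparison is a bundle morphism.
  have h0 : (0 : ℝ) ∈ A := by
    intro h hh hp
    let φ := S.und.hom (sliceZero p)
    have h1 : SmAt X (S.und.bun _).tot (fun x => φ.lift x (h x)) x₀ :=
      φ.smAt_lift (smAt_id x₀) hh hp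
    have h2 : SmAt X Q.tot (fun x => (S.und.hom (zeroHom (a := a) p.2)).map (φ.lift x (h x))) x₀ :=
      SmAt.comp x₀ ((S.und.hom (zeroHom (a := a) p.2)).map.smAt _) h1
    refine h2.congr ?_
    filter_upwards [hp] with x hx
    have h3 : φ.map (φ.lift x (h x)) = h x := φ.map_lift hx
    conv_lhs => rw [← h3]
    exact (comparison_map_one S.und (sliceZero p) rfl _).trans (comparison_zero S.und _ _)
  have hclopen : IsClopen A := by
    constructor
    · refine ⟨Metric.isOpen_iff.2 fun s hs => ?_⟩
      obtain ⟨ε, hε, h⟩ := key s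
      exact ⟨ε, hε, fun t ht ht' => hs (h t ht s (Metric.mem_ball_self hε) ht')⟩
    · refine Metric.isOpen_iff.2 fun s hs => ?_
      obtain ⟨ε, hε, h⟩ := key s
      exact ⟨ε, hε, fun t ht => h s (Metric.mem_ball_self hε) t ht hs⟩
  have : s ∈ A := by
    rw [hclopen.eq_univ ⟨0, h0⟩]; trivial
  exact this

/-- The object `(α, f)` is the slice at `1` of its cylinder, and by equivariance it suffices to test
on a local section. -/
theorem smooth_comparison (p : (DiffActGpd a).Obj X) :
    Sm (S.und.bun p).tot (S.und.bun (idPtConn a)).tot (comparison S.und p) := by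
  intro z
  obtain ⟨σ, hσ⟩ := (S.und.bun p).exists_locSec ((S.und.bun p).proj z)
  refine (S.und.bun p).smAt_of_equivariant _ (S.und.bun (idPtConn a)).smooth_act
    (comparison_act S.und p) σ hσ ?_
  have h1 := smAt_comparison_cylinder S p ((S.und.bun p).proj z) 1
    (fun x => (S.und.hom (sliceOne p)).map (σ.s x))
    (SmAt.comp _ ((S.und.hom (sliceOne p)).map.smAt _) (σ.smooth_s _ hσ)) (by
      filter_upwards [σ.U.isOpen.mem_nhds hσ] with x hx
      rw [(S.und.hom (sliceOne p)).proj_map, σ.proj_s x hx]; rfl)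
  refine h1.congr (Filter.Eventually.of_forall fun x => ?_)
  exact (comparison_map_one S.und (sliceOne p) rfl _).symm

/-- The comparison as a bundle morphism. -/
def comparisonHom (p : (DiffActGpd a).Obj X) :
    BunHom p.2 (S.und.bun p) (S.und.bun (idPtConn a)) where
  map := ⟨comparison S.und p, smooth_comparison S p⟩
  map_act := comparison_act S.und p
  proj_map := proj_comparison S.und p

end SmoothComparison

/-! ### The connection on the values of a morphism -/

section ConnComparison

variable {G : LieGrp.{u}} {M : Mfd.{u}} {a : LeftAction G M} {K : LieGrp.{u}}

/-- The argument without connections breaks because the morphism with component `g` leads from the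
zero form to the form `0 · g⁻¹` over the action map, not to a zero form. The comparison for that
object, which is smooth, replaces the missing morphism to `(0, id_M)`. -/
theorem evalConnSmooth : EvalConnSmooth a K := by
  intro S
  let Q := S.und.bun (idPtConn a)
  let o : (DiffActGpd a).Obj (G.toMfd.prod M) :=
    (OneForm.zero _ G.Lie, (ContMDiffMap.snd : Map (G.toMfd.prod M) M))
  let act : Map (G.toMfd.prod M) M := ⟨fun z => a.act z.1 z.2, a.smooth⟩
  let g : Map (G.toMfd.prod M) G.toMfd := ContMDiffMap.fst
  let p : (DiffActGpd a).Obj (G.toMfd.prod M) := ((OneForm.zero _ G.Lie).gauge g⁻¹, act)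
  let e := S.und.hom (zeroHom (a := a) (X := G.toMfd.prod M) ContMDiffMap.snd)
  let φ : (DiffActGpd a).Hom (Map.id _) o p := ⟨g, (pull_id _).symm, fun _ => rfl⟩
  have key : ∀ (g : G) (q : Q.tot), evalMapConn S g q
      = comparison S.und p ((S.und.hom φ).map (e.lift (g, Q.proj q) q)) := by
    intro g q
    have h1 : e.map (e.lift (g, Q.proj q) q) = q := e.map_lift rfl
    have h2 := comparison_map S.und φ (e.lift (g, Q.proj q) q)
    rw [comparison_zero] at h2
    rw [h2]
    have h3 : φ.1 ((S.und.bun o).proj (e.lift (g, Q.proj q) q)) = g :=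
      congrArg Prod.fst (e.proj_lift (g, Q.proj q) q)
    rw [h3]
    exact congrArg (S.und.hom (shiftConn a g)).map h1.symm
  intro z
  have h1 : SmAt (G.toMfd.prod Q.tot) (S.und.bun o).tot
      (fun z => e.lift (z.1, Q.proj z.2) z.2) z :=
    e.smAt_lift (Z := G.toMfd.prod Q.tot)
      (SmAt.prodMk contMDiffAt_fst (SmAt.comp (X := G.toMfd.prod Q.tot) (f := fun z => z.2) z
        (Q.proj.smAt _) contMDiffAt_snd))
      contMDiffAt_snd (Filter.Eventually.of_forall fun z => rfl)
  have h2 := SmAt.comp (X := G.toMfd.prod Q.tot) z (smooth_comparison S p _)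
    (SmAt.comp (X := G.toMfd.prod Q.tot) z ((S.und.hom φ).map.smAt _) h1)
  have h3 : (fun z : G × Q.tot => evalMapConn S z.1 z.2)
      = fun z => comparison S.und p ((S.und.hom φ).map (e.lift (z.1, Q.proj z.2) z.2)) :=
    funext fun z => key z.1 z.2
  rw [← h3] at h2
  exact h2

variable (a K) in
/-- Evaluation at `(0, id_M)`. -/
abbrev evalConn : Mor (DiffActGpd a) (BConn K) ⥤ EqBunConn a K := evalConnFunctor evalConnSmooth

theorem LeftAction.fund_smul {N : Mfd.{u}} (b : LeftAction G N) (c : ℝ) (A : G.Lie) (m : N) :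
    (b.fund (c • A) m : N.E) = c • (b.fund A m : N.E) := by
  rw [b.fund_eq, b.fund_eq]
  have h := (der (b.orb m) (1 : G)).map_smul c A
  refine (congrArg (fun v : N.E => -v) h).trans ?_
  exact (smul_neg c _).symm

theorem line_vec (w : ULift.{u} ℝ) : w = w.down • (oneL : ULift.{u} ℝ) := by
  refine ULift.ext _ _ ?_
  change w.down = w.down * 1
  rw [mul_one]

theorem smooth_form_oneL {V : Type u} [NormedAddCommGroup V] [NormedSpace ℝ V]
    [FiniteDimensional ℝ V] (β : OneForm Mfd.line.{u} V) :
    Sm Mfd.line (Mfd.vec V) (fun t => β.val t oneL) := by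
  have h2 : ContMDiff 𝓘(ℝ, ULift.{u} ℝ) 𝓘(ℝ, ULift.{u} ℝ).tangent ∞
      (fun z : Mfd.line.{u} =>
        (⟨z, oneL⟩ : TangentBundle 𝓘(ℝ, ULift.{u} ℝ) (ULift.{u} ℝ))) := by
    intro z
    refine Bundle.contMDiffAt_totalSpace.2 ⟨contMDiffAt_id, ?_⟩
    refine (contMDiffAt_const (c := (oneL : ULift.{u} ℝ))).congr_of_eventuallyEq
      (Filter.Eventually.of_forall fun s => ?_)
    simp
  exact β.smooth.comp h2

/-- After a reparametrization of the line, a form on it can be gauged away. -/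
theorem exists_gauge_zero (β : OneForm Mfd.line.{u} G.Lie) :
    ∃ ε : ℝ, ε ≠ 0 ∧ ∃ g : Map Mfd.line.{u} G.toMfd,
      gauge (pull (sinMap 0 ε) β.val) g⁻¹ = (OneForm.zero Mfd.line.{u} G.Lie).val ∧
      ∀ t, G.mc (g t) (der g t oneL) = pull (sinMap 0 ε) β.val t oneL := by
  obtain ⟨N, ε, l, -, hx, hε, hl⟩ := exists_lie_flow (K := G) (X := Mfd.pt.{u}) (x₀ := PUnit.unit)
    (s₀ := 0) (b := fun z => β.val z.2 oneL) (Filter.Eventually.of_forall fun z =>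
      SmAt.comp (X := Mfd.pt.prod Mfd.line.{u}) (Y := Mfd.line.{u}) (f := fun z => z.2) z
        (smooth_form_oneL β z.2) contMDiffAt_snd)
  -- The solution exists only for parameters of absolute value less than `ε`; an oscillation of
  -- amplitude `ε / 2` stays inside.
  let r : Map Mfd.line.{u} Mfd.line.{u} := sinMap 0 (ε / 2)
  have hr : ∀ t, |(r t).down - 0| < ε := fun t => by
    have h1 : (r t).down = 0 + ε / 2 * Real.sin t.down := rfl
    rw [h1, zero_add, sub_zero, abs_mul, abs_of_pos (half_pos hε)]
    exact lt_of_le_of_lt (mul_le_of_le_one_right (half_pos hε).le (Real.abs_sin_le_one _))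
      (half_lt_self hε)
  have hl0 : ∀ t, SmAt Mfd.line G.toMfd (fun s => l (PUnit.unit, s)) (r t) := fun t =>
    SmAt.comp (X := Mfd.line.{u}) (Y := Mfd.pt.prod Mfd.line.{u}) (f := fun s => (PUnit.unit, s))
      (r t) (hl _ hx _ (hr t)).1 (SmAt.prodMk (smAt_const _ _) (smAt_id _))
  let g : Map Mfd.line.{u} G.toMfd := ⟨fun t => l (PUnit.unit, r t), fun t =>
    SmAt.comp (X := Mfd.line.{u}) (Y := Mfd.line.{u}) t (hl0 t) (r.smAt t)⟩
  have hmc : ∀ t, G.mc (g t) (der g t oneL) = pull r β.val t oneL := fun t => by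
    have h1 := der_comp_at (X := Mfd.line.{u}) (Y := Mfd.line.{u}) (Z := G.toMfd)
      (g := fun s => l (PUnit.unit, s)) (f := r) t (hl0 t).diff (r.mdiff t) oneL
    have h2 : (der r t oneL : ULift.{u} ℝ) = (der r t oneL : ULift.{u} ℝ).down • oneL :=
      line_vec _
    rw [h2] at h1
    have h3 := h1.trans ((der (X := Mfd.line.{u}) (Y := G.toMfd) (fun s => l (PUnit.unit, s))
      (r t)).map_smul (der r t oneL : ULift.{u} ℝ).down oneL)
    refine (congrArg (G.mc (g t)) h3).trans ?_
    refine ((G.mc (g t)).map_smul _ _).trans ?_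
    refine (congrArg (fun v : G.E => (der r t oneL : ULift.{u} ℝ).down • v)
      (hl _ hx _ (hr t)).2).trans ?_
    refine ((β.val (r t)).map_smul _ _).symm.trans ?_
    exact congrArg (β.val (r t)) h2.symm
  refine ⟨ε / 2, (half_pos hε).ne', g, ?_, hmc⟩
  funext t
  refine ContinuousLinearMap.ext fun w : ULift.{u} ℝ => ?_
  have h0 : gauge (pull r β.val) g⁻¹ t oneL = 0 := by
    refine (gauge_apply (pull r β.val) g⁻¹ t oneL).trans ?_
    have h1 : G.mc ((g⁻¹ : Map _ _) t) (der (g⁻¹ : Map Mfd.line.{u} G.toMfd) t oneL)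
        = -G.Ad (g t) (G.mc (g t) (der g t oneL)) := mc_inv (g.smAt t) oneL
    have h2 : ((g⁻¹ : Map Mfd.line.{u} G.toMfd) t)⁻¹ = g t := inv_inv _
    rw [h1, h2, hmc]
    exact add_neg_cancel _
  rw [line_vec w]
  refine ((gauge (pull r β.val) g⁻¹ t).map_smul _ _).trans ?_
  rw [h0]
  exact (smul_zero _)

variable (S : Mor (DiffActGpd a) (BConn K)) {X : Mfd.{u}}

/-- Along the curve, after reparametrization, the form is gauged away by some `g` with `g^* θ` equal
to the pullback of `α`. Then `g` is a morphism from the restricted object to one with zero form,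
whose connection comes from `(0, id_M)`, and the comparison `κ` turns into `g κ`. Differentiating `g
κ` with the invariant connection produces the term with `ρ(α)`. -/
theorem val_comparison_curve (p : (DiffActGpd a).Obj X) (c : Map Mfd.line.{u} (S.und.bun p).tot) :
    ∃ ε : ℝ, ε ≠ 0 ∧ ∀ t, let c' : Map Mfd.line.{u} (S.und.bun p).tot := c.comp (sinMap 0 ε)
      (S.connOf p).val (c' t) (der c' t oneL)
        = (S.connOf (idPtConn a)).val (comparison S.und p (c' t))
            (der (X := Mfd.line) (Y := (S.und.bun (idPtConn a)).tot)
              (fun t => comparison S.und p (c' t)) t oneL)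
          - (S.connOf (idPtConn a)).val (comparison S.und p (c' t))
            (((evalConn a K).obj S).gact.fund (p.1.val ((S.und.bun p).proj (c' t))
              (der (X := Mfd.line) (Y := X) (fun t => (S.und.bun p).proj (c' t)) t oneL))
              (comparison S.und p (c' t))) := by
  let Q := S.und.bun (idPtConn a)
  obtain ⟨ε, hε, g, hg, hmc⟩ := exists_gauge_zero (p.1.pull ((S.und.bun p).proj.cmp c))
  refine ⟨ε, hε, fun t => ?_⟩
  intro c'
  let u' : Map Mfd.line.{u} X := (S.und.bun p).proj.cmp c'
  have hu' : pull (sinMap 0 ε) (p.1.pull ((S.und.bun p).proj.cmp c)).val = pull u' p.1.val :=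
    pull_pull _ _ _
  rw [hu'] at hg hmc
  let pc : (DiffActGpd a).Obj Mfd.line.{u} := (p.1.pull u', p.2.comp u')
  let ψ : (DiffActGpd a).Hom u' pc p := diffActHom a rfl fun _ => rfl
  let f' : Map Mfd.line.{u} M := ⟨fun t => a.act (g t) (p.2 (u' t)), fun t =>
    a.smAt_act (g.smAt t) (SmAt.comp t (p.2.smAt _) (u'.smAt t))⟩
  let φ : (DiffActGpd a).Hom (Map.id _) pc ((OneForm.zero _ G.Lie, f') : (DiffActGpd a).Obj _) :=
    ⟨g, hg.trans (pull_id _).symm, fun _ => rfl⟩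
  let y : Mfd.line.{u} → (S.und.bun pc).tot := fun t => (S.und.hom ψ).lift t (c' t)
  have hψy : ∀ t, (S.und.hom ψ).map (y t) = c' t := fun t => (S.und.hom ψ).map_lift rfl
  have hy : SmAt Mfd.line.{u} (S.und.bun pc).tot y t :=
    (S.und.hom ψ).smAt_lift (Z := Mfd.line.{u}) (smAt_id t) (c'.smAt t)
      (Filter.Eventually.of_forall fun _ => rfl)
  have hy1 : SmAt Mfd.line.{u} (S.und.bun _).tot (fun t => (S.und.hom φ).map (y t)) t :=
    SmAt.comp (X := Mfd.line.{u}) t ((S.und.hom φ).map.smAt _) hy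
  have e1 := (S.pres ψ).val_der hy.diff oneL
  have e2 := (S.pres φ).val_der hy.diff oneL
  have e3 := (S.pres (zeroHom f')).val_der hy1.diff oneL
  have e4 : ∀ t, (S.und.hom (zeroHom (a := a) f')).map ((S.und.hom φ).map (y t))
      = ((evalConn a K).obj S).gact.act (g t) (comparison S.und p (c' t)) := by
    intro t
    refine (comparison_zero S.und f' _).symm.trans ((comparison_map S.und φ (y t)).trans ?_)
    have h1 : (S.und.bun pc).proj (y t) = t := (S.und.hom ψ).proj_lift t (c' t)
    rw [h1, ← hψy t, comparison_map_one S.und ψ rfl]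
    rfl
  have hκ : SmAt Mfd.line.{u} Q.tot (fun t => comparison S.und p (c' t)) t :=
    SmAt.comp (X := Mfd.line.{u}) t (smooth_comparison S p _) (c'.smAt t)
  have e5 := (S.connOf (idPtConn a)).val_der_gact ((evalConn a K).obj S).gact
    (((evalConn a K).obj S).invariant) (g.smAt t).diff hκ.diff oneL
  rw [hmc] at e5
  refine Eq.trans ?_ e5
  have e6 : (fun t => (S.und.hom ψ).map (y t)) = c' := funext hψy
  have e7 : (fun t => (S.und.hom (zeroHom (a := a) f')).map ((S.und.hom φ).map (y t)))
      = fun t => ((evalConn a K).obj S).gact.act (g t) (comparison S.und p (c' t)) := funext e4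
  rw [e6, hψy] at e1
  rw [e7, e4] at e3
  exact e1.trans (e2.symm.trans e3.symm)

/-- The connection on the value at `(α, f)`. -/
theorem val_comparison (p : (DiffActGpd a).Obj X) (z : (S.und.bun p).tot)
    (w : (S.und.bun p).tot.T z) :
    (S.connOf p).val z w
      = (S.connOf (idPtConn a)).val (comparison S.und p z) (der (comparisonHom S p).map z w)
        - (S.connOf (idPtConn a)).val (comparison S.und p z)
          (((evalConn a K).obj S).gact.fund (p.1.val ((S.und.bun p).proj z)
            (der (S.und.bun p).proj z w)) (comparison S.und p z)) := by
  let Q := S.und.bun (idPtConn a)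
  -- The difference of the two sides. It is homogeneous in `w`, so it vanishes once it does on a
  -- nonzero multiple of `w`, and such a multiple is the velocity of a reparametrized curve.
  let D : ∀ z : (S.und.bun p).tot, (S.und.bun p).tot.E → K.E := fun z w =>
    (S.connOf p).val z w
      - ((S.connOf (idPtConn a)).val (comparison S.und p z) (der (comparisonHom S p).map z w)
        - (S.connOf (idPtConn a)).val (comparison S.und p z)
          (((evalConn a K).obj S).gact.fund (p.1.val ((S.und.bun p).proj z)
            (der (S.und.bun p).proj z w)) (comparison S.und p z)))
  have hD : ∀ (r : ℝ) z w, D z (r • w) = r • D z w := by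
    intro r z w
    have h1 := ((S.connOf p).val z).map_smul r w
    have h2 := (der (comparisonHom S p).map z).map_smul r w
    have h3 := ((S.connOf (idPtConn a)).val (comparison S.und p z)).map_smul r
      (der (comparisonHom S p).map z w)
    have h4 := (der (S.und.bun p).proj z).map_smul r w
    have h5 := (p.1.val ((S.und.bun p).proj z)).map_smul r (der (S.und.bun p).proj z w)
    have h6 := ((evalConn a K).obj S).gact.fund_smul r (p.1.val ((S.und.bun p).proj z)
      (der (S.und.bun p).proj z w)) (comparison S.und p z)
    have h7 := ((S.connOf (idPtConn a)).val (comparison S.und p z)).map_smul r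
      (((evalConn a K).obj S).gact.fund (p.1.val ((S.und.bun p).proj z)
        (der (S.und.bun p).proj z w)) (comparison S.und p z))
    change (S.connOf p).val z (r • w)
      - ((S.connOf (idPtConn a)).val (comparison S.und p z) (der (comparisonHom S p).map z (r • w))
        - (S.connOf (idPtConn a)).val (comparison S.und p z)
          (((evalConn a K).obj S).gact.fund (p.1.val ((S.und.bun p).proj z)
            (der (S.und.bun p).proj z (r • w))) (comparison S.und p z))) = _
    rw [show (der (comparisonHom S p).map z (r • w)) = _ from h2,
      show (der (S.und.bun p).proj z (r • w)) = _ from h4]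
    refine (congrArg₂ (fun x y : K.E => x - y) h1 (congrArg₂ (fun x y : K.E => x - y) h3
      ((congrArg (fun A : G.E => (S.connOf (idPtConn a)).val (comparison S.und p z)
        (((evalConn a K).obj S).gact.fund A (comparison S.und p z))) h5).trans
        ((congrArg ((S.connOf (idPtConn a)).val (comparison S.und p z)) h6).trans h7)))).trans ?_
    rw [smul_sub, smul_sub]
  obtain ⟨c, ε, hε, hc, hcw⟩ := exists_curve z w
  obtain ⟨ε', hε', hf⟩ := val_comparison_curve S p c
  have h := hf ⟨0⟩
  let c' : Map Mfd.line.{u} (S.und.bun p).tot := c.comp (sinMap.{u} 0 ε')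
  have hc'0 : c' ⟨0⟩ = z := by
    rw [← hc]
    refine congrArg c ?_
    simp [sinMap]
  have hs0 : sinMap.{u} 0 ε' ⟨0⟩ = (⟨0⟩ : ULift.{u} ℝ) := by simp [sinMap]
  have hd : (der c' ⟨0⟩ oneL : (S.und.bun p).tot.E) = ε' • ε • w := by
    have h1 := der_comp c (sinMap.{u} 0 ε') ⟨0⟩ oneL
    rw [der_sinMap] at h1
    refine h1.trans ((der_congr_pt c hs0 _).trans ?_)
    have h2 : (⟨ε'⟩ : ULift.{u} ℝ) = ε' • (oneL : ULift.{u} ℝ) := line_vec _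
    rw [h2]
    refine ((der c (⟨0⟩ : Mfd.line.{u})).map_smul ε' oneL).trans ?_
    exact congrArg (fun v : (S.und.bun p).tot.E => ε' • v) hcw
  have hκ := der_comp (comparisonHom S p).map c' ⟨0⟩ oneL
  have hπ := der_comp (S.und.bun p).proj c' ⟨0⟩ oneL
  have h0 : D (c' ⟨0⟩) (der c' ⟨0⟩ oneL) = 0 := by
    refine sub_eq_zero.2 ?_
    rw [← show _ = der (comparisonHom S p).map (c' ⟨0⟩) (der c' ⟨0⟩ oneL) from hκ,
      ← show _ = der (S.und.bun p).proj (c' ⟨0⟩) (der c' ⟨0⟩ oneL) from hπ]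
    exact h
  rw [show (der c' ⟨0⟩ oneL : (S.und.bun p).tot.E) = _ from hd, hc'0] at h0
  have h1 : D z w = 0 := by
    have h2 : ε' • ε • D z w = 0 :=
      ((hD ε' z (ε • (w : (S.und.bun p).tot.E))).trans
        (congrArg (fun v : K.E => ε' • v) (hD ε z w))).symm.trans h0
    rwa [smul_eq_zero_iff_right hε', smul_eq_zero_iff_right hε] at h2
  exact sub_eq_zero.1 h1

end ConnComparison

/-! ### Full faithfulness of the evaluation with connections -/

section EvalConn

variable {G : LieGrp.{u}} {M : Mfd.{u}} {a : LeftAction G M} {K : LieGrp.{u}}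

theorem comparison_ptMap {S S' : Mor (DiffActGpd a) (B K)}
    {ψ : BunHom (Map.id M) (S.bun (idPtConn a)) (S'.bun (idPtConn a))}
    (hψ : ∀ g z, ψ.map ((S.hom (diffData.sh g)).map z) = (S'.hom (diffData.sh g)).map (ψ.map z))
    {X : Mfd.{u}} (p : (DiffActGpd a).Obj X) (z : (S.bun p).tot) :
    comparison S' p (ptMap diffData.ptObjs S S' (diffData.fam ψ) p z)
      = ψ.map (comparison S p z) := by
  obtain ⟨w, hw⟩ : ∃ w, (S.hom (ptArr p ((S.bun p).proj z))).map w = z :=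
    ⟨_, (S.hom (ptArr p _)).map_lift (x := PUnit.unit) rfl⟩
  rw [← hw, ptMap_map diffData.ptObjs (diffData.natural_fam hψ), comparison_ptArr, comparison_ptArr]
  exact diffData.map_fam ψ _ w

/-- The pointwise extension of `ψ` corresponds to `ψ` under the two comparison maps, which are
smooth bundle morphisms, so it is a smooth lift. By `val_comparison` the connections on both sides
are expressed through the form `α`, the connection at `(0, id_M)` and the action of `G`, all of
which `ψ` respects. -/
theorem full_evalConn : (evalConn a K).Full where
  map_surjective {S S'} ψ := by
    let ψ₀ : BunHom (Map.id M) (S.und.bun (idPtConn a)) (S'.und.bun (idPtConn a)) := ψ.toBunHom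
    have hψ : ∀ g z, ψ₀.map ((S.und.hom (diffData.sh g)).map z)
        = (S'.und.hom (diffData.sh g)).map (ψ₀.map z) := fun g z => ψ.map_gact g z
    let τ : ∀ {X : Mfd.{u}} (p : (DiffActGpd a).Obj X), (S.und.bun p).tot → (S'.und.bun p).tot :=
      fun p => ptMap diffData.ptObjs S.und S'.und (diffData.fam ψ₀) p
    have hτ : ∀ {X : Mfd.{u}} (p : (DiffActGpd a).Obj X) z,
        comparison S'.und p (τ p z) = ψ₀.map (comparison S.und p z) :=
      fun p z => comparison_ptMap hψ p z
    have hpr : ∀ {X : Mfd.{u}} (p : (DiffActGpd a).Obj X) z,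
        (S'.und.bun p).proj (τ p z) = (S.und.bun p).proj z := fun p z =>
      proj_ptMap diffData.ptObjs (diffData.natural_fam hψ) p z
    have hs : ∀ {X : Mfd.{u}} (p : (DiffActGpd a).Obj X),
        Sm (S.und.bun p).tot (S'.und.bun p).tot (τ p) := by
      intro X p z
      have h1 : SmAt (S.und.bun p).tot (S'.und.bun p).tot
          (fun z => (comparisonHom S' p).lift ((S.und.bun p).proj z)
            (ψ₀.map (comparison S.und p z))) z :=
        (comparisonHom S' p).smAt_lift (Z := (S.und.bun p).tot) ((S.und.bun p).proj.smAt z)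
          (SmAt.comp z (ψ₀.map.smAt _) (smooth_comparison S p z))
          (Filter.Eventually.of_forall fun z => by
            rw [ψ₀.proj_map]
            exact proj_comparison S.und p z)
      refine h1.congr (Filter.Eventually.of_forall fun z => ?_)
      exact ((comparisonHom S' p).lift_eq (hpr p z) (hτ p z)).symm
    let σ : Trans S.und S'.und := ptTrans diffData.ptObjs (diffData.natural_fam hψ) hs
    have hσ : ∀ {X : Mfd.{u}} (p : (DiffActGpd a).Obj X),
        (S.connOf p).Pres (S'.connOf p) (σ.hom p).map := by
      intro X p
      funext z
      refine ContinuousLinearMap.ext fun w => ?_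
      let t : Map (S.und.bun p).tot (S'.und.bun p).tot := ⟨τ p, hs p⟩
      change (S'.connOf p).val (t z) (der t z w) = (S.connOf p).val z w
      rw [val_comparison, val_comparison]
      have h1 := der_comp (comparisonHom S' p).map t z w
      have h2 := der_comp ψ₀.map (comparisonHom S p).map z w
      have h3 := der_comp (S'.und.bun p).proj t z w
      have h4 : (fun z => (comparisonHom S' p).map (t z))
          = fun z => ψ₀.map ((comparisonHom S p).map z) := funext fun z => hτ p z
      have h5 : (fun z => (S'.und.bun p).proj (t z)) = (S.und.bun p).proj := funext fun z => hpr p z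
      rw [h4] at h1
      rw [h5] at h3
      have h6 : comparison S'.und p (t z) = ψ₀.map (comparison S.und p z) := hτ p z
      have h7 : (S'.und.bun p).proj (t z) = (S.und.bun p).proj z := hpr p z
      have hψp : ∀ (q : (S.und.bun (idPtConn a)).tot) (v : (S.und.bun (idPtConn a)).tot.E),
          (S'.connOf (idPtConn a)).val (ψ₀.map q) (der ψ₀.map q v)
            = (S.connOf (idPtConn a)).val q v := fun q v =>
        congrArg (fun β : ∀ q, (S.und.bun (idPtConn a)).tot.T q →L[ℝ] K.Lie => β q v) ψ.pres
      have e1 : (S'.connOf (idPtConn a)).val (comparison S'.und p (t z))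
          (der (comparisonHom S' p).map (t z) (der t z w))
          = (S.connOf (idPtConn a)).val (comparison S.und p z) (der (comparisonHom S p).map z w) :=
        ((S'.connOf (idPtConn a)).toOneForm.val_congr h6 _).trans
          ((congrArg ((S'.connOf (idPtConn a)).val (ψ₀.map (comparison S.und p z)))
            (h1.symm.trans h2)).trans (hψp _ _))
      have e2 : (S'.connOf (idPtConn a)).val (comparison S'.und p (t z))
          (((evalConn a K).obj S').gact.fund (p.1.val ((S'.und.bun p).proj (t z))
            (der (S'.und.bun p).proj (t z) (der t z w))) (comparison S'.und p (t z)))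
          = (S.connOf (idPtConn a)).val (comparison S.und p z)
            (((evalConn a K).obj S).gact.fund (p.1.val ((S.und.bun p).proj z)
              (der (S.und.bun p).proj z w)) (comparison S.und p z)) := by
        have h8 : p.1.val ((S'.und.bun p).proj (t z))
            (der (S'.und.bun p).proj (t z) (der t z w))
            = p.1.val ((S.und.bun p).proj z) (der (S.und.bun p).proj z w) :=
          (p.1.val_congr h7 _).trans (congrArg (p.1.val ((S.und.bun p).proj z)) h3.symm)
        rw [h8, h6]
        refine (congrArg ((S'.connOf (idPtConn a)).val (ψ₀.map (comparison S.und p z)))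
          (LeftAction.fund_map (a := ((evalConn a K).obj S).gact)
          (b := ((evalConn a K).obj S').gact) ψ₀.map (fun g m => ψ.map_gact g m)
            _ (comparison S.und p z))).trans (hψp _ _)
      rw [e1, e2]
    refine ⟨Trans.withConn σ hσ, ?_⟩
    exact EqConnHom.ext (ContMDiffMap.ext fun q => diffData.ptMap_o hψ q)

theorem faithful_evalConn : (evalConn a K).Faithful where
  map_injective h := Trans.forget_injective (diffData.ext fun z =>
    congrArg (fun ψ : EqConnHom _ _ => ψ.map z) h)

/-! ### Precomposition with the morphism which forgets the form -/

/-- A morphism of `M // G` lifts to a morphism to an object with vanishing form. -/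
def liftHom {X Y : Mfd.{u}} {u : Map X Y} {f : Map X M} {f' : Map Y M}
    (φ : (ActGpd a).Hom u f f') :
    (DiffActGpd a).Hom u (((OneForm.zero X G.Lie).gauge φ.1, f) : (DiffActGpd a).Obj X)
      ((OneForm.zero Y G.Lie, f') : (DiffActGpd a).Obj Y) :=
  ⟨φ.1, by
    change gauge (gauge _ _) _ = _
    rw [gauge_gauge, mul_inv_cancel, gauge_one]
    funext x; ext w; rfl, φ.2⟩

/-- The objects `(α, f)` and `(0, f)` have the same restrictions to points, and the restriction
arrows have the same image in `M // G`. A transformation is determined by its values over points. -/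
theorem forget_app_eq {S S' : Mor (ActGpd a) (BConn K)}
    (σ : Trans ((forgetForm a).comp S) ((forgetForm a).comp S')) {X : Mfd.{u}} (f : Map X M)
    (α : OneForm X G.Lie) :
    (show ConnHom (Map.id X) (S.obj (f : (ActGpd a).Obj X)) (S'.obj (f : (ActGpd a).Obj X)) from
      σ.app ((α, f) : (DiffActGpd a).Obj X))
      = σ.app ((OneForm.zero X G.Lie, f) : (DiffActGpd a).Obj X) := by
  let T : Mor (DiffActGpd a) (B K) := ((forgetForm a).comp S).und
  let T' : Mor (DiffActGpd a) (B K) := ((forgetForm a).comp S').und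
  let p : (DiffActGpd a).Obj X := (α, f)
  let p₀ : (DiffActGpd a).Obj X := (OneForm.zero X G.Lie, f)
  refine ConnHom.ext (ContMDiffMap.ext fun (z : (T.bun p).tot) => ?_)
  obtain ⟨w, hw⟩ : ∃ w, (T.hom (ptArr p ((T.bun p).proj z))).map w = z :=
    ⟨_, (T.hom (ptArr p _)).map_lift (x := PUnit.unit) rfl⟩
  have h1 := σ.forget.hom_map (ptArr p ((T.bun p).proj z)) w
  have h2 := σ.forget.hom_map (ptArr p₀ ((T.bun p).proj z)) w
  have hw' : (T.hom (ptArr p₀ ((T.bun p).proj z))).map w = z := hw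
  change (σ.forget.hom p).map z = (σ.forget.hom p₀).map z
  rw [← hw]
  refine h1.trans (h2.symm.trans ?_)
  rw [hw, hw']

/-- A morphism `f → f'` of `M // G` lifts to one with target `(0, f')`, but with source `(0 · g,
f)`. Naturality on this lift is enough, because the component at an object does not depend on its
form. -/
theorem full_forgetForm : ((forgetForm a).precomp (BConn K)).Full where
  map_surjective {S S'} σ := by
    refine ⟨⟨fun {X} f => σ.app ((OneForm.zero X G.Lie, f) : (DiffActGpd a).Obj X),
      fun {X Y u f f'} φ => ?_⟩, ?_⟩
    · have h1 := σ.naturality (liftHom φ)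
      rw [show σ.app (((OneForm.zero X G.Lie).gauge φ.1, f) : (DiffActGpd a).Obj X)
        = σ.app ((OneForm.zero X G.Lie, f) : (DiffActGpd a).Obj X) from
          forget_app_eq (S := S) (S' := S') σ f _] at h1
      exact h1
    · refine Trans.ext ?_
      funext X p
      exact (forget_app_eq (S := S) (S' := S') σ p.2 p.1).symm

theorem faithful_forgetForm : ((forgetForm a).precomp (BConn K)).Faithful where
  map_injective {S S'} σ σ' h := by
    refine Trans.ext ?_
    funext X f
    exact congrArg (fun τ : Trans ((forgetForm a).comp S) ((forgetForm a).comp S') =>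
      τ.app ((OneForm.zero X G.Lie, f) : (DiffActGpd a).Obj X)) h

/-! ### Basic connections -/

/-- In `M // G` the projection and the action map `G × M → M` both underlie morphisms to `id_M`, and
both preserve connections. One family over `G` is sent by the first to the constant `q` and by the
second to the orbit of `q`; hence the connection form vanishes along the orbit. -/
theorem isBasic_eval_forgetForm (S : Mor (ActGpd a) (BConn K)) :
    IsBasic a K (((forgetForm a).precomp (BConn K) ⋙ evalConn a K).obj S) := by
  intro A (q : (S.und.bun (idPt a)).tot)
  let Q := S.und.bun (idPt a)
  let o : (ActGpd a).Obj (G.toMfd.prod M) := (ContMDiffMap.snd : Map (G.toMfd.prod M) M)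
  let act : Map (G.toMfd.prod M) M := ⟨fun z => a.act z.1 z.2, a.smooth⟩
  let e : (ActGpd a).Hom (ContMDiffMap.snd : Map (G.toMfd.prod M) M) o (idPt a) :=
    ⟨1, fun _ => a.one_act _⟩
  let d : (ActGpd a).Hom act o (idPt a) := ⟨ContMDiffMap.fst, fun _ => rfl⟩
  let y : G → (S.und.bun o).tot := fun g => (S.und.hom e).lift (g, Q.proj q) q
  have hy : ∀ g, SmAt G.toMfd (S.und.bun o).tot y g := fun g =>
    (S.und.hom e).smAt_lift (Z := G.toMfd) (SmAt.prodMk (smAt_id g) (smAt_const _ g))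
      (smAt_const q g) (Filter.Eventually.of_forall fun _ => rfl)
  have hey : ∀ g, (S.und.hom e).map (y g) = q := fun g => (S.und.hom e).map_lift rfl
  let b : LeftAction G Q.tot := (((forgetForm a).precomp (BConn K) ⋙ evalConn a K).obj S).gact
  have hdy : ∀ g, (S.und.hom d).map (y g) = b.act g q := by
    intro g
    let i : Map M (G.toMfd.prod M) := ⟨fun m => (g, m), contMDiff_const.prodMk contMDiff_id⟩
    let j : (ActGpd a).Hom i (idPt a) o := ⟨1, fun _ => a.one_act _⟩
    have h1 : y g = (S.und.hom j).map q := by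
      refine (S.und.hom e).lift_eq ((S.und.hom j).proj_map q) ?_
      rw [← S.und.hom_comp]
      refine (congrArg (fun f : Map _ _ => f q) (map_eq S.und _ ((ActGpd a).id _) rfl ?_)).trans
        (S.und.hom_id _ q)
      exact mul_one (1 : Map M G.toMfd)
    rw [h1, ← S.und.hom_comp]
    refine congrArg (fun f : Map _ _ => f q) (map_eq S.und _ (shift a g) rfl ?_)
    ext m
    exact mul_one g
  have h1 := (S.pres e).val_der (hy 1).diff (-A)
  have h2 := (S.pres d).val_der (hy 1).diff (-A)
  have h3 : (fun g => (S.und.hom e).map (y g)) = fun _ => q := funext hey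
  have h4 : (fun g => (S.und.hom d).map (y g)) = fun g => b.act g q := funext hdy
  rw [h3, hey] at h1
  rw [h4, hdy, b.one_act] at h2
  refine h2.trans (h1.symm.trans ?_)
  have h5 : (der (X := G.toMfd) (Y := Q.tot) (fun _ => q) 1 (-A) : Q.tot.E) = 0 :=
    der_const (X := G.toMfd) q (1 : G) (-A)
  exact (congrArg ((S.connOf (idPt a)).val q) h5).trans (map_zero _)

theorem isBasic_of_hom {Q R : EqBunConn a K} (ψ : Q ⟶ R) (h : IsBasic a K R) : IsBasic a K Q := by
  intro A q
  let ψ' : EqConnHom Q R := ψ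
  have h1 : R.conn.val (ψ'.map q) (der ψ'.map q (Q.gact.fund A q)) = Q.conn.val q (Q.gact.fund A q) :=
    congrArg (fun β : ∀ q, Q.tot.T q →L[ℝ] K.Lie => β q (Q.gact.fund A q)) ψ'.pres
  rw [← h1]
  refine (congrArg (R.conn.val (ψ'.map q)) ?_).trans (h A (ψ'.map q))
  exact (LeftAction.fund_map (a := Q.gact) (b := R.gact) ψ'.map ψ'.map_gact A q).symm

/-- Evaluation at `(0, id_M)` of the bundles which descend to `M // G`. -/
abbrev evalBasic (a : LeftAction G M) (K : LieGrp.{u}) :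
    Mor (ActGpd a) (BConn K) ⥤ (IsBasic a K).FullSubcategory :=
  (IsBasic a K).lift ((forgetForm a).precomp (BConn K) ⋙ evalConn a K) isBasic_eval_forgetForm

theorem full_evalBasic : (evalBasic a K).Full := by
  have := full_forgetForm (a := a) (K := K)
  have := full_evalConn (a := a) (K := K)
  infer_instance

theorem faithful_evalBasic : (evalBasic a K).Faithful := by
  have := faithful_forgetForm (a := a) (K := K)
  have := faithful_evalConn (a := a) (K := K)
  infer_instance

/-- A bundle with connection on `M //_∇ G` descends to `M // G` if and only if the connection of its
value at `(0, id_M)` is basic. -/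
theorem essImage_forgetForm_iff [(evalBasic a K).EssSurj] (S : Mor (DiffActGpd a) (BConn K)) :
    ((forgetForm a).precomp (BConn K)).essImage S ↔ IsBasic a K ((evalConn a K).obj S) := by
  constructor
  · rintro ⟨S₀, ⟨i⟩⟩
    exact isBasic_of_hom ((evalConn a K).map i.inv) (isBasic_eval_forgetForm S₀)
  · intro h
    have := full_evalConn (a := a) (K := K)
    have := faithful_evalConn (a := a) (K := K)
    let Q : (IsBasic a K).FullSubcategory := ⟨_, h⟩
    refine ⟨(evalBasic a K).objPreimage Q, ⟨(evalConn a K).preimageIso ?_⟩⟩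
    exact (IsBasic a K).ι.mapIso ((evalBasic a K).objObjPreimageIso Q)

end EvalConn

/-! ### Gluing of principal bundles -/

section Charts

variable (Z : Mfd.{u}) (N : Type u) [TopologicalSpace N] [ChartedSpace Z.carrier N]

/-- The coordinate changes of an atlas with values in a manifold are smooth. -/
def SmoothChanges : Prop := ∀ e ∈ atlas Z.carrier N, ∀ e' ∈ atlas Z.carrier N,
  ContMDiffOn Z.I Z.I ∞ (e.symm.trans e') (e.symm.trans e').source

variable {Z N}

/-- A chart of the composite atlas is a chart with values in `Z` followed by a chart of `Z`. A
coordinate change is then a smooth change between charts with values in `Z`, sandwiched between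
charts of `Z`. -/
theorem SmoothChanges.isManifold (h : SmoothChanges Z N) :
    letI := ChartedSpace.comp Z.H Z.carrier N
    IsManifold Z.I ∞ N := by
  let _ := ChartedSpace.comp Z.H Z.carrier N
  refine isManifold_of_contDiffOn Z.I ∞ N ?_
  rintro _ _ ⟨e, he, φ, hφ, rfl⟩ ⟨e', he', φ', hφ', rfl⟩
  have h1 := contMDiffOn_symm_of_mem_maximalAtlas (I := Z.I) (n := ∞)
    (StructureGroupoid.subset_maximalAtlas _ hφ)
  have h2 := contMDiffOn_of_mem_maximalAtlas (I := Z.I) (n := ∞)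
    (StructureGroupoid.subset_maximalAtlas _ hφ')
  have h3 := h e he e' he'
  have hr : ContMDiffOn 𝓘(ℝ, Z.E) Z.I ∞ Z.I.symm (Set.range Z.I) := Z.I.contMDiffOn_symm
  refine ContMDiffOn.contDiffOn ?_
  have h4 : ContMDiffOn Z.I 𝓘(ℝ, Z.E) ∞ Z.I Set.univ := Z.I.contMDiff.contMDiffOn
  have h5 := h4.comp (h2.comp (h3.comp (h1.comp (hr.mono
    (Set.inter_subset_right (s := Z.I.symm ⁻¹' ((e.trans φ).symm.trans (e'.trans φ')).source)))
    ?_) ?_) ?_) ?_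
  · exact h5
  all_goals
    rintro x ⟨hx, -⟩
    simp only [Set.mem_preimage, mfld_simps] at hx ⊢
    try tauto

theorem SmoothChanges.contMDiffOn (h : SmoothChanges Z N)
    {e : OpenPartialHomeomorph N Z.carrier} (he : e ∈ atlas Z.carrier N) :
    letI := ChartedSpace.comp Z.H Z.carrier N
    ContMDiffOn Z.I Z.I ∞ e e.source := by
  let _ := ChartedSpace.comp Z.H Z.carrier N
  have := h.isManifold
  intro p hp
  let φ := chartAt Z.H (e p)
  have hm : e.trans φ ∈ atlas Z.H N := ⟨e, he, φ, chart_mem_atlas _ _, rfl⟩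
  have h1 := contMDiffOn_of_mem_maximalAtlas (I := Z.I) (n := ∞)
    (StructureGroupoid.subset_maximalAtlas _ hm)
  have h2 := contMDiffOn_symm_of_mem_maximalAtlas (I := Z.I) (n := ∞)
    (StructureGroupoid.subset_maximalAtlas _ (chart_mem_atlas Z.H (e p)))
  have hsrc : (e.trans φ).source ∈ 𝓝 p := (e.trans φ).open_source.mem_nhds (by simp [hp, φ])
  have h3 : ContMDiffAt Z.I Z.I ∞ (fun q => φ.symm (φ (e q))) p := by
    refine ContMDiffAt.comp p (g := φ.symm) (f := fun q => φ (e q)) ?_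
      (h1.contMDiffAt hsrc)
    exact h2.contMDiffAt (φ.open_target.mem_nhds (φ.map_source (mem_chart_source _ _)))
  refine (h3.congr_of_eventuallyEq ?_).contMDiffWithinAt
  filter_upwards [hsrc] with q hq
  rw [OpenPartialHomeomorph.trans_source] at hq
  exact (φ.left_inv hq.2).symm

theorem SmoothChanges.contMDiffOn_symm (h : SmoothChanges Z N)
    {e : OpenPartialHomeomorph N Z.carrier} (he : e ∈ atlas Z.carrier N) :
    letI := ChartedSpace.comp Z.H Z.carrier N
    ContMDiffOn Z.I Z.I ∞ e.symm e.target := by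
  let _ := ChartedSpace.comp Z.H Z.carrier N
  have := h.isManifold
  intro z hz
  let φ := chartAt Z.H z
  have hm : e.trans φ ∈ atlas Z.H N := ⟨e, he, φ, chart_mem_atlas _ _, rfl⟩
  have h1 := contMDiffOn_symm_of_mem_maximalAtlas (I := Z.I) (n := ∞)
    (StructureGroupoid.subset_maximalAtlas _ hm)
  have h2 := contMDiffOn_of_mem_maximalAtlas (I := Z.I) (n := ∞)
    (StructureGroupoid.subset_maximalAtlas _ (chart_mem_atlas Z.H z))
  have hz' : z ∈ φ.source := mem_chart_source _ _
  have h3 : ContMDiffAt Z.I Z.I ∞ (fun y => (e.trans φ).symm (φ y)) z := by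
    refine ContMDiffAt.comp z (g := (e.trans φ).symm) (f := φ) ?_
      (h2.contMDiffAt (φ.open_source.mem_nhds hz'))
    refine h1.contMDiffAt ((e.trans φ).open_target.mem_nhds ?_)
    simp only [mfld_simps]
    exact ⟨φ.map_source hz', by rw [φ.left_inv hz']; exact hz⟩
  refine (h3.congr_of_eventuallyEq ?_).contMDiffWithinAt
  filter_upwards [φ.open_source.mem_nhds hz'] with y hy
  change e.symm y = e.symm (φ.symm (φ y))
  rw [φ.left_inv hy]

end Charts

/-- The data from which a principal bundle is glued: a set with a free action of `K` whose orbits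
are the fibres of a map to `X`, and sections of it, over neighbourhoods of the points of `X`, which
differ by smooth functions. -/
structure GlueData (K : LieGrp.{u}) (X : Mfd.{u}) where
  R : Type u
  proj : R → X
  act : R → K → R
  act_one : ∀ r, act r 1 = r
  act_mul : ∀ r k l, act r (k * l) = act (act r k) l
  proj_act : ∀ r k, proj (act r k) = proj r
  div : R → R → K
  act_div : ∀ {r r'}, proj r = proj r' → act r (div r r') = r'
  div_act : ∀ r k, div r (act r k) = k
  U : X → TopologicalSpace.Opens X
  mem : ∀ x, x ∈ U x
  s : X → X → R
  proj_s : ∀ {i x}, x ∈ U i → proj (s i x) = x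
  smooth : ∀ {i j x}, x ∈ U i → x ∈ U j →
    SmAt X K.toMfd (fun x => div (s i x) (s j x)) x

namespace GlueData

variable {K : LieGrp.{u}} {X : Mfd.{u}} (D : GlueData K X)

theorem act_injective {r : D.R} {k l : K} (h : D.act r k = D.act r l) : k = l := by
  rw [← D.div_act r k, h, D.div_act]

theorem div_act_of_proj {r r' : D.R} (h : D.proj r = D.proj r') (k : K) :
    D.div r (D.act r' k) = D.div r r' * k := by
  apply D.act_injective (r := r)
  rw [D.act_div (h.trans (D.proj_act r' k).symm), D.act_mul, D.act_div h]

/-- The trivialization of the set `R` over `U i`. -/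
def chart (i : X) : PartialEquiv D.R (X.prod K.toMfd).carrier where
  toFun r := (D.proj r, D.div (D.s i (D.proj r)) r)
  invFun z := D.act (D.s i z.1) z.2
  source := D.proj ⁻¹' D.U i
  target := (D.U i : Set X) ×ˢ Set.univ
  map_source' _ hr := ⟨hr, trivial⟩
  map_target' z hz := by
    rw [Set.mem_preimage, D.proj_act, D.proj_s hz.1]
    exact hz.1
  left_inv' r hr := D.act_div (D.proj_s hr)
  right_inv' z hz := by
    rw [D.proj_act, D.proj_s hz.1, D.div_act]

theorem chart_trans_source (i j : X) :
    ((D.chart i).symm.trans (D.chart j)).source = ((D.U i : Set X) ∩ D.U j) ×ˢ Set.univ := by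
  ext z
  rw [PartialEquiv.trans_source]
  constructor
  · rintro ⟨h1, h2⟩
    have h3 : D.proj (D.act (D.s i z.1) z.2) ∈ D.U j := h2
    rw [D.proj_act, D.proj_s h1.1] at h3
    exact ⟨⟨h1.1, h3⟩, trivial⟩
  · rintro ⟨⟨h1, h2⟩, -⟩
    refine ⟨⟨h1, trivial⟩, ?_⟩
    change D.proj (D.act (D.s i z.1) z.2) ∈ D.U j
    rw [D.proj_act, D.proj_s h1]
    exact h2

theorem contMDiffOn_chart_trans (i j : X) :
    ContMDiffOn (X.prod K.toMfd).I (X.prod K.toMfd).I ∞ ((D.chart i).symm.trans (D.chart j))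
      ((D.chart i).symm.trans (D.chart j)).source := by
  rw [chart_trans_source]
  rintro z ⟨⟨h1, h2⟩, -⟩
  have h3 : SmAt (X.prod K.toMfd) (X.prod K.toMfd)
      (fun z => (z.1, D.div (D.s j z.1) (D.s i z.1) * z.2)) z :=
    (contMDiffAt_fst).prodMk ((SmAt.comp (X := X.prod K.toMfd) (Y := X) (Z := K.toMfd)
      (f := fun z => z.1) z (D.smooth h2 h1) contMDiffAt_fst).mul contMDiffAt_snd)
  refine h3.contMDiffWithinAt.congr_of_mem ?_ ⟨⟨h1, h2⟩, trivial⟩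
  rintro y ⟨⟨h1, h2⟩, -⟩
  change (D.proj (D.act (D.s i y.1) y.2), D.div (D.s j (D.proj (D.act (D.s i y.1) y.2)))
    (D.act (D.s i y.1) y.2)) = _
  rw [D.proj_act, D.proj_s h1, D.div_act_of_proj]
  rw [D.proj_s h1, D.proj_s h2]

/-- The atlas of trivializations. -/
def core : ChartedSpaceCore (X.prod K.toMfd).carrier D.R where
  atlas := Set.range D.chart
  chartAt r := D.chart (D.proj r)
  mem_chart_source r := D.mem (D.proj r)
  chart_mem_atlas r := ⟨_, rfl⟩
  open_source := by
    rintro _ _ ⟨i, rfl⟩ ⟨j, rfl⟩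
    rw [chart_trans_source]
    exact ((D.U i).isOpen.inter (D.U j).isOpen).prod isOpen_univ
  continuousOn_toFun := by
    rintro _ _ ⟨i, rfl⟩ ⟨j, rfl⟩
    exact (D.contMDiffOn_chart_trans i j).continuousOn

instance : TopologicalSpace D.R := D.core.toTopologicalSpace

instance : ChartedSpace (X.prod K.toMfd).carrier D.R := D.core.toChartedSpace

/-- The trivialization over `U i`, as a homeomorphism. -/
def triv (i : X) : OpenPartialHomeomorph D.R (X.prod K.toMfd).carrier :=
  D.core.openPartialHomeomorph (D.chart i) ⟨i, rfl⟩

theorem triv_mem (i : X) : D.triv i ∈ atlas (X.prod K.toMfd).carrier D.R :=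
  Set.mem_iUnion₂.2 ⟨D.chart i, ⟨i, rfl⟩, rfl⟩

theorem smoothChanges : SmoothChanges (X.prod K.toMfd) D.R := by
  intro e he e' he'
  obtain ⟨_, ⟨i, rfl⟩, h⟩ := Set.mem_iUnion₂.1 he
  obtain ⟨_, ⟨j, rfl⟩, h'⟩ := Set.mem_iUnion₂.1 he'
  rw [Set.mem_singleton_iff.1 h, Set.mem_singleton_iff.1 h']
  exact D.contMDiffOn_chart_trans i j

theorem continuous_proj : Continuous D.proj := by
  refine continuous_iff_continuousAt.2 fun r => ?_
  have h := (D.triv (D.proj r)).continuousAt (D.mem (D.proj r))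
  exact continuousAt_fst.comp h

/-- Points over different base points are separated in `X`. Points over the same base point lie in a
common trivialization, whose domain is a full preimage. -/
instance : T2Space D.R := by
  refine ⟨fun r r' hr => ?_⟩
  by_cases h : D.proj r = D.proj r'
  · let e := D.triv (D.proj r)
    have h1 : r ∈ e.source := D.mem (D.proj r)
    have h2 : r' ∈ e.source := by
      change D.proj r' ∈ D.U (D.proj r)
      rw [← h]
      exact D.mem _
    obtain ⟨u, v, hu, hv, hru, hrv, huv⟩ := t2_separation (e.injOn.ne h1 h2 hr)
    refine ⟨_, _, e.isOpen_inter_preimage hu, e.isOpen_inter_preimage hv, ⟨h1, hru⟩, ⟨h2, hrv⟩, ?_⟩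
    exact (huv.preimage e).mono Set.inter_subset_right Set.inter_subset_right
  · obtain ⟨u, v, hu, hv, hru, hrv, huv⟩ := t2_separation h
    exact ⟨_, _, hu.preimage D.continuous_proj, hv.preimage D.continuous_proj, hru, hrv,
      huv.preimage _⟩

/-- Countably many of the sets `U x` cover `X`. The preferred chart at a point is indexed by its
base point, so `s x x` stands for the chart over `U x`. -/
instance : SecondCountableTopology D.R := by
  obtain ⟨t, ht, hc⟩ := TopologicalSpace.countable_cover_nhds (f := fun x : X => (D.U x : Set X))
    fun x => (D.U x).isOpen.mem_nhds (D.mem x)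
  have : SecondCountableTopology (X.prod K.toMfd).carrier := (X.prod K.toMfd).secondCountable
  refine ChartedSpace.secondCountable_of_countable_cover (X.prod K.toMfd).carrier
    (s := (fun x => D.s x x) '' t) ?_ (ht.image _)
  refine Set.eq_univ_of_forall fun r => ?_
  have hr : D.proj r ∈ ⋃ x ∈ t, (D.U x : Set X) := hc ▸ Set.mem_univ _
  obtain ⟨x, hx, hrx⟩ := Set.mem_iUnion₂.1 hr
  refine Set.mem_iUnion₂.2 ⟨D.s x x, ⟨x, hx, rfl⟩, ?_⟩
  change D.proj r ∈ D.U (D.proj (D.s x x))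
  rw [D.proj_s (D.mem x)]
  exact hrx

/-- The total space. -/
def tot : Mfd.{u} :=
  letI := ChartedSpace.comp (X.prod K.toMfd).H (X.prod K.toMfd).carrier D.R
  haveI := D.smoothChanges.isManifold
  { carrier := D.R
    E := (X.prod K.toMfd).E
    H := (X.prod K.toMfd).H
    I := (X.prod K.toMfd).I }

theorem smAt_triv (i : X) {r : D.tot} (h : D.proj r ∈ D.U i) :
    SmAt D.tot (X.prod K.toMfd) (fun r => (D.proj r, D.div (D.s i (D.proj r)) r)) r :=
  ContMDiffOn.contMDiffAt (M := D.tot.carrier) (D.smoothChanges.contMDiffOn (D.triv_mem i))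
    ((D.triv i).open_source.mem_nhds h)

theorem smAt_triv_symm (i : X) {z : X.prod K.toMfd} (h : z.1 ∈ D.U i) :
    SmAt (X.prod K.toMfd) D.tot (fun z => D.act (D.s i z.1) z.2) z :=
  ContMDiffOn.contMDiffAt (M' := D.tot.carrier) (D.smoothChanges.contMDiffOn_symm (D.triv_mem i))
    ((D.triv i).open_target.mem_nhds ⟨h, trivial⟩)

/-- In a trivialization the action is right multiplication in the factor `K`. -/
theorem smooth_act : Sm (D.tot.prod K.toMfd) D.tot (fun z => D.act z.1 z.2) := by
  intro z
  let i := D.proj z.1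
  have h0 := D.smAt_triv i (D.mem i)
  have h1 : SmAt (D.tot.prod K.toMfd) (X.prod K.toMfd)
      (fun z => (D.proj z.1, D.div (D.s i (D.proj z.1)) z.1)) z :=
    SmAt.comp (X := D.tot.prod K.toMfd) (Y := D.tot) (Z := X.prod K.toMfd) (f := fun z => z.1) z
      h0 contMDiffAt_fst
  have h2 : SmAt (D.tot.prod K.toMfd) (X.prod K.toMfd)
      (fun z => (D.proj z.1, D.div (D.s i (D.proj z.1)) z.1 * z.2)) z :=
    SmAt.comp (X := D.tot.prod K.toMfd) (Y := (X.prod K.toMfd).prod K.toMfd)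
      (Z := X.prod K.toMfd) (f := fun z => ((D.proj z.1, D.div (D.s i (D.proj z.1)) z.1), z.2))
      (g := fun y => (y.1.1, y.1.2 * y.2)) z
      ((contMDiffAt_fst.comp _ contMDiffAt_fst).prodMk
        ((contMDiffAt_snd.comp _ contMDiffAt_fst).mul contMDiffAt_snd))
      (h1.prodMk contMDiffAt_snd)
  have h3 := SmAt.comp (X := D.tot.prod K.toMfd) (Y := X.prod K.toMfd) (Z := D.tot) z
    (D.smAt_triv_symm i (D.mem i)) h2
  refine h3.congr ?_
  have h4 : ∀ᶠ y : D.tot.prod K.toMfd in 𝓝 z, D.proj y.1 ∈ D.U i :=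
    (continuous_fst.tendsto z).eventually ((D.triv i).open_source.mem_nhds (D.mem i))
  filter_upwards [h4] with y hy
  exact (congrArg (fun r => D.act r y.2) (D.act_div (D.proj_s hy)).symm).trans
    (D.act_mul _ _ _).symm

/-- The glued bundle. -/
def bundle : PrinBundle K X where
  tot := D.tot
  proj := ⟨D.proj, fun r => SmAt.comp (X := D.tot) (Y := X.prod K.toMfd) (Z := X)
    (g := fun z => z.1) r contMDiffAt_fst (D.smAt_triv (D.proj r) (D.mem _))⟩
  act := D.act
  act_one := D.act_one
  act_mul := D.act_mul
  proj_act := D.proj_act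
  smooth_act := D.smooth_act
  locTriv x := by
    refine ⟨D.U x, D.triv x, D.mem x, (D.U x).isOpen, rfl, rfl, ?_, ?_, fun _ _ => rfl,
      fun r hr k => ?_⟩
    · exact fun r hr => ContMDiffAt.contMDiffWithinAt (M := D.tot.carrier) (D.smAt_triv x hr)
    · exact fun z hz =>
        ContMDiffAt.contMDiffWithinAt (M' := D.tot.carrier) (D.smAt_triv_symm x hz.1)
    · have hr' : D.proj r ∈ D.U x := hr
      refine Prod.ext (D.proj_act r k) ?_
      refine (congrArg (fun y => D.div (D.s x y) (D.act r k)) (D.proj_act r k)).trans ?_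
      exact D.div_act_of_proj (D.proj_s hr') k

theorem smAt_sec {i x : X} (h : x ∈ D.U i) : SmAt X D.tot (D.s i) x := by
  have h1 := SmAt.comp (X := X) (Y := X.prod K.toMfd) (Z := D.tot) (f := fun x => (x, (1 : K))) x
    (D.smAt_triv_symm i (z := (x, 1)) h) (contMDiffAt_id.prodMk contMDiffAt_const)
  exact h1.congr (Filter.Eventually.of_forall fun y => (D.act_one _).symm)

end GlueData

/-! ### Quotients of `F^* Q` -/

variable {G K : LieGrp.{u}} {M : Mfd.{u}} {a : LeftAction G M}

theorem BorelObj.proj_div_act {X : Mfd.{u}} (P : BorelObj a X) (Q : EqBun a K) {b b' : P.tot}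
    {q : Q.tot} (h : P.F b' = Q.proj q) (e : P.proj b = P.proj b') :
    P.F b = Q.proj (Q.gact.act (P.div b b') q) := by
  rw [Q.proj_gact, ← h]
  nth_rewrite 2 [← P.act_div e]
  rw [P.F_act, ← a.mul_act, mul_inv_cancel, a.one_act]

namespace FibProd

variable {Q : EqBun a K} {X Y : Mfd.{u}} {P : BorelObj a X}

open Classical in
/-- The pair `(p, q)` if it belongs to `F^* Q`, and some pair `(p, q')` otherwise. -/
def total (Q : EqBun a K) (P : BorelObj a X) (p : P.tot) (q : Q.tot) : FibProd Q P :=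
  if h : P.F p = Q.proj q then mk p q h
  else mk p (Q.proj_surj (P.F p)).choose (Q.proj_surj (P.F p)).choose_spec.symm

theorem total_eq {p : P.tot} {q : Q.tot} (h : P.F p = Q.proj q) : total Q P p q = mk p q h :=
  dif_pos h

/-- Two points are in the same orbit. -/
def Rel (z z' : FibProd Q P) : Prop :=
  ∃ g : G, z'.1.1 = P.act z.1.1 g⁻¹ ∧ z'.1.2 = Q.gact.act g z.1.2

variable (Q P) in
theorem rel_equivalence : Equivalence (Rel (Q := Q) (P := P)) where
  refl z := ⟨1, by rw [inv_one, P.act_one], by rw [Q.gact.one_act]⟩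
  symm := by
    rintro z z' ⟨g, h1, h2⟩
    refine ⟨g⁻¹, ?_, ?_⟩
    · rw [h1, ← P.act_mul, inv_inv, inv_mul_cancel, P.act_one]
    · rw [h2, ← Q.gact.mul_act, inv_mul_cancel, Q.gact.one_act]
  trans := by
    rintro z z' z'' ⟨g, h1, h2⟩ ⟨g', h1', h2'⟩
    refine ⟨g' * g, ?_, ?_⟩
    · rw [h1', h1, ← P.act_mul, mul_inv_rev]
    · rw [h2', h2, Q.gact.mul_act]

/-- The action of `K`. -/
def act (z : FibProd Q P) (k : K) : FibProd Q P :=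
  mk z.1.1 (Q.act z.1.2 k) (z.2.trans (Q.proj_act z.1.2 k).symm)

/-- The element of `K` which takes the orbit of `(p, q)` to the orbit of `(p', q')`. -/
def div (p : P.tot) (q : Q.tot) (p' : P.tot) (q' : Q.tot) : K :=
  Q.div q (Q.gact.act (P.div p p') q')

/-- An element of `G` moves `p'` to `p`; then the second components lie in one fibre of `Q` and
differ by an element of `K`. -/
theorem rel_div {z z' : FibProd Q P} (h : P.proj z.1.1 = P.proj z'.1.1) :
    Rel (z.act (div z.1.1 z.1.2 z'.1.1 z'.1.2)) z' := by
  refine ⟨(P.div z.1.1 z'.1.1)⁻¹, ?_, ?_⟩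
  · rw [inv_inv]
    exact (P.act_div h).symm
  · have h1 := P.proj_div_act Q z'.2 h
    change _ = Q.gact.act _ (Q.act z.1.2 (Q.div z.1.2 (Q.gact.act _ z'.1.2)))
    rw [Q.act_div (z.2.symm.trans h1), ← Q.gact.mul_act, inv_mul_cancel, Q.gact.one_act]

theorem Rel.act {z z' : FibProd Q P} (h : Rel z z') (k : K) : Rel (z.act k) (z'.act k) := by
  obtain ⟨g, h1, h2⟩ := h
  refine ⟨g, h1, ?_⟩
  change Q.act z'.1.2 k = Q.gact.act g (Q.act z.1.2 k)
  rw [h2, Q.gact_act]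

theorem Rel.proj {z z' : FibProd Q P} (h : Rel z z') : P.proj z.1.1 = P.proj z'.1.1 := by
  obtain ⟨g, h1, -⟩ := h
  rw [h1, P.proj_act]

/-- The action of `G` on `P` is free, so the element relating two pairs with the same first
component is `1`. Freeness then reduces to `Q`. -/
theorem rel_act_free {z : FibProd Q P} {k l : K} (h : Rel (z.act k) (z.act l)) : k = l := by
  obtain ⟨g, h1, h2⟩ := h
  have h3 : g⁻¹ = 1 := P.act_free (p := z.1.1) (h1.symm.trans (P.act_one _).symm)
  rw [inv_eq_one.1 h3, Q.gact.one_act] at h2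
  exact Q.act_free h2.symm

theorem smAt_div {b b' : Y → P.tot} {c c' : Y → Q.tot} {y : Y} (hb : SmAt Y P.tot b y)
    (hc : SmAt Y Q.tot c y) (hb' : SmAt Y P.tot b' y) (hc' : SmAt Y Q.tot c' y)
    (h : ∀ᶠ z in 𝓝 y, P.F (b z) = Q.proj (c z)) (h' : ∀ᶠ z in 𝓝 y, P.F (b' z) = Q.proj (c' z))
    (hp : ∀ᶠ z in 𝓝 y, P.proj (b z) = P.proj (b' z)) :
    SmAt Y K.toMfd (fun z => div (b z) (c z) (b' z) (c' z)) y := by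
  refine Q.smAt_div hc (Q.gact.smAt_act (P.smAt_div hb hb' hp) hc') ?_
  filter_upwards [h, h', hp] with z h1 h2 h3
  exact h1.symm.trans (P.proj_div_act Q h2 h3)

end FibProd

/-- Compatible local sections of `P` and `Q`. -/
structure PairSec (Q : EqBun a K) {X : Mfd.{u}} (P : BorelObj a X) where
  U : TopologicalSpace.Opens X
  b : X → P.tot
  c : X → Q.tot
  smooth_b : ∀ x ∈ U, SmAt X P.tot b x
  smooth_c : ∀ x ∈ U, SmAt X Q.tot c x
  proj_b : ∀ x ∈ U, P.proj (b x) = x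
  compat : ∀ x ∈ U, P.F (b x) = Q.proj (c x)

/-- A local section `σ` of `P`, together with a local section of `Q` evaluated along `F ∘ σ`. -/
theorem exists_pairSec (Q : EqBun a K) {X : Mfd.{u}} (P : BorelObj a X) (x : X) :
    ∃ σ : PairSec Q P, x ∈ σ.U := by
  obtain ⟨σ, hσ⟩ := P.exists_locSec x
  obtain ⟨τ, hτ⟩ := Q.exists_locSec (P.F (σ.s x))
  have hF : ∀ y ∈ σ.U, SmAt X M (fun y => P.F (σ.s y)) y := fun y hy =>
    SmAt.comp y (P.F.smAt _) (σ.smooth_s y hy)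
  have ho : IsOpen ((σ.U : Set X) ∩ (fun y => P.F (σ.s y)) ⁻¹' τ.U) :=
    ContinuousOn.isOpen_inter_preimage (fun y hy => (hF y hy).continuousAt.continuousWithinAt)
      σ.U.isOpen τ.U.isOpen
  exact ⟨⟨⟨_, ho⟩, σ.s, fun y => τ.s (P.F (σ.s y)), fun y hy => σ.smooth_s y hy.1,
    fun y hy => SmAt.comp y (τ.smooth_s _ hy.2) (hF y hy.1), fun y hy => σ.proj_s y hy.1,
    fun y hy => (τ.proj_s _ hy.2).symm⟩, hσ, hτ⟩

/-! #### Construction of the quotient -/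

section Construction

variable (Q : EqBun a K) {X : Mfd.{u}} (P : BorelObj a X)

/-- The set of orbits. -/
def Orbits : Type u := _root_.Quotient (⟨FibProd.Rel, FibProd.rel_equivalence Q P⟩ :
  Setoid (FibProd Q P))

variable {Q P} in
/-- The orbit of a point. -/
def Orbits.mk (z : FibProd Q P) : Orbits Q P := _root_.Quotient.mk _ z

namespace Orbits

variable {Q P}

theorem mk_eq_iff {z z' : FibProd Q P} : mk z = mk z' ↔ FibProd.Rel z z' := _root_.Quotient.eq

theorem mk_surjective : Function.Surjective (mk (Q := Q) (P := P)) := _root_.Quotient.mk_surjective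

/-- The projection. -/
def proj : Orbits Q P → X := _root_.Quotient.lift (fun z => P.proj z.1.1) fun _ _ (h : FibProd.Rel _ _) => h.proj

/-- The action of `K`. -/
def act (r : Orbits Q P) (k : K) : Orbits Q P :=
  _root_.Quotient.lift (fun z => mk (FibProd.act z k)) (fun _ _ (h : FibProd.Rel _ _) =>
    mk_eq_iff.2 (h.act k)) r

/-- A representative. -/
def out (r : Orbits Q P) : FibProd Q P := _root_.Quotient.out r

theorem mk_out (r : Orbits Q P) : mk r.out = r := _root_.Quotient.out_eq r

/-- The quotient of two elements. -/
def div (r r' : Orbits Q P) : K := FibProd.div r.out.1.1 r.out.1.2 r'.out.1.1 r'.out.1.2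

theorem act_div {r r' : Orbits Q P} (h : proj r = proj r') : act r (div r r') = r' := by
  have h1 : P.proj r.out.1.1 = P.proj r'.out.1.1 := by
    rw [← mk_out r, ← mk_out r'] at h
    exact h
  calc act r (div r r') = act (mk r.out) (div r r') := by rw [mk_out]
    _ = mk r'.out := mk_eq_iff.2 (FibProd.rel_div h1)
    _ = r' := mk_out r'

theorem act_free {r : Orbits Q P} {k l : K} (h : act r k = act r l) : k = l := by
  obtain ⟨z, rfl⟩ := mk_surjective r
  exact FibProd.rel_act_free (mk_eq_iff.1 h)

theorem proj_act (r : Orbits Q P) (k : K) : proj (act r k) = proj r := by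
  obtain ⟨z, rfl⟩ := mk_surjective r
  rfl

theorem mk_act_div {z z' : FibProd Q P} (h : P.proj z.1.1 = P.proj z'.1.1) :
    act (mk z) (FibProd.div z.1.1 z.1.2 z'.1.1 z'.1.2) = mk z' :=
  mk_eq_iff.2 (FibProd.rel_div h)

theorem div_mk {z z' : FibProd Q P} (h : P.proj z.1.1 = P.proj z'.1.1) :
    div (mk z) (mk z') = FibProd.div z.1.1 z.1.2 z'.1.1 z'.1.2 :=
  act_free ((act_div (show proj (mk z) = proj (mk z') from h)).trans (mk_act_div h).symm)

end Orbits

/-- The gluing data of the quotient. -/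
def orbitData : GlueData K X where
  R := Orbits Q P
  proj := Orbits.proj
  act := Orbits.act
  act_one r := by
    obtain ⟨z, rfl⟩ := Orbits.mk_surjective r
    refine congrArg Orbits.mk (Subtype.ext (Prod.ext rfl ?_))
    exact Q.act_one _
  act_mul r k l := by
    obtain ⟨z, rfl⟩ := Orbits.mk_surjective r
    refine congrArg Orbits.mk (Subtype.ext (Prod.ext rfl ?_))
    exact Q.act_mul _ _ _
  proj_act := Orbits.proj_act
  div := Orbits.div
  act_div := Orbits.act_div
  div_act r k := Orbits.act_free (Orbits.act_div (Orbits.proj_act r k).symm)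
  U i := (exists_pairSec Q P i).choose.U
  mem i := (exists_pairSec Q P i).choose_spec
  s i x := Orbits.mk (FibProd.total Q P ((exists_pairSec Q P i).choose.b x)
    ((exists_pairSec Q P i).choose.c x))
  proj_s {i x} hx := by
    rw [FibProd.total_eq ((exists_pairSec Q P i).choose.compat x hx)]
    exact (exists_pairSec Q P i).choose.proj_b x hx
  smooth {i j x} hi hj := by
    let σ := (exists_pairSec Q P i).choose
    let τ := (exists_pairSec Q P j).choose
    have h1 : ∀ᶠ y in 𝓝 x, y ∈ σ.U := σ.U.isOpen.mem_nhds hi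
    have h2 : ∀ᶠ y in 𝓝 x, y ∈ τ.U := τ.U.isOpen.mem_nhds hj
    have h3 : ∀ᶠ y in 𝓝 x, P.proj (σ.b y) = P.proj (τ.b y) := by
      filter_upwards [h1, h2] with y hy hy'
      exact (σ.proj_b y hy).trans (τ.proj_b y hy').symm
    refine (FibProd.smAt_div (σ.smooth_b x hi) (σ.smooth_c x hi) (τ.smooth_b x hj)
      (τ.smooth_c x hj) (h1.mono σ.compat) (h2.mono τ.compat) h3).congr ?_
    filter_upwards [h1, h2, h3] with y hy hy' hy3
    change Orbits.div (Orbits.mk (FibProd.total Q P (σ.b y) (σ.c y)))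
      (Orbits.mk (FibProd.total Q P (τ.b y) (τ.c y))) = _
    rw [FibProd.total_eq (σ.compat y hy), FibProd.total_eq (τ.compat y hy'), Orbits.div_mk hy3]

/-- The quotient bundle `(F^* Q) / G`. -/
def quotBundle : PrinBundle K X := (orbitData Q P).bundle

/-- The quotient map. -/
def quotBundleQuotient : Quotient Q P (quotBundle Q P) where
  quo := Orbits.mk
  surj := Orbits.mk_surjective
  fibre _ _ := Orbits.mk_eq_iff
  quo_act _ _ _ _ := rfl
  proj_quo _ := rfl
  smooth Y b c h := by
    intro y
    obtain ⟨σ, hσ⟩ : ∃ σ : PairSec Q P, σ = (exists_pairSec Q P (P.proj (b y))).choose := ⟨_, rfl⟩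
    have hx : P.proj (b y) ∈ σ.U := hσ ▸ (exists_pairSec Q P (P.proj (b y))).choose_spec
    have hp : SmAt Y X (fun y => P.proj (b y)) y := SmAt.comp y (P.proj.smAt _) (b.smAt y)
    have h1 : ∀ᶠ z in 𝓝 y, P.proj (b z) ∈ σ.U := hp.eventually (σ.U.isOpen.mem_nhds hx)
    have h2 : ∀ᶠ z in 𝓝 y, P.proj (σ.b (P.proj (b z))) = P.proj (b z) := h1.mono fun z hz =>
      σ.proj_b _ hz
    have h3 : SmAt X (quotBundle Q P).tot
        (fun x => Orbits.mk (FibProd.total Q P (σ.b x) (σ.c x))) (P.proj (b y)) := by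
      subst hσ
      exact (orbitData Q P).smAt_sec (i := P.proj (b y)) hx
    have h4 := FibProd.smAt_div (SmAt.comp y (σ.smooth_b _ hx) hp)
      (SmAt.comp y (σ.smooth_c _ hx) hp) (b.smAt y) (c.smAt y)
      (h1.mono fun z hz => σ.compat _ hz) (Filter.Eventually.of_forall h) h2
    -- The class of `(b, c)` is the class of the section pair times the smooth division function.
    refine ((quotBundle Q P).smAt_act (SmAt.comp y h3 hp) h4).congr ?_
    filter_upwards [h1, h2] with z hz hz2
    have h5 := Orbits.mk_act_div (z := FibProd.mk _ _ (σ.compat _ hz))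
      (z' := FibProd.mk _ _ (h z)) hz2
    exact h5.symm.trans (congrArg (fun w => Orbits.act (Orbits.mk w) _)
      (FibProd.total_eq (σ.compat _ hz)).symm)

end Construction

/-! ### Properties of quotients -/

variable {G K : LieGrp.{u}} {M : Mfd.{u}} {a : LeftAction G M}

namespace Quotient

variable {Q Q' : EqBun a K} {X Y Z : Mfd.{u}} {P : BorelObj a X} {P' : BorelObj a Y}
  {R : PrinBundle K X} {R' : PrinBundle K Y} (τ : Quotient Q P R)

/-- The class of the pair `(p, q)`. -/
def cls (p : P.tot) (q : Q.tot) : R.tot := τ.quo (FibProd.total Q P p q)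

theorem cls_eq {p : P.tot} {q : Q.tot} (h : P.F p = Q.proj q) :
    τ.cls p q = τ.quo (FibProd.mk p q h) := congrArg τ.quo (FibProd.total_eq h)

theorem proj_cls {p : P.tot} {q : Q.tot} (h : P.F p = Q.proj q) : R.proj (τ.cls p q) = P.proj p := by
  rw [τ.cls_eq h, τ.proj_quo]

theorem cls_act {p : P.tot} {q : Q.tot} (h : P.F p = Q.proj q) (k : K) :
    τ.cls p (Q.act q k) = R.act (τ.cls p q) k := by
  rw [τ.cls_eq h, τ.cls_eq (h.trans (Q.proj_act q k).symm), τ.quo_act p q h]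

theorem cls_act_div {p p' : P.tot} {q q' : Q.tot} (h : P.F p = Q.proj q) (h' : P.F p' = Q.proj q')
    (e : P.proj p = P.proj p') :
    R.act (τ.cls p q) (FibProd.div p q p' q') = τ.cls p' q' := by
  rw [← τ.cls_act h, τ.cls_eq (h.trans (Q.proj_act q _).symm), τ.cls_eq h']
  exact (τ.fibre _ _).2 (FibProd.rel_div (z := FibProd.mk p q h) (z' := FibProd.mk p' q' h') e)

/-- The smoothness required of a quotient concerns families defined on a whole manifold. The section
pair is therefore restricted to the open submanifold `U`, and smoothness is carried back to `X` by
the retraction. -/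
theorem smAt_sec (σ : PairSec Q P) {x : X} (hx : x ∈ σ.U) :
    SmAt X R.tot (fun x => τ.cls (σ.b x) (σ.c x)) x := by
  let b' : Map (X.opn σ.U) P.tot := ⟨fun x => σ.b x, fun x =>
    SmAt.comp (X := X.opn σ.U) (f := X.incl σ.U) x (σ.smooth_b _ x.2) ((X.incl σ.U).smAt x)⟩
  let c' : Map (X.opn σ.U) Q.tot := ⟨fun x => σ.c x, fun x =>
    SmAt.comp (X := X.opn σ.U) (f := X.incl σ.U) x (σ.smooth_c _ x.2) ((X.incl σ.U).smAt x)⟩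
  have h1 := τ.smooth (X.opn σ.U) b' c' fun x => σ.compat x x.2
  have h2 := SmAt.comp (X := X) (Y := X.opn σ.U) (Z := R.tot) (f := X.retr σ.U ⟨x, hx⟩) x (h1 _)
    (X.smAt_retr σ.U ⟨x, hx⟩ hx)
  refine h2.congr ?_
  filter_upwards [σ.U.isOpen.mem_nhds hx] with y hy
  refine (τ.cls_eq (σ.compat y hy)).trans ?_
  have h3 : X.retr σ.U ⟨x, hx⟩ y = ⟨y, hy⟩ := X.retr_of_mem σ.U ⟨x, hx⟩ hy
  rw [h3]
  rfl

/-- The quotient map takes smooth families of points to smooth families. -/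
theorem smAt_cls {b : Z → P.tot} {c : Z → Q.tot} {z : Z} (hb : SmAt Z P.tot b z)
    (hc : SmAt Z Q.tot c z) (h : ∀ᶠ y in 𝓝 z, P.F (b y) = Q.proj (c y)) :
    SmAt Z R.tot (fun y => τ.cls (b y) (c y)) z := by
  obtain ⟨σ, hσ⟩ := exists_pairSec Q P (P.proj (b z))
  have hp : SmAt Z X (fun y => P.proj (b y)) z := SmAt.comp z (P.proj.smAt _) hb
  have h1 : ∀ᶠ y in 𝓝 z, P.proj (b y) ∈ σ.U := hp.eventually (σ.U.isOpen.mem_nhds hσ)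
  have h2 : ∀ᶠ y in 𝓝 z, P.proj (σ.b (P.proj (b y))) = P.proj (b y) := h1.mono fun z hz =>
    σ.proj_b _ hz
  have h3 := FibProd.smAt_div (SmAt.comp z (σ.smooth_b _ hσ) hp)
    (SmAt.comp z (σ.smooth_c _ hσ) hp) hb hc (h1.mono fun z hz => σ.compat _ hz) h h2
  refine (R.smAt_act (SmAt.comp z (τ.smAt_sec σ hσ) hp) h3).congr ?_
  filter_upwards [h1, h2, h] with y hy hy2 hy3
  exact (τ.cls_act_div (σ.compat _ hy) hy3 hy2).symm

/-- A local lift of the points of the quotient to `F^* Q`. -/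
structure Lift where
  U : TopologicalSpace.Opens X
  b : R.tot → P.tot
  c : R.tot → Q.tot
  smooth_b : ∀ r, R.proj r ∈ U → SmAt R.tot P.tot b r
  smooth_c : ∀ r, R.proj r ∈ U → SmAt R.tot Q.tot c r
  compat : ∀ r, R.proj r ∈ U → P.F (b r) = Q.proj (c r)
  cls_lift : ∀ r, R.proj r ∈ U → τ.cls (b r) (c r) = r

/-- Start from a section pair at `π(r)` and correct the second component by the element of `K` which
takes its class to `r`. -/
theorem exists_lift (x : X) : ∃ L : Lift τ, x ∈ L.U := by
  obtain ⟨σ, hσ⟩ := exists_pairSec Q P x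
  have hb : ∀ r, R.proj r ∈ σ.U → SmAt R.tot P.tot (fun r => σ.b (R.proj r)) r := fun r hr =>
    SmAt.comp r (σ.smooth_b _ hr) (R.proj.smAt r)
  have hpr : ∀ r, R.proj r ∈ σ.U → R.proj (τ.cls (σ.b (R.proj r)) (σ.c (R.proj r))) = R.proj r :=
    fun r hr => (τ.proj_cls (σ.compat _ hr)).trans (σ.proj_b _ hr)
  refine ⟨⟨σ.U, fun r => σ.b (R.proj r), fun r => Q.act (σ.c (R.proj r))
    (R.div (τ.cls (σ.b (R.proj r)) (σ.c (R.proj r))) r), hb, fun r hr => ?_, fun r hr => ?_,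
    fun r hr => ?_⟩, hσ⟩
  · refine Q.smAt_act (SmAt.comp r (σ.smooth_c _ hr) (R.proj.smAt r)) (R.smAt_div
      (SmAt.comp r (τ.smAt_sec σ hr) (R.proj.smAt r)) (smAt_id r) ?_)
    exact ((R.proj.smAt r).eventually (σ.U.isOpen.mem_nhds hr)).mono hpr
  · rw [Q.proj_act]
    exact σ.compat _ hr
  · rw [τ.cls_act (σ.compat _ hr), R.act_div (hpr r hr)]

variable {τ} in
theorem Lift.eventually (L : Lift τ) {r : R.tot} (hr : R.proj r ∈ L.U) :
    ∀ᶠ r' in 𝓝 r, R.proj r' ∈ L.U :=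
  (R.proj.smAt r).eventually (L.U.isOpen.mem_nhds hr)

/-- A map from the quotient is smooth if the induced map from `F^* Q` is. -/
theorem smAt_desc {f : R.tot → Z} (h : ∀ (b : R.tot → P.tot) (c : R.tot → Q.tot) (r : R.tot),
    SmAt R.tot P.tot b r → SmAt R.tot Q.tot c r → (∀ᶠ r' in 𝓝 r, P.F (b r') = Q.proj (c r')) →
    SmAt R.tot Z (fun r => f (τ.cls (b r) (c r))) r) : Sm R.tot Z f := by
  intro r
  obtain ⟨L, hL⟩ := τ.exists_lift (R.proj r)
  refine SmAt.congr (h L.b L.c r (L.smooth_b r hL) (L.smooth_c r hL)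
    ((L.eventually hL).mono L.compat)) ?_
  exact (L.eventually hL).mono fun r' hr => congrArg f (L.cls_lift r' hr).symm

/-- Families of points with the same classes differ by a smooth family of elements of `G`. -/
theorem exists_gact {b b' : Z → P.tot} {c c' : Z → Q.tot} {z : Z} (hb : SmAt Z P.tot b z)
    (hb' : SmAt Z P.tot b' z) (h : ∀ᶠ y in 𝓝 z, P.F (b y) = Q.proj (c y))
    (h' : ∀ᶠ y in 𝓝 z, P.F (b' y) = Q.proj (c' y))
    (e : ∀ᶠ y in 𝓝 z, τ.cls (b y) (c y) = τ.cls (b' y) (c' y)) :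
    ∃ g : Z → G, SmAt Z G.toMfd g z ∧ (∀ᶠ y in 𝓝 z, b' y = P.act (b y) (g y)⁻¹) ∧
      ∀ᶠ y in 𝓝 z, c' y = Q.gact.act (g y) (c y) := by
  have h1 : ∀ᶠ y in 𝓝 z, ∃ g : G, b' y = P.act (b y) g⁻¹ ∧ c' y = Q.gact.act g (c y) := by
    filter_upwards [h, h', e] with y h1 h2 h3
    rw [τ.cls_eq h1, τ.cls_eq h2] at h3
    exact (τ.fibre _ _).1 h3
  have h2 : ∀ᶠ y in 𝓝 z, b' y = P.act (b y) (P.div (b y) (b' y)) ∧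
      c' y = Q.gact.act (P.div (b y) (b' y))⁻¹ (c y) := by
    filter_upwards [h1] with y hy
    obtain ⟨g, h1, h2⟩ := hy
    have h3 : P.div (b y) (b' y) = g⁻¹ := P.div_eq h1.symm
    rw [h3, inv_inv]
    exact ⟨h1, h2⟩
  refine ⟨fun y => (P.div (b y) (b' y))⁻¹, (P.smAt_div hb hb' ?_).inv, ?_, ?_⟩
  · filter_upwards [h2] with y hy
    rw [hy.1, P.proj_act]
  · filter_upwards [h2] with y hy
    rw [inv_inv]
    exact hy.1
  · exact h2.mono fun y hy => hy.2

variable {τ}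

/-- The map of quotients induced by a morphism in the Borel quotient stack and a morphism of
equivariant bundles. -/
theorem exists_desc {u : Map X Y} (τ : Quotient Q P R) (τ' : Quotient Q' P' R')
    (φ : BorelHom u P P') (ψ : EqHom Q Q') : ∃ χ : BunHom u R R',
      ∀ z, χ.map (τ.quo z) = τ'.quo (FibProd.mapRight ψ (FibProd.mapLeft Q φ z)) := by
  let T : FibProd Q P → FibProd Q' P' := fun z => FibProd.mapRight ψ (FibProd.mapLeft Q φ z)
  let f : R.tot → R'.tot := fun r => τ'.quo (T (τ.surj r).choose)
  have hf : ∀ z, f (τ.quo z) = τ'.quo (T z) := by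
    intro z
    -- The chosen representative and `z` differ by an element of `G`, and `φ` and `ψ` are
    -- equivariant, so the images have the same class.
    obtain ⟨g, h1, h2⟩ := (τ.fibre _ _).1 (τ.surj (τ.quo z)).choose_spec
    refine (τ'.fibre _ _).2 ⟨g, ?_, ?_⟩
    · exact (congrArg φ.map h1).trans (φ.map_act _ _)
    · exact (congrArg ψ.map h2).trans (ψ.map_gact _ _)
  have hs : Sm R.tot R'.tot f := by
    refine τ.smAt_desc fun b c r hb hc h => ?_
    refine (τ'.smAt_cls (b := fun r => φ.map (b r)) (c := fun r => ψ.map (c r))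
      (SmAt.comp r (φ.map.smAt _) hb) (SmAt.comp r (ψ.map.smAt _) hc) ?_).congr ?_
    · exact h.mono fun r hr => (T (FibProd.mk _ _ hr)).2
    · refine h.mono fun r hr => ?_
      change f (τ.cls (b r) (c r)) = _
      rw [τ.cls_eq hr, hf]
      exact (τ'.cls_eq (T (FibProd.mk _ _ hr)).2).symm
  refine ⟨⟨⟨f, hs⟩, fun r k => ?_, fun r => ?_⟩, hf⟩
  · obtain ⟨z, rfl⟩ := τ.surj r
    change f (R.act (τ.quo z) k) = R'.act (f (τ.quo z)) k
    have h1 := τ.quo_act z.1.1 z.1.2 z.2 k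
    refine (congrArg f h1.symm).trans ((hf _).trans ?_)
    rw [hf]
    refine Eq.trans ?_ (τ'.quo_act (T z).1.1 (T z).1.2 (T z).2 k)
    exact congrArg τ'.quo (Subtype.ext (Prod.ext rfl (ψ.map_act _ _)))
  · obtain ⟨z, rfl⟩ := τ.surj r
    change R'.proj (f (τ.quo z)) = _
    rw [hf, τ'.proj_quo, τ.proj_quo]
    exact φ.proj_map _

/-- The induced map of quotients. -/
def desc {u : Map X Y} (τ : Quotient Q P R) (τ' : Quotient Q' P' R')
    (φ : BorelHom u P P') (ψ : EqHom Q Q') : BunHom u R R' := (exists_desc τ τ' φ ψ).choose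

theorem map_desc {u : Map X Y} (τ : Quotient Q P R) (τ' : Quotient Q' P' R')
    (φ : BorelHom u P P') (ψ : EqHom Q Q') (z : FibProd Q P) :
    (desc τ τ' φ ψ).map (τ.quo z) = τ'.quo (FibProd.mapRight ψ (FibProd.mapLeft Q φ z)) :=
  (exists_desc τ τ' φ ψ).choose_spec z

theorem hom_ext (τ : Quotient Q P R) {u : Map X Y} {χ χ' : BunHom u R R'}
    (h : ∀ z, χ.map (τ.quo z) = χ'.map (τ.quo z)) : χ = χ' := by
  refine BunHom.ext (ContMDiffMap.ext fun r => ?_)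
  obtain ⟨z, rfl⟩ := τ.surj r
  exact h z

theorem desc_id (τ : Quotient Q P R) : desc τ τ (BorelHom.id P) (EqHom.id Q) = BunHom.id R :=
  τ.hom_ext fun z => τ.map_desc τ _ _ z

theorem desc_comp {X₃ : Mfd.{u}} {Q₃ : EqBun a K} {P₃ : BorelObj a X₃} {R₃ : PrinBundle K X₃}
    (τ : Quotient Q P R) (τ' : Quotient Q' P' R') (τ₃ : Quotient Q₃ P₃ R₃) {u : Map X Y}
    {u' : Map Y X₃} (φ : BorelHom u P P') (φ' : BorelHom u' P' P₃) (ψ : EqHom Q Q')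
    (ψ' : EqHom Q' Q₃) :
    (desc τ τ' φ ψ).comp (desc τ' τ₃ φ' ψ') = desc τ τ₃ (φ.comp φ') (ψ.comp ψ') := by
  refine τ.hom_ext fun z => ?_
  refine (congrArg (desc τ' τ₃ φ' ψ').map (map_desc τ τ' φ ψ z)).trans ?_
  exact (map_desc τ' τ₃ φ' ψ' _).trans (map_desc τ τ₃ (φ.comp φ') (ψ.comp ψ') z).symm

end Quotient

/-- The associated bundles, for a given choice of quotients. -/
def assocFunctor : AssocFunctor a K where
  functor :=
    { obj := fun Q =>
        { obj := fun P => quotBundle Q P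
          map := fun φ => Quotient.desc (quotBundleQuotient Q _) (quotBundleQuotient Q _) φ
            (EqHom.id Q)
          map_id := fun P => (quotBundleQuotient Q P).desc_id
          map_comp := fun φ ψ => (Quotient.desc_comp _ _ _ φ ψ (EqHom.id Q) (EqHom.id Q)).symm }
      map := fun {Q Q'} ψ =>
        { app := fun P => Quotient.desc (quotBundleQuotient Q P) (quotBundleQuotient Q' P)
            (BorelHom.id P) ψ
          naturality := fun φ => (Quotient.desc_comp _ _ _ φ (BorelHom.id _) (EqHom.id Q) ψ).trans
            (Quotient.desc_comp _ _ _ (BorelHom.id _) φ ψ (EqHom.id Q')).symm }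
      map_id := fun Q => Trans.ext (by
        funext X P
        exact (quotBundleQuotient Q P).desc_id)
      map_comp := fun ψ ψ' => Trans.ext (by
        funext X P
        exact (Quotient.desc_comp _ _ _ (BorelHom.id P) (BorelHom.id P) ψ ψ').symm) }
  quotient Q _ P := quotBundleQuotient Q P
  map_quo Q _ _ _ _ _ φ z := Quotient.map_desc _ _ φ (EqHom.id Q) z
  app_quo ψ _ P z := Quotient.map_desc _ _ (BorelHom.id P) ψ z

/-! ### Induced connections on quotients -/

variable {G K : LieGrp.{u}} {M : Mfd.{u}} {a : LeftAction G M}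

namespace EqBunConn

variable (Q : EqBunConn a K)

/-- The values of the connection on the fundamental vector fields of the action of `G`. -/
def moment (q : Q.tot) : G.Lie →L[ℝ] K.Lie :=
  -(Q.conn.val (Q.gact.orb q 1)).comp (der (Q.gact.orb q) (1 : G))

theorem moment_apply (q : Q.tot) (A : G.Lie) :
    (Q.moment q A : K.E) = Q.conn.val q (Q.gact.fund A q) := by
  rw [Q.gact.fund_eq]
  refine Eq.trans ?_ ((Q.conn.val q).map_neg _).symm
  exact congrArg Neg.neg (Q.conn.toOneForm.val_congr (Q.gact.one_act q) _)

/-- Translation by `g` carries `ρ(A)` to `ρ(Ad_g A)` and preserves the connection. -/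
theorem moment_gact (g : G) (q : Q.tot) (A : G.Lie) :
    (Q.moment (Q.gact.act g q) (G.Ad g A) : K.E) = Q.moment q A := by
  rw [moment_apply, moment_apply, Q.gact.fund_Ad]
  exact congrArg (fun (β : ∀ q : Q.tot, Q.tot.T q →L[ℝ] K.Lie) => β q (Q.gact.fund A q))
    (Q.invariant g)

theorem moment_act (q : Q.tot) (k : K) (A : G.Lie) :
    (Q.moment (Q.act q k) A : K.E) = K.Ad k⁻¹ (Q.moment q A) := by
  rw [moment_apply, moment_apply]
  have h := LeftAction.fund_map (a := Q.gact) (b := Q.gact) (Q.ract k)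
    (fun g q => (Q.gact_act g q k).symm) A q
  exact (congrArg (Q.conn.val (Q.act q k)) h).trans (Q.conn.equivariant q k _)

/-- Up to sign the moment is the connection form pulled back by the action map `G × Q → Q`,
evaluated on the smooth family of tangent vectors `(A, 0)` at `(1, q)`. -/
theorem moment_smooth : ContMDiff (𝓘(ℝ, G.E).prod Q.tot.I) 𝓘(ℝ, K.E) ∞
    (fun z : G.E × Q.tot => (Q.moment z.2 z.1 : K.E)) := by
  let m : Map (G.toMfd.prod Q.tot) Q.tot := ⟨fun z => Q.gact.act z.1 z.2, Q.gact.smooth⟩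
  have hz : ContMDiff (𝓘(ℝ, G.E).prod Q.tot.I) Q.tot.I.tangent ∞
      (fun z : G.E × Q.tot => (⟨z.2, 0⟩ : TangentBundle Q.tot.I Q.tot)) :=
    (Bundle.contMDiff_zeroSection ℝ (TangentSpace Q.tot.I : Q.tot → Type _)).comp contMDiff_snd
  have hA : ContMDiff (𝓘(ℝ, G.E).prod Q.tot.I) G.I.tangent ∞
      (fun z : G.E × Q.tot => (⟨(1 : G), z.1⟩ : TangentBundle G.I G)) := by
    intro z
    refine Bundle.contMDiffAt_totalSpace.2 ⟨contMDiffAt_const, ?_⟩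
    refine contMDiffAt_fst.congr_of_eventuallyEq (Filter.Eventually.of_forall fun s => ?_)
    exact tangentCoordChange_self (I := G.I) (x := (1 : G)) (z := (1 : G)) (v := s.1)
      (mem_extChartAt_source (1 : G))
  have hc := (Q.conn.toOneForm.pull m).smooth.comp ((contMDiff_equivTangentBundleProd_symm
    (I := G.I) (M := G) (I' := Q.tot.I) (M' := Q.tot)).comp (hA.prodMk hz))
  refine hc.neg.congr fun z => congrArg Neg.neg ?_
  refine congrArg (Q.conn.val (Q.gact.act 1 z.2)) ?_
  refine Eq.trans ?_ (mfderiv_prod_eq_add_apply (v := ((z.1, 0) : G.E × Q.tot.E))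
    (m.mdiff ((1 : G), z.2))).symm
  have h0 : der (X := Q.tot) (Y := Q.tot) (fun q => m ((1 : G), q)) z.2 (0 : Q.tot.E) = 0 :=
    map_zero _
  exact ((congrArg (fun s : Q.tot.E => @HAdd.hAdd Q.tot.E Q.tot.E Q.tot.E _
    (der (X := G.toMfd) (Y := Q.tot) (fun g => m (g, z.2)) (1 : G) z.1) s) h0).trans
    (add_zero (M := Q.tot.E) _)).symm

theorem contMDiffOn_moment {E H N : Type u} [NormedAddCommGroup E]
    [NormedSpace ℝ E] [TopologicalSpace H] {I : ModelWithCorners ℝ E H} [TopologicalSpace N] [ChartedSpace H N]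
    {A : N → G.E} {c : N → Q.tot} {s : Set N} (hA : ContMDiffOn I 𝓘(ℝ, G.E) ∞ A s)
    (hc : ContMDiffOn I Q.tot.I ∞ c s) :
    ContMDiffOn I 𝓘(ℝ, K.E) ∞ (fun x => (Q.moment (c x) (A x) : K.E)) s :=
  have h := Q.moment_smooth.comp_contMDiffOn (hA.prodMk hc)
  h

end EqBunConn

/-! ### The form on `F^* Q` and its behaviour under `G` -/

section Induced

variable (Q : EqBunConn a K) {X Y Z : Mfd.{u}} {P : BorelObj a X} (η : OneForm P.tot G.Lie)

/-- The value of the form `(1 - ι_{ρ(η)}) F^* Θ_Q` on the derivative of a family of points of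
`F^* Q`. -/
def indVal (b : Z → P.tot) (c : Z → Q.tot) (z : Z) (w : Z.T z) : K.E :=
  @HSub.hSub K.E K.E K.E _ (Q.conn.val (c z) (der (X := Z) (Y := Q.tot) c z w))
    (Q.moment (c z) (η.val (b z) (der (X := Z) (Y := P.tot) b z w)))

/-- The form `(1 - ι_{ρ(η)}) F^* Θ_Q` descends to the quotient. -/
def Descends : Prop := ∀ (Z : Mfd.{u}) (b : Z → P.tot) (g : Z → G) (z : Z) (w : Z.T z) (q : Q.tot),
  SmAt Z P.tot b z → SmAt Z G.toMfd g z →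
  (Q.moment (Q.gact.act (g z) q) (η.val (P.act (b z) (g z)⁻¹)
      (der (X := Z) (Y := P.tot) (fun z => P.act (b z) (g z)⁻¹) z w)) : K.E)
    = Q.moment q (@HSub.hSub G.E G.E G.E _ (η.val (b z) (der (X := Z) (Y := P.tot) b z w))
        (G.mc (g z) (der (X := Z) (Y := G.toMfd) g z w)))

theorem descends_zero (hQ : IsBasic a K Q) : Descends Q (OneForm.zero P.tot G.Lie) := by
  intro Z b g z w q _ _
  rw [EqBunConn.moment_apply, EqBunConn.moment_apply]
  exact (hQ _ _).trans (hQ _ _).symm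

/-- On the derivative of `b g⁻¹` the connection form is `Ad_g` of its value on the derivative of `b`
minus the Maurer-Cartan form of `g`. The equivariance of the moment absorbs `Ad_g`. -/
theorem descends_conn {P : BorelConnObj a X} :
    Descends Q (P := P.toBorelObj) P.conn.toOneForm := by
  intro Z b g z w q hb hg
  have h1 := P.conn.val_der_act (k := fun z => (g z)⁻¹) hb.diff (SmAt.diff hg.inv) w
  have h2 : (P.conn.val (P.act (b z) (g z)⁻¹)
      (der (X := Z) (Y := P.tot) (fun z => P.act (b z) (g z)⁻¹) z w) : G.E)
      = G.Ad (g z) (@HSub.hSub G.E G.E G.E _ (P.conn.val (b z) (der (X := Z) (Y := P.tot) b z w))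
        (G.mc (g z) (der (X := Z) (Y := G.toMfd) g z w))) := by
    refine h1.trans ?_
    rw [inv_inv]
    refine (congrArg (fun v : G.E => @HAdd.hAdd G.E G.E G.E _ (G.Ad (g z) (P.conn.val (b z)
      (der (X := Z) (Y := P.tot) b z w))) v) (mc_inv hg w)).trans ?_
    exact (sub_eq_add_neg (G := G.E) _ _).symm.trans (map_sub (G.Ad (g z)) _ _).symm
  exact (congrArg (Q.moment (Q.gact.act (g z) q)) h2).trans (Q.moment_gact _ _ _)

variable {Q η}

theorem indVal_congr {b b' : Z → P.tot} {c c' : Z → Q.tot} {z : Z} (hb : b =ᶠ[𝓝 z] b')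
    (hc : c =ᶠ[𝓝 z] c') (w : Z.T z) : indVal Q η b c z w = indVal Q η b' c' z w := by
  have h1 := der_congr hb w
  have h2 := der_congr hc w
  have h3 : b z = b' z := hb.self_of_nhds
  have h4 : c z = c' z := hc.self_of_nhds
  unfold indVal
  rw [h1, h2, h4]
  have h5 := η.val_congr h3 (der (X := Z) (Y := P.tot) b' z w)
  have h6 := Q.conn.toOneForm.val_congr h4 (der (X := Z) (Y := Q.tot) c' z w)
  exact congrArg₂ (fun (s : K.E) (t : G.E) => @HSub.hSub K.E K.E K.E _ s (Q.moment (c' z) t)) rfl h5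

theorem indVal_comp {b : Z → P.tot} {c : Z → Q.tot} {f : Y → Z} {y : Y} (hf : DiffAt Y Z f y)
    (hb : DiffAt Z P.tot b (f y)) (hc : DiffAt Z Q.tot c (f y)) (w : Y.T y) :
    indVal Q η (fun y => b (f y)) (fun y => c (f y)) y w
      = indVal Q η b c (f y) (der (X := Y) (Y := Z) f y w) := by
  unfold indVal
  rw [der_comp_at y hb hf w, der_comp_at y hc hf w]

/-- Both `F^* Θ_Q` and the correction term change by the moment of the Maurer-Cartan form of `g`,
and the two changes cancel. -/
theorem indVal_gact (h : Descends Q η) {b : Z → P.tot} {c : Z → Q.tot} {g : Z → G} {z : Z}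
    (hb : SmAt Z P.tot b z) (hc : SmAt Z Q.tot c z) (hg : SmAt Z G.toMfd g z) (w : Z.T z) :
    indVal Q η (fun z => P.act (b z) (g z)⁻¹) (fun z => Q.gact.act (g z) (c z)) z w
      = indVal Q η b c z w := by
  have h1 := Q.conn.val_der_gact Q.gact Q.invariant hg.diff hc.diff w
  have h2 := h Z b g z w (c z) hb hg
  unfold indVal
  refine (congrArg₂ (@HSub.hSub K.E K.E K.E _) h1 h2).trans ?_
  refine (congrArg (fun v : K.E => @HSub.hSub K.E K.E K.E _ (@HSub.hSub K.E K.E K.E _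
    (Q.conn.val (c z) (der (X := Z) (Y := Q.tot) c z w)) (Q.conn.val (c z) (Q.gact.fund
      (G.mc (g z) (der (X := Z) (Y := G.toMfd) g z w)) (c z)))) v)
    (map_sub (Q.moment (c z)) _ _)).trans ?_
  rw [← Q.moment_apply]
  exact sub_sub_sub_cancel_right (G := K.E) _ _ _

theorem contMDiffOn_indVal {b : Z → P.tot} {c : Z → Q.tot} {U : Set Z} (ho : IsOpen U)
    (hb : ContMDiffOn Z.I P.tot.I ∞ b U) (hc : ContMDiffOn Z.I Q.tot.I ∞ c U) :
    ContMDiffOn Z.I.tangent 𝓘(ℝ, K.E) ∞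
    (fun w : TangentBundle Z.I Z => indVal Q η b c w.proj w.snd)
    (Bundle.TotalSpace.proj ⁻¹' U) := by
  have h1 : ContMDiffOn Z.I.tangent 𝓘(ℝ, K.E) ∞
      (fun w : TangentBundle Z.I Z => (Q.conn.val (c w.proj)
        (der (X := Z) (Y := Q.tot) c w.proj w.snd) : K.E)) (Bundle.TotalSpace.proj ⁻¹' U) :=
    contMDiffOn_pull Q.conn.toOneForm ho hc
  have h2 : ContMDiffOn Z.I.tangent 𝓘(ℝ, G.E) ∞
      (fun w : TangentBundle Z.I Z => (η.val (b w.proj)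
        (der (X := Z) (Y := P.tot) b w.proj w.snd) : G.E)) (Bundle.TotalSpace.proj ⁻¹' U) :=
    contMDiffOn_pull η ho hb
  have h3 : ContMDiffOn Z.I.tangent Q.tot.I ∞
      (fun w : TangentBundle Z.I Z => c w.proj) (Bundle.TotalSpace.proj ⁻¹' U) :=
    ContMDiffOn.comp (t := U) hc (Bundle.contMDiff_proj _).contMDiffOn fun _ h => h
  have h4 : ContMDiffOn Z.I.tangent 𝓘(ℝ, K.E) ∞
      (fun w : TangentBundle Z.I Z => (Q.moment (c w.proj)
        (η.val (b w.proj) (der (X := Z) (Y := P.tot) b w.proj w.snd)) : K.E))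
      (Bundle.TotalSpace.proj ⁻¹' U) :=
    Q.contMDiffOn_moment h2 h3
  exact (contDiff_fst.sub contDiff_snd : ContDiff ℝ ∞ (fun z : K.E × K.E => z.1 - z.2)).contMDiff
    |>.comp_contMDiffOn (h1.prodMk_space h4)

end Induced

variable {G K : LieGrp.{u}} {M : Mfd.{u}} {a : LeftAction G M}

/-! ### The connection induced on a quotient -/

namespace Quotient

variable {Q : EqBunConn a K} {X Y Z : Mfd.{u}} {P : BorelObj a X} {η : OneForm P.tot G.Lie}
  {R : PrinBundle K X} (τ : Quotient Q.toEqBun P R)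

/-- Families with the same classes differ by a smooth family in `G`, under which the value is
invariant. -/
theorem indVal_cls (h : Descends Q η) {b b' : Z → P.tot} {c c' : Z → Q.tot} {z : Z}
    (hb : SmAt Z P.tot b z) (hb' : SmAt Z P.tot b' z) (hc : SmAt Z Q.tot c z)
    (hF : ∀ᶠ y in 𝓝 z, P.F (b y) = Q.proj (c y)) (hF' : ∀ᶠ y in 𝓝 z, P.F (b' y) = Q.proj (c' y))
    (e : ∀ᶠ y in 𝓝 z, τ.cls (b y) (c y) = τ.cls (b' y) (c' y)) (w : Z.T z) :
    indVal Q η b c z w = indVal Q η b' c' z w := by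
  obtain ⟨g, hg, h1, h2⟩ := τ.exists_gact hb hb' hF hF' e
  exact (indVal_gact h hb hc hg w).symm.trans (indVal_congr h1 h2 w).symm

/-- The connection `Θ` on the quotient is induced by the form `(1 - ι_{ρ(η)}) F^* Θ_Q`. -/
def Induces (η : OneForm P.tot G.Lie) (Θ : Connection R) : Prop :=
  ∀ (Z : Mfd.{u}) (b : Z → P.tot) (c : Z → Q.tot) (z : Z) (w : Z.T z), SmAt Z P.tot b z →
    SmAt Z Q.tot c z → (∀ᶠ y in 𝓝 z, P.F (b y) = Q.proj (c y)) →
    (Θ.val (τ.cls (b z) (c z)) (der (X := Z) (Y := R.tot) (fun y => τ.cls (b y) (c y)) z w) : K.E)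
      = indVal Q η b c z w

variable (η) in
/-- The induced form at a point of the quotient. -/
def indForm (r : R.tot) : R.tot.T r →L[ℝ] K.Lie :=
  (Q.conn.val ((τ.exists_lift (R.proj r)).choose.c r)).comp
      (der (X := R.tot) (Y := Q.tot) (τ.exists_lift (R.proj r)).choose.c r) -
    (Q.moment ((τ.exists_lift (R.proj r)).choose.c r)).comp
      ((η.val ((τ.exists_lift (R.proj r)).choose.b r)).comp
        (der (X := R.tot) (Y := P.tot) (τ.exists_lift (R.proj r)).choose.b r))

/-- The chosen local lift, composed with the family of classes, is another family in `F^* Q` with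
the same classes as `(b, c)`. Thus the form does not depend on the choice of the lift. -/
theorem indForm_cls (h : Descends Q η) {b : Z → P.tot} {c : Z → Q.tot} {z : Z} (w : Z.T z)
    (hb : SmAt Z P.tot b z) (hc : SmAt Z Q.tot c z)
    (hF : ∀ᶠ y in 𝓝 z, P.F (b y) = Q.proj (c y)) :
    (τ.indForm η (τ.cls (b z) (c z))
      (der (X := Z) (Y := R.tot) (fun y => τ.cls (b y) (c y)) z w) : K.E)
      = indVal Q η b c z w := by
  let f : Z → R.tot := fun y => τ.cls (b y) (c y)
  have hf : SmAt Z R.tot f z := τ.smAt_cls hb hc hF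
  obtain ⟨L, hL⟩ : ∃ L, L = (τ.exists_lift (R.proj (f z))).choose := ⟨_, rfl⟩
  have hz : R.proj (f z) ∈ L.U := hL ▸ (τ.exists_lift (R.proj (f z))).choose_spec
  have hz' : ∀ᶠ y in 𝓝 z, R.proj (f y) ∈ L.U := hf.eventually (L.eventually hz)
  have h1 : indVal Q η (fun y => L.b (f y)) (fun y => L.c (f y)) z w = indVal Q η b c z w :=
    τ.indVal_cls h (SmAt.comp z (L.smooth_b _ hz) hf) hb (SmAt.comp z (L.smooth_c _ hz) hf)
      (hz'.mono fun y hy => L.compat _ hy) hF (hz'.mono fun y hy => L.cls_lift _ hy) w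
  rw [← h1, indVal_comp hf.diff (L.smooth_b _ hz).diff (L.smooth_c _ hz).diff, hL]
  rfl

theorem indForm_eq (h : Descends Q η) (L : Lift τ) {r : R.tot} (hr : R.proj r ∈ L.U)
    (w : R.tot.T r) : (τ.indForm η r w : K.E) = indVal Q η L.b L.c r w := by
  have h1 := τ.indForm_cls h w (L.smooth_b r hr) (L.smooth_c r hr)
    ((L.eventually hr).mono L.compat)
  rw [← h1]
  have h2 : (fun r => τ.cls (L.b r) (L.c r)) =ᶠ[𝓝 r] fun r => r :=
    (L.eventually hr).mono L.cls_lift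
  have h3 := (der_congr h2 w).trans (der_id r w)
  have h4 : ∀ {r r' : R.tot} (_ : r = r') (w : R.tot.E),
      (τ.indForm η r w : K.E) = τ.indForm η r' w := by
    rintro r _ rfl w
    rfl
  exact (h4 (L.cls_lift r hr).symm w).trans (congrArg (τ.indForm η _) h3.symm)

/-- The induced connection. -/
def indConn (h : Descends Q η) : Connection R where
  val := τ.indForm η
  smooth := by
    intro w
    obtain ⟨L, hL⟩ := τ.exists_lift (R.proj w.proj)
    have ho : IsOpen (Bundle.TotalSpace.proj ⁻¹' (R.proj ⁻¹' L.U) :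
        Set (TangentBundle R.tot.I R.tot)) :=
      (L.U.isOpen.preimage R.proj.contMDiff.continuous).preimage
        (Bundle.contMDiff_proj (n := ∞) (IB := R.tot.I) (TangentSpace R.tot.I)).continuous
    have hs := contMDiffOn_indVal (Q := Q) (η := η)
      (L.U.isOpen.preimage R.proj.contMDiff.continuous)
      (fun r hr => (L.smooth_b r hr).contMDiffWithinAt)
      (fun r hr => (L.smooth_c r hr).contMDiffWithinAt)
    refine (hs.contMDiffAt (ho.mem_nhds hL)).congr_of_eventuallyEq ?_
    filter_upwards [ho.mem_nhds hL] with w' hw'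
    exact τ.indForm_eq h L hw' w'.snd
  equivariant r k w := by
    obtain ⟨L, hL⟩ := τ.exists_lift (R.proj r)
    have h1 := L.eventually hL
    -- Right translation by `k` lifts to right translation of `c` alone, so equivariance follows
    -- from that of `Θ_Q` and of the moment.
    have h2 : (fun r' => τ.cls (L.b r') (Q.act (L.c r') k)) =ᶠ[𝓝 r] fun r' => R.act r' k := by
      filter_upwards [h1] with r' hr'
      rw [τ.cls_act (L.compat r' hr'), L.cls_lift r' hr']
    have h3 := τ.indForm_cls h (b := L.b) (c := fun r' => Q.act (L.c r') k) w (L.smooth_b r hL)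
      (Q.smAt_act (L.smooth_c r hL) (smAt_const k r)) (h1.mono fun r' hr' =>
        (L.compat r' hr').trans (Q.proj_act _ k).symm)
    have h4 : ∀ {r r' : R.tot} (_ : r = r') (w : R.tot.E),
        (τ.indForm η r w : K.E) = τ.indForm η r' w := by
      rintro r _ rfl w
      rfl
    refine (congrArg (τ.indForm η _) (der_congr h2 w).symm).trans ?_
    refine (h4 h2.self_of_nhds.symm _).trans (h3.trans ?_)
    rw [τ.indForm_eq h L hL w]
    have h5 := Q.conn.val_der_act (k := fun _ => k) (L.smooth_c r hL).diff
      (SmAt.diff (smAt_const (X := R.tot) (Y := K.toMfd) k r)) w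
    have h6 : (K.mc k (der (X := R.tot) (Y := K.toMfd) (fun _ => k) r w) : K.E) = 0 := mc_const k r w
    have h7 := h5.trans ((congrArg (fun v : K.E => @HAdd.hAdd K.E K.E K.E _ (K.Ad k⁻¹
      (Q.conn.val (L.c r) (der (X := R.tot) (Y := Q.tot) L.c r w))) v) h6).trans
      (add_zero (M := K.E) _))
    refine (congrArg₂ (@HSub.hSub K.E K.E K.E _) h7 (Q.moment_act (L.c r) k _)).trans ?_
    exact (map_sub (K.Ad k⁻¹) _ _).symm
  vertical r A := by
    obtain ⟨L, hL⟩ := τ.exists_lift (R.proj r)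
    -- The orbit of `r` lifts to the orbit of `c` with `b` constant; the correction term vanishes on
    -- it and `Θ_Q` gives `A`.
    have h2 : (fun k => τ.cls (L.b r) (Q.act (L.c r) k)) = fun k => R.act r k := by
      funext k
      rw [τ.cls_act (L.compat r hL), L.cls_lift r hL]
    have h3 := τ.indForm_cls h (Z := K.toMfd) (b := fun _ => L.b r) (c := fun k => Q.act (L.c r) k)
      (z := (1 : K)) A (smAt_const _ _) (Map.smAt (Q.orb (L.c r)) 1)
      (Filter.Eventually.of_forall fun k => (L.compat r hL).trans (Q.proj_act _ k).symm)
    have h4 : ∀ (f f' : K → R.tot) (_ : f = f'),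
        (τ.indForm η (f 1) (der (X := K.toMfd) (Y := R.tot) f 1 A) : K.E)
          = τ.indForm η (f' 1) (der (X := K.toMfd) (Y := R.tot) f' 1 A) := by
      rintro f _ rfl
      rfl
    refine (h4 _ _ h2.symm).trans (h3.trans ?_)
    have h5 : (η.val (L.b r) (der (X := K.toMfd) (Y := P.tot) (fun _ => L.b r) 1 A) : G.E) = 0 :=
      (congrArg (η.val (L.b r)) (der_const (X := K.toMfd) (Y := P.tot) (L.b r) 1 A)).trans
        (map_zero _)
    refine (congrArg₂ (fun (s : K.E) (t : G.E) => @HSub.hSub K.E K.E K.E _ s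
      (Q.moment (Q.act (L.c r) 1) t)) (Q.conn.vertical (L.c r) A) h5).trans ?_
    exact (congrArg (fun s : K.E => A - s) (map_zero _)).trans (sub_zero (G := K.E) _)

theorem induces_indConn (h : Descends Q η) : τ.Induces η (τ.indConn h) :=
  fun _ _ _ _ w hb hc hF => τ.indForm_cls h w hb hc hF

variable {τ}

theorem Induces.smooth_family {Θ : Connection R} (h : τ.Induces η Θ) (b : Map Z P.tot)
    (c : Map Z Q.tot) (hF : ∀ y, P.F (b y) = Q.proj (c y)) (z : Z) (w : Z.T z) :
    (Θ.val (τ.quo (FibProd.mk (b z) (c z) (hF z))) (der (X := Z) (Y := R.tot)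
      (fun y => τ.quo (FibProd.mk (b y) (c y) (hF y))) z w) : K.E) = indVal Q η b c z w := by
  have h1 := h Z b c z w (b.smAt z) (c.smAt z) (Filter.Eventually.of_forall hF)
  have h2 : (fun y => τ.cls (b y) (c y)) = fun y => τ.quo (FibProd.mk (b y) (c y) (hF y)) := by
    funext y
    exact τ.cls_eq (hF y)
  have h4 : ∀ (f f' : Z → R.tot) (_ : f = f'),
      (Θ.val (f z) (der (X := Z) (Y := R.tot) f z w) : K.E)
        = Θ.val (f' z) (der (X := Z) (Y := R.tot) f' z w) := by
    rintro f _ rfl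
    rfl
  exact (h4 _ _ h2.symm).trans h1

/-- The maps of quotients induced by connection-preserving morphisms preserve the induced
connections. -/
theorem pres_desc {Q' : EqBunConn a K} {P' : BorelObj a Y} {η' : OneForm P'.tot G.Lie}
    {R' : PrinBundle K Y} {τ' : Quotient Q'.toEqBun P' R'} {Θ : Connection R} {Θ' : Connection R'}
    (h : τ.Induces η Θ) (h' : τ'.Induces η' Θ') {u : Map X Y} (φ : BorelHom u P P')
    (ψ : EqConnHom Q Q') (hφ : pull φ.map η'.val = η.val) :
    Θ.Pres Θ' (desc τ τ' φ ψ.toEqHom).map := by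
  let χ := desc τ τ' φ ψ.toEqHom
  funext r
  ext w
  obtain ⟨L, hL⟩ := τ.exists_lift (R.proj r)
  have h1 := L.eventually hL
  have e1 : (fun r => τ.cls (L.b r) (L.c r)) =ᶠ[𝓝 r] fun r => r := h1.mono L.cls_lift
  have hF' : ∀ r, R.proj r ∈ L.U → P'.F (φ.map (L.b r)) = Q'.proj (ψ.map (L.c r)) := fun r hr =>
    (FibProd.mapRight ψ.toEqHom (FibProd.mapLeft Q.toEqBun φ (FibProd.mk _ _ (L.compat r hr)))).2
  have e2 : (fun r => τ'.cls (φ.map (L.b r)) (ψ.map (L.c r))) =ᶠ[𝓝 r] fun r => χ.map r := by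
    filter_upwards [h1] with r hr
    have h2 := map_desc τ τ' φ ψ.toEqHom (FibProd.mk _ _ (L.compat r hr))
    rw [← τ.cls_eq (L.compat r hr), L.cls_lift r hr] at h2
    exact (τ'.cls_eq (hF' r hr)).trans h2.symm
  have k1 := h R.tot L.b L.c r w (L.smooth_b r hL) (L.smooth_c r hL) (h1.mono L.compat)
  have k2 := h' R.tot (fun r => φ.map (L.b r)) (fun r => ψ.map (L.c r)) r w
    (SmAt.comp r (φ.map.smAt _) (L.smooth_b r hL)) (SmAt.comp r (ψ.map.smAt _) (L.smooth_c r hL))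
    (h1.mono hF')
  -- Here `φ` preserves the form `η`, while `ψ` preserves the connection and, being equivariant,
  -- also the moment.
  have k3 : indVal Q' η' (fun r => φ.map (L.b r)) (fun r => ψ.map (L.c r)) r w
      = indVal Q η L.b L.c r w := by
    unfold indVal
    have d1 := der_comp_at (X := R.tot) (Y := Q.tot) (Z := Q'.tot) r (ψ.map.mdiff _)
      (L.smooth_c r hL).diff w
    have d2 := der_comp_at (X := R.tot) (Y := P.tot) (Z := P'.tot) r (φ.map.mdiff _)
      (L.smooth_b r hL).diff w
    rw [d1, d2]
    have p1 := congrArg (fun (β : ∀ q : Q.tot, Q.tot.T q →L[ℝ] K.Lie) => β (L.c r)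
      (der (X := R.tot) (Y := Q.tot) L.c r w)) ψ.pres
    have p2 := congrArg (fun (β : ∀ p : P.tot, P.tot.T p →L[ℝ] G.Lie) => β (L.b r)
      (der (X := R.tot) (Y := P.tot) L.b r w)) hφ
    have p3 : ∀ A : G.Lie, (Q'.moment (ψ.map (L.c r)) A : K.E) = Q.moment (L.c r) A := by
      intro A
      rw [Q'.moment_apply, Q.moment_apply]
      have f1 := LeftAction.fund_map (a := Q.gact) (b := Q'.gact) ψ.map ψ.map_gact A (L.c r)
      refine (congrArg (Q'.conn.val (ψ.map (L.c r))) f1).trans ?_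
      exact congrArg (fun (β : ∀ q : Q.tot, Q.tot.T q →L[ℝ] K.Lie) => β (L.c r)
        (Q.gact.fund A (L.c r))) ψ.pres
    exact congrArg₂ (@HSub.hSub K.E K.E K.E _) p1 ((congrArg (Q'.moment _) p2).trans (p3 _))
  have h4 : ∀ {r r' : R.tot} (_ : r = r') (w : R.tot.E), (Θ.val r w : K.E) = Θ.val r' w := by
    rintro r _ rfl w
    rfl
  have h5 : ∀ {r r' : R'.tot} (_ : r = r') (w : R'.tot.E), (Θ'.val r w : K.E) = Θ'.val r' w := by
    rintro r _ rfl w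
    rfl
  have m1 : (Θ.val r w : K.E) = indVal Q η L.b L.c r w := by
    rw [← k1]
    exact (h4 e1.self_of_nhds.symm w).trans
      (congrArg (Θ.val _) ((der_congr e1 w).trans (der_id r w)).symm)
  refine Eq.trans ?_ m1.symm
  rw [← k3, ← k2]
  exact (h5 e2.self_of_nhds.symm _).trans (congrArg (Θ'.val _) (der_congr e2 w).symm)

end Quotient

/-! ### The associated bundles with connection -/

variable {G K : LieGrp.{u}} {M : Mfd.{u}} {a : LeftAction G M}

theorem ConnHom.ext_of_toBunHom {X Y : Mfd.{u}} {f : Map X Y} {P : BunConn K X} {Q : BunConn K Y}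
    {φ ψ : ConnHom f P Q} (h : φ.toBunHom = ψ.toBunHom) : φ = ψ :=
  ConnHom.ext (congrArg BunHom.map h)

/-- The quotient bundle `(F^* Q) / G` with the connection induced by `(1 - ι_{ρ(η)}) F^* Θ_Q`. -/
def quotBunConn (Q : EqBunConn a K) {X : Mfd.{u}} {P : BorelObj a X} {η : OneForm P.tot G.Lie}
    (h : Descends Q η) : BunConn K X :=
  { quotBundle Q.toEqBun P with conn := (quotBundleQuotient Q.toEqBun P).indConn h }

/-- The map of quotient bundles with connection induced by connection-preserving morphisms. -/
def quotBunConnMap {Q Q' : EqBunConn a K} {X Y : Mfd.{u}} {f : Map X Y} {P : BorelObj a X}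
    {P' : BorelObj a Y} {η : OneForm P.tot G.Lie} {η' : OneForm P'.tot G.Lie} (h : Descends Q η)
    (h' : Descends Q' η') (φ : BorelHom f P P') (ψ : EqConnHom Q Q')
    (hφ : pull φ.map η'.val = η.val) : ConnHom f (quotBunConn Q h) (quotBunConn Q' h') :=
  { Quotient.desc (quotBundleQuotient Q.toEqBun P) (quotBundleQuotient Q'.toEqBun P') φ
      ψ.toEqHom with
    pres := Quotient.pres_desc (Quotient.induces_indConn _ h) (Quotient.induces_indConn _ h') φ ψ
      hφ }

theorem pull_zero {X Y : Mfd.{u}} {V : Type u} [NormedAddCommGroup V] [NormedSpace ℝ V]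
    (f : Map X Y) : pull f (OneForm.zero Y V).val = (OneForm.zero X V).val := rfl

/-- The associated bundles with connection, for a given choice of quotients. -/
def assocConnFunctor : AssocConnFunctor a K where
  functor :=
    { obj := fun Q =>
        { obj := fun P => quotBunConn Q (descends_conn Q (P := P))
          map := fun φ => quotBunConnMap _ _ φ.toBorelHom (𝟙 Q) φ.pres
          map_id := fun P => ConnHom.ext_of_toBunHom
            (quotBundleQuotient Q.toEqBun (BorelConnObj.toBorelObj P)).desc_id
          map_comp := fun φ ψ => ConnHom.ext_of_toBunHom (Quotient.desc_comp _ _ _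
            (BorelConnHom.toBorelHom φ) (BorelConnHom.toBorelHom ψ) (EqHom.id Q.toEqBun)
            (EqHom.id Q.toEqBun)).symm }
      map := fun {Q Q'} ψ =>
        { app := fun P => quotBunConnMap (descends_conn Q (P := P)) (descends_conn Q' (P := P))
            (BorelHom.id (BorelConnObj.toBorelObj P)) ψ (pull_id _)
          naturality := fun φ => ConnHom.ext_of_toBunHom ((Quotient.desc_comp _ _ _
            (BorelConnHom.toBorelHom φ) (BorelHom.id _) (EqHom.id Q.toEqBun)
            (EqConnHom.toEqHom ψ)).trans (Quotient.desc_comp _ _ _ (BorelHom.id _)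
            (BorelConnHom.toBorelHom φ) (EqConnHom.toEqHom ψ) (EqHom.id Q'.toEqBun)).symm) }
      map_id := fun Q => Trans.ext (by
        funext X P
        exact ConnHom.ext_of_toBunHom
          (quotBundleQuotient Q.toEqBun (BorelConnObj.toBorelObj P)).desc_id)
      map_comp := fun ψ ψ' => Trans.ext (by
        funext X P
        exact ConnHom.ext_of_toBunHom (Quotient.desc_comp _ _ _
          (BorelHom.id (BorelConnObj.toBorelObj P)) (BorelHom.id (BorelConnObj.toBorelObj P))
          (EqConnHom.toEqHom ψ) (EqConnHom.toEqHom ψ')).symm) }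
  quotient Q _ P := quotBundleQuotient Q.toEqBun P.toBorelObj
  conn Q X P Y b c h y w := by
    refine (Quotient.Induces.smooth_family (Quotient.induces_indConn _ (descends_conn Q (P := P)))
      b c h y w).trans ?_
    exact congrArg (fun v : K.E => @HSub.hSub K.E K.E K.E _ _ v) (Q.moment_apply _ _)
  map_quo Q _ _ _ _ _ φ z := Quotient.map_desc _ _ φ.toBorelHom (EqHom.id Q.toEqBun) z
  app_quo ψ _ P z := Quotient.map_desc _ _ (BorelHom.id P.toBorelObj) (EqConnHom.toEqHom ψ) z

/-- The associated bundles of bundles with basic connections, for a given choice of quotients. -/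
def assocBasicFunctor : AssocBasicFunctor a K where
  functor :=
    { obj := fun Q =>
        { obj := fun P => quotBunConn Q.obj (descends_zero Q.obj (P := P) Q.property)
          map := fun φ => quotBunConnMap _ _ φ (𝟙 Q.obj) (pull_zero _)
          map_id := fun P => ConnHom.ext_of_toBunHom (quotBundleQuotient Q.obj.toEqBun P).desc_id
          map_comp := fun φ ψ => ConnHom.ext_of_toBunHom (Quotient.desc_comp _ _ _ φ ψ
            (EqHom.id Q.obj.toEqBun) (EqHom.id Q.obj.toEqBun)).symm }
      map := fun {Q Q'} ψ =>
        { app := fun P => quotBunConnMap (descends_zero Q.obj (P := P) Q.property)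
            (descends_zero Q'.obj (P := P) Q'.property) (BorelHom.id P) ψ.hom (pull_zero _)
          naturality := fun φ => ConnHom.ext_of_toBunHom ((Quotient.desc_comp _ _ _ φ
            (BorelHom.id _) (EqHom.id Q.obj.toEqBun) (EqConnHom.toEqHom ψ.hom)).trans
            (Quotient.desc_comp _ _ _ (BorelHom.id _) φ (EqConnHom.toEqHom ψ.hom)
            (EqHom.id Q'.obj.toEqBun)).symm) }
      map_id := fun Q => Trans.ext (by
        funext X P
        exact ConnHom.ext_of_toBunHom (quotBundleQuotient Q.obj.toEqBun P).desc_id)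
      map_comp := fun ψ ψ' => Trans.ext (by
        funext X P
        exact ConnHom.ext_of_toBunHom (Quotient.desc_comp _ _ _ (BorelHom.id P) (BorelHom.id P)
          (EqConnHom.toEqHom ψ.hom) (EqConnHom.toEqHom ψ'.hom)).symm) }
  quotient Q _ P := quotBundleQuotient Q.obj.toEqBun P
  conn Q X P Y b c h y w := by
    refine (Quotient.Induces.smooth_family (Quotient.induces_indConn _
      (descends_zero Q.obj (P := P) Q.property)) b c h y w).trans ?_
    exact (congrArg (fun v : K.E => @HSub.hSub K.E K.E K.E _ _ v) (map_zero _)).trans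
      (sub_zero (G := K.E) _)
  map_quo Q _ _ _ _ _ φ z := Quotient.map_desc _ _ φ (EqHom.id Q.obj.toEqBun) z
  app_quo ψ _ P z := Quotient.map_desc _ _ (BorelHom.id P) (EqConnHom.toEqHom ψ.hom) z

/-! ### The equivalences -/

section Triangle

variable {C : Type*} {D : Type*} {E : Type*} [Category* C] [Category* D] [Category* E]

/-- If two functors of a cyclic triangle are fully faithful and the composite is isomorphic to the
identity at one vertex, then all three are equivalences. -/
theorem isEquivalence_of_triangle {F : C ⥤ D} {J : D ⥤ E} {V : E ⥤ C} (hJ : J.Full)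
    (hJ' : J.Faithful) (hV : V.Full) (hV' : V.Faithful) (i : 𝟭 C ≅ F ⋙ J ⋙ V) :
    F.IsEquivalence ∧ J.IsEquivalence ∧ V.IsEquivalence := by
  -- Every `c` is isomorphic to `V (J (F c))`.
  have : V.EssSurj := ⟨fun c => ⟨J.obj (F.obj c), ⟨(i.app c).symm⟩⟩⟩
  -- Since `V` is fully faithful, the isomorphism of `V e` with `V (J (F (V e)))` comes from one of
  -- `e` with `J (F (V e))`.
  have : J.EssSurj := ⟨fun e => ⟨F.obj (V.obj e), ⟨V.preimageIso (i.app (V.obj e)).symm⟩⟩⟩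
  have hVe : V.IsEquivalence := { }
  have hJe : J.IsEquivalence := { }
  -- Nothing has been assumed of `F`; it is an equivalence because `J ⋙ V` and the composite with it
  -- are.
  have : (F ⋙ (J ⋙ V)).IsEquivalence := Functor.isEquivalence_of_iso i
  exact ⟨Functor.isEquivalence_of_comp_right F (J ⋙ V), hJe, hVe⟩

end Triangle

variable {G K : LieGrp.{u}} {M : Mfd.{u}} {a : LeftAction G M}

/-- The inverse of a morphism of equivariant bundles. -/
def EqHom.inv {Q R : EqBun a K} (φ : EqHom Q R) : EqHom R Q :=
  { φ.toBunHom.inv with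
    map_gact := fun g r => by
      have h1 : φ.map (Q.gact.act g (φ.toBunHom.inv.map r)) = R.gact.act g r :=
        (φ.map_gact _ _).trans (congrArg (R.gact.act g) (φ.toBunHom.map_inv r))
      exact (congrArg φ.toBunHom.inv.map h1.symm).trans (φ.toBunHom.inv_map _) }

theorem EqHom.comp_inv {Q R : EqBun a K} (φ : EqHom Q R) : φ.comp φ.inv = EqHom.id Q :=
  EqHom.ext (ContMDiffMap.ext fun q => φ.toBunHom.inv_map q)

theorem EqHom.inv_comp {Q R : EqBun a K} (φ : EqHom Q R) : φ.inv.comp φ = EqHom.id R :=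
  EqHom.ext (ContMDiffMap.ext fun q => φ.toBunHom.map_inv q)

instance {Q R : EqBun a K} (φ : Q ⟶ R) : IsIso φ :=
  ⟨EqHom.inv φ, EqHom.comp_inv φ, EqHom.inv_comp φ⟩

instance {Q R : EqBunConn a K} (φ : Q ⟶ R) : IsIso φ :=
  ⟨({ EqHom.inv (EqConnHom.toEqHom φ) with
      pres := BunHom.pres_inv (EqConnHom.toEqHom φ).toBunHom (EqConnHom.pres φ) } : EqConnHom R Q),
    EqConnHom.ext (congrArg (fun ψ : EqHom Q.toEqBun Q.toEqBun => ψ.map)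
      (EqHom.comp_inv (EqConnHom.toEqHom φ))),
    EqConnHom.ext (congrArg (fun ψ : EqHom R.toEqBun R.toEqBun => ψ.map)
      (EqHom.inv_comp (EqConnHom.toEqHom φ)))⟩

instance {Q R : (IsBasic a K).FullSubcategory} (φ : Q ⟶ R) : IsIso φ := by
  have : IsIso ((IsBasic a K).ι.map φ) := by
    change IsIso (φ.hom : Q.obj ⟶ R.obj)
    infer_instance
  exact isIso_of_reflects_iso φ (IsBasic a K).ι

/-! ### The isomorphism of `Q` with its associated bundle over the universal object -/

namespace Quotient

variable {Q : EqBun a K} {R : PrinBundle K M}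

/-- The point `(π(q), 1)` of the trivial bundle. -/
def unitPt (Q : EqBun a K) : Map Q.tot (trivObj a (Map.id M)).tot :=
  ⟨fun q => (Q.proj q, 1), Q.proj.contMDiff.prodMk contMDiff_const⟩

theorem F_unitPt (q : Q.tot) : (trivObj a (Map.id M)).F (unitPt Q q) = Q.proj q := by
  change a.act (1 : G)⁻¹ (Q.proj q) = Q.proj q
  rw [inv_one, a.one_act]

/-- The isomorphism from `Q` to the value of the associated bundle at the universal object. -/
def unitHom (τ : Quotient Q (trivObj a (Map.id M)) R) : BunHom (Map.id M) Q.toPrinBundle R where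
  map := ⟨fun q => τ.quo (FibProd.mk (unitPt Q q) q (F_unitPt q)),
    τ.smooth Q.tot (unitPt Q) (Map.id Q.tot) F_unitPt⟩
  map_act q k := by
    refine Eq.trans ?_ (τ.quo_act (unitPt Q q) q (F_unitPt q) k)
    exact congrArg τ.quo (Subtype.ext (Prod.ext (Prod.ext (Q.proj_act q k) rfl) rfl))
  proj_map q := τ.proj_quo _

/-- With `x = π(q)`, the pairs `((g x, 1), g q)` and `((g x, g), q)` lie in one orbit of `G`; the
second is the image of `((x, 1), q)` under the shift by `g`. -/
theorem unitHom_gact (τ : Quotient Q (trivObj a (Map.id M)) R) (g : G) (q : Q.tot) :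
    (unitHom τ).map (Q.gact.act g q) = τ.quo (FibProd.mapLeft Q
      (trivHom a (u := a.transl g) (ContMDiffMap.const g) fun _ => rfl)
      (FibProd.mk (unitPt Q q) q (F_unitPt q))) := by
  refine ((τ.fibre _ _).2 ⟨g, ?_, rfl⟩).symm
  refine Prod.ext (Q.proj_gact g q) ?_
  change (1 : G) = g * 1 * g⁻¹
  group

end Quotient

/-- The associated bundle functor, followed by the evaluation at the universal object, is isomorphic
to the identity. -/
def unitIso (T : AssocFunctor a K) :
    𝟭 (EqBun a K) ≅ T.functor ⋙ (triv a).precomp (B K) ⋙ evalFunctor (evalSmooth a) :=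
  let ν : 𝟭 (EqBun a K) ⟶ T.functor ⋙ (triv a).precomp (B K) ⋙ evalFunctor (evalSmooth a) :=
    { app := fun Q => ({ (T.quotient Q (trivObj a (Map.id M))).unitHom with
          map_gact := fun g q => ((T.quotient Q (trivObj a (Map.id M))).unitHom_gact g q).trans
            (T.map_quo Q _ _).symm } :
          EqHom Q ((T.functor ⋙ (triv a).precomp (B K) ⋙ evalFunctor (evalSmooth a)).obj Q))
      naturality := fun Q Q' ψ => EqHom.ext (ContMDiffMap.ext fun q => by
        refine Eq.trans ?_ (T.app_quo ψ (trivObj a (Map.id M))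
          (FibProd.mk (Quotient.unitPt Q q) q (Quotient.F_unitPt q))).symm
        exact congrArg (T.quotient Q' _).quo (Subtype.ext (Prod.ext (Prod.ext
          (BunHom.proj_map (EqHom.toBunHom ψ) q) rfl) rfl))) }
  have : IsIso ν := NatIso.isIso_of_isIso_app ν
  asIso ν

/-- The section `x ↦ (x, 1)` is horizontal for the connection of the zero form, so the correction
term of the induced connection vanishes along it and `Θ_Q` is recovered. -/
theorem conn_unitPt (Q : EqBun a K) (q : Q.tot) (w : Q.tot.T q) :
    ((trivConn (OneForm.zero M G.Lie)).val (Quotient.unitPt Q q)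
      (der (Quotient.unitPt Q) q w) : G.E) = 0 := by
  refine (trivConn_val_der (OneForm.zero M G.Lie) ((Quotient.unitPt Q).mdiff q) w).trans ?_
  refine (congrArg₂ (@HAdd.hAdd G.E G.E G.E _) (map_zero (G.Ad (1 : G)⁻¹)) (mc_const (1 : G) q w)).trans
    (add_zero (M := G.E) _)

/-- The same, for bundles with connection. -/
def unitConnIso (T : AssocConnFunctor a K) :
    𝟭 (EqBunConn a K) ≅ T.functor ⋙ (trivWithConn a).precomp (BConn K) ⋙ evalConn a K :=
  let o : BorelConnObj a M := (trivWithConn a).obj (idPtConn a)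
  let ν : 𝟭 (EqBunConn a K) ⟶ T.functor ⋙ (trivWithConn a).precomp (BConn K) ⋙ evalConn a K :=
    { app := fun Q => ({ (T.quotient Q o).unitHom with
          map_gact := fun g q => ((T.quotient Q o).unitHom_gact g q).trans
            (T.map_quo Q ((trivWithConn a).map (shiftConn a g)) _).symm
          pres := by
            funext q
            ext w
            refine (T.conn Q o Q.tot (Quotient.unitPt Q.toEqBun) (Map.id Q.tot) Quotient.F_unitPt
              q w).trans ?_
            have h1 : (o.conn.val (Quotient.unitPt Q.toEqBun q)
              (der (Quotient.unitPt Q.toEqBun) q w) : G.E) = 0 := conn_unitPt Q.toEqBun q w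
            have h2 : (Q.conn.val q (Q.gact.fund (0 : G.Lie) q) : K.E) = 0 :=
              (congrArg (Q.conn.val q) (Q.gact.fund_zero q)).trans (map_zero _)
            refine (congrArg₂ (@HSub.hSub K.E K.E K.E _) (congrArg (Q.conn.val q) (der_id q w))
              ((congrArg (fun A : G.Lie => (Q.conn.val q (Q.gact.fund A q) : K.E)) h1).trans
                h2)).trans (sub_zero (G := K.E) _) } :
          EqConnHom Q ((T.functor ⋙ (trivWithConn a).precomp (BConn K) ⋙ evalConn a K).obj Q))
      naturality := fun Q Q' ψ => EqConnHom.ext (ContMDiffMap.ext fun q => by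
        refine Eq.trans ?_ (T.app_quo ψ o
          (FibProd.mk (Quotient.unitPt Q.toEqBun q) q (Quotient.F_unitPt q))).symm
        exact congrArg (T.quotient Q' _).quo (Subtype.ext (Prod.ext (Prod.ext
          (BunHom.proj_map (EqConnHom.toEqHom ψ).toBunHom q) rfl) rfl))) }
  have : IsIso ν := NatIso.isIso_of_isIso_app ν
  asIso ν

/-- The same, for bundles with basic connection. -/
def unitBasicIso (T : AssocBasicFunctor a K) :
    𝟭 (IsBasic a K).FullSubcategory ≅ T.functor ⋙ (triv a).precomp (BConn K) ⋙ evalBasic a K :=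
  let o : BorelObj a M := trivObj a (Map.id M)
  let ν : 𝟭 (IsBasic a K).FullSubcategory ⟶
      T.functor ⋙ (triv a).precomp (BConn K) ⋙ evalBasic a K :=
    { app := fun Q => ObjectProperty.homMk ({ (T.quotient Q o).unitHom with
          map_gact := fun g q => ((T.quotient Q o).unitHom_gact g q).trans
            (T.map_quo Q ((triv a).map (shift a g)) _).symm
          pres := by
            funext q
            ext w
            refine (T.conn Q o Q.obj.tot (Quotient.unitPt Q.obj.toEqBun) (Map.id Q.obj.tot)
              Quotient.F_unitPt q w).trans ?_
            exact congrArg (Q.obj.conn.val q) (der_id q w) } :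
          EqConnHom Q.obj
            ((T.functor ⋙ (triv a).precomp (BConn K) ⋙ evalBasic a K).obj Q).obj)
      naturality := fun Q Q' ψ => ObjectProperty.hom_ext _ (EqConnHom.ext (ContMDiffMap.ext fun q => by
        refine Eq.trans ?_ (T.app_quo ψ o
          (FibProd.mk (Quotient.unitPt Q.obj.toEqBun q) q (Quotient.F_unitPt q))).symm
        exact congrArg (T.quotient Q' _).quo (Subtype.ext (Prod.ext (Prod.ext
          (BunHom.proj_map (EqConnHom.toEqHom ψ.hom).toBunHom q) rfl) rfl)))) }
  have : IsIso ν := NatIso.isIso_of_isIso_app ν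
  asIso ν

theorem isEquivalence_assoc (T : AssocFunctor a K) :
    T.functor.IsEquivalence ∧ ((triv a).precomp (B K)).IsEquivalence ∧
      (evalFunctor (K := K) (evalSmooth a)).IsEquivalence :=
  isEquivalence_of_triangle (locEquiv_triv a).full_B (locEquiv_triv a).faithful_B
    (full_evalFunctor a _) (faithful_evalFunctor a _) (unitIso T)

theorem isEquivalence_assocConn (T : AssocConnFunctor a K) :
    T.functor.IsEquivalence ∧ ((trivWithConn a).precomp (BConn K)).IsEquivalence ∧
      (evalConn a K).IsEquivalence :=
  isEquivalence_of_triangle (locEquiv_trivWithConn a).full_BConn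
    (locEquiv_trivWithConn a).faithful_BConn full_evalConn faithful_evalConn (unitConnIso T)

theorem isEquivalence_assocBasic (T : AssocBasicFunctor a K) :
    T.functor.IsEquivalence ∧ ((triv a).precomp (BConn K)).IsEquivalence ∧
      (evalBasic a K).IsEquivalence :=
  isEquivalence_of_triangle (locEquiv_triv a).full_BConn (locEquiv_triv a).faithful_BConn
    full_evalBasic faithful_evalBasic (unitBasicIso T)

end EquivBun

end

theorem theorem4p1 (G K : EquivBun.LieGrp.{u}) (M : EquivBun.Mfd.{u})
    (a : EquivBun.LeftAction G M) :
    -- with connections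
    (Nonempty (EquivBun.AssocConnFunctor a K) ∧
      ∀ T₁ : EquivBun.AssocConnFunctor a K, T₁.functor.IsEquivalence) ∧
    (EquivBun.Mor.precomp (EquivBun.trivWithConn a) (EquivBun.BConn K)).IsEquivalence ∧
    (∃ hs : EquivBun.EvalConnSmooth a K,
      (EquivBun.evalConnFunctor hs).IsEquivalence ∧
      -- descent to `M // G`, and basic connections
      (∀ S : EquivBun.Mor (EquivBun.DiffActGpd a) (EquivBun.BConn K),
        (EquivBun.Mor.precomp (EquivBun.forgetForm a) (EquivBun.BConn K)).essImage S ↔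
          EquivBun.IsBasic a K ((EquivBun.evalConnFunctor hs).obj S)) ∧
      ∃ hb : ∀ S : EquivBun.Mor (EquivBun.ActGpd a) (EquivBun.BConn K),
          EquivBun.IsBasic a K ((EquivBun.Mor.precomp (EquivBun.forgetForm a) (EquivBun.BConn K) ⋙
            EquivBun.evalConnFunctor hs).obj S),
        ((EquivBun.IsBasic a K).lift
          (EquivBun.Mor.precomp (EquivBun.forgetForm a) (EquivBun.BConn K) ⋙
            EquivBun.evalConnFunctor hs) hb).IsEquivalence) ∧
    (Nonempty (EquivBun.AssocBasicFunctor a K) ∧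
      ∀ T₁ : EquivBun.AssocBasicFunctor a K, T₁.functor.IsEquivalence) ∧
    (EquivBun.Mor.precomp (EquivBun.triv a) (EquivBun.BConn K)).IsEquivalence ∧
    -- without connections
    (Nonempty (EquivBun.AssocFunctor a K) ∧
      ∀ T₁ : EquivBun.AssocFunctor a K, T₁.functor.IsEquivalence) ∧
    (EquivBun.Mor.precomp (EquivBun.triv a) (EquivBun.B K)).IsEquivalence ∧
    ∃ hs : EquivBun.EvalSmooth a K, (EquivBun.evalFunctor hs).IsEquivalence := by
  have hb := EquivBun.isEquivalence_assocBasic (EquivBun.assocBasicFunctor (a := a) (K := K))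
  have hc := EquivBun.isEquivalence_assocConn (EquivBun.assocConnFunctor (a := a) (K := K))
  have h := EquivBun.isEquivalence_assoc (EquivBun.assocFunctor (a := a) (K := K))
  -- Makes the essential surjectivity needed by `essImage_forgetForm_iff` available: every
  -- equivariant bundle with basic connection comes from `M // G`.
  have := hb.2.2
  exact ⟨⟨⟨EquivBun.assocConnFunctor⟩, fun T => (EquivBun.isEquivalence_assocConn T).1⟩, hc.2.1,
    ⟨EquivBun.evalConnSmooth, hc.2.2, EquivBun.essImage_forgetForm_iff,
      EquivBun.isBasic_eval_forgetForm, hb.2.2⟩,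
    ⟨⟨EquivBun.assocBasicFunctor⟩, fun T => (EquivBun.isEquivalence_assocBasic T).1⟩, hb.2.1,
    ⟨⟨EquivBun.assocFunctor⟩, fun T => (EquivBun.isEquivalence_assoc T).1⟩, h.2.1,
    EquivBun.evalSmooth a, h.2.2⟩
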